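/- Let $d>2$ and $\beta\in(0,1)$. On the unit circle $\mathbb T$ write $f'=df/dw$ and $⨍_{\mathbb T} g(\tau)\,d\tau=\frac1{2\pi i}\int_{\mathbb T}g(\tau)\,d\tau$, let $\|g\|_{C^\beta}=\|g\|_\infty+\sup_{x\ne y}|g(x)-g(y)|/|x-y|^\beta$, and let $$X=\Big\{f\in C^{1+\beta}(\mathbb T): f(w)=\sum_{n\ge1}a_nw^{-n},\ a_n\in\mathbb R\Big\},\qquad \widehat Y=\Big\{g\in C^\beta(\mathbb T): g=\sum_{n\ge2}a_n\,\mathrm{Im}(w^n),\ a_n\in\mathbb R\Big\},$$ with the norms $\|f\|_X=\|f\|_\infty+\|f'\|_{C^\beta}$ and $\|g\|_{C^\beta}$; let $B_1$ be the open unit ball of $X$. With $A=\tau-w$ and $B=f(\tau)-f(w)$ put $$\begin{aligned}F(U,\varepsilon,f)(w)={}&2Uw\big(1+\varepsilon f'(w)\big)-f'(w)+\Big(⨍_{\mathbb T}\frac{\overline A+\varepsilon\overline B}{A+\varepsilon B}f'(\tau)d\tau+⨍_{\mathbb T}\frac{A\overline B-\overline AB}{A(A+\varepsilon B)}d\tau\Big)w\big(1+\varepsilon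 f'(w)\big)\\&+\Big(⨍_{\mathbb T}\frac{\overline\tau+\varepsilon f(\overline\tau)}{\varepsilon(\tau+w)+\varepsilon^2(f(\tau)+f(w))-2d}\big(1+\varepsilon f'(\tau)\big)d\tau\Big)w\big(1+\varepsilon f'(w)\big).\end{aligned}$$ For $|\varepsilon|<\frac12$ and $f\in B_1$ there is exactly one real $U=U(\varepsilon,f)$ with $$⨍_{\mathbb T}F(U,\varepsilon,f)(w)\,\overline w^2\,dw-⨍_{\mathbb T}F(U,\varepsilon,f)(w)\,dw=0 ;$$ moreover $U(0,0)=\frac1{4d}$, and $\widehat G(\varepsilon,f):=\mathrm{Im}\,F(U(\varepsilon,f),\varepsilon,f)$ belongs to $\widehat Y$. The following hold. (i) $\widehat G(0,\cdot)$ is Fréchet differentiable at $f=0$ as a map into $\widehat Y$, with derivative $\partial_f\widehat G(0,0)h=-\mathrm{Im}\,h'$, and this is an isomorphism (a linear homeomorphism) of $X$ onto $\widehat Y$. (ii) There are $\varepsilon_0\in(0,\frac12)$ and a $C^1$ curve $\varepsilon\in[-\varepsilon_0,\varepsilon_0]\mapsto f_\varepsilon\in B_1$ such that $$\{(\varepsilon,f)\in[-\varepsilon_0,\varepsilon_0]\times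 B_1:\ \widehat G(\varepsilon,f)=0\}=\{(\varepsilon,f_\varepsilon):\ |\varepsilon|\le\varepsilon_0\},$$ and $f_\varepsilon\ne0$ for $\varepsilon\ne0$. For $0<|\varepsilon|\le\varepsilon_0$ the map $w\mapsto\varepsilon(w+\varepsilon f_\varepsilon(w))$ is a regular $C^1$ parametrization of a Jordan curve; let $D_1^\varepsilon$ be the domain that it encloses, which contains $0$, and let $D_2^\varepsilon=2d-D_1^\varepsilon$. Then $\overline{D_1^\varepsilon}$ and $\overline{D_2^\varepsilon}$ are disjoint, and the two patches form a counter-rotating (translating) pair for the planar Euler equations with the velocity $iU$, $U=U(\varepsilon,f_\varepsilon)$: the velocity $v$ generated through the Biot–Savart law by the vorticity $\varepsilon^{-2}(\chi_{D_1^\varepsilon}-\chi_{D_2^\varepsilon})$ satisfies $\mathrm{Re}\{(\overline{v(z)}+iU)\,\vec n(z)\}=0$ for all $z\in\partial D_1^\varepsilon\cup\partial D_2^\varepsilon$, where $\vec n$ is the exterior unit normal. (iii) If $|\varepsilon|<\frac12$, $f\in B_1$ and $\widehat G(\varepsilon,f)=0$, then $\widehat G(-\varepsilon,\tilde f)=0$,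 where $\tilde f(w)=f(-w)$ and $\tilde f\in B_1$. In particular $f_{-\varepsilon}(w)=f_\varepsilon(-w)$ for $|\varepsilon|\le\varepsilon_0$. (iv) For $0<|\varepsilon|\le\varepsilon_0$ the domain $D_1^\varepsilon$ is strictly convex (it is convex and its boundary contains no segment), and hence so is $D_2^\varepsilon$. -/

import Mathlib

open scoped NNReal

namespace VortexPair

noncomputable section

/-! ### Functions on the unit circle -/

/-- The mean `(1 / 2πi) ∫_𝕋 g(τ) dτ`, where `dτ` is complex integration along the
positively oriented unit circle `τ = e^{iθ}`. -/
def circleMean (g : Circle → ℂ) : ℂ :=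
  (2 * Real.pi * Complex.I)⁻¹ *
    ∫ θ in (0 : ℝ)..2 * Real.pi, g (Circle.exp θ) * (Complex.I * (Circle.exp θ : ℂ))

/-- The Fourier coefficient of `w ^ n` in `g`. -/
def circleCoeff (g : Circle → ℂ) (n : ℤ) : ℂ :=
  circleMean fun τ => g τ * (τ : ℂ) ^ (-n - 1)

/-- The derivative `df/dw = -i e^{-iη} (d/dη) f(e^{iη})` at `w = e^{iη}`. -/
def circleDeriv (f : Circle → ℂ) (w : Circle) : ℂ :=
  -Complex.I * (w : ℂ)⁻¹ * deriv (fun η : ℝ => f (Circle.exp η)) (Complex.arg (w : ℂ))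

/-- The supremum norm (for bounded functions). -/
def supNorm {E : Type*} [NormedAddCommGroup E] (g : Circle → E) : ℝ := ⨆ w, ‖g w‖

/-- The norm of `C^β(𝕋)`: sup norm plus the best `β`-Hölder constant with respect to the
chord distance `|x - y|`. -/
def holderNorm {E : Type*} [NormedAddCommGroup E] (β : ℝ≥0) (g : Circle → E) : ℝ :=
  supNorm g + (nnHolderNorm β g : ℝ)

/-- `f` is of class `C¹` on the circle. -/
def IsC1 (f : Circle → ℂ) : Prop :=
  Continuous f ∧ Differentiable ℝ (fun η : ℝ => f (Circle.exp η)) ∧ Continuous (circleDeriv f)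

theorem exp_arg_comp (f : Circle → ℂ) (w : Circle) :
    f (Circle.exp (Complex.arg (w : ℂ))) = f w := by
  rw [Circle.exp_arg]

theorem circleDeriv_add {f g : Circle → ℂ} (hf : IsC1 f) (hg : IsC1 g) :
    circleDeriv (f + g) = circleDeriv f + circleDeriv g := by
  funext w
  have h : deriv (fun η : ℝ => (f + g) (Circle.exp η)) (Complex.arg (w : ℂ))
      = deriv (fun η : ℝ => f (Circle.exp η)) (Complex.arg (w : ℂ))
        + deriv (fun η : ℝ => g (Circle.exp η)) (Complex.arg (w : ℂ)) :=
    deriv_add (hf.2.1 _) (hg.2.1 _)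
  simp only [circleDeriv, Pi.add_apply] at h ⊢
  rw [h]
  ring

theorem circleDeriv_smul (c : ℝ) {f : Circle → ℂ} (hf : IsC1 f) :
    circleDeriv (c • f) = c • circleDeriv f := by
  funext w
  have h : deriv (fun η : ℝ => (c • f) (Circle.exp η)) (Complex.arg (w : ℂ))
      = c • deriv (fun η : ℝ => f (Circle.exp η)) (Complex.arg (w : ℂ)) :=
    deriv_const_smul c (hf.2.1 _)
  simp only [circleDeriv, Pi.smul_apply, Complex.real_smul] at h ⊢
  rw [h]
  ring

theorem isC1_zero : IsC1 0 := by
  have h : circleDeriv 0 = 0 := by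
    funext w
    simp [circleDeriv]
  refine ⟨continuous_zero, ?_, ?_⟩
  · exact differentiable_const (0 : ℂ)
  · rw [h]
    exact continuous_zero

theorem IsC1.add {f g : Circle → ℂ} (hf : IsC1 f) (hg : IsC1 g) : IsC1 (f + g) := by
  refine ⟨hf.1.add hg.1, hf.2.1.add hg.2.1, ?_⟩
  rw [circleDeriv_add hf hg]
  exact hf.2.2.add hg.2.2

theorem IsC1.smul (c : ℝ) {f : Circle → ℂ} (hf : IsC1 f) : IsC1 (c • f) := by
  refine ⟨hf.1.const_smul c, hf.2.1.const_smul c, ?_⟩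
  rw [circleDeriv_smul c hf]
  exact hf.2.2.const_smul c

theorem circleCoeff_add {f g : Circle → ℂ} (hf : Continuous f) (hg : Continuous g) (n : ℤ) :
    circleCoeff (f + g) n = circleCoeff f n + circleCoeff g n := by
  have key : ∀ h : Circle → ℂ, Continuous h → IntervalIntegrable
      (fun θ : ℝ => h (Circle.exp θ) * (Circle.exp θ : ℂ) ^ (-n - 1)
        * (Complex.I * (Circle.exp θ : ℂ))) MeasureTheory.volume 0 (2 * Real.pi) := by
    intro h hh
    apply Continuous.intervalIntegrable
    have h1 : Continuous fun θ : ℝ => (Circle.exp θ : ℂ) :=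
      continuous_induced_dom.comp Circle.exp.continuous
    have h2 : Continuous fun θ : ℝ => (Circle.exp θ : ℂ) ^ (-n - 1) :=
      h1.zpow₀ _ fun θ => Or.inl (Circle.coe_ne_zero _)
    exact ((hh.comp Circle.exp.continuous).mul h2).mul (continuous_const.mul h1)
  simp only [circleCoeff, circleMean, Pi.add_apply, add_mul]
  rw [intervalIntegral.integral_add (key f hf) (key g hg), mul_add]

theorem circleCoeff_smul (c : ℝ) (f : Circle → ℂ) (n : ℤ) :
    circleCoeff (c • f) n = c * circleCoeff f n := by
  simp only [circleCoeff, circleMean, Pi.smul_apply, Complex.real_smul, mul_assoc]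
  rw [intervalIntegral.integral_const_mul]
  ring

theorem supNorm_nonneg {E : Type*} [NormedAddCommGroup E] (g : Circle → E) : 0 ≤ supNorm g :=
  Real.iSup_nonneg fun _ => norm_nonneg _

theorem bddAbove_norm {E : Type*} [NormedAddCommGroup E] {g : Circle → E} (hg : Continuous g) :
    BddAbove (Set.range fun w => ‖g w‖) :=
  (isCompact_range hg.norm).bddAbove

theorem supNorm_add_le {E : Type*} [NormedAddCommGroup E] {f g : Circle → E}
    (hf : Continuous f) (hg : Continuous g) : supNorm (f + g) ≤ supNorm f + supNorm g :=
  ciSup_le fun w => (norm_add_le (f w) (g w)).trans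
    (add_le_add (le_ciSup (bddAbove_norm hf) w) (le_ciSup (bddAbove_norm hg) w))

theorem supNorm_smul {E : Type*} [NormedAddCommGroup E] [NormedSpace ℝ E] (c : ℝ)
    (g : Circle → E) : supNorm (c • g) = ‖c‖ * supNorm g := by
  simp only [supNorm, Pi.smul_apply, norm_smul]
  exact (Real.mul_iSup_of_nonneg (norm_nonneg c) _).symm

theorem eq_zero_of_supNorm {E : Type*} [NormedAddCommGroup E] {g : Circle → E}
    (hg : Continuous g) (h : supNorm g = 0) : g = 0 := by
  funext w
  have := le_ciSup (bddAbove_norm hg) w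
  exact norm_le_zero_iff.mp (this.trans h.le)

theorem holderNorm_nonneg {E : Type*} [NormedAddCommGroup E] (β : ℝ≥0) (g : Circle → E) :
    0 ≤ holderNorm β g :=
  add_nonneg (supNorm_nonneg g) (NNReal.coe_nonneg _)

theorem holderNorm_add_le {E : Type*} [NormedAddCommGroup E] {β : ℝ≥0} {f g : Circle → E}
    (hf : Continuous f) (hg : Continuous g) (hf' : MemHolder β f) (hg' : MemHolder β g) :
    holderNorm β (f + g) ≤ holderNorm β f + holderNorm β g := by
  have h1 := supNorm_add_le hf hg
  have h2 : (nnHolderNorm β (f + g) : ℝ) ≤ nnHolderNorm β f + nnHolderNorm β g := by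
    exact_mod_cast hf'.nnHolderNorm_add_le hg'
  simp only [holderNorm]
  linarith

theorem holderNorm_smul {E : Type*} [NormedAddCommGroup E] [NormedSpace ℝ E] {β : ℝ≥0} (c : ℝ)
    {g : Circle → E} (hg : MemHolder β g) : holderNorm β (c • g) = ‖c‖ * holderNorm β g := by
  have h2 : (nnHolderNorm β (c • g) : ℝ) = ‖c‖ * nnHolderNorm β g := by
    rw [hg.nnHolderNorm_smul c]
    simp
  simp only [holderNorm, supNorm_smul, h2]
  ring

/-! ### The spaces `X` and `Ŷ` -/

/-- `f ∈ C^{1+β}(𝕋)` with Fourier expansion `f(w) = ∑_{n ≥ 1} a_n w^{-n}`, `a_n ∈ ℝ`. -/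
def xSubmodule (β : ℝ≥0) : Submodule ℝ (Circle → ℂ) where
  carrier := {f | IsC1 f ∧ MemHolder β (circleDeriv f) ∧
    (∀ n : ℤ, 0 ≤ n → circleCoeff f n = 0) ∧ ∀ n : ℤ, (circleCoeff f n).im = 0}
  zero_mem' := by
    have h : circleDeriv 0 = 0 := by
      funext w
      simp [circleDeriv]
    refine ⟨isC1_zero, ?_, ?_, ?_⟩
    · rw [h]
      exact memHolder_zero
    · intro n _
      simp [circleCoeff, circleMean]
    · intro n
      simp [circleCoeff, circleMean]
  add_mem' := by
    rintro f g ⟨hf, hf', hf0, hfr⟩ ⟨hg, hg', hg0, hgr⟩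
    refine ⟨hf.add hg, ?_, ?_, ?_⟩
    · rw [circleDeriv_add hf hg]
      exact hf'.add hg'
    · intro n hn
      rw [circleCoeff_add hf.1 hg.1, hf0 n hn, hg0 n hn, add_zero]
    · intro n
      rw [circleCoeff_add hf.1 hg.1, Complex.add_im, hfr n, hgr n, add_zero]
  smul_mem' := by
    rintro c f ⟨hf, hf', hf0, hfr⟩
    refine ⟨hf.smul c, ?_, ?_, ?_⟩
    · rw [circleDeriv_smul c hf]
      exact hf'.smul
    · intro n hn
      rw [circleCoeff_smul, hf0 n hn, mul_zero]
    · intro n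
      rw [circleCoeff_smul, Complex.im_ofReal_mul, hfr n, mul_zero]

/-- Real `f ∈ C^β(𝕋)` with Fourier expansion `f = ∑_{n ≥ 2} a_n e_n`, `a_n ∈ ℝ`, where
`e_n(w) = Im(w^n) = (w^n - w^{-n}) / 2i`. For real-valued `f` this says that all coefficients of
`w^n` are purely imaginary (so there are no cosine terms) and that the one of `w` vanishes. -/
def yHatSubmodule (β : ℝ≥0) : Submodule ℝ (Circle → ℝ) where
  carrier := {f | Continuous f ∧ MemHolder β f ∧
    (∀ n : ℤ, (circleCoeff (fun w => (f w : ℂ)) n).re = 0) ∧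
    circleCoeff (fun w => (f w : ℂ)) 1 = 0}
  zero_mem' := by
    refine ⟨continuous_zero, memHolder_zero, ?_, ?_⟩
    · intro n
      simp [circleCoeff, circleMean]
    · simp [circleCoeff, circleMean]
  add_mem' := by
    rintro f g ⟨hf, hf', hfr, hf1⟩ ⟨hg, hg', hgr, hg1⟩
    have h : ∀ n, circleCoeff (fun w => (((f + g) w : ℝ) : ℂ)) n =
        circleCoeff (fun w => (f w : ℂ)) n + circleCoeff (fun w => (g w : ℂ)) n := by
      intro n
      have hf2 : Continuous fun w => (f w : ℂ) := Complex.continuous_ofReal.comp hf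
      have hg2 : Continuous fun w => (g w : ℂ) := Complex.continuous_ofReal.comp hg
      rw [← circleCoeff_add hf2 hg2]
      congr 1
      funext w
      simp
    refine ⟨hf.add hg, hf'.add hg', ?_, ?_⟩
    · intro n
      rw [h, Complex.add_re, hfr n, hgr n, add_zero]
    · rw [h, hf1, hg1, add_zero]
  smul_mem' := by
    rintro c f ⟨hf, hf', hfr, hf1⟩
    have h : ∀ n, circleCoeff (fun w => (((c • f) w : ℝ) : ℂ)) n =
        c * circleCoeff (fun w => (f w : ℂ)) n := by
      intro n
      rw [← circleCoeff_smul]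
      congr 1
      funext w
      simp
    refine ⟨hf.const_smul c, hf'.smul, ?_, ?_⟩
    · intro n
      rw [h, Complex.re_ofReal_mul, hfr n, mul_zero]
    · rw [h, hf1, mul_zero]

/-- The space `X`. -/
def XSpace (β : ℝ≥0) : Type := xSubmodule β

/-- The space `Ŷ`. -/
def YHat (β : ℝ≥0) : Type := yHatSubmodule β

instance (β : ℝ≥0) : AddCommGroup (XSpace β) := inferInstanceAs (AddCommGroup (xSubmodule β))

instance (β : ℝ≥0) : Module ℝ (XSpace β) := inferInstanceAs (Module ℝ (xSubmodule β))

instance (β : ℝ≥0) : AddCommGroup (YHat β) := inferInstanceAs (AddCommGroup (yHatSubmodule β))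

instance (β : ℝ≥0) : Module ℝ (YHat β) := inferInstanceAs (Module ℝ (yHatSubmodule β))

instance (β : ℝ≥0) : CoeFun (XSpace β) fun _ => Circle → ℂ := ⟨Subtype.val⟩

instance (β : ℝ≥0) : CoeFun (YHat β) fun _ => Circle → ℝ := ⟨Subtype.val⟩

/-- `‖f‖ = ‖f‖_∞ + ‖f'‖_{C^β}`. -/
instance (β : ℝ≥0) : Norm (XSpace β) := ⟨fun f => supNorm f + holderNorm β (circleDeriv f)⟩

/-- `‖f‖ = ‖f‖_{C^β}`. -/
instance (β : ℝ≥0) : Norm (YHat β) := ⟨fun f => holderNorm β f⟩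

theorem XSpace.core (β : ℝ≥0) : NormedSpace.Core ℝ (XSpace β) where
  norm_nonneg f := add_nonneg (supNorm_nonneg _) (holderNorm_nonneg _ _)
  norm_smul c f := by
    change supNorm (c • f.1) + holderNorm β (circleDeriv (c • f.1))
      = ‖c‖ * (supNorm f.1 + holderNorm β (circleDeriv f.1))
    rw [circleDeriv_smul c f.2.1, supNorm_smul, holderNorm_smul c f.2.2.1]
    ring
  norm_triangle f g := by
    change supNorm (f.1 + g.1) + holderNorm β (circleDeriv (f.1 + g.1))
      ≤ (supNorm f.1 + holderNorm β (circleDeriv f.1))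
        + (supNorm g.1 + holderNorm β (circleDeriv g.1))
    rw [circleDeriv_add f.2.1 g.2.1]
    have h1 := supNorm_add_le f.2.1.1 g.2.1.1
    have h2 := holderNorm_add_le f.2.1.2.2 g.2.1.2.2 f.2.2.1 g.2.2.1
    linarith
  norm_eq_zero_iff f := by
    change supNorm f.1 + holderNorm β (circleDeriv f.1) = 0 ↔ f = 0
    constructor
    · intro h
      have h1 := supNorm_nonneg f.1
      have h2 := holderNorm_nonneg β (circleDeriv f.1)
      exact Subtype.ext (eq_zero_of_supNorm f.2.1.1 (by linarith))
    · rintro rfl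
      change supNorm (0 : Circle → ℂ) + holderNorm β (circleDeriv 0) = 0
      have h : circleDeriv 0 = 0 := by
        funext w
        simp [circleDeriv]
      simp [h, holderNorm, supNorm]

theorem YHat.core (β : ℝ≥0) : NormedSpace.Core ℝ (YHat β) where
  norm_nonneg f := holderNorm_nonneg _ _
  norm_smul c f := by
    change holderNorm β (c • f.1) = ‖c‖ * holderNorm β f.1
    exact holderNorm_smul c f.2.2.1
  norm_triangle f g := by
    change holderNorm β (f.1 + g.1) ≤ holderNorm β f.1 + holderNorm β g.1
    exact holderNorm_add_le f.2.1 g.2.1 f.2.2.1 g.2.2.1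
  norm_eq_zero_iff f := by
    change supNorm f.1 + (nnHolderNorm β f.1 : ℝ) = 0 ↔ f = 0
    constructor
    · intro h
      have h1 := supNorm_nonneg f.1
      have h2 := NNReal.coe_nonneg (nnHolderNorm β f.1)
      exact Subtype.ext (eq_zero_of_supNorm f.2.1 (by linarith))
    · rintro rfl
      change supNorm (0 : Circle → ℝ) + (nnHolderNorm β (0 : Circle → ℝ) : ℝ) = 0
      simp [supNorm]

instance (β : ℝ≥0) : NormedAddCommGroup (XSpace β) := NormedAddCommGroup.ofCore (XSpace.core β)

instance (β : ℝ≥0) : NormedSpace ℝ (XSpace β) := NormedSpace.ofCore (XSpace.core β)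

instance (β : ℝ≥0) : NormedAddCommGroup (YHat β) := NormedAddCommGroup.ofCore (YHat.core β)

instance (β : ℝ≥0) : NormedSpace ℝ (YHat β) := NormedSpace.ofCore (YHat.core β)

/-! ### The functional -/

/-- `F₁ = 2U w (1 + ε f'(w)) - f'(w)`. -/
def F₁ (U ε : ℝ) (f : Circle → ℂ) (w : Circle) : ℂ :=
  2 * U * w * (1 + ε * circleDeriv f w) - circleDeriv f w

/-- `F₂`, with `A = τ - w`, `B = f(τ) - f(w)`. -/
def F₂ (ε : ℝ) (f : Circle → ℂ) (w : Circle) : ℂ :=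
  (circleMean (fun τ =>
      (star ((τ : ℂ) - w) + ε * star (f τ - f w)) / (((τ : ℂ) - w) + ε * (f τ - f w))
        * circleDeriv f τ)
    + circleMean (fun τ =>
      (((τ : ℂ) - w) * star (f τ - f w) - star ((τ : ℂ) - w) * (f τ - f w))
        / (((τ : ℂ) - w) * (((τ : ℂ) - w) + ε * (f τ - f w)))))
  * (w * (1 + ε * circleDeriv f w))

/-- `F₃`, the interaction with the second patch (here `τ⁻¹` is the conjugate of `τ`). -/
def F₃ (d ε : ℝ) (f : Circle → ℂ) (w : Circle) : ℂ :=
  circleMean (fun τ =>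
      ((τ⁻¹ : Circle) + ε * f τ⁻¹) / (ε * ((τ : ℂ) + w) + ε ^ 2 * (f τ + f w) - 2 * d)
        * (1 + ε * circleDeriv f τ))
  * (w * (1 + ε * circleDeriv f w))

/-- The functional `F(U, ε, f)`; the equation of the translating pair is `Im F = 0`. -/
def F (d U ε : ℝ) (f : Circle → ℂ) (w : Circle) : ℂ :=
  F₁ U ε f w + F₂ ε f w + F₃ d ε f w

/-- The coefficient of `w` minus that of `w⁻¹` in `g`; this is the coefficient of `e_1` in
`Im g` when `g` has real Fourier coefficients. -/
def firstCoeff (g : Circle → ℂ) : ℂ :=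
  circleMean (fun w => g w * star (w : ℂ) ^ 2) - circleMean g

/-- The speed `U(ε, f)`: the solution `U` of the constraint `firstCoeff (F d U ε f) = 0`, in
which `F₁` contributes `2U (1 + ε ⨍ f)`. -/
def speed (d ε : ℝ) (f : Circle → ℂ) : ℝ :=
  -(firstCoeff fun w => F₂ ε f w + F₃ d ε f w).re / (2 * (1 + ε * (circleMean f).re))

open Classical in
/-- The reduced functional `Ĝ(ε, f) = Im F(U(ε, f), ε, f)` as an element of `Ŷ`
(extended by `0` where the right-hand side is not in `Ŷ`). -/
def Ghat {β : ℝ≥0} (d ε : ℝ) (f : XSpace β) : YHat β :=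
  if h : (fun w => (F d (speed d ε f) ε f w).im) ∈ yHatSubmodule β then ⟨_, h⟩ else 0

/-! ### Patches -/

/-- The parametrization `w ↦ ε (w + ε f(w))` of the boundary of `D₁^ε`. -/
def boundaryCurve (ε : ℝ) (f : Circle → ℂ) (w : Circle) : ℂ := ε * (w + ε * f w)

/-- The region enclosed by a closed curve: the union of the bounded components of the
complement. -/
def enclosed (γ : Circle → ℂ) : Set ℂ :=
  {z | z ∉ Set.range γ ∧ Bornology.IsBounded (connectedComponentIn (Set.range γ)ᶜ z)}

/-- The first patch `D₁^ε`. -/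
def patch₁ (ε : ℝ) (f : Circle → ℂ) : Set ℂ := enclosed (boundaryCurve ε f)

/-- The second patch `D₂^ε = -D₁^ε + 2d`. -/
def patch₂ (d ε : ℝ) (f : Circle → ℂ) : Set ℂ := (fun z => -z + 2 * (d : ℂ)) '' patch₁ ε f

/-- The complex conjugate of the velocity field generated (Biot–Savart) by the vorticity
`ε⁻² χ_{D₁^ε} - ε⁻² χ_{D₂^ε}`. -/
def conjVelocity (d ε : ℝ) (f : Circle → ℂ) (z : ℂ) : ℂ :=
  -(Complex.I / (2 * Real.pi * ε ^ 2)) * (∫ ζ in patch₁ ε f, (z - ζ)⁻¹)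
    + (Complex.I / (2 * Real.pi * ε ^ 2)) * ∫ ζ in patch₂ d ε f, (z - ζ)⁻¹

/-- The unit normal `w γ'(w) / |w γ'(w)|` to a positively oriented closed curve. -/
def unitNormal (γ : Circle → ℂ) (w : Circle) : ℂ :=
  w * circleDeriv γ w / (‖circleDeriv γ w‖ : ℂ)

/-- The vorticity `ε⁻² χ_{D₁^ε} - ε⁻² χ_{D₂^ε}`, with `D₁^ε ∋ 0` bounded by a regular Jordan
curve, translates with the velocity `iU` (speed `U` in the direction `Oy`): in the moving frame the
velocity is tangent to the boundaries of both patches. -/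
def IsTranslatingPair (d ε U : ℝ) (f : Circle → ℂ) : Prop :=
  Function.Injective (boundaryCurve ε f) ∧
  (∀ w, circleDeriv (boundaryCurve ε f) w ≠ 0) ∧
  (0 : ℂ) ∈ patch₁ ε f ∧
  frontier (patch₁ ε f) = Set.range (boundaryCurve ε f) ∧
  Disjoint (closure (patch₁ ε f)) (closure (patch₂ d ε f)) ∧
  ∀ w : Circle,
    ((conjVelocity d ε f (boundaryCurve ε f w) + Complex.I * U)
      * unitNormal (boundaryCurve ε f) w).re = 0 ∧
    ((conjVelocity d ε f (-boundaryCurve ε f w + 2 * (d : ℂ)) + Complex.I * U)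
      * (-unitNormal (boundaryCurve ε f) w)).re = 0

/-- A strictly convex planar domain: nonempty, open and convex, with no segment in its boundary. -/
def IsStrictlyConvexDomain (D : Set ℂ) : Prop :=
  D.Nonempty ∧ IsOpen D ∧ Convex ℝ D ∧ StrictConvex ℝ (closure D)

end

end VortexPair

namespace VortexPair

noncomputable section

/-! ### Arc length on the circle -/

open MeasureTheory

/-! At ε = 0 the equation is linear. A function f with only negative modes makes the
self-interaction `F₂` vanish (`circleMean_selfIntegrand_zero`), `F₃` is -w/(2d), and the speed
1/(4d) makes 2Uw cancel it. So Ĝ(0, f) = -Im f' on the whole unit ball, not merely to first order.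
The operator h ↦ -Im h' is inverted by the Cauchy singular integral C: if p has only negative modes,
then p = -2i C(Im p) (`eq_cauchyFun_im`), and C is bounded on C^β by Privalov's theorem
(`norm_cauchyFun_sub_le`).

Smoothness in (ε, f) is algebraic. The function f enters only through f', its difference quotient
and its values, which depend linearly and boundedly on f and live in Banach algebras of Hölder
functions and of kernels (`Hol`). The functional is built from them by products, conjugation, ring
inverses and the bounded integration map `meanOp`. The implicit function theorem then gives the
curve. It is unique in all of the unit ball because Ĝ(ε, f) + Im f' tends to 0 uniformly there
(`tendsto_Ghat_sub`), so that every zero is close to 0 when ε is. It is not trivial since circular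
patches do not solve the equation (`Ghat_zero_right_ne_zero`).

Rotating f by s on the circle turns the functional into one of the same form with s as a parameter
(`FHat_rotate`). For s = -1 this gives the symmetry ε ↦ -ε. For s near 1 it gives regularity: f and
its rotation solve nearby equations whose nonprincipal part is C¹ and, at ε = 0, independent of the
data, so f'(sw) - f'(w) is bounded by C|s - 1| plus a small multiple of its own norm
(`exists_lipschitz_deriv`).

This Lipschitz bound on f' is what convexity needs, since smallness in C^{1+β} does not control
curvature. A C^{1,1}-small perturbation of the circle lies strictly on one side of each of its
tangents (`supportedCurve_add`). The enclosed domain is then an intersection of half-planes, and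
strictly convex. Being star-shaped about each of its boundary points, it has coordinates along
chords, in which the Biot–Savart area integrals become the boundary integrals of F
(`integral_inv_sub_boundary`, `integral_inv_sub_outside`). In the moving frame the conjugate
velocity times the normal is i(ε/2)F - i/2, whose real part vanishes exactly when Im F does. -/

instance : MeasurableSpace Circle := borel Circle

instance : BorelSpace Circle := ⟨rfl⟩

/-- Arc length on the unit circle. -/
def arc : Measure Circle :=
  letI : Fact (0 < 2 * Real.pi) := ⟨Real.two_pi_pos⟩
  (volume : Measure (AddCircle (2 * Real.pi))).map AddCircle.homeomorphCircle'

theorem measurePreserving_homeomorphCircle [Fact (0 < 2 * Real.pi)] :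
    MeasurePreserving AddCircle.homeomorphCircle'
      (volume : Measure (AddCircle (2 * Real.pi))) arc :=
  ⟨AddCircle.homeomorphCircle'.continuous.measurable, rfl⟩

theorem arc_integral {E : Type*} [NormedAddCommGroup E] [NormedSpace ℝ E] (g : Circle → E)
    (a : ℝ) : ∫ w, g w ∂arc = ∫ θ in a..a + 2 * Real.pi, g (Circle.exp θ) := by
  have : Fact (0 < 2 * Real.pi) := ⟨Real.two_pi_pos⟩
  rw [← measurePreserving_homeomorphCircle.integral_comp
    AddCircle.homeomorphCircle'.measurableEmbedding,
    ← AddCircle.intervalIntegral_preimage (2 * Real.pi) a]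
  rfl

instance : IsFiniteMeasure arc := by
  have : Fact (0 < 2 * Real.pi) := ⟨Real.two_pi_pos⟩
  unfold arc
  infer_instance

theorem measurePreserving_exp (a : ℝ) :
    MeasurePreserving Circle.exp (volume.restrict (Set.Ioc a (a + 2 * Real.pi))) arc := by
  have : Fact (0 < 2 * Real.pi) := ⟨Real.two_pi_pos⟩
  exact measurePreserving_homeomorphCircle.comp (AddCircle.measurePreserving_mk (2 * Real.pi) a)

instance : arc.IsMulLeftInvariant := by
  have : Fact (0 < 2 * Real.pi) := ⟨Real.two_pi_pos⟩
  constructor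
  intro g
  obtain ⟨x, rfl⟩ := AddCircle.homeomorphCircle'.surjective g
  have h : (fun w => AddCircle.homeomorphCircle' x * w) ∘ AddCircle.homeomorphCircle'
      = AddCircle.homeomorphCircle' ∘ (fun y => x + y) := by
    funext y
    exact (Real.Angle.toCircle_add x y).symm
  unfold arc
  rw [Measure.map_map (by fun_prop) AddCircle.homeomorphCircle'.continuous.measurable, h,
    ← Measure.map_map AddCircle.homeomorphCircle'.continuous.measurable (by fun_prop),
    map_add_left_eq_self]

instance : arc.IsInvInvariant := by
  have : Fact (0 < 2 * Real.pi) := ⟨Real.two_pi_pos⟩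
  constructor
  have h : Inv.inv ∘ AddCircle.homeomorphCircle'
      = AddCircle.homeomorphCircle' ∘ (Neg.neg : AddCircle (2 * Real.pi) → _) := by
    funext y
    exact (Real.Angle.toCircle_neg y).symm
  unfold arc
  rw [Measure.inv_def, Measure.map_map (by fun_prop) AddCircle.homeomorphCircle'.continuous.measurable, h,
    ← Measure.map_map AddCircle.homeomorphCircle'.continuous.measurable (by fun_prop),
    Measure.map_neg_eq_self]

/-- Makes the diagonal τ = w negligible, so that the default value of division by zero never
influences an integral. -/
instance : NullSingletonClass arc := by
  have : Fact (0 < 2 * Real.pi) := ⟨Real.two_pi_pos⟩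
  refine ⟨fun w => ?_⟩
  obtain ⟨x, rfl⟩ := AddCircle.homeomorphCircle'.surjective w
  have h : AddCircle.homeomorphCircle' ⁻¹' {AddCircle.homeomorphCircle' x}
      = Metric.closedBall x 0 := by
    ext y
    simp
  rw [arc, Measure.map_apply AddCircle.homeomorphCircle'.continuous.measurable
    (measurableSet_singleton _), h, AddCircle.volume_closedBall]
  simp [Real.pi_pos.le]

theorem arc_univ : arc.real Set.univ = 2 * Real.pi := by
  have h := arc_integral (fun _ => (1:ℝ)) 0
  simpa using h

/-- Along the circle dτ = iτ dθ, and the i cancels against 2πi. -/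
theorem circleMean_eq (g : Circle → ℂ) :
    circleMean g = ((2 * Real.pi)⁻¹ : ℝ) * ∫ w, g w * (w : ℂ) ∂arc := by
  have hpi : (Real.pi : ℂ) ≠ 0 := by exact_mod_cast Real.pi_ne_zero
  rw [arc_integral _ 0, circleMean, zero_add]
  have : ∀ θ : ℝ, g (Circle.exp θ) * (Complex.I * (Circle.exp θ : ℂ))
      = Complex.I * (g (Circle.exp θ) * (Circle.exp θ : ℂ)) := fun θ => by ring
  simp_rw [this]
  rw [intervalIntegral.integral_const_mul, ← mul_assoc]
  congr 1
  push_cast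
  field_simp

/-! ### Algebras of bounded functions with a weighted Lipschitz condition -/

section Hol

variable {Ω : Type*} [MeasurableSpace Ω] {N : Ω → Ω → ℝ≥0}

/-- Bounded measurable functions `k` for which `N a b * ‖k a - k b‖` is bounded. -/
def holAlg (N : Ω → Ω → ℝ≥0) : Subalgebra ℝ (Ω → ℂ) where
  carrier := {k | Measurable k ∧ (∃ M : ℝ, ∀ a, ‖k a‖ ≤ M) ∧
    ∃ M : ℝ, ∀ a b, N a b * ‖k a - k b‖ ≤ M}
  mul_mem' := by
    rintro f g ⟨hf, ⟨A, hA⟩, B, hB⟩ ⟨hg, ⟨A', hA'⟩, B', hB'⟩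
    refine ⟨hf.mul hg, ⟨A * A', fun a => ?_⟩, A * B' + B * A', fun a b => ?_⟩
    · rw [Pi.mul_apply, norm_mul]
      exact mul_le_mul (hA a) (hA' a) (norm_nonneg _) ((norm_nonneg _).trans (hA a))
    · have h : (f * g) a - (f * g) b = f a * (g a - g b) + (f a - f b) * g b := by
        simp only [Pi.mul_apply]
        ring
      calc N a b * ‖(f * g) a - (f * g) b‖
          ≤ N a b * (‖f a‖ * ‖g a - g b‖ + ‖f a - f b‖ * ‖g b‖) := by
            rw [h]
            gcongr
            exact (norm_add_le _ _).trans (by rw [norm_mul, norm_mul])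
        _ = ‖f a‖ * (N a b * ‖g a - g b‖) + (N a b * ‖f a - f b‖) * ‖g b‖ := by ring
        _ ≤ A * B' + B * A' := by
            have h1 : 0 ≤ N a b * ‖g a - g b‖ := by positivity
            have h2 : 0 ≤ N a b * ‖f a - f b‖ := by positivity
            exact add_le_add
              (mul_le_mul (hA a) (hB' a b) h1 ((norm_nonneg _).trans (hA a)))
              (mul_le_mul (hB a b) (hA' b) (norm_nonneg _) (h2.trans (hB a b)))
  add_mem' := by
    rintro f g ⟨hf, ⟨A, hA⟩, B, hB⟩ ⟨hg, ⟨A', hA'⟩, B', hB'⟩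
    refine ⟨hf.add hg, ⟨A + A', fun a => ?_⟩, B + B', fun a b => ?_⟩
    · exact (norm_add_le _ _).trans (add_le_add (hA a) (hA' a))
    · have h : (f + g) a - (f + g) b = (f a - f b) + (g a - g b) := by
        simp only [Pi.add_apply]
        ring
      rw [h]
      calc N a b * ‖(f a - f b) + (g a - g b)‖
          ≤ N a b * (‖f a - f b‖ + ‖g a - g b‖) := by gcongr; exact norm_add_le _ _
        _ ≤ B + B' := by rw [mul_add]; exact add_le_add (hB a b) (hB' a b)
  algebraMap_mem' r := by
    refine ⟨measurable_const, ⟨‖(r : ℂ)‖, fun a => le_of_eq rfl⟩, 0, fun a b => ?_⟩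
    have : algebraMap ℝ (Ω → ℂ) r a - algebraMap ℝ (Ω → ℂ) r b = 0 := sub_self (r : ℂ)
    rw [this]
    simp

/-- The algebra `holAlg N` with the norm `sup ‖k‖ + sup N a b ‖k a - k b‖`. -/
def Hol (N : Ω → Ω → ℝ≥0) : Type _ := holAlg N

instance : CommRing (Hol N) := inferInstanceAs (CommRing (holAlg N))

instance : Algebra ℝ (Hol N) := inferInstanceAs (Algebra ℝ (holAlg N))

instance : CoeFun (Hol N) fun _ => Ω → ℂ := ⟨Subtype.val⟩

namespace Hol

/-- Bundle a function of `holAlg N`. -/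
def of (f : Ω → ℂ) (h : f ∈ holAlg N) : Hol N := ⟨f, h⟩

@[ext] theorem ext {f g : Hol N} (h : ∀ a, f a = g a) : f = g := Subtype.ext (funext h)

@[simp] theorem add_apply (f g : Hol N) (a : Ω) : (f + g) a = f a + g a := rfl
@[simp] theorem neg_apply (f : Hol N) (a : Ω) : (-f) a = -f a := rfl
@[simp] theorem mul_apply (f g : Hol N) (a : Ω) : (f * g) a = f a * g a := rfl
@[simp] theorem one_apply (a : Ω) : (1 : Hol N) a = 1 := rfl
@[simp] theorem zero_apply (a : Ω) : (0 : Hol N) a = 0 := rfl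
@[simp] theorem smul_apply (c : ℝ) (f : Hol N) (a : Ω) : (c • f) a = c * f a := rfl

theorem measurable (f : Hol N) : Measurable f.1 := f.2.1

instance : Norm (Hol N) :=
  ⟨fun f => (⨆ a, ‖f a‖) + ⨆ p : Ω × Ω, (N p.1 p.2 : ℝ) * ‖f p.1 - f p.2‖⟩

theorem norm_def (f : Hol N) :
    ‖f‖ = (⨆ a, ‖f a‖) + ⨆ p : Ω × Ω, (N p.1 p.2 : ℝ) * ‖f p.1 - f p.2‖ := rfl

theorem bdd_sup (f : Hol N) : BddAbove (Set.range fun a => ‖f a‖) := by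
  obtain ⟨M, hM⟩ := f.2.2.1
  exact ⟨M, by rintro _ ⟨a, rfl⟩; exact hM a⟩

theorem bdd_semi (f : Hol N) :
    BddAbove (Set.range fun p : Ω × Ω => (N p.1 p.2 : ℝ) * ‖f p.1 - f p.2‖) := by
  obtain ⟨M, hM⟩ := f.2.2.2
  exact ⟨M, by rintro _ ⟨a, rfl⟩; exact hM _ _⟩

theorem sup_nonneg (f : Hol N) : 0 ≤ ⨆ a, ‖f a‖ := Real.iSup_nonneg fun _ => norm_nonneg _

theorem semi_nonneg (f : Hol N) : 0 ≤ ⨆ p : Ω × Ω, (N p.1 p.2 : ℝ) * ‖f p.1 - f p.2‖ :=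
  Real.iSup_nonneg fun _ => by positivity

theorem le_sup (f : Hol N) (a : Ω) : ‖f a‖ ≤ ⨆ a, ‖f a‖ := le_ciSup f.bdd_sup a

theorem le_semi (f : Hol N) (a b : Ω) :
    N a b * ‖f a - f b‖ ≤ ⨆ p : Ω × Ω, (N p.1 p.2 : ℝ) * ‖f p.1 - f p.2‖ :=
  le_ciSup f.bdd_semi (a, b)

theorem norm_apply_le (f : Hol N) (a : Ω) : ‖f a‖ ≤ ‖f‖ :=
  (f.le_sup a).trans (le_add_of_nonneg_right f.semi_nonneg)

theorem weight_mul_le (f : Hol N) (a b : Ω) : N a b * ‖f a - f b‖ ≤ ‖f‖ :=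
  (f.le_semi a b).trans (le_add_of_nonneg_left f.sup_nonneg)

theorem norm_le {f : Hol N} {A B : ℝ} (hA0 : 0 ≤ A) (hB0 : 0 ≤ B) (hA : ∀ a, ‖f a‖ ≤ A)
    (hB : ∀ a b, N a b * ‖f a - f b‖ ≤ B) : ‖f‖ ≤ A + B :=
  add_le_add (Real.iSup_le hA hA0) (Real.iSup_le (fun _ => hB _ _) hB0)

theorem core (N : Ω → Ω → ℝ≥0) : NormedSpace.Core ℝ (Hol N) where
  norm_nonneg f := add_nonneg f.sup_nonneg f.semi_nonneg
  norm_smul c f := by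
    rw [norm_def, norm_def, mul_add, Real.mul_iSup_of_nonneg (norm_nonneg c),
      Real.mul_iSup_of_nonneg (norm_nonneg c)]
    congr 1
    · congr 1
      funext a
      rw [smul_apply, norm_mul, Complex.norm_real]
    · congr 1
      funext p
      rw [smul_apply, smul_apply, ← mul_sub, norm_mul, Complex.norm_real]
      ring
  norm_triangle f g := by
    have h := norm_le (f := f + g) (add_nonneg f.sup_nonneg g.sup_nonneg)
      (add_nonneg f.semi_nonneg g.semi_nonneg)
      (fun a => (norm_add_le _ _).trans (add_le_add (f.le_sup a) (g.le_sup a)))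
      (fun a b => by
        have e : (f + g) a - (f + g) b = (f a - f b) + (g a - g b) := by
          simp only [add_apply]; ring
        rw [e]
        calc N a b * ‖(f a - f b) + (g a - g b)‖
            ≤ N a b * (‖f a - f b‖ + ‖g a - g b‖) := by gcongr; exact norm_add_le _ _
          _ ≤ _ := by rw [mul_add]; exact add_le_add (f.le_semi a b) (g.le_semi a b))
    rw [norm_def f, norm_def g]
    linarith
  norm_eq_zero_iff f := by
    constructor
    · intro h
      ext a
      have := f.norm_apply_le a
      rw [h] at this
      simpa using this
    · rintro rfl
      simp [norm_def]

instance : NormedAddCommGroup (Hol N) := NormedAddCommGroup.ofCore (core N)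

theorem norm_mul_le' (f g : Hol N) : ‖f * g‖ ≤ ‖f‖ * ‖g‖ := by
  have hf := f.sup_nonneg
  have hf' := f.semi_nonneg
  have hg := g.sup_nonneg
  have hg' := g.semi_nonneg
  have h := norm_le (f := f * g) (mul_nonneg hf hg)
    (add_nonneg (mul_nonneg hf hg') (mul_nonneg hf' hg))
    (fun a => by
      rw [mul_apply, norm_mul]
      exact mul_le_mul (f.le_sup a) (g.le_sup a) (norm_nonneg _) hf)
    (fun a b => by
      have e : (f * g) a - (f * g) b = f a * (g a - g b) + (f a - f b) * g b := by
        simp only [mul_apply]; ring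
      calc N a b * ‖(f * g) a - (f * g) b‖
          ≤ N a b * (‖f a‖ * ‖g a - g b‖ + ‖f a - f b‖ * ‖g b‖) := by
            rw [e]
            gcongr
            exact (norm_add_le _ _).trans (by rw [norm_mul, norm_mul])
        _ = ‖f a‖ * (N a b * ‖g a - g b‖) + (N a b * ‖f a - f b‖) * ‖g b‖ := by ring
        _ ≤ _ := add_le_add
              (mul_le_mul (f.le_sup a) (g.le_semi a b) (by positivity) hf)
              (mul_le_mul (f.le_semi a b) (g.le_sup b) (norm_nonneg _) hf'))
  rw [norm_def f, norm_def g]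
  -- The product of the two norms exceeds the bound just obtained by the product of the two
  -- seminorms.
  nlinarith [mul_nonneg hf' hg']

instance : NormedCommRing (Hol N) :=
  { (inferInstance : NormedAddCommGroup (Hol N)), (inferInstance : CommRing (Hol N)) with
    norm_mul_le := norm_mul_le' }

instance : NormedAlgebra ℝ (Hol N) where
  norm_smul_le c f := ((core N).norm_smul c f).le

theorem cauchy_apply {u : ℕ → Hol N} (hu : CauchySeq u) (a : Ω) :
    CauchySeq fun n => u n a := by
  rw [Metric.cauchySeq_iff] at hu ⊢
  intro ε hε
  obtain ⟨n, hn⟩ := hu ε hε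
  refine ⟨n, fun i hi j hj => ?_⟩
  have := hn i hi j hj
  rw [dist_eq_norm] at this ⊢
  exact ((u i - u j).norm_apply_le a).trans_lt this

/-- Completeness is what makes ring inversion smooth in `Hol N`. Each of the two bounds involves
only one or two points at a time, so it passes to pointwise limits. -/
instance : CompleteSpace (Hol N) := by
  refine Metric.complete_of_cauchySeq_tendsto fun u hu => ?_
  choose l hl using fun a => cauchySeq_tendsto_of_complete (cauchy_apply hu a)
  have hbd : ∀ ε > 0, ∃ n, ∀ m ≥ n, (∀ a, ‖u m a - l a‖ ≤ ε) ∧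
      ∀ a b, N a b * ‖(u m a - l a) - (u m b - l b)‖ ≤ ε := by
    intro ε hε
    obtain ⟨n, hn⟩ := Metric.cauchySeq_iff.mp hu ε hε
    refine ⟨n, fun m hm => ⟨fun a => ?_, fun a b => ?_⟩⟩
    · refine le_of_tendsto ((tendsto_const_nhds.sub (hl a)).norm) ?_
      filter_upwards [Filter.eventually_ge_atTop n] with j hj
      have h := hn m hm j hj
      rw [dist_eq_norm] at h
      exact ((u m - u j).norm_apply_le a).trans h.le
    · refine le_of_tendsto (((tendsto_const_nhds.sub (hl a)).sub
        (tendsto_const_nhds.sub (hl b))).norm.const_mul _) ?_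
      filter_upwards [Filter.eventually_ge_atTop n] with j hj
      have h := hn m hm j hj
      rw [dist_eq_norm] at h
      exact ((u m - u j).weight_mul_le a b).trans h.le
  have hmem : l ∈ holAlg N := by
    obtain ⟨n, hn⟩ := hbd 1 one_pos
    obtain ⟨h1, h2⟩ := hn n le_rfl
    refine ⟨measurable_of_tendsto_metrizable (fun n => (u n).measurable)
      (tendsto_pi_nhds.mpr hl), ⟨‖u n‖ + 1, fun a => ?_⟩, ‖u n‖ + 1, fun a b => ?_⟩
    · have e : l a = u n a - (u n a - l a) := by ring
      rw [e]
      exact (norm_sub_le _ _).trans (add_le_add ((u n).norm_apply_le a) (h1 a))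
    · have e : l a - l b = (u n a - u n b) - ((u n a - l a) - (u n b - l b)) := by ring
      rw [e]
      calc _ ≤ (N a b : ℝ) * (‖u n a - u n b‖ + ‖(u n a - l a) - (u n b - l b)‖) := by
            gcongr; exact norm_sub_le _ _
        _ ≤ _ := by rw [mul_add]; exact add_le_add ((u n).weight_mul_le a b) (h2 a b)
  refine ⟨of l hmem, ?_⟩
  rw [Metric.tendsto_atTop]
  intro ε hε
  obtain ⟨n, hn⟩ := hbd (ε / 3) (by positivity)
  refine ⟨n, fun m hm => ?_⟩
  obtain ⟨h1, h2⟩ := hn m hm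
  rw [dist_eq_norm]
  refine (norm_le (f := u m - of l hmem) (by positivity) (by positivity) h1 h2).trans_lt ?_
  linarith

/-- Since 1/x - 1/y = (y - x)/(xy), a lower bound on |f| carries the weighted bound over to 1/f. All
denominators of the functional are inverted in this way. -/
theorem isUnit_of_le {f : Hol N} {c : ℝ} (hc : 0 < c) (h : ∀ a, c ≤ ‖f a‖) : IsUnit f := by
  have h0 : ∀ a, f a ≠ 0 := fun a => norm_pos_iff.mp (hc.trans_le (h a))
  have hmem : (fun a => (f a)⁻¹) ∈ holAlg N := by
    refine ⟨f.measurable.inv, ⟨c⁻¹, fun a => ?_⟩, c⁻¹ * c⁻¹ * ‖f‖, fun a b => ?_⟩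
    · rw [norm_inv]
      exact inv_anti₀ hc (h a)
    · rw [inv_sub_inv (h0 a) (h0 b), norm_div, norm_mul, norm_sub_rev, div_eq_inv_mul,
        mul_inv]
      have e1 : ‖f a‖⁻¹ ≤ c⁻¹ := inv_anti₀ hc (h a)
      have e2 : ‖f b‖⁻¹ ≤ c⁻¹ := inv_anti₀ hc (h b)
      calc (N a b : ℝ) * (‖f a‖⁻¹ * ‖f b‖⁻¹ * ‖f a - f b‖)
          = ‖f a‖⁻¹ * ‖f b‖⁻¹ * (N a b * ‖f a - f b‖) := by ring
        _ ≤ c⁻¹ * c⁻¹ * ‖f‖ := by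
            have := f.weight_mul_le a b
            gcongr
  refine IsUnit.of_mul_eq_one (of _ hmem) ?_
  ext a
  exact mul_inv_cancel₀ (h0 a)

theorem inverse_apply {f : Hol N} (h : IsUnit f) (a : Ω) : Ring.inverse f a = (f a)⁻¹ := by
  have := congrArg (fun k : Hol N => k a) (Ring.mul_inverse_cancel f h)
  simp only [mul_apply, one_apply] at this
  exact eq_inv_of_mul_eq_one_right this

/-- Pointwise complex conjugation. -/
def conj : Hol N →L[ℝ] Hol N :=
  LinearMap.mkContinuous
    { toFun := fun f => of (fun a => star (f a)) <| by
        obtain ⟨hf, ⟨A, hA⟩, B, hB⟩ := f.2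
        refine ⟨Complex.continuous_conj.measurable.comp hf, ⟨A, fun a => ?_⟩, B, fun a b => ?_⟩
        · rw [norm_star]; exact hA a
        · rw [← star_sub, norm_star]; exact hB a b
      map_add' := fun f g => by ext a; exact star_add _ _
      map_smul' := fun c f => by
        ext a
        change star ((c : ℂ) * f a) = c * star (f a)
        simp } 1 (fun f => by
    rw [one_mul]
    refine (norm_le f.sup_nonneg f.semi_nonneg (fun a => ?_) (fun a b => ?_))
    · change ‖star (f a)‖ ≤ _
      rw [norm_star]
      exact f.le_sup a
    · change N a b * ‖star (f a) - star (f b)‖ ≤ _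
      rw [← star_sub, norm_star]
      exact f.le_semi a b)

/-- Complex constants. -/
def const (N : Ω → Ω → ℝ≥0) : ℂ →L[ℝ] Hol N :=
  LinearMap.mkContinuous
    { toFun := fun c => of (fun _ => c) ⟨measurable_const, ⟨‖c‖, fun _ => le_rfl⟩, 0, by simp⟩
      map_add' := fun _ _ => rfl
      map_smul' := fun _ _ => rfl } 1 (fun c => by
    rw [one_mul, ← add_zero ‖c‖]
    exact norm_le (norm_nonneg c) le_rfl (fun _ => le_rfl) (fun a b => by
      change (N a b : ℝ) * ‖c - c‖ ≤ 0
      simp))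

@[simp] theorem const_apply (c : ℂ) (a : Ω) : const N c a = c := rfl

end Hol

end Hol

/-! ### Singular integrals of powers of the distance -/

theorem dist_eq (τ w : Circle) : dist τ w = ‖(τ : ℂ) - w‖ := by
  rw [← dist_eq_norm]
  rfl

theorem dist_mul_left_eq (w τ τ' : Circle) : dist (w * τ) (w * τ') = dist τ τ' := by
  rw [dist_eq, dist_eq, Circle.coe_mul, Circle.coe_mul, ← mul_sub, norm_mul, Circle.norm_coe,
    one_mul]

theorem dist_inv_inv_eq (τ τ' : Circle) : dist τ⁻¹ τ'⁻¹ = dist τ τ' := by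
  rw [← dist_mul_left_eq τ, mul_inv_cancel, ← dist_mul_left_eq τ', mul_one,
    mul_left_comm, mul_inv_cancel, mul_one, dist_comm]

theorem dist_le_two (τ w : Circle) : dist τ w ≤ 2 := by
  rw [dist_eq]
  refine (norm_sub_le _ _).trans ?_
  norm_num [Circle.norm_coe]

theorem dist_mul_exp (w : Circle) (θ : ℝ) :
    dist (w * Circle.exp θ) w = 2 * |Real.sin (θ / 2)| := by
  have h := dist_mul_left_eq w (Circle.exp θ) 1
  rw [mul_one] at h
  rw [h, dist_eq, Circle.coe_exp, Circle.coe_one, mul_comm, Complex.norm_exp_I_mul_ofReal_sub_one,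
    norm_mul, Real.norm_eq_abs, Real.norm_eq_abs, abs_two]

theorem dist_mul_exp_le (w : Circle) (θ : ℝ) : dist (w * Circle.exp θ) w ≤ |θ| := by
  rw [dist_mul_exp]
  have := Real.abs_sin_le_abs (x := θ / 2)
  rw [abs_div, abs_two] at this
  linarith

/-- Jordan's inequality for the sine: chord and arc are comparable, with ratio π/2. -/
theorem le_dist_mul_exp (w : Circle) {θ : ℝ} (hθ : |θ| ≤ Real.pi) :
    2 / Real.pi * |θ| ≤ dist (w * Circle.exp θ) w := by
  rw [dist_mul_exp]
  have := Real.mul_abs_le_abs_sin (x := θ / 2) (by rw [abs_div, abs_two]; linarith)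
  rw [abs_div, abs_two] at this
  linarith

theorem exists_mul_exp (w τ : Circle) : ∃ θ : ℝ, |θ| ≤ Real.pi ∧ τ = w * Circle.exp θ :=
  ⟨Complex.arg (w⁻¹ * τ : Circle), Complex.abs_arg_le_pi _, by rw [Circle.exp_arg]; group⟩

theorem measurePreserving_mul_exp (w : Circle) :
    MeasurePreserving (fun θ => w * Circle.exp θ)
      (volume.restrict (Set.Ioc (-Real.pi) (-Real.pi + 2 * Real.pi))) arc :=
  (measurePreserving_mul_left arc w).comp (measurePreserving_exp _)

/-- The circle is unrolled from w by τ = w e^{iθ}. The bound is even in θ, whence the factor 2 and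
an integral over the half-line, where powers have explicit primitives. -/
theorem arc_integral_le {E : Type*} [NormedAddCommGroup E] {φ : Circle → E}
    (hφ : AEStronglyMeasurable φ arc) (w : Circle) {g : ℝ → ℝ}
    (hg : IntegrableOn g (Set.Ioi 0)) (hg0 : ∀ x, 0 ≤ g x)
    (h : ∀ θ : ℝ, θ ≠ 0 → |θ| ≤ Real.pi → ‖φ (w * Circle.exp θ)‖ ≤ g |θ|) :
    Integrable φ arc ∧ ∫ τ, ‖φ τ‖ ∂arc ≤ 2 * ∫ x in Set.Ioi 0, g x := by
  have hgi : Integrable fun x : ℝ => g |x| := by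
    rw [← integrableOn_univ, ← Set.Iic_union_Ioi (a := (0:ℝ)), integrableOn_union]
    have h1 : IntegrableOn (fun x : ℝ => g |x|) (Set.Ioi 0) :=
      hg.congr_fun (fun x hx => by rw [abs_of_pos hx]) measurableSet_Ioi
    refine ⟨?_, h1⟩
    rw [integrableOn_Iic_iff_integrableOn_Iio]
    have := (MeasurePreserving.integrableOn_comp_preimage (Measure.measurePreserving_neg volume)
      (Homeomorph.neg ℝ).measurableEmbedding (s := Set.Ioi 0) (f := fun x : ℝ => g |x|)).mpr h1
    simpa [Function.comp_def] using this
  have hmp := measurePreserving_mul_exp w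
  have hae : ∀ᵐ θ ∂(volume.restrict (Set.Ioc (-Real.pi) (-Real.pi + 2 * Real.pi))),
      ‖φ (w * Circle.exp θ)‖ ≤ g |θ| := by
    filter_upwards [ae_restrict_mem measurableSet_Ioc, Measure.ae_ne _ (0:ℝ)] with θ hθ h0
    exact h θ h0 (abs_le.mpr ⟨hθ.1.le, by linarith [hθ.2]⟩)
  have hi : Integrable φ arc :=
    (hmp.integrable_comp hφ).mp (Integrable.mono' hgi.restrict
      (hφ.comp_measurePreserving hmp) hae)
  refine ⟨hi, ?_⟩
  rw [← integral_comp_abs, ← hmp.map_eq, integral_map hmp.measurable.aemeasurable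
    (by rw [hmp.map_eq]; exact hφ.norm)]
  calc _ ≤ ∫ θ in Set.Ioc (-Real.pi) (-Real.pi + 2 * Real.pi), g |θ| :=
        integral_mono_ae ((hmp.integrable_comp hφ).mpr hi).norm hgi.restrict hae
    _ ≤ _ := setIntegral_le_integral hgi (ae_of_all _ fun x => hg0 _)

theorem integral_dist_rpow_near {s : ℝ} (hs0 : 0 ≤ s) (hs1 : s < 1) (w : Circle) {ρ : ℝ}
    (hρ : 0 < ρ) :
    Integrable ({τ | dist τ w ≤ ρ}.indicator fun τ => dist τ w ^ (-s)) arc ∧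
    ∫ τ, {τ | dist τ w ≤ ρ}.indicator (fun τ => dist τ w ^ (-s)) τ ∂arc
      ≤ Real.pi / (1 - s) * ρ ^ (1 - s) := by
  have hpi := Real.pi_pos
  -- A chord of length at most ρ spans an arc of length at most (π/2)ρ.
  set g : ℝ → ℝ := (Set.Ioc 0 (Real.pi / 2 * ρ)).indicator
    fun x => (2 / Real.pi) ^ (-s) * x ^ (-s) with hgdef
  have hcρ : 0 < Real.pi / 2 * ρ := by positivity
  have hmeas : Measurable ({τ | dist τ w ≤ ρ}.indicator fun τ => dist τ w ^ (-s)) :=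
    Measurable.indicator (by fun_prop) (measurableSet_le (by fun_prop) measurable_const)
  have hint : IntegrableOn (fun x : ℝ => (2 / Real.pi) ^ (-s) * x ^ (-s))
      (Set.Ioc 0 (Real.pi / 2 * ρ)) := by
    rw [← intervalIntegrable_iff_integrableOn_Ioc_of_le hcρ.le]
    exact (intervalIntegral.intervalIntegrable_rpow' (by linarith)).const_mul _
  have hg : IntegrableOn g (Set.Ioi 0) :=
    (hint.integrable_indicator measurableSet_Ioc).integrableOn
  have hg0 : ∀ x, 0 ≤ g x := fun x => Set.indicator_nonneg (fun y hy => by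
    have := hy.1.le
    positivity) _
  have hval : ∫ x in Set.Ioi 0, g x = Real.pi / 2 / (1 - s) * ρ ^ (1 - s) := by
    rw [hgdef, setIntegral_indicator measurableSet_Ioc,
      Set.inter_eq_self_of_subset_right fun x hx => hx.1,
      ← intervalIntegral.integral_of_le hcρ.le, intervalIntegral.integral_const_mul,
      integral_rpow (Or.inl (by linarith)), Real.zero_rpow (by linarith), sub_zero,
      neg_add_eq_sub, Real.mul_rpow (by positivity) hρ.le]
    have : (2 / Real.pi) ^ (-s) * (Real.pi / 2) ^ (1 - s) = Real.pi / 2 := by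
      rw [← inv_div Real.pi 2, Real.inv_rpow (by positivity), ← Real.rpow_neg (by positivity),
        neg_neg, ← Real.rpow_add (by positivity)]
      simp
    calc _ = ((2 / Real.pi) ^ (-s) * (Real.pi / 2) ^ (1 - s)) * ρ ^ (1 - s) / (1 - s) := by ring
      _ = _ := by rw [this]; ring
  have key := arc_integral_le hmeas.aestronglyMeasurable w hg hg0 (fun θ hθ0 hθ => by
    have h1 := le_dist_mul_exp w hθ
    have h2 : 0 < |θ| := abs_pos.mpr hθ0
    by_cases hle : dist (w * Circle.exp θ) w ≤ ρ
    · rw [Set.indicator_of_mem (show w * Circle.exp θ ∈ {τ | dist τ w ≤ ρ} from hle), hgdef,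
        Set.indicator_of_mem, Real.norm_of_nonneg (by positivity),
        ← Real.mul_rpow (by positivity) h2.le]
      · exact Real.rpow_le_rpow_of_nonpos (by positivity) h1 (by linarith)
      · refine ⟨h2, ?_⟩
        have := h1.trans hle
        rw [div_mul_eq_mul_div, div_le_iff₀ hpi] at this
        linarith
    · rw [Set.indicator_of_notMem (show w * Circle.exp θ ∉ {τ | dist τ w ≤ ρ} from hle), norm_zero]
      exact hg0 _)
  refine ⟨key.1, ?_⟩
  refine (integral_mono key.1 key.1.norm fun τ => Real.le_norm_self _).trans (key.2.trans ?_)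
  rw [hval]
  apply le_of_eq
  ring

theorem integral_dist_rpow_far {t : ℝ} (ht : 1 < t) (w : Circle) {ρ : ℝ} (hρ : 0 < ρ) :
    Integrable ({τ | ρ < dist τ w}.indicator fun τ => dist τ w ^ (-t)) arc ∧
    ∫ τ, {τ | ρ < dist τ w}.indicator (fun τ => dist τ w ^ (-t)) τ ∂arc
      ≤ 2 * (2 / Real.pi) ^ (-t) / (t - 1) * ρ ^ (1 - t) := by
  have hpi := Real.pi_pos
  -- The support comes from the other comparison: an arc is at least as long as its chord, which
  -- exceeds ρ.
  set g : ℝ → ℝ := (Set.Ioi ρ).indicator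
    fun x => (2 / Real.pi) ^ (-t) * x ^ (-t) with hgdef
  have hmeas : Measurable ({τ | ρ < dist τ w}.indicator fun τ => dist τ w ^ (-t)) :=
    Measurable.indicator (by fun_prop) (measurableSet_lt measurable_const (by fun_prop))
  have hint : IntegrableOn (fun x : ℝ => (2 / Real.pi) ^ (-t) * x ^ (-t)) (Set.Ioi ρ) :=
    (integrableOn_Ioi_rpow_of_lt (by linarith) hρ).const_mul _
  have hg : IntegrableOn g (Set.Ioi 0) :=
    (hint.integrable_indicator measurableSet_Ioi).integrableOn
  have hg0 : ∀ x, 0 ≤ g x := fun x => Set.indicator_nonneg (fun y hy => by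
    have : 0 < y := hρ.trans hy
    positivity) _
  have hval : ∫ x in Set.Ioi 0, g x = (2 / Real.pi) ^ (-t) / (t - 1) * ρ ^ (1 - t) := by
    rw [hgdef, setIntegral_indicator measurableSet_Ioi,
      Set.inter_eq_self_of_subset_right (Set.Ioi_subset_Ioi hρ.le),
      integral_const_mul, integral_Ioi_rpow_of_lt (by linarith) hρ, neg_add_eq_sub]
    have h1 : 1 - t ≠ 0 := by linarith
    have h2 : t - 1 ≠ 0 := by linarith
    field_simp
    ring
  have key := arc_integral_le hmeas.aestronglyMeasurable w hg hg0 (fun θ hθ0 hθ => by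
    have h1 := le_dist_mul_exp w hθ
    have h2 : 0 < |θ| := abs_pos.mpr hθ0
    by_cases hle : ρ < dist (w * Circle.exp θ) w
    · rw [Set.indicator_of_mem (show w * Circle.exp θ ∈ {τ | ρ < dist τ w} from hle), hgdef,
        Set.indicator_of_mem, Real.norm_of_nonneg (by positivity),
        ← Real.mul_rpow (by positivity) h2.le]
      · exact Real.rpow_le_rpow_of_nonpos (by positivity) h1 (by linarith)
      · exact hle.trans_le (dist_mul_exp_le w θ)
    · rw [Set.indicator_of_notMem (show w * Circle.exp θ ∉ {τ | ρ < dist τ w} from hle), norm_zero]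
      exact hg0 _)
  refine ⟨key.1, ?_⟩
  refine (integral_mono key.1 key.1.norm fun τ => Real.le_norm_self _).trans (key.2.trans ?_)
  rw [hval]
  apply le_of_eq
  ring

theorem integral_dist_rpow {s : ℝ} (hs0 : 0 ≤ s) (hs1 : s < 1) (w : Circle) :
    Integrable (fun τ => dist τ w ^ (-s)) arc ∧
    ∫ τ, dist τ w ^ (-s) ∂arc ≤ 2 * Real.pi / (1 - s) := by
  have h := integral_dist_rpow_near hs0 hs1 w two_pos
  have e : {τ : Circle | dist τ w ≤ 2} = Set.univ :=
    Set.eq_univ_of_forall fun τ => dist_le_two τ w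
  rw [e, Set.indicator_univ] at h
  refine ⟨h.1, h.2.trans ?_⟩
  have h1 : (2:ℝ) ^ (1 - s) ≤ 2 ^ (1:ℝ) :=
    Real.rpow_le_rpow_of_exponent_le one_le_two (by linarith)
  have h2 : 0 ≤ Real.pi / (1 - s) := div_nonneg Real.pi_pos.le (by linarith)
  rw [Real.rpow_one] at h1
  calc _ ≤ Real.pi / (1 - s) * 2 := by gcongr
    _ = _ := by ring

/-! ### Hölder functions and kernels on the circle -/

@[fun_prop] theorem continuous_coe_circle : Continuous fun w : Circle => (w : ℂ) :=
  continuous_induced_dom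

@[fun_prop] theorem measurable_coe_circle : Measurable fun w : Circle => (w : ℂ) :=
  continuous_coe_circle.measurable

/-- The weight of the space `C^β`. -/
def holderWeight (β : ℝ≥0) (w w' : Circle) : ℝ≥0 := nndist w w' ^ (-(β : ℝ))

/-- The weight for kernels `k(τ, w)` with `|k(τ, w) - k(τ, w')| |τ - w| ≤ M |w - w'|`. -/
def kernelWeight (p p' : Circle × Circle) : ℝ≥0 :=
  open Classical in if p.1 = p'.1 then nndist p.1 p.2 / nndist p.2 p'.2 else 0

/-- Complex functions of class `C^β`. -/
abbrev CHol (β : ℝ≥0) : Type := Hol (holderWeight β)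

/-- Bounded kernels that are Lipschitz off the diagonal. -/
abbrev Ker : Type := Hol kernelWeight

theorem holderWeight_mul_le_iff {β : ℝ≥0} {w w' : Circle} (h : w ≠ w') {x M : ℝ} :
    holderWeight β w w' * x ≤ M ↔ x ≤ M * dist w w' ^ (β : ℝ) := by
  have hd : 0 < dist w w' := dist_pos.mpr h
  have hp : 0 < dist w w' ^ (β : ℝ) := Real.rpow_pos_of_pos hd _
  rw [holderWeight, NNReal.coe_rpow, coe_nndist, Real.rpow_neg hd.le, inv_mul_le_iff₀ hp,
    mul_comm]

theorem norm_sub_le_rpow {β : ℝ≥0} (g : CHol β) (w w' : Circle) :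
    ‖g w - g w'‖ ≤ ‖g‖ * dist w w' ^ (β : ℝ) := by
  by_cases h : w = w'
  · subst h
    rw [sub_self, norm_zero]
    positivity
  · exact (holderWeight_mul_le_iff h).mp (g.weight_mul_le w w')

theorem holderWeight_mul_le {β : ℝ≥0} {g : Circle → ℂ} {M : ℝ} (hM : 0 ≤ M)
    (h : ∀ w w', ‖g w - g w'‖ ≤ M * dist w w' ^ (β : ℝ)) (w w' : Circle) :
    holderWeight β w w' * ‖g w - g w'‖ ≤ M := by
  by_cases e : w = w'
  · subst e
    simpa using hM
  · exact (holderWeight_mul_le_iff e).mpr (h w w')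

theorem holderWith_of_le {E : Type*} [NormedAddCommGroup E] {β : ℝ≥0} {g : Circle → E} {M : ℝ≥0}
    (h : ∀ w w', ‖g w - g w'‖ ≤ M * dist w w' ^ (β : ℝ)) : HolderWith M β g := by
  intro w w'
  rw [edist_nndist, edist_nndist, ← ENNReal.coe_rpow_of_nonneg _ β.coe_nonneg]
  norm_cast
  have := h w w'
  rw [← dist_eq_norm] at this
  exact_mod_cast this

theorem _root_.MemHolder.norm_sub_le {E : Type*} [NormedAddCommGroup E] {β : ℝ≥0} {g : Circle → E}
    (h : MemHolder β g) (w w' : Circle) :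
    ‖g w - g w'‖ ≤ nnHolderNorm β g * dist w w' ^ (β : ℝ) := by
  rw [← dist_eq_norm]
  exact h.holderWith.dist_le w w'

theorem _root_.MemHolder.continuous {E : Type*} [NormedAddCommGroup E] {β : ℝ≥0}
    (hβ : 0 < β) {g : Circle → E} (h : MemHolder β g) : Continuous g :=
  h.holderWith.continuous hβ

theorem memHolder_chol {β : ℝ≥0} (g : CHol β) : MemHolder β g.1 :=
  ⟨‖g‖₊, holderWith_of_le (norm_sub_le_rpow g)⟩

theorem continuous_chol {β : ℝ≥0} (hβ : 0 < β) (g : CHol β) : Continuous g.1 :=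
  (memHolder_chol g).continuous hβ

theorem norm_le_supNorm {E : Type*} [NormedAddCommGroup E] {g : Circle → E} (hg : Continuous g)
    (w : Circle) : ‖g w‖ ≤ supNorm g :=
  le_ciSup (bddAbove_norm hg) w

theorem mem_holAlg {β : ℝ≥0} {g : Circle → ℂ} (hg : Continuous g) (h : MemHolder β g) :
    g ∈ holAlg (holderWeight β) :=
  ⟨hg.measurable, ⟨_, norm_le_supNorm hg⟩, nnHolderNorm β g,
    holderWeight_mul_le (NNReal.coe_nonneg _) h.norm_sub_le⟩

theorem norm_of_le_holderNorm {β : ℝ≥0} {g : Circle → ℂ} (hg : Continuous g) (h : MemHolder β g) :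
    ‖(Hol.of g (mem_holAlg hg h) : CHol β)‖ ≤ holderNorm β g :=
  Hol.norm_le (supNorm_nonneg g) (NNReal.coe_nonneg _) (norm_le_supNorm hg)
    (holderWeight_mul_le (NNReal.coe_nonneg _) h.norm_sub_le)

theorem holderNorm_le {E : Type*} [NormedAddCommGroup E] {β : ℝ≥0} {g : Circle → E} {A B : ℝ}
    (hA0 : 0 ≤ A) (hB0 : 0 ≤ B) (hA : ∀ w, ‖g w‖ ≤ A)
    (hB : ∀ w w', ‖g w - g w'‖ ≤ B * dist w w' ^ (β : ℝ)) : holderNorm β g ≤ A + B := by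
  lift B to ℝ≥0 using hB0
  exact add_le_add (Real.iSup_le hA hA0) (by exact_mod_cast (holderWith_of_le hB).nnholderNorm_le)

/-- Bundling a function of class `C^β` from explicit bounds. -/
theorem mem_holAlg_of_le {β : ℝ≥0} (hβ : 0 < β) {g : Circle → ℂ} {A B : ℝ} (hB0 : 0 ≤ B)
    (hA : ∀ w, ‖g w‖ ≤ A) (hB : ∀ w w', ‖g w - g w'‖ ≤ B * dist w w' ^ (β : ℝ)) :
    g ∈ holAlg (holderWeight β) := by
  lift B to ℝ≥0 using hB0
  exact ⟨((holderWith_of_le hB).continuous hβ).measurable, ⟨A, hA⟩, B,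
    holderWeight_mul_le B.2 hB⟩

theorem kernelWeight_mul_le {k : Circle × Circle → ℂ} {M : ℝ} (hM : 0 ≤ M)
    (h : ∀ τ w w', ‖k (τ, w) - k (τ, w')‖ * dist τ w ≤ M * dist w w') (p p' : Circle × Circle) :
    kernelWeight p p' * ‖k p - k p'‖ ≤ M := by
  obtain ⟨τ, w⟩ := p
  obtain ⟨τ', w'⟩ := p'
  rw [kernelWeight]
  split_ifs with e
  · obtain rfl : τ = τ' := e
    rw [NNReal.coe_div, coe_nndist, coe_nndist]
    by_cases hw : w = w'
    · subst hw
      simpa using hM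
    · have hd : 0 < dist w w' := dist_pos.mpr hw
      rw [div_mul_eq_mul_div, div_le_iff₀ hd, mul_comm]
      exact h τ w w'
  · simpa using hM

theorem ker_norm_sub_mul_le (k : Ker) (τ w w' : Circle) :
    ‖k (τ, w) - k (τ, w')‖ * dist τ w ≤ ‖k‖ * dist w w' := by
  by_cases hw : w = w'
  · subst hw
    simp
  have hd : 0 < dist w w' := dist_pos.mpr hw
  have h := k.weight_mul_le (τ, w) (τ, w')
  rw [kernelWeight, if_pos rfl, NNReal.coe_div, coe_nndist, coe_nndist, div_mul_eq_mul_div,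
    div_le_iff₀ hd] at h
  rwa [mul_comm]

/-- Interpolates between the trivial bound 2‖k‖ and the Lipschitz bound ‖k‖x, x = |w - w'|/|τ - w|,
by min(1, x) ≤ x^s. For s < 1 the result is integrable in τ, unlike the Lipschitz bound. -/
theorem ker_norm_sub_le_rpow (k : Ker) {s : ℝ} (hs0 : 0 ≤ s) (hs1 : s ≤ 1) {τ w : Circle}
    (hτ : τ ≠ w) (w' : Circle) :
    ‖k (τ, w) - k (τ, w')‖ ≤ 2 * ‖k‖ * dist w w' ^ s * dist τ w ^ (-s) := by
  have hr : 0 < dist τ w := dist_pos.mpr hτ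
  have hk := norm_nonneg k
  have e : dist w w' ^ s * dist τ w ^ (-s) = (dist w w' / dist τ w) ^ s := by
    rw [Real.div_rpow dist_nonneg hr.le, Real.rpow_neg hr.le, div_eq_mul_inv]
  rw [mul_assoc, e]
  rcases le_total (dist τ w) (dist w w') with h | h
  · have h1 : 1 ≤ (dist w w' / dist τ w) ^ s := Real.one_le_rpow ((one_le_div hr).mpr h) hs0
    have h2 : ‖k (τ, w) - k (τ, w')‖ ≤ 2 * ‖k‖ := by
      refine (norm_sub_le _ _).trans ?_
      linarith [k.norm_apply_le (τ, w), k.norm_apply_le (τ, w')]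
    nlinarith
  · have h1 : dist w w' / dist τ w ≤ (dist w w' / dist τ w) ^ s :=
      Real.self_le_rpow_of_le_one (by positivity) ((div_le_one hr).mpr h) hs1
    have h2 : ‖k (τ, w) - k (τ, w')‖ ≤ ‖k‖ * (dist w w' / dist τ w) := by
      rw [← mul_div_assoc, le_div_iff₀ hr]
      exact ker_norm_sub_mul_le k τ w w'
    have h3 : 0 ≤ dist w w' / dist τ w := by positivity
    nlinarith [mul_le_mul_of_nonneg_left h1 hk]

/-! ### Integration of kernels in the first variable -/

theorem ker_slice_integrable (k : Ker) (w : Circle) : Integrable (fun τ => k (τ, w)) arc :=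
  Integrable.of_bound (k.measurable.comp (by fun_prop)).aestronglyMeasurable ‖k‖
    (ae_of_all _ fun _ => k.norm_apply_le _)

theorem integrable_mul_coe {g : Circle → ℂ} (hg : Integrable g arc) :
    Integrable (fun τ => g τ * (τ : ℂ)) arc :=
  hg.mul_bdd (c := 1) measurable_coe_circle.aestronglyMeasurable
    (ae_of_all _ fun τ => (Circle.norm_coe τ).le)

theorem circleMean_add {g h : Circle → ℂ} (hg : Integrable g arc) (hh : Integrable h arc) :
    circleMean (fun τ => g τ + h τ) = circleMean g + circleMean h := by
  simp only [circleMean_eq, add_mul]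
  rw [integral_add (integrable_mul_coe hg) (integrable_mul_coe hh), mul_add]

theorem circleMean_sub {g h : Circle → ℂ} (hg : Integrable g arc) (hh : Integrable h arc) :
    circleMean (fun τ => g τ - h τ) = circleMean g - circleMean h := by
  simp only [circleMean_eq, sub_mul]
  rw [integral_sub (integrable_mul_coe hg) (integrable_mul_coe hh), mul_sub]

theorem circleMean_const_mul (c : ℂ) (g : Circle → ℂ) :
    circleMean (fun τ => c * g τ) = c * circleMean g := by
  simp only [circleMean_eq, mul_assoc]
  rw [integral_const_mul]
  ring

theorem circleMean_congr_ae {g h : Circle → ℂ} (e : g =ᵐ[arc] h) :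
    circleMean g = circleMean h := by
  simp only [circleMean_eq]
  congr 1
  exact integral_congr_ae (e.mono fun τ hτ => by simp only [hτ])

theorem norm_circleMean_le_integral (g : Circle → ℂ) :
    ‖circleMean g‖ ≤ (2 * Real.pi)⁻¹ * ∫ τ, ‖g τ‖ ∂arc := by
  have := Real.pi_pos
  rw [circleMean_eq, norm_mul, Complex.norm_real, Real.norm_of_nonneg (by positivity)]
  gcongr
  refine (norm_integral_le_integral_norm _).trans (le_of_eq ?_)
  simp only [norm_mul, Circle.norm_coe, mul_one]

theorem norm_circleMean_le {g : Circle → ℂ} {M : ℝ} (h : ∀ τ, ‖g τ‖ ≤ M) :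
    ‖circleMean g‖ ≤ M := by
  have hpi := Real.pi_pos
  rw [circleMean_eq, norm_mul, Complex.norm_real, Real.norm_of_nonneg (by positivity),
    inv_mul_le_iff₀ (by positivity), mul_comm]
  rw [← arc_univ]
  refine norm_integral_le_of_norm_le_const (ae_of_all _ fun τ => ?_)
  rw [norm_mul, Circle.norm_coe, mul_one]
  exact h τ

theorem norm_mean_sub_le (β : ℝ≥0) (hβ₁ : β < 1) (k : Ker) (w w' : Circle) :
    ‖circleMean (fun τ => k (τ, w)) - circleMean (fun τ => k (τ, w'))‖
      ≤ 2 / (1 - β) * ‖k‖ * dist w w' ^ (β : ℝ) := by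
  have hβ1 : (β : ℝ) < 1 := by exact_mod_cast hβ₁
  have hpi := Real.pi_pos
  rw [← circleMean_sub (ker_slice_integrable k w) (ker_slice_integrable k w')]
  refine (norm_circleMean_le_integral _).trans ?_
  obtain ⟨h1, h2⟩ := integral_dist_rpow β.2 hβ1 w
  have h3 : ∫ τ, ‖k (τ, w) - k (τ, w')‖ ∂arc
      ≤ ∫ τ, 2 * ‖k‖ * dist w w' ^ (β : ℝ) * dist τ w ^ (-(β : ℝ)) ∂arc := by
    refine integral_mono_ae ((ker_slice_integrable k w).sub (ker_slice_integrable k w')).norm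
      (h1.const_mul _) ?_
    filter_upwards [Measure.ae_ne arc w] with τ hτ
    exact ker_norm_sub_le_rpow k β.2 hβ1.le hτ w'
  rw [integral_const_mul] at h3
  have h4 : 0 < 1 - (β : ℝ) := by linarith
  calc (2 * Real.pi)⁻¹ * ∫ τ, ‖k (τ, w) - k (τ, w')‖ ∂arc
      ≤ (2 * Real.pi)⁻¹ * (2 * ‖k‖ * dist w w' ^ (β : ℝ) * (2 * Real.pi / (1 - β))) := by
        refine mul_le_mul_of_nonneg_left (h3.trans ?_) (by positivity)
        exact mul_le_mul_of_nonneg_left h2 (by positivity)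
    _ = _ := by field_simp

/-- Integration of a kernel in its first variable. -/
def meanFun (β : ℝ≥0) (hβ₀ : 0 < β) (hβ₁ : β < 1) (k : Ker) : CHol β :=
  Hol.of (fun w => circleMean fun τ => k (τ, w)) <|
    mem_holAlg_of_le hβ₀ (B := 2 / (1 - β) * ‖k‖)
      (mul_nonneg (div_nonneg zero_le_two (sub_nonneg.mpr (by exact_mod_cast hβ₁.le)))
        (norm_nonneg k))
      (fun _ => norm_circleMean_le fun _ => k.norm_apply_le _) (norm_mean_sub_le β hβ₁ k)

theorem meanFun_apply {β : ℝ≥0} (hβ₀ : 0 < β) (hβ₁ : β < 1) (k : Ker) (w : Circle) :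
    meanFun β hβ₀ hβ₁ k w = circleMean fun τ => k (τ, w) := rfl

theorem norm_meanFun_le {β : ℝ≥0} (hβ₀ : 0 < β) (hβ₁ : β < 1) (k : Ker) :
    ‖meanFun β hβ₀ hβ₁ k‖ ≤ (1 + 2 / (1 - β)) * ‖k‖ := by
  have h : (0:ℝ) ≤ 2 / (1 - β) * ‖k‖ :=
    mul_nonneg (div_nonneg zero_le_two (sub_nonneg.mpr (by exact_mod_cast hβ₁.le)))
      (norm_nonneg k)
  rw [add_mul, one_mul]
  exact Hol.norm_le (norm_nonneg k) h
    (fun w => norm_circleMean_le fun τ => k.norm_apply_le _)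
    (holderWeight_mul_le h (norm_mean_sub_le β hβ₁ k))

/-- Integration of a kernel in its first variable, as a linear map into `C^β`. -/
def meanLin (β : ℝ≥0) (hβ₀ : 0 < β) (hβ₁ : β < 1) : Ker →ₗ[ℝ] CHol β where
  toFun := meanFun β hβ₀ hβ₁
  map_add' k l := Hol.ext fun w => by
    rw [Hol.add_apply, meanFun_apply, meanFun_apply, meanFun_apply]
    exact circleMean_add (ker_slice_integrable k w) (ker_slice_integrable l w)
  map_smul' c k := Hol.ext fun w => by
    rw [RingHom.id_apply, Hol.smul_apply, meanFun_apply, meanFun_apply]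
    exact circleMean_const_mul (c : ℂ) _

/-- Integration of a kernel in its first variable, as a continuous linear map into `C^β`. -/
def meanOp (β : ℝ≥0) (hβ₀ : 0 < β) (hβ₁ : β < 1) : Ker →L[ℝ] CHol β :=
  (meanLin β hβ₀ hβ₁).mkContinuous (1 + 2 / (1 - β)) (norm_meanFun_le hβ₀ hβ₁)

/-- The kernel `(τ, w) ↦ g τ`. -/
def fstKer (β : ℝ≥0) : CHol β →L[ℝ] Ker :=
  LinearMap.mkContinuous
    { toFun := fun g => Hol.of (fun p => g p.1) ⟨g.measurable.comp measurable_fst,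
        ⟨‖g‖, fun _ => g.norm_apply_le _⟩, 0, kernelWeight_mul_le le_rfl (by simp)⟩
      map_add' := fun _ _ => rfl
      map_smul' := fun _ _ => rfl } 1 (fun g => by
    rw [one_mul, ← add_zero ‖g‖]
    exact Hol.norm_le (norm_nonneg g) le_rfl (fun _ => g.norm_apply_le _)
      (kernelWeight_mul_le le_rfl fun τ w w' => by
        change ‖g τ - g τ‖ * _ ≤ _
        simp))

/-! ### Differentiable functions on the circle and their Fourier coefficients -/

/-- `circleDeriv` differentiates at the principal argument; a shift c by a period carries this to an
arbitrary parameter η. -/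
theorem exists_arg_eq_add (η : ℝ) :
    ∃ c : ℝ, Complex.arg (Circle.exp η : ℂ) = η + c ∧ ∀ x, Circle.exp (x + c) = Circle.exp x := by
  refine ⟨Complex.arg (Circle.exp η : ℂ) - η, by ring, fun x => ?_⟩
  rw [Circle.exp_add, Circle.exp_sub, Circle.exp_arg]
  simp

theorem IsC1.hasDerivAt {f : Circle → ℂ} (hf : IsC1 f) (η : ℝ) :
    HasDerivAt (fun η : ℝ => f (Circle.exp η))
      (Complex.I * (Circle.exp η : ℂ) * circleDeriv f (Circle.exp η)) η := by
  obtain ⟨c, hc, hper⟩ := exists_arg_eq_add η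
  have h2 := deriv_comp_add_const (fun η : ℝ => f (Circle.exp η)) c η
  simp only [hper] at h2
  have e : Complex.I * (Circle.exp η : ℂ) * circleDeriv f (Circle.exp η)
      = deriv (fun η : ℝ => f (Circle.exp η)) η := by
    have h0 : (Circle.exp η : ℂ) ≠ 0 := Circle.coe_ne_zero _
    simp only [circleDeriv, hc]
    rw [← h2]
    field_simp
    simp
  rw [e]
  exact (hf.2.1 η).hasDerivAt

theorem hasDerivAt_coe_exp (η : ℝ) :
    HasDerivAt (fun η : ℝ => (Circle.exp η : ℂ)) (Complex.I * (Circle.exp η : ℂ)) η := by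
  simp only [Circle.coe_exp]
  have h : HasDerivAt (fun η : ℝ => (η : ℂ) * Complex.I) Complex.I η := by
    simpa using (Complex.ofRealCLM.hasDerivAt (x := η)).mul_const Complex.I
  simpa [mul_comm] using h.cexp

theorem circleDeriv_eq {f g : Circle → ℂ}
    (h : ∀ η : ℝ, HasDerivAt (fun η : ℝ => f (Circle.exp η))
      (Complex.I * (Circle.exp η : ℂ) * g (Circle.exp η)) η) : circleDeriv f = g := by
  funext w
  rw [circleDeriv, (h _).deriv, Circle.exp_arg]
  have : (w : ℂ) ≠ 0 := Circle.coe_ne_zero _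
  field_simp
  simp

theorem isC1_of_hasDerivAt {f g : Circle → ℂ} (hf : Continuous f) (hg : Continuous g)
    (h : ∀ η : ℝ, HasDerivAt (fun η : ℝ => f (Circle.exp η))
      (Complex.I * (Circle.exp η : ℂ) * g (Circle.exp η)) η) : IsC1 f :=
  ⟨hf, fun η => (h η).differentiableAt, by rwa [circleDeriv_eq h]⟩

/-- The mean value inequality along the shorter arc, which is at most π/2 times the chord. -/
theorem IsC1.norm_sub_le {f : Circle → ℂ} (hf : IsC1 f) {M : ℝ}
    (hM : ∀ w, ‖circleDeriv f w‖ ≤ M) (τ w : Circle) :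
    ‖f τ - f w‖ ≤ Real.pi / 2 * M * dist τ w := by
  have hpi := Real.pi_pos
  have hM0 : 0 ≤ M := (norm_nonneg _).trans (hM 1)
  obtain ⟨θ, hθ, rfl⟩ := exists_mul_exp w τ
  obtain ⟨η, rfl⟩ : ∃ η, Circle.exp η = w := ⟨_, Circle.exp_arg w⟩
  have h := Convex.norm_image_sub_le_of_norm_hasDerivWithin_le (s := Set.univ) (C := M)
    (x := η) (y := η + θ)
    (fun x _ => (hf.hasDerivAt x).hasDerivWithinAt) (fun x _ => by
      rw [norm_mul, norm_mul, Complex.norm_I, Circle.norm_coe, one_mul, one_mul]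
      exact hM _) convex_univ trivial trivial
  rw [add_sub_cancel_left, Circle.exp_add] at h
  refine h.trans ?_
  have h2 := le_dist_mul_exp (Circle.exp η) hθ
  rw [div_mul_eq_mul_div, div_le_iff₀ hpi] at h2
  rw [Real.norm_eq_abs]
  nlinarith

/-! #### Fourier coefficients -/

theorem circleCoeff_eq (g : Circle → ℂ) (n : ℤ) :
    circleCoeff g n = ((2 * Real.pi)⁻¹ : ℝ) * ∫ w, g w * (w : ℂ) ^ (-n) ∂arc := by
  rw [circleCoeff, circleMean_eq]
  congr 2
  funext w
  rw [mul_assoc, ← zpow_add_one₀ (Circle.coe_ne_zero w)]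
  congr 2
  ring

theorem circleMean_eq_circleCoeff (g : Circle → ℂ) : circleMean g = circleCoeff g (-1) := by
  simp [circleCoeff]

/-- Vanishing coefficients are summable, and a continuous function with summable Fourier
coefficients is the pointwise sum of its series. -/
theorem eq_zero_of_circleCoeff {g : Circle → ℂ} (hg : Continuous g)
    (h : ∀ n, circleCoeff g n = 0) : g = 0 := by
  have : Fact (0 < 2 * Real.pi) := ⟨Real.two_pi_pos⟩
  have hpi : (Real.pi : ℂ) ≠ 0 := by exact_mod_cast Real.pi_ne_zero
  let F : C(AddCircle (2 * Real.pi), ℂ) :=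
    ⟨fun x => g (AddCircle.homeomorphCircle' x), hg.comp AddCircle.homeomorphCircle'.continuous⟩
  have hF : fourierCoeff F = 0 := by
    funext n
    have h1 := h n
    rw [circleCoeff_eq, arc_integral _ 0, mul_eq_zero] at h1
    have h2 := h1.resolve_left (by
      have := Real.pi_pos
      exact_mod_cast (by positivity : (2 * Real.pi)⁻¹ ≠ 0))
    rw [fourierCoeff_eq_intervalIntegral _ n 0]
    have e : ∀ x : ℝ, fourier (-n) (x : AddCircle (2 * Real.pi)) • F (x : AddCircle (2 * Real.pi))
        = g (Circle.exp x) * (Circle.exp x : ℂ) ^ (-n) := by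
      intro x
      rw [fourier_coe_apply, smul_eq_mul, mul_comm, Circle.coe_exp, ← Complex.exp_int_mul]
      congr 2
      push_cast
      field_simp
    simp only [e, h2, smul_zero, Pi.zero_apply]
  have hs := has_pointwise_sum_fourier_series_of_summable (f := F) (by
    rw [hF]; exact summable_zero)
  funext w
  obtain ⟨x, rfl⟩ := AddCircle.homeomorphCircle'.surjective w
  have := hs x
  rw [hF] at this
  simpa [F] using this.unique (by simp)

theorem ext_of_circleCoeff {g h : Circle → ℂ} (hg : Continuous g) (hh : Continuous h)
    (e : ∀ n, circleCoeff g n = circleCoeff h n) : g = h := by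
  rw [← sub_eq_zero]
  refine eq_zero_of_circleCoeff (hg.sub hh) fun n => ?_
  have : g - h = g + (-1 : ℝ) • h := by
    funext w; simp [sub_eq_add_neg]
  rw [this, circleCoeff_add hg (hh.const_smul _), circleCoeff_smul, e]
  simp

/-- Integration by parts over a period: the product of f and w^{-(n+1)} takes the same value at both
ends. -/
theorem circleCoeff_circleDeriv {f : Circle → ℂ} (hf : IsC1 f) (n : ℤ) :
    circleCoeff (circleDeriv f) n = (n + 1) * circleCoeff f (n + 1) := by
  rw [circleCoeff_eq, circleCoeff_eq, mul_left_comm, arc_integral _ 0, arc_integral _ 0]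
  congr 1
  rw [← intervalIntegral.integral_const_mul]
  have hz : ∀ η : ℝ, HasDerivAt (fun η : ℝ => (Circle.exp η : ℂ) ^ (-(n + 1)))
      (-(n + 1) * (Circle.exp η : ℂ) ^ (-(n + 1) - 1) * (Complex.I * Circle.exp η)) η := by
    intro η
    have := (hasDerivAt_zpow (-(n + 1)) (Circle.exp η : ℂ)
      (Or.inl (Circle.coe_ne_zero _))).scomp η (hasDerivAt_coe_exp η)
    simp only [smul_eq_mul, Int.cast_neg, Int.cast_add, Int.cast_one] at this
    rw [mul_comm] at this
    exact this
  have hd := fun η : ℝ => (hf.hasDerivAt η).mul (hz η)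
  have hc1 : Continuous fun η : ℝ => (Circle.exp η : ℂ) := by fun_prop
  have hcz : ∀ m : ℤ, Continuous fun η : ℝ => (Circle.exp η : ℂ) ^ m := fun m =>
    hc1.zpow₀ _ fun _ => Or.inl (Circle.coe_ne_zero _)
  have hcf : Continuous fun η : ℝ => f (Circle.exp η) := hf.1.comp Circle.exp.continuous
  have hcd : Continuous fun η : ℝ => circleDeriv f (Circle.exp η) :=
    hf.2.2.comp Circle.exp.continuous
  have hint := intervalIntegral.integral_eq_sub_of_hasDerivAt (a := 0) (b := 0 + 2 * Real.pi)
    (fun η _ => hd η) (by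
      apply Continuous.intervalIntegrable
      exact (((continuous_const.mul hc1).mul hcd).mul (hcz _)).add
        (hcf.mul ((continuous_const.mul (hcz _)).mul (continuous_const.mul hc1))))
  have e : ∀ η : ℝ, Complex.I * (Circle.exp η : ℂ) * circleDeriv f (Circle.exp η) *
      (Circle.exp η : ℂ) ^ (-(n + 1)) + f (Circle.exp η) *
      (-(n + 1) * (Circle.exp η : ℂ) ^ (-(n + 1) - 1) * (Complex.I * Circle.exp η))
      = Complex.I * (circleDeriv f (Circle.exp η) * (Circle.exp η : ℂ) ^ (-n))
        - Complex.I * ((n + 1) * (f (Circle.exp η) * (Circle.exp η : ℂ) ^ (-(n + 1)))) := by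
    intro η
    have h0 : (Circle.exp η : ℂ) ≠ 0 := Circle.coe_ne_zero _
    have h1 : (Circle.exp η : ℂ) ^ (-n) = (Circle.exp η : ℂ) ^ (-(n + 1)) * Circle.exp η := by
      rw [← zpow_add_one₀ h0]; congr 1; ring
    have h2 : (Circle.exp η : ℂ) ^ (-(n + 1))
        = (Circle.exp η : ℂ) ^ (-(n + 1) - 1) * Circle.exp η := by
      rw [← zpow_add_one₀ h0]; congr 1; ring
    rw [h1, h2]
    ring
  simp only [e] at hint
  have hper : Circle.exp (0 + 2 * Real.pi) = Circle.exp 0 := by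
    rw [Circle.exp_add, Circle.exp_two_pi, mul_one]
  simp only [Pi.mul_apply, hper, sub_self] at hint
  rw [intervalIntegral.integral_sub, intervalIntegral.integral_const_mul,
    intervalIntegral.integral_const_mul, ← mul_sub, mul_eq_zero] at hint
  · exact sub_eq_zero.mp (hint.resolve_left Complex.I_ne_zero)
  · exact (continuous_const.mul (hcd.mul (hcz _))).intervalIntegrable _ _
  · exact (continuous_const.mul (continuous_const.mul (hcf.mul (hcz _)))).intervalIntegrable _ _

theorem star_zpow_coe (w : Circle) (n : ℤ) : star ((w : ℂ) ^ n) = (w : ℂ) ^ (-n) := by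
  rw [zpow_neg, ← inv_zpow, star_zpow₀]
  congr 1
  exact (Circle.coe_inv_eq_conj w).symm.trans (Circle.coe_inv w)

theorem star_coe (w : Circle) : star (w : ℂ) = (w : ℂ)⁻¹ :=
  (Circle.coe_inv_eq_conj w).symm.trans (Circle.coe_inv w)

theorem circleCoeff_star (g : Circle → ℂ) (n : ℤ) :
    circleCoeff (fun w => star (g w)) n = star (circleCoeff g (-n)) := by
  have h : star (∫ w, g w * (w : ℂ) ^ (- -n) ∂arc) = ∫ w, star (g w * (w : ℂ) ^ (- -n)) ∂arc :=
    integral_conj.symm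
  rw [circleCoeff_eq, circleCoeff_eq, star_mul', h]
  congr 1
  · simp
  · congr 1
    funext w
    rw [star_mul', star_zpow_coe, neg_neg]

theorem circleCoeff_inv (g : Circle → ℂ) (n : ℤ) :
    circleCoeff (fun w => g w⁻¹) n = circleCoeff g (-n) := by
  rw [circleCoeff_eq, circleCoeff_eq, ← integral_inv_eq_self _ arc]
  simp

theorem circleCoeff_mul_left (g : Circle → ℂ) (s : Circle) (n : ℤ) :
    circleCoeff (fun w => g (s * w)) n = (s : ℂ) ^ n * circleCoeff g n := by
  rw [circleCoeff_eq, circleCoeff_eq, ← integral_mul_left_eq_self _ s⁻¹, mul_left_comm]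
  congr 1
  rw [← integral_const_mul]
  congr 1
  funext w
  simp only [mul_inv_cancel_left, Circle.coe_mul, Circle.coe_inv]
  rw [mul_zpow, inv_zpow', neg_neg]
  ring

theorem circleCoeff_zpow_mul (g : Circle → ℂ) (m n : ℤ) :
    circleCoeff (fun w => (w : ℂ) ^ m * g w) n = circleCoeff g (n - m) := by
  rw [circleCoeff_eq, circleCoeff_eq]
  congr 2
  funext w
  rw [mul_comm ((w : ℂ) ^ m), mul_assoc, ← zpow_add₀ (Circle.coe_ne_zero w)]
  congr 2
  ring

theorem circleCoeff_const_mul (c : ℂ) (g : Circle → ℂ) (n : ℤ) :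
    circleCoeff (fun w => c * g w) n = c * circleCoeff g n := by
  simp only [circleCoeff, mul_assoc]
  exact circleMean_const_mul c _

theorem circleCoeff_one (n : ℤ) :
    circleCoeff (fun _ => 1) n = if n = 0 then 1 else 0 := by
  have hc : IsC1 fun _ => (1 : ℂ) :=
    isC1_of_hasDerivAt continuous_const (g := fun _ => 0) continuous_const fun η => by
      simpa using hasDerivAt_const η (1 : ℂ)
  have hd : circleDeriv (fun _ => (1 : ℂ)) = 0 :=
    circleDeriv_eq fun η => by simpa using hasDerivAt_const η (1 : ℂ)
  split_ifs with h
  · subst h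
    rw [circleCoeff_eq]
    simp only [neg_zero, zpow_zero, mul_one, integral_const, arc_univ]
    have := Real.pi_pos
    rw [Complex.real_smul, mul_one, ← Complex.ofReal_mul, inv_mul_cancel₀ (by positivity)]
    simp
  -- The derivative of a constant is 0, so n times its n-th coefficient is 0.
  · have h1 := circleCoeff_circleDeriv hc (n - 1)
    rw [hd, sub_add_cancel] at h1
    have h0 : circleCoeff 0 (n - 1) = 0 := by simp [circleCoeff, circleMean]
    rw [h0, eq_comm, mul_eq_zero] at h1
    refine h1.resolve_left ?_
    push_cast
    simpa using h

theorem circleCoeff_zpow (m n : ℤ) :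
    circleCoeff (fun w => (w : ℂ) ^ m) n = if n = m then 1 else 0 := by
  have h := circleCoeff_zpow_mul (fun _ => 1) m n
  simp only [mul_one] at h
  rw [h, circleCoeff_one]
  simp only [sub_eq_zero]

/-! ### The Cauchy singular integral on `C^β` -/

theorem norm_coe_sub (τ w : Circle) : ‖(τ : ℂ) - w‖ = dist τ w := (dist_eq τ w).symm

/-- The difference quotient `(g τ - g w) / (τ - w)`. -/
def diffQuot (g : Circle → ℂ) (w τ : Circle) : ℂ := (g τ - g w) / ((τ : ℂ) - w)

theorem measurable_diffQuot {g : Circle → ℂ} (hg : Measurable g) (w : Circle) :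
    Measurable (diffQuot g w) := by
  unfold diffQuot
  fun_prop

theorem norm_diffQuot_le {β : ℝ≥0} (g : CHol β) {w τ : Circle} (h : τ ≠ w) :
    ‖diffQuot g w τ‖ ≤ ‖g‖ * dist τ w ^ (-(1 - β : ℝ)) := by
  have hd : 0 < dist τ w := dist_pos.mpr h
  rw [diffQuot, norm_div, norm_coe_sub, div_le_iff₀ hd, mul_assoc, ← Real.rpow_add_one hd.ne']
  rw [show -(1 - (β : ℝ)) + 1 = β by ring]
  exact norm_sub_le_rpow g τ w

theorem integrable_diffQuot {β : ℝ≥0} (hβ₀ : 0 < β) (hβ₁ : β < 1) (g : CHol β) (w : Circle) :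
    Integrable (diffQuot g w) arc := by
  have hb0 : (0 : ℝ) < β := hβ₀
  have hb1 : (β : ℝ) < 1 := hβ₁
  refine ((integral_dist_rpow (s := 1 - β) (by linarith) (by linarith) w).1.const_mul ‖g‖).mono'
    (measurable_diffQuot g.measurable w).aestronglyMeasurable ?_
  filter_upwards [Measure.ae_ne arc w] with τ hτ
  exact norm_diffQuot_le g hτ

/-- The reflection τ ↦ w²/τ preserves arc length and the distance to w, and the values of τ/(τ - w)
at a point and at its reflection add up to 1. The truncated integral is therefore half the length of
the truncation set, so the bound does not depend on ρ. -/
theorem norm_integral_far_le (w : Circle) {ρ : ℝ} (hρ : 0 < ρ) :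
    ‖∫ τ, {τ | ρ < dist τ w}.indicator (fun τ : Circle => (τ : ℂ) / ((τ : ℂ) - w)) τ ∂arc‖
      ≤ Real.pi := by
  set φ : Circle → ℂ := {τ | ρ < dist τ w}.indicator fun τ : Circle => (τ : ℂ) / ((τ : ℂ) - w)
    with hφ
  have hset : MeasurableSet {τ : Circle | ρ < dist τ w} :=
    measurableSet_lt measurable_const (by fun_prop)
  have hmeas : Measurable φ := Measurable.indicator (by fun_prop) hset
  have hbd : ∀ τ, ‖φ τ‖ ≤ ρ⁻¹ := by
    intro τ
    by_cases h : ρ < dist τ w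
    · rw [hφ, Set.indicator_of_mem (show τ ∈ {τ | ρ < dist τ w} from h), norm_div,
        Circle.norm_coe, norm_coe_sub, one_div]
      exact inv_anti₀ hρ h.le
    · rw [hφ, Set.indicator_of_notMem (show τ ∉ {τ | ρ < dist τ w} from h), norm_zero]
      positivity
  have hint : Integrable φ arc := Integrable.of_bound hmeas.aestronglyMeasurable _ (ae_of_all _ hbd)
  have hint2 : Integrable (fun τ => φ (w * w / τ)) arc :=
    Integrable.of_bound (hmeas.comp (by fun_prop)).aestronglyMeasurable _
      (ae_of_all _ fun _ => hbd _)
  have hrefl : ∫ τ, φ (w * w / τ) ∂arc = ∫ τ, φ τ ∂arc := integral_div_left_eq_self φ arc (w * w)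
  have hsum : ∀ τ, ‖φ τ + φ (w * w / τ)‖ ≤ 1 := by
    intro τ
    have hd : dist (w * w / τ) w = dist τ w := by
      have h1 := dist_mul_left_eq (w * w) τ⁻¹ w⁻¹
      rw [dist_inv_inv_eq] at h1
      rw [← h1, div_eq_mul_inv]
      congr 1
      group
    by_cases h : ρ < dist τ w
    · have h' : ρ < dist (w * w / τ) w := by rwa [hd]
      rw [hφ, Set.indicator_of_mem (show τ ∈ {τ | ρ < dist τ w} from h),
        Set.indicator_of_mem (show w * w / τ ∈ {τ | ρ < dist τ w} from h')]
      have h0 : (τ : ℂ) - w ≠ 0 := by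
        rw [← norm_pos_iff, norm_coe_sub]
        exact hρ.trans h
      have h1 : (τ : ℂ) ≠ 0 := Circle.coe_ne_zero τ
      have h2 : (w : ℂ) ≠ 0 := Circle.coe_ne_zero w
      have h3 : (w : ℂ) - τ ≠ 0 := by
        rw [← neg_sub]; exact neg_ne_zero.mpr h0
      have e : ((w * w / τ : Circle) : ℂ) / (((w * w / τ : Circle) : ℂ) - w)
          = w / ((w : ℂ) - τ) := by
        rw [Circle.coe_div, Circle.coe_mul]
        have : (w : ℂ) * w / τ - w = w * (w - τ) / τ := by field_simp
        rw [this]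
        field_simp
      rw [e, ← neg_sub (τ : ℂ) w, div_neg, ← sub_eq_add_neg, ← sub_div, div_self h0, norm_one]
    · have h' : ¬ ρ < dist (w * w / τ) w := by rwa [hd]
      rw [hφ, Set.indicator_of_notMem (show τ ∉ {τ | ρ < dist τ w} from h),
        Set.indicator_of_notMem (show w * w / τ ∉ {τ | ρ < dist τ w} from h')]
      simp
  have h2 : (2 : ℂ) * ∫ τ, φ τ ∂arc = ∫ τ, (φ τ + φ (w * w / τ)) ∂arc := by
    rw [integral_add hint hint2, hrefl, two_mul]
  have h3 : ‖∫ τ, (φ τ + φ (w * w / τ)) ∂arc‖ ≤ 1 * arc.real Set.univ :=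
    norm_integral_le_of_norm_le_const (ae_of_all _ hsum)
  rw [← h2, norm_mul, Complex.norm_ofNat, arc_univ] at h3
  linarith

/-- The Cauchy singular integral `⨍ (g τ - g w) / (τ - w) dτ`. -/
def cauchyFun (g : Circle → ℂ) (w : Circle) : ℂ := circleMean (diffQuot g w)

/-- A bound for the Cauchy singular integral on `C^β`. -/
def privalovConst (β : ℝ≥0) : ℝ :=
  5 * Real.pi / β + 4 * (2 / Real.pi) ^ (-(2 - β : ℝ)) / (1 - β) + 1

/-- Privalov's theorem. With δ = |w - w'|, the points with |τ - w| ≤ 2δ are estimated directly.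
Elsewhere the difference of the two quotients is (g τ - g w')(w - w')/((τ - w)(τ - w')) + (g w' - g
w)/(τ - w). The first term integrates to O(δ^β); the second does because the truncated integral of
1/(τ - w) stays bounded. -/
theorem norm_cauchyFun_sub_le {β : ℝ≥0} (hβ₀ : 0 < β) (hβ₁ : β < 1) (g : CHol β)
    (w w' : Circle) :
    ‖cauchyFun g w - cauchyFun g w'‖ ≤ privalovConst β * ‖g‖ * dist w w' ^ (β : ℝ) := by
  have hpi := Real.pi_pos
  have hb0 : (0 : ℝ) < β := hβ₀
  have hb1 : (β : ℝ) < 1 := hβ₁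
  have hg0 := norm_nonneg g
  have hC : 0 ≤ privalovConst β := by
    have : 0 < 1 - (β : ℝ) := by linarith
    unfold privalovConst
    positivity
  by_cases hw : w = w'
  · subst hw
    rw [sub_self, norm_zero]
    positivity
  set δ := dist w w' with hδdef
  have hδ : 0 < δ := dist_pos.mpr hw
  set s : ℝ := 1 - β with hs
  have hs0 : 0 < s := by linarith
  have hs1 : s < 1 := by linarith
  set A : Set Circle := {τ | 2 * δ < dist τ w} with hA
  have hAm : MeasurableSet A := measurableSet_lt measurable_const (by fun_prop)
  set φ : Circle → ℂ := fun τ => diffQuot g w τ - diffQuot g w' τ with hφ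
  set ψ : Circle → ℂ := fun τ => (g τ - g w') * ((w : ℂ) - w') / (((τ : ℂ) - w) * ((τ : ℂ) - w'))
    with hψ
  have hφi : Integrable φ arc :=
    (integrable_diffQuot hβ₀ hβ₁ g w).sub (integrable_diffQuot hβ₀ hβ₁ g w')
  have hgm := g.measurable
  have hψm : Measurable (A.indicator ψ) := by
    apply Measurable.indicator _ hAm
    rw [hψ]
    fun_prop
  -- the near part
  obtain ⟨n1, n2⟩ := integral_dist_rpow_near hs0.le hs1 w (ρ := 2 * δ) (by positivity)
  obtain ⟨n3, n4⟩ := integral_dist_rpow_near hs0.le hs1 w' (ρ := 3 * δ) (by positivity)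
  have hnear : ∫ τ, ‖Aᶜ.indicator φ τ‖ ∂arc ≤ 5 * Real.pi / β * ‖g‖ * δ ^ (β : ℝ) := by
    have hle : ∫ τ, ‖Aᶜ.indicator φ τ‖ ∂arc ≤ ∫ τ, ‖g‖ *
        ({τ | dist τ w ≤ 2 * δ}.indicator (fun τ => dist τ w ^ (-s)) τ +
          {τ | dist τ w' ≤ 3 * δ}.indicator (fun τ => dist τ w' ^ (-s)) τ) ∂arc := by
      refine integral_mono_ae (hφi.indicator hAm.compl).norm ((n1.add n3).const_mul _) ?_
      filter_upwards [Measure.ae_ne arc w, Measure.ae_ne arc w'] with τ hτ hτ'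
      by_cases h : τ ∈ A
      · rw [Set.indicator_of_notMem (Set.notMem_compl_iff.mpr h), norm_zero]
        refine mul_nonneg hg0 (add_nonneg ?_ ?_) <;>
        exact Set.indicator_nonneg (fun _ _ => by positivity) _
      · have h1 : dist τ w ≤ 2 * δ := not_lt.mp h
        have h2 : dist τ w' ≤ 3 * δ := by
          have := dist_triangle τ w w'
          linarith
        rw [Set.indicator_of_mem (show τ ∈ Aᶜ from h),
          Set.indicator_of_mem (show τ ∈ {τ | dist τ w ≤ 2 * δ} from h1),
          Set.indicator_of_mem (show τ ∈ {τ | dist τ w' ≤ 3 * δ} from h2), mul_add]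
        exact (norm_sub_le _ _).trans (add_le_add (norm_diffQuot_le g hτ) (norm_diffQuot_le g hτ'))
    refine hle.trans ?_
    rw [integral_const_mul, integral_add n1 n3]
    have e1 : 1 - s = β := by rw [hs]; ring
    rw [e1] at n2 n4
    have e2 : (2 * δ) ^ (β : ℝ) ≤ 2 * δ ^ (β : ℝ) := by
      rw [Real.mul_rpow zero_le_two hδ.le]
      gcongr
      exact Real.rpow_le_self_of_one_le one_le_two hb1.le
    have e3 : (3 * δ) ^ (β : ℝ) ≤ 3 * δ ^ (β : ℝ) := by
      rw [Real.mul_rpow zero_le_three hδ.le]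
      gcongr
      exact Real.rpow_le_self_of_one_le (by norm_num) hb1.le
    calc _ ≤ ‖g‖ * (Real.pi / β * (2 * δ ^ (β : ℝ)) + Real.pi / β * (3 * δ ^ (β : ℝ))) := by
          refine mul_le_mul_of_nonneg_left (add_le_add (n2.trans ?_) (n4.trans ?_)) hg0 <;>
          exact mul_le_mul_of_nonneg_left (by assumption) (by positivity)
      _ = _ := by ring
  -- the far part
  obtain ⟨f1, f2⟩ := integral_dist_rpow_far (t := 1 + s) (by linarith) w (ρ := 2 * δ)
    (by positivity)
  have hfar_pt : ∀ τ, ‖A.indicator ψ τ‖ ≤ 2 * ‖g‖ * δ *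
      {τ | 2 * δ < dist τ w}.indicator (fun τ => dist τ w ^ (-(1 + s))) τ := by
    intro τ
    by_cases h : τ ∈ A
    · have h1 : 2 * δ < dist τ w := h
      have hd : 0 < dist τ w := by linarith
      have h2 : dist τ w / 2 ≤ dist τ w' := by
        have := dist_triangle τ w' w
        rw [dist_comm w' w] at this
        linarith
      have hd' : 0 < dist τ w' := by linarith
      have hτ' : τ ≠ w' := dist_pos.mp hd'
      rw [Set.indicator_of_mem h, Set.indicator_of_mem h]
      have e : ψ τ = diffQuot g w' τ * (((w : ℂ) - w') / ((τ : ℂ) - w)) := by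
        simp only [hψ, diffQuot]
        rw [div_mul_div_comm, mul_comm ((τ : ℂ) - w)]
      rw [e, norm_mul, norm_div, norm_coe_sub, norm_coe_sub]
      have h3 : ‖diffQuot g w' τ‖ ≤ 2 * ‖g‖ * dist τ w ^ (-s) := by
        refine (norm_diffQuot_le g hτ').trans ?_
        have h4 : dist τ w' ^ (-s) ≤ (dist τ w / 2) ^ (-s) :=
          Real.rpow_le_rpow_of_nonpos (by positivity) h2 (by linarith)
        have h5 : (dist τ w / 2) ^ (-s) ≤ 2 * dist τ w ^ (-s) := by
          rw [Real.div_rpow hd.le zero_le_two, Real.rpow_neg zero_le_two, div_inv_eq_mul, mul_comm]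
          gcongr
          exact Real.rpow_le_self_of_one_le one_le_two hs1.le
        calc ‖g‖ * dist τ w' ^ (-s) ≤ ‖g‖ * (2 * dist τ w ^ (-s)) := by
              gcongr; exact h4.trans h5
          _ = _ := by ring
      calc _ ≤ 2 * ‖g‖ * dist τ w ^ (-s) * (δ / dist τ w) := by gcongr
        _ = _ := by
          rw [neg_add, add_comm, Real.rpow_add hd, Real.rpow_neg_one]
          ring
    · rw [Set.indicator_of_notMem h, Set.indicator_of_notMem h]
      simp
  have hψi : Integrable (A.indicator ψ) arc :=
    (f1.const_mul (2 * ‖g‖ * δ)).mono' hψm.aestronglyMeasurable (ae_of_all _ hfar_pt)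
  have hfar : ∫ τ, ‖A.indicator ψ τ‖ ∂arc
      ≤ 4 * (2 / Real.pi) ^ (-(2 - β : ℝ)) / (1 - β) * ‖g‖ * δ ^ (β : ℝ) := by
    refine (integral_mono hψi.norm (f1.const_mul _) hfar_pt).trans ?_
    rw [integral_const_mul]
    have e1 : (2 * δ) ^ (1 - (1 + s)) ≤ δ ^ (-s) := by
      rw [show 1 - (1 + s) = -s by ring]
      exact Real.rpow_le_rpow_of_nonpos hδ (by linarith) (by linarith)
    have e2 : δ * δ ^ (-s) = δ ^ (β : ℝ) := by
      rw [mul_comm, ← Real.rpow_add_one hδ.ne']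
      congr 1
      rw [hs]; ring
    have e3 : -(1 + s) = -(2 - β : ℝ) := by rw [hs]; ring
    have e4 : 1 + s - 1 = 1 - β := by rw [hs]; ring
    rw [e3, e4] at f2
    have hs' : 0 < 1 - (β : ℝ) := hs0
    rw [e3]
    calc _ ≤ 2 * ‖g‖ * δ * (2 * (2 / Real.pi) ^ (-(2 - β : ℝ)) / (1 - β) * δ ^ (-s)) := by
          refine mul_le_mul_of_nonneg_left (f2.trans ?_) (by positivity)
          exact mul_le_mul_of_nonneg_left e1 (by positivity)
      _ = 4 * (2 / Real.pi) ^ (-(2 - β : ℝ)) / (1 - β) * ‖g‖ * (δ * δ ^ (-s)) := by ring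
      _ = _ := by rw [e2]
  -- the principal value part
  set χ : Circle → ℂ := A.indicator fun τ => ((τ : ℂ) - w)⁻¹ with hχ
  have hχm : Measurable χ := Measurable.indicator (by fun_prop) hAm
  have hχi : Integrable χ arc := by
    refine Integrable.of_bound hχm.aestronglyMeasurable (2 * δ)⁻¹ (ae_of_all _ fun τ => ?_)
    by_cases h : τ ∈ A
    · rw [hχ, Set.indicator_of_mem h, norm_inv, norm_coe_sub]
      exact inv_anti₀ (by positivity) (le_of_lt h)
    · rw [hχ, Set.indicator_of_notMem h, norm_zero]
      positivity
  have hpv : ‖circleMean χ‖ ≤ 1 := by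
    have h1 := norm_integral_far_le w (ρ := 2 * δ) (by positivity)
    have e : ∀ τ, χ τ * (τ : ℂ) = A.indicator (fun τ : Circle => (τ : ℂ) / ((τ : ℂ) - w)) τ := by
      intro τ
      by_cases h : τ ∈ A
      · rw [hχ, Set.indicator_of_mem h, Set.indicator_of_mem h, inv_mul_eq_div]
      · rw [hχ, Set.indicator_of_notMem h, Set.indicator_of_notMem h, zero_mul]
    rw [circleMean_eq, norm_mul, Complex.norm_real, Real.norm_of_nonneg (by positivity),
      inv_mul_le_iff₀ (by positivity)]
    simp only [e]
    linarith
  have hsplit : ∀ᵐ τ ∂arc, φ τ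
      = (Aᶜ.indicator φ τ + A.indicator ψ τ) + (g w' - g w) * χ τ := by
    filter_upwards [Measure.ae_ne arc w, Measure.ae_ne arc w'] with τ hτ hτ'
    have h0 : (τ : ℂ) - w ≠ 0 := sub_ne_zero.mpr fun h => hτ (Circle.ext h)
    have h0' : (τ : ℂ) - w' ≠ 0 := sub_ne_zero.mpr fun h => hτ' (Circle.ext h)
    by_cases h : τ ∈ A
    · rw [hχ, Set.indicator_of_mem h, Set.indicator_of_mem h,
        Set.indicator_of_notMem (Set.notMem_compl_iff.mpr h)]
      simp only [hφ, hψ, diffQuot]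
      field_simp
      ring
    · rw [hχ, Set.indicator_of_notMem h, Set.indicator_of_notMem h,
        Set.indicator_of_mem (show τ ∈ Aᶜ from h)]
      simp
  have hmain : cauchyFun g w - cauchyFun g w'
      = (circleMean (Aᶜ.indicator φ) + circleMean (A.indicator ψ))
        + (g w' - g w) * circleMean χ := by
    have hi1 : Integrable (fun τ => Aᶜ.indicator φ τ + A.indicator ψ τ) arc :=
      (hφi.indicator hAm.compl).add hψi
    rw [cauchyFun, cauchyFun, ← circleMean_sub (integrable_diffQuot hβ₀ hβ₁ g w)
      (integrable_diffQuot hβ₀ hβ₁ g w'), circleMean_congr_ae hsplit,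
      circleMean_add hi1 (hχi.const_mul (g w' - g w)),
      circleMean_add (hφi.indicator hAm.compl) hψi, circleMean_const_mul]
  have hmean : ∀ (h : Circle → ℂ) (M : ℝ), ∫ τ, ‖h τ‖ ∂arc ≤ M → ‖circleMean h‖ ≤ M := by
    intro h M hM
    have h0 : 0 ≤ ∫ τ, ‖h τ‖ ∂arc := integral_nonneg fun _ => norm_nonneg _
    refine (norm_circleMean_le_integral h).trans (le_trans ?_ hM)
    refine mul_le_of_le_one_left h0 (inv_le_one_of_one_le₀ ?_)
    linarith [Real.pi_gt_three]
  have h4 : ‖(g w' - g w) * circleMean χ‖ ≤ 1 * ‖g‖ * δ ^ (β : ℝ) := by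
    rw [norm_mul, norm_sub_rev]
    calc _ ≤ ‖g‖ * δ ^ (β : ℝ) * 1 := by
          have := norm_sub_le_rpow g w w'
          gcongr
      _ = _ := by ring
  rw [hmain]
  refine (norm_add_le _ _).trans ((add_le_add ((norm_add_le _ _).trans (add_le_add
    (hmean _ _ hnear) (hmean _ _ hfar))) h4).trans (le_of_eq ?_))
  rw [privalovConst]
  ring

theorem norm_cauchyFun_le {β : ℝ≥0} (hβ₀ : 0 < β) (hβ₁ : β < 1) (g : CHol β) (w : Circle) :
    ‖cauchyFun g w‖ ≤ 1 / β * ‖g‖ := by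
  have hpi := Real.pi_pos
  have hb0 : (0 : ℝ) < β := hβ₀
  have hb1 : (β : ℝ) < 1 := hβ₁
  obtain ⟨h1, h2⟩ := integral_dist_rpow (s := 1 - β) (by linarith) (by linarith) w
  have h3 : ∫ τ, ‖diffQuot g w τ‖ ∂arc ≤ ∫ τ, ‖g‖ * dist τ w ^ (-(1 - β : ℝ)) ∂arc := by
    refine integral_mono_ae (integrable_diffQuot hβ₀ hβ₁ g w).norm (h1.const_mul _) ?_
    filter_upwards [Measure.ae_ne arc w] with τ hτ
    exact norm_diffQuot_le g hτ
  rw [integral_const_mul] at h3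
  refine (norm_circleMean_le_integral _).trans ?_
  calc _ ≤ (2 * Real.pi)⁻¹ * (‖g‖ * (2 * Real.pi / (1 - (1 - β)))) := by
        refine mul_le_mul_of_nonneg_left (h3.trans ?_) (by positivity)
        exact mul_le_mul_of_nonneg_left h2 (norm_nonneg _)
    _ = _ := by
      rw [sub_sub_cancel]
      field_simp

/-! ### The Cauchy singular integral on Fourier coefficients -/

theorem cauchyFun_eq_rotate (g : Circle → ℂ) (w : Circle) :
    cauchyFun g w = circleMean fun σ => (g (w * σ) - g w) / ((σ : ℂ) - 1) := by
  have h0 : (w : ℂ) ≠ 0 := Circle.coe_ne_zero w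
  rw [cauchyFun, circleMean_eq, circleMean_eq, ← integral_mul_left_eq_self _ w]
  congr 2
  funext σ
  rw [diffQuot, Circle.coe_mul, show (w : ℂ) * σ - w = w * (σ - 1) by ring]
  field_simp

theorem circleCoeff_geom_sum (m : ℕ) (n : ℤ) :
    circleCoeff (fun σ => ∑ k ∈ Finset.range m, (σ : ℂ) ^ k) n
      = if 0 ≤ n ∧ n < m then 1 else 0 := by
  induction m with
  | zero =>
    rw [if_neg (by push_cast; omega)]
    simp [circleCoeff, circleMean]
  | succ m ih =>
    have e : (fun σ : Circle => ∑ k ∈ Finset.range (m + 1), (σ : ℂ) ^ k)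
        = (fun σ : Circle => ∑ k ∈ Finset.range m, (σ : ℂ) ^ k)
          + fun σ : Circle => (σ : ℂ) ^ (m : ℤ) := by
      funext σ
      simp [Finset.sum_range_succ]
    rw [e, circleCoeff_add (by fun_prop) (by simp only [zpow_natCast]; fun_prop), ih,
      circleCoeff_zpow]
    push_cast
    split_ifs <;> first | omega | simp

/-- The quotient is a finite geometric sum, and the mean reads off its mode σ⁻¹. For n ≥ 0 there is
none. For n = -m the sum is -σ^{-m}(1 + ... + σ^{m-1}), which contains -σ⁻¹ exactly when m > 0. -/
theorem circleMean_zpow_sub_one_div (n : ℤ) :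
    circleMean (fun σ => ((σ : ℂ) ^ n - 1) / ((σ : ℂ) - 1)) = if n < 0 then -1 else 0 := by
  have hne : ∀ {σ : Circle}, σ ≠ 1 → (σ : ℂ) - 1 ≠ 0 := fun h =>
    sub_ne_zero.mpr fun h' => h (Circle.ext h')
  obtain ⟨m, rfl | rfl⟩ := n.eq_nat_or_neg
  · rw [if_neg (by omega)]
    have e : (fun σ : Circle => ((σ : ℂ) ^ (m : ℤ) - 1) / ((σ : ℂ) - 1))
        =ᵐ[arc] fun σ => ∑ k ∈ Finset.range m, (σ : ℂ) ^ k := by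
      filter_upwards [Measure.ae_ne arc 1] with σ hσ
      rw [div_eq_iff (hne hσ), zpow_natCast, mul_comm, mul_geom_sum]
    rw [circleMean_congr_ae e, circleMean_eq_circleCoeff, circleCoeff_geom_sum, if_neg (by omega)]
  · have e : (fun σ : Circle => ((σ : ℂ) ^ (-(m : ℤ)) - 1) / ((σ : ℂ) - 1))
        =ᵐ[arc] fun σ => (-1) * ((σ : ℂ) ^ (-(m : ℤ)) * ∑ k ∈ Finset.range m, (σ : ℂ) ^ k) := by
      filter_upwards [Measure.ae_ne arc 1] with σ hσ
      have h0 : (σ : ℂ) ^ m ≠ 0 := pow_ne_zero _ (Circle.coe_ne_zero σ)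
      rw [div_eq_iff (hne hσ), zpow_neg, zpow_natCast, mul_assoc, mul_assoc,
        mul_comm (∑ k ∈ _, _), mul_geom_sum]
      field_simp
      ring
    rw [circleMean_congr_ae e, circleMean_const_mul, circleMean_eq_circleCoeff,
      circleCoeff_zpow_mul, circleCoeff_geom_sum]
    split_ifs <;> first | omega | simp

/-- The substitution τ = wσ places the singularity at σ = 1 for every w. Fubini's theorem and the
rotation rule for coefficients then leave the n-th coefficient of g times the mean of (σⁿ - 1)/(σ -
1). -/
theorem circleCoeff_cauchyFun {β : ℝ≥0} (hβ₀ : 0 < β) (hβ₁ : β < 1) (g : CHol β) (n : ℤ) :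
    circleCoeff (cauchyFun g) n = if n < 0 then -circleCoeff g n else 0 := by
  have hpi := Real.pi_pos
  have hb0 : (0 : ℝ) < β := hβ₀
  have hb1 : (β : ℝ) < 1 := hβ₁
  have hgc : Continuous g.1 := continuous_chol hβ₀ g
  set Φ : Circle × Circle → ℂ := fun p =>
    ((g (p.1 * p.2) - g p.1) / ((p.2 : ℂ) - 1) * p.2) * (p.1 : ℂ) ^ (-n) with hΦ
  have hΦm : Measurable Φ := by
    have h1 : Measurable fun p : Circle × Circle => (p.1 : ℂ) ^ (-n) :=
      (Continuous.zpow₀ (by fun_prop) _ fun p => Or.inl (Circle.coe_ne_zero _)).measurable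
    have h2 : Measurable fun p : Circle × Circle => g (p.1 * p.2) :=
      (hgc.comp continuous_mul).measurable
    have h3 : Measurable fun p : Circle × Circle => g p.1 := (hgc.comp continuous_fst).measurable
    exact (((h2.sub h3).div (by fun_prop)).mul (by fun_prop)).mul h1
  have hΦi : Integrable Φ (arc.prod arc) := by
    obtain ⟨h1, -⟩ := integral_dist_rpow (s := 1 - β) (by linarith) (by linarith) 1
    have h2 : Integrable (fun p : Circle × Circle => ‖g‖ * dist p.2 1 ^ (-(1 - β : ℝ)))
        (arc.prod arc) := (h1.const_mul ‖g‖).comp_snd arc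
    refine h2.mono' hΦm.aestronglyMeasurable ?_
    have h3 : ∀ᵐ p : Circle × Circle ∂(arc.prod arc), p.2 ≠ 1 :=
      Measure.quasiMeasurePreserving_snd.ae (Measure.ae_ne arc 1)
    filter_upwards [h3] with p hp
    have hd : 0 < dist p.2 1 := dist_pos.mpr hp
    simp only [hΦ, norm_mul, norm_div, norm_zpow, Circle.norm_coe, one_zpow, mul_one]
    have e : ‖(p.2 : ℂ) - 1‖ = dist p.2 1 := by rw [← norm_coe_sub, Circle.coe_one]
    rw [e, div_le_iff₀ hd, mul_assoc, ← Real.rpow_add_one hd.ne']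
    have h4 := norm_sub_le_rpow g (p.1 * p.2) p.1
    have h5 := dist_mul_left_eq p.1 p.2 1
    rw [mul_one] at h5
    rw [h5] at h4
    rwa [show -(1 - (β : ℝ)) + 1 = β by ring]
  have h1 : circleCoeff (cauchyFun g) n = ((2 * Real.pi)⁻¹ : ℝ) * (((2 * Real.pi)⁻¹ : ℝ) *
      ∫ w, ∫ σ, Φ (w, σ) ∂arc ∂arc) := by
    rw [circleCoeff_eq]
    congr 1
    rw [← integral_const_mul]
    congr 1
    funext w
    rw [cauchyFun_eq_rotate, circleMean_eq, mul_assoc, ← integral_mul_const]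
  have h2 : ∀ σ : Circle, ((2 * Real.pi)⁻¹ : ℝ) * ∫ w, Φ (w, σ) ∂arc
      = circleCoeff g n * (((σ : ℂ) ^ n - 1) / ((σ : ℂ) - 1) * σ) := by
    intro σ
    have e : (fun w => Φ (w, σ)) = fun w => ((σ : ℂ) / ((σ : ℂ) - 1)) *
        ((g (σ * w) - g w) * (w : ℂ) ^ (-n)) := by
      funext w
      simp only [hΦ, mul_comm w σ]
      ring
    rw [e, integral_const_mul, mul_left_comm, ← circleCoeff_eq (fun w => g (σ * w) - g w)]
    have e2 : (fun w => g (σ * w) - g w) = (fun w => g (σ * w)) + (-1 : ℝ) • g.1 := by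
      funext w
      simp [sub_eq_add_neg]
    have hc1 : Continuous fun w => g (σ * w) := hgc.comp (continuous_const.mul continuous_id)
    rw [e2, circleCoeff_add hc1 (hgc.const_smul _), circleCoeff_smul, circleCoeff_mul_left]
    push_cast
    ring
  rw [h1, integral_integral_swap (f := fun w σ => Φ (w, σ)) hΦi]
  have h3 : ((2 * Real.pi)⁻¹ : ℝ) * ∫ σ, ∫ w, Φ (w, σ) ∂arc ∂arc
      = circleCoeff g n * ∫ σ, (((σ : ℂ) ^ n - 1) / ((σ : ℂ) - 1) * σ) ∂arc := by
    rw [← integral_const_mul, ← integral_const_mul]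
    congr 1
    funext σ
    exact h2 σ
  rw [h3, mul_left_comm, ← circleMean_eq (fun σ => ((σ : ℂ) ^ n - 1) / ((σ : ℂ) - 1)),
    circleMean_zpow_sub_one_div]
  split_ifs <;> simp

/-! ### The isomorphism `h ↦ -Im h'` -/

theorem holderNorm_le_norm {β : ℝ≥0} (g : CHol β) : holderNorm β g.1 ≤ ‖g‖ := by
  refine holderNorm_le g.sup_nonneg g.semi_nonneg g.le_sup fun w w' => ?_
  by_cases h : w = w'
  · subst h
    rw [sub_self, norm_zero]
    exact mul_nonneg g.semi_nonneg (by positivity)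
  · exact (holderWeight_mul_le_iff h).mp (g.le_semi w w')

theorem norm_circleCoeff_le {g : Circle → ℂ} {M : ℝ} (h : ∀ τ, ‖g τ‖ ≤ M) (n : ℤ) :
    ‖circleCoeff g n‖ ≤ M :=
  norm_circleMean_le fun τ => by rw [norm_mul, norm_zpow, Circle.norm_coe, one_zpow, mul_one]; exact h τ

theorem circleCoeff_neg (g : Circle → ℂ) (n : ℤ) :
    circleCoeff (fun w => -g w) n = -circleCoeff g n := by
  have := circleCoeff_const_mul (-1) g n
  simpa using this

theorem circleCoeff_sub {f g : Circle → ℂ} (hf : Continuous f) (hg : Continuous g) (n : ℤ) :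
    circleCoeff (fun w => f w - g w) n = circleCoeff f n - circleCoeff g n := by
  have hg' : Continuous fun w => -g w := hg.neg
  have h := circleCoeff_add hf hg' n
  have e : (f + fun w => -g w) = fun w => f w - g w := by
    funext w; simp [sub_eq_add_neg]
  rw [e, circleCoeff_neg] at h
  rw [h, sub_eq_add_neg]

theorem im_eq (z : ℂ) : ((z.im : ℝ) : ℂ) = (-Complex.I / 2) * (z - star z) := by
  apply Complex.ext
  · simp
    ring
  · simp

theorem circleCoeff_im {g : Circle → ℂ} (hg : Continuous g) (n : ℤ) :
    circleCoeff (fun w => ((g w).im : ℂ)) n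
      = (-Complex.I / 2) * (circleCoeff g n - star (circleCoeff g (-n))) := by
  simp only [im_eq]
  have hs : Continuous fun w => star (g w) := continuous_star.comp hg
  rw [circleCoeff_const_mul, circleCoeff_sub hg hs, circleCoeff_star]

/-- The imaginary part, as a complex function. -/
def imHol (β : ℝ≥0) : CHol β →L[ℝ] CHol β :=
  (ContinuousLinearMap.mul ℝ (CHol β) (Hol.const _ (-Complex.I / 2))).comp
    (ContinuousLinearMap.id ℝ (CHol β) - Hol.conj)

@[simp] theorem imHol_apply {β : ℝ≥0} (g : CHol β) (w : Circle) :
    imHol β g w = ((g w).im : ℂ) := by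
  rw [im_eq]
  rfl

/-- The Cauchy singular integral on `C^β`. -/
def cauchyHol {β : ℝ≥0} (hβ₀ : 0 < β) (hβ₁ : β < 1) (g : CHol β) : CHol β :=
  Hol.of (cauchyFun g) <| mem_holAlg_of_le hβ₀
    (B := max (privalovConst β) 0 * ‖g‖) (by positivity) (norm_cauchyFun_le hβ₀ hβ₁ g)
    fun w w' => (norm_cauchyFun_sub_le hβ₀ hβ₁ g w w').trans (by
      gcongr; exact le_max_left _ _)

theorem norm_cauchyHol_le {β : ℝ≥0} (hβ₀ : 0 < β) (hβ₁ : β < 1) (g : CHol β) :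
    ‖cauchyHol hβ₀ hβ₁ g‖ ≤ (1 / β + max (privalovConst β) 0) * ‖g‖ := by
  rw [add_mul]
  refine Hol.norm_le (by positivity) (by positivity) (norm_cauchyFun_le hβ₀ hβ₁ g)
    (holderWeight_mul_le (by positivity) fun w w' =>
      (norm_cauchyFun_sub_le hβ₀ hβ₁ g w w').trans (by gcongr; exact le_max_left _ _))

theorem continuous_cauchyFun {β : ℝ≥0} (hβ₀ : 0 < β) (hβ₁ : β < 1) (g : CHol β) :
    Continuous (cauchyFun g) :=
  continuous_chol hβ₀ (cauchyHol hβ₀ hβ₁ g)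

/-- For n < 0 the conjugate part of Im p involves only the coefficient of p at -n > 0, which is 0;
hence Im p has coefficient -i/2 times that of p. The Cauchy integral keeps the negative modes with a
minus sign, and (-2i)(i/2) = 1. -/
theorem eq_cauchyFun_im {β : ℝ≥0} (hβ₀ : 0 < β) (hβ₁ : β < 1) (p : CHol β)
    (hp : ∀ n : ℤ, 0 ≤ n → circleCoeff p n = 0) :
    p = Hol.const _ (-2 * Complex.I) * cauchyHol hβ₀ hβ₁ (imHol β p) := by
  have hpc := continuous_chol hβ₀ p
  have him : (imHol β p).1 = fun w => ((p w).im : ℂ) := funext fun w => imHol_apply p w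
  apply Subtype.ext
  refine ext_of_circleCoeff hpc (continuous_chol hβ₀ _) fun n => ?_
  have h1 : circleCoeff (Hol.const (holderWeight β) (-2 * Complex.I) *
      cauchyHol hβ₀ hβ₁ (imHol β p)).1 n
      = -2 * Complex.I * circleCoeff (cauchyFun (imHol β p)) n := circleCoeff_const_mul _ _ _
  rw [h1, circleCoeff_cauchyFun hβ₀ hβ₁, him, circleCoeff_im hpc]
  split_ifs with h
  · rw [hp (-n) (by omega), star_zero, sub_zero]
    linear_combination (circleCoeff p n) * Complex.I_mul_I
  · rw [hp n (by omega), mul_zero]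

theorem norm_le_norm_imHol {β : ℝ≥0} (hβ₀ : 0 < β) (hβ₁ : β < 1) (p : CHol β)
    (hp : ∀ n : ℤ, 0 ≤ n → circleCoeff p n = 0) :
    ‖p‖ ≤ ‖Hol.const (holderWeight β) (-2 * Complex.I)‖ * (1 / β + max (privalovConst β) 0)
      * ‖imHol β p‖ := by
  conv_lhs => rw [eq_cauchyFun_im hβ₀ hβ₁ p hp]
  refine (norm_mul_le _ _).trans ?_
  rw [mul_assoc]
  exact mul_le_mul_of_nonneg_left (norm_cauchyHol_le hβ₀ hβ₁ _) (norm_nonneg _)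

/-! #### The space `Ŷ` -/

/-- For real coefficients g_n, Im g has coefficients (-i/2)(g_n - g_{-n}). The first mode vanishes
when g_1 = g_{-1}, which is the constraint that determines the speed. -/
theorem im_mem_yHat {β : ℝ≥0} {g : Circle → ℂ} (hg : Continuous g) (hg' : MemHolder β g)
    (hre : ∀ n, (circleCoeff g n).im = 0) (h1 : circleCoeff g 1 = circleCoeff g (-1)) :
    (fun w => (g w).im) ∈ yHatSubmodule β := by
  have hstar : ∀ n, star (circleCoeff g n) = circleCoeff g n := fun n =>
    Complex.conj_eq_iff_im.mpr (hre n)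
  refine ⟨Complex.continuous_im.comp hg, ⟨nnHolderNorm β g, holderWith_of_le fun w w' => ?_⟩,
    fun n => ?_, ?_⟩
  · rw [← Complex.sub_im]
    exact (Complex.abs_im_le_norm _).trans (hg'.norm_sub_le w w')
  · rw [circleCoeff_im hg, hstar]
    simp [hre]
  · rw [circleCoeff_im hg, hstar, h1, sub_self, mul_zero]

theorem yHat_inv {β : ℝ≥0} (y : YHat β) (w : Circle) : y w⁻¹ = -y w := by
  have hc : Continuous fun w => (y w : ℂ) := Complex.continuous_ofReal.comp y.2.1
  have h : (fun w : Circle => (y w⁻¹ : ℂ)) = fun w => -(y w : ℂ) := by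
    refine ext_of_circleCoeff (hc.comp continuous_inv) hc.neg fun n => ?_
    rw [circleCoeff_inv (fun w => (y w : ℂ)), circleCoeff_neg]
    have h2 := circleCoeff_star (fun w => (y w : ℂ)) (-n)
    have e : (fun w => star (y w : ℂ)) = fun w => (y w : ℂ) :=
      funext fun w => Complex.conj_ofReal _
    rw [e, neg_neg] at h2
    rw [h2]
    apply Complex.ext
    · simp [y.2.2.2.1 n]
    · simp
  have h2 : (y w⁻¹ : ℂ) = -(y w : ℂ) := congrFun h w
  exact_mod_cast h2

theorem norm_yHat_def {β : ℝ≥0} (y : YHat β) : ‖y‖ = holderNorm β y.1 := rfl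

theorem dist_le_two_mul_rpow {β : ℝ≥0} (hβ₀ : 0 < β) (hβ₁ : β < 1) (w w' : Circle) :
    dist w w' ≤ 2 * dist w w' ^ (β : ℝ) := by
  have hb0 : (0 : ℝ) < β := hβ₀
  have hb1 : (β : ℝ) < 1 := hβ₁
  rcases eq_or_ne w w' with rfl | h
  · rw [dist_self]; positivity
  have hd : 0 < dist w w' := dist_pos.mpr h
  have e : dist w w' = dist w w' ^ (1 - β : ℝ) * dist w w' ^ (β : ℝ) := by
    rw [← Real.rpow_add hd, sub_add_cancel, Real.rpow_one]
  conv_lhs => rw [e]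
  gcongr
  calc dist w w' ^ (1 - β : ℝ) ≤ 2 ^ (1 - β : ℝ) :=
        Real.rpow_le_rpow hd.le (dist_le_two _ _) (by linarith)
    _ ≤ 2 := Real.rpow_le_self_of_one_le one_le_two (by linarith)

/-- The odd part of `Im g`, without its first mode. -/
def yHatProjFun (g : Circle → ℂ) (w : Circle) : ℝ :=
  ((g w).im - (g w⁻¹).im) / 2
    -- The coefficient of w in Im w is -i/2, so a first coefficient im (m real) is removed by adding
    -- 2m Im w.
    + 2 * (circleCoeff (fun w => ((((g w).im - (g w⁻¹).im) / 2 : ℝ) : ℂ)) 1).im * (w : ℂ).im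

theorem norm_yHatProjFun_le {β : ℝ≥0} (g : CHol β) (w : Circle) :
    ‖yHatProjFun g w‖ ≤ 3 * ‖g‖ := by
  have h : ∀ w, ‖((g w).im - (g w⁻¹).im) / 2‖ ≤ ‖g‖ := by
    intro w
    have h1 := (Complex.abs_im_le_norm (g w)).trans (g.norm_apply_le w)
    have h2 := (Complex.abs_im_le_norm (g w⁻¹)).trans (g.norm_apply_le w⁻¹)
    rw [Real.norm_eq_abs, abs_div, abs_two, div_le_iff₀ two_pos]
    exact (abs_sub _ _).trans (by linarith)
  have h3 : |(circleCoeff (fun w => ((((g w).im - (g w⁻¹).im) / 2 : ℝ) : ℂ)) 1).im| ≤ ‖g‖ :=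
    (Complex.abs_im_le_norm _).trans (norm_circleCoeff_le (fun τ => by
      rw [Complex.norm_real]; exact h τ) 1)
  have h4 : |(w : ℂ).im| ≤ 1 := (Complex.abs_im_le_norm _).trans (Circle.norm_coe w).le
  refine (norm_add_le _ _).trans ?_
  have h5 : ‖2 * (circleCoeff (fun w => ((((g w).im - (g w⁻¹).im) / 2 : ℝ) : ℂ)) 1).im
      * (w : ℂ).im‖ ≤ 2 * ‖g‖ * 1 := by
    rw [norm_mul, norm_mul, Real.norm_eq_abs, Real.norm_eq_abs, Real.norm_eq_abs, abs_two]
    gcongr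
  linarith [h w]

theorem norm_yHatProjFun_sub_le {β : ℝ≥0} (hβ₀ : 0 < β) (hβ₁ : β < 1) (g : CHol β)
    (w w' : Circle) :
    ‖yHatProjFun g w - yHatProjFun g w'‖ ≤ 5 * ‖g‖ * dist w w' ^ (β : ℝ) := by
  have h1 : |(g w).im - (g w').im| ≤ ‖g‖ * dist w w' ^ (β : ℝ) := by
    rw [← Complex.sub_im]
    exact (Complex.abs_im_le_norm _).trans (norm_sub_le_rpow g w w')
  have h2 : |(g w⁻¹).im - (g w'⁻¹).im| ≤ ‖g‖ * dist w w' ^ (β : ℝ) := by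
    rw [← Complex.sub_im, ← dist_inv_inv_eq]
    exact (Complex.abs_im_le_norm _).trans (norm_sub_le_rpow g w⁻¹ w'⁻¹)
  have h3 : |(circleCoeff (fun w => ((((g w).im - (g w⁻¹).im) / 2 : ℝ) : ℂ)) 1).im| ≤ ‖g‖ := by
    refine (Complex.abs_im_le_norm _).trans (norm_circleCoeff_le (fun w => ?_) 1)
    have h1 := (Complex.abs_im_le_norm (g w)).trans (g.norm_apply_le w)
    have h2 := (Complex.abs_im_le_norm (g w⁻¹)).trans (g.norm_apply_le w⁻¹)
    rw [Complex.norm_real, Real.norm_eq_abs, abs_div, abs_two, div_le_iff₀ two_pos]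
    exact (abs_sub _ _).trans (by linarith)
  have h4 : |(w : ℂ).im - (w' : ℂ).im| ≤ 2 * dist w w' ^ (β : ℝ) := by
    rw [← Complex.sub_im]
    refine (Complex.abs_im_le_norm _).trans ?_
    rw [norm_coe_sub]
    exact dist_le_two_mul_rpow hβ₀ hβ₁ w w'
  set m := (circleCoeff (fun w => ((((g w).im - (g w⁻¹).im) / 2 : ℝ) : ℂ)) 1).im with hm
  have e : yHatProjFun g w - yHatProjFun g w' = ((g w).im - (g w').im) / 2
      - ((g w⁻¹).im - (g w'⁻¹).im) / 2 + 2 * m * ((w : ℂ).im - (w' : ℂ).im) := by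
    rw [yHatProjFun, yHatProjFun, ← hm]
    ring
  have h5 : |2 * m * ((w : ℂ).im - (w' : ℂ).im)| ≤ 2 * ‖g‖ * (2 * dist w w' ^ (β : ℝ)) := by
    rw [abs_mul, abs_mul, abs_two]
    gcongr
  rw [e, Real.norm_eq_abs]
  rw [abs_le] at *
  constructor <;> linarith [h1.1, h1.2, h2.1, h2.2, h5.1, h5.2]

theorem yHatProjFun_mem {β : ℝ≥0} (hβ₀ : 0 < β) (hβ₁ : β < 1) (g : CHol β) :
    yHatProjFun g ∈ yHatSubmodule β := by
  have hH : HolderWith (5 * ‖g‖₊) β (yHatProjFun g) := holderWith_of_le fun w w' => by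
    push_cast
    exact norm_yHatProjFun_sub_le hβ₀ hβ₁ g w w'
  have hgc := continuous_chol hβ₀ g
  set o : Circle → ℂ := fun w => ((((g w).im - (g w⁻¹).im) / 2 : ℝ) : ℂ) with ho
  have hoc : Continuous o := Complex.continuous_ofReal.comp
    (((Complex.continuous_im.comp hgc).sub
      (Complex.continuous_im.comp (hgc.comp continuous_inv))).div_const 2)
  -- Reality gives that c_n is the conjugate of c_{-n}, and oddness gives c_{-n} = -c_n; together
  -- c_n is purely imaginary.
  have hore : ∀ n, (circleCoeff o n).re = 0 := by
    intro n
    have h1 := circleCoeff_star o n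
    have h2 := circleCoeff_inv o n
    have e1 : (fun w => star (o w)) = o := funext fun w => Complex.conj_ofReal _
    have e2 : (fun w => o w⁻¹) = fun w => -o w := by
      funext w
      simp only [ho, inv_inv]
      push_cast
      ring
    rw [e1] at h1
    rw [e2, circleCoeff_neg] at h2
    rw [← h2] at h1
    have := congrArg Complex.re h1
    simp at this
    linarith
  have hw : ∀ n, circleCoeff (fun w : Circle => (((w : ℂ).im : ℝ) : ℂ)) n
      = (-Complex.I / 2) * ((if n = 1 then 1 else 0) - if n = -1 then 1 else 0) := by
    intro n
    rw [circleCoeff_im continuous_coe_circle]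
    have h1 := circleCoeff_zpow 1 n
    have h2 := circleCoeff_zpow 1 (-n)
    simp only [zpow_one] at h1 h2
    rw [h1, h2]
    congr 2
    split_ifs <;> first | omega | simp
  set m : ℝ := 2 * (circleCoeff o 1).im with hm
  have hP : ∀ n, circleCoeff (fun w => ((yHatProjFun g w : ℝ) : ℂ)) n = circleCoeff o n
      + m * ((-Complex.I / 2) * ((if n = 1 then 1 else 0) - if n = -1 then 1 else 0)) := by
    intro n
    have e : (fun w => ((yHatProjFun g w : ℝ) : ℂ))
        = o + fun w : Circle => (m : ℂ) * (((w : ℂ).im : ℝ) : ℂ) := by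
      funext w
      simp only [yHatProjFun, Pi.add_apply, hm, ho]
      push_cast
      ring
    rw [e, circleCoeff_add hoc (by fun_prop), circleCoeff_const_mul, hw]
  refine ⟨hH.continuous hβ₀, hH.memHolder, fun n => ?_, ?_⟩
  · rw [hP, Complex.add_re, hore, zero_add, Complex.re_ofReal_mul]
    split_ifs <;> simp
  · rw [hP, if_pos rfl, if_neg (by norm_num), hm]
    apply Complex.ext
    · simp [hore]
    · simp
      ring

/-- A bounded projection of `C^β` onto `Ŷ`, given by `g ↦ Im g` when `Im g ∈ Ŷ`. -/
def yHatProjLin {β : ℝ≥0} (hβ₀ : 0 < β) (hβ₁ : β < 1) : CHol β →ₗ[ℝ] YHat β where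
  toFun g := ⟨yHatProjFun g, yHatProjFun_mem hβ₀ hβ₁ g⟩
  map_add' f g := Subtype.ext <| funext fun w => by
    change yHatProjFun (f + g).1 w = yHatProjFun f w + yHatProjFun g w
    have hc : ∀ g : CHol β, Continuous fun w => ((((g w).im - (g w⁻¹).im) / 2 : ℝ) : ℂ) :=
      fun g => Complex.continuous_ofReal.comp
        (((Complex.continuous_im.comp (continuous_chol hβ₀ g)).sub
        (Complex.continuous_im.comp ((continuous_chol hβ₀ g).comp continuous_inv))).div_const 2)
    have e : (fun w => (((((f + g) w).im - ((f + g) w⁻¹).im) / 2 : ℝ) : ℂ))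
        = (fun w => ((((f w).im - (f w⁻¹).im) / 2 : ℝ) : ℂ))
          + fun w => ((((g w).im - (g w⁻¹).im) / 2 : ℝ) : ℂ) := by
      funext w
      simp only [Pi.add_apply, Hol.add_apply, Complex.add_im]
      push_cast
      ring
    simp only [yHatProjFun]
    rw [e, circleCoeff_add (hc f) (hc g)]
    simp only [Hol.add_apply, Complex.add_im]
    ring
  map_smul' c g := Subtype.ext <| funext fun w => by
    change yHatProjFun (c • g).1 w = c * yHatProjFun g w
    have e : (fun w => (((((c • g) w).im - ((c • g) w⁻¹).im) / 2 : ℝ) : ℂ))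
        = (fun w => (c : ℂ) * ((((g w).im - (g w⁻¹).im) / 2 : ℝ) : ℂ)) := by
      funext w
      simp only [Hol.smul_apply, Complex.im_ofReal_mul]
      push_cast
      ring
    simp only [yHatProjFun]
    rw [e, circleCoeff_const_mul]
    simp only [Hol.smul_apply, Complex.im_ofReal_mul]
    ring

/-- The projection `yHatProjLin` as a continuous linear map. -/
def yHatProj {β : ℝ≥0} (hβ₀ : 0 < β) (hβ₁ : β < 1) : CHol β →L[ℝ] YHat β :=
  (yHatProjLin hβ₀ hβ₁).mkContinuous 8 fun g => by
    rw [norm_yHat_def, show (8:ℝ) * ‖g‖ = 3 * ‖g‖ + 5 * ‖g‖ by ring]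
    exact holderNorm_le (by positivity) (by positivity) (norm_yHatProjFun_le g)
      (norm_yHatProjFun_sub_le hβ₀ hβ₁ g)

theorem yHatProj_apply_of_mem {β : ℝ≥0} (hβ₀ : 0 < β) (hβ₁ : β < 1) {g : CHol β}
    (h : (fun w => (g w).im) ∈ yHatSubmodule β) (w : Circle) :
    yHatProj hβ₀ hβ₁ g w = (g w).im := by
  have hodd : ∀ w, (g w⁻¹).im = -(g w).im := fun w => yHat_inv (⟨_, h⟩ : YHat β) w
  change yHatProjFun g w = _
  have e : ∀ w, ((g w).im - (g w⁻¹).im) / 2 = (g w).im := fun w => by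
    rw [hodd]; ring
  simp only [yHatProjFun, e]
  rw [h.2.2.2]
  simp

/-- Inclusion of `Ŷ` in `C^β`. -/
def yHatIncl {β : ℝ≥0} (y : YHat β) : CHol β :=
  Hol.of (fun w => (y w : ℂ)) ⟨Complex.measurable_ofReal.comp y.2.1.measurable,
    ⟨supNorm y.1, fun w => by
      rw [Complex.norm_real]; exact norm_le_supNorm y.2.1 w⟩, nnHolderNorm β y.1,
    holderWeight_mul_le (NNReal.coe_nonneg _) fun w w' => by
      rw [← Complex.ofReal_sub, Complex.norm_real]
      exact y.2.2.1.norm_sub_le w w'⟩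

@[simp] theorem yHatIncl_apply {β : ℝ≥0} (y : YHat β) (w : Circle) : yHatIncl y w = (y w : ℂ) :=
  rfl

theorem norm_yHatIncl_le {β : ℝ≥0} (y : YHat β) : ‖yHatIncl y‖ ≤ ‖y‖ :=
  Hol.norm_le (supNorm_nonneg _) (NNReal.coe_nonneg _)
    (fun w => by
      rw [yHatIncl_apply, Complex.norm_real]; exact norm_le_supNorm y.2.1 w)
    (holderWeight_mul_le (NNReal.coe_nonneg _) fun w w' => by
      rw [yHatIncl_apply, yHatIncl_apply, ← Complex.ofReal_sub, Complex.norm_real]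
      exact y.2.2.1.norm_sub_le w w')

/-! ### The data of a function entering the functional -/

/-- Functions of class `C^{1+β}` on the circle. -/
def c1Hol (β : ℝ≥0) : Submodule ℝ (Circle → ℂ) where
  carrier := {f | IsC1 f ∧ MemHolder β (circleDeriv f)}
  zero_mem' := ⟨(0 : XSpace β).2.1, (0 : XSpace β).2.2.1⟩
  add_mem' := by
    rintro f g ⟨hf, hf'⟩ ⟨hg, hg'⟩
    exact ⟨hf.add hg, by rw [circleDeriv_add hf hg]; exact hf'.add hg'⟩
  smul_mem' := by
    rintro c f ⟨hf, hf'⟩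
    exact ⟨hf.smul c, by rw [circleDeriv_smul c hf]; exact hf'.smul⟩

/-- The derivative as an element of `C^β`. -/
def derivHol {β : ℝ≥0} (f : c1Hol β) : CHol β :=
  Hol.of (circleDeriv f.1) (mem_holAlg f.2.1.2.2 f.2.2)

@[simp] theorem derivHol_apply {β : ℝ≥0} (f : c1Hol β) (w : Circle) :
    derivHol f w = circleDeriv f.1 w := rfl

theorem c1Hol_lipschitz {β : ℝ≥0} (f : c1Hol β) (τ w : Circle) :
    ‖f.1 τ - f.1 w‖ ≤ Real.pi / 2 * ‖derivHol f‖ * dist τ w :=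
  f.2.1.norm_sub_le (fun w => (derivHol f).norm_apply_le w) τ w

theorem mem_ker {k : Circle × Circle → ℂ} (hk : Measurable k) {A M : ℝ} (hM : 0 ≤ M)
    (hA : ∀ p, ‖k p‖ ≤ A)
    (h : ∀ τ w w', ‖k (τ, w) - k (τ, w')‖ * dist τ w ≤ M * dist w w') :
    k ∈ holAlg kernelWeight :=
  ⟨hk, ⟨A, hA⟩, M, kernelWeight_mul_le hM h⟩

/-- The difference splits as (f w' - f w)/(τ - w) plus the quotient at w' times (w - w')/(τ - w),
and each term is at most Λ|w - w'|/|τ - w|. Difference quotients of Lipschitz functions are thus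
admissible kernels. -/
theorem diffQuot_kernel_bound {f : Circle → ℂ} {Λ : ℝ} (hΛ : 0 ≤ Λ)
    (hf : ∀ τ w, ‖f τ - f w‖ ≤ Λ * dist τ w) (τ w w' : Circle) :
    ‖diffQuot f w τ - diffQuot f w' τ‖ * dist τ w ≤ 2 * Λ * dist w w' := by
  rcases eq_or_ne τ w with rfl | h
  · rw [dist_self, mul_zero]
    positivity
  have hd : 0 < dist τ w := dist_pos.mpr h
  -- At τ = w' the second quotient is 0/0 = 0, and the Lipschitz bound alone suffices.
  rcases eq_or_ne τ w' with rfl | h'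
  · have e : diffQuot f τ τ = 0 := by simp [diffQuot]
    rw [e, sub_zero, diffQuot, norm_div, norm_coe_sub, div_mul_cancel₀ _ hd.ne', dist_comm w]
    refine (hf τ w).trans ?_
    have : 0 ≤ Λ * dist τ w := by positivity
    linarith
  have hd' : 0 < dist τ w' := dist_pos.mpr h'
  have h0 : (τ : ℂ) - w ≠ 0 := sub_ne_zero.mpr fun e => h (Circle.ext e)
  have h0' : (τ : ℂ) - w' ≠ 0 := sub_ne_zero.mpr fun e => h' (Circle.ext e)
  have e : diffQuot f w τ - diffQuot f w' τ
      = (f w' - f w) / ((τ : ℂ) - w)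
        + (f τ - f w') / ((τ : ℂ) - w') * (((w : ℂ) - w') / ((τ : ℂ) - w)) := by
    simp only [diffQuot]
    field_simp
    ring
  rw [e]
  have h1 : ‖(f w' - f w) / ((τ : ℂ) - w)‖ ≤ Λ * dist w w' / dist τ w := by
    rw [norm_div, norm_coe_sub]
    gcongr
    rw [norm_sub_rev]
    exact hf w w'
  have h2 : ‖(f τ - f w') / ((τ : ℂ) - w') * (((w : ℂ) - w') / ((τ : ℂ) - w))‖
      ≤ Λ * (dist w w' / dist τ w) := by
    rw [norm_mul, norm_div, norm_div, norm_coe_sub, norm_coe_sub, norm_coe_sub]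
    gcongr
    rw [div_le_iff₀ hd']
    exact hf τ w'
  calc _ ≤ (Λ * dist w w' / dist τ w + Λ * (dist w w' / dist τ w)) * dist τ w := by
        gcongr
        exact (norm_add_le _ _).trans (add_le_add h1 h2)
    _ = _ := by field_simp; ring

theorem norm_diffQuot_le_of_lipschitz {f : Circle → ℂ} {Λ : ℝ} (hΛ : 0 ≤ Λ)
    (hf : ∀ τ w, ‖f τ - f w‖ ≤ Λ * dist τ w) (w τ : Circle) : ‖diffQuot f w τ‖ ≤ Λ := by
  rw [diffQuot, norm_div, norm_coe_sub]
  exact div_le_of_le_mul₀ dist_nonneg hΛ (hf τ w)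

/-- The kernel `(f τ - f w) / (τ - w)`. -/
def diffKer {β : ℝ≥0} (f : c1Hol β) : Ker :=
  Hol.of (fun p => diffQuot f.1 p.2 p.1) <| mem_ker
    (by
      have h1 : Measurable fun p : Circle × Circle => f.1 p.1 :=
        (f.2.1.1.comp continuous_fst).measurable
      have h2 : Measurable fun p : Circle × Circle => f.1 p.2 :=
        (f.2.1.1.comp continuous_snd).measurable
      exact (h1.sub h2).div (by fun_prop))
    (M := 2 * (Real.pi / 2 * ‖derivHol f‖)) (by positivity)
    (fun p => norm_diffQuot_le_of_lipschitz (by positivity) (c1Hol_lipschitz f) _ _)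
    (diffQuot_kernel_bound (by positivity) (c1Hol_lipschitz f))

@[simp] theorem diffKer_apply {β : ℝ≥0} (f : c1Hol β) (p : Circle × Circle) :
    diffKer f p = (f.1 p.1 - f.1 p.2) / ((p.1 : ℂ) - p.2) := rfl

/-- The kernel `f τ`. -/
def fstFun {β : ℝ≥0} (f : c1Hol β) : Ker :=
  Hol.of (fun p => f.1 p.1) <| mem_ker (f.2.1.1.comp continuous_fst).measurable
    (M := 0) le_rfl (fun _ => norm_le_supNorm f.2.1.1 _) (by simp)

@[simp] theorem fstFun_apply {β : ℝ≥0} (f : c1Hol β) (p : Circle × Circle) :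
    fstFun f p = f.1 p.1 := rfl

theorem snd_kernel_bound {f : Circle → ℂ} {Λ : ℝ} (hΛ : 0 ≤ Λ)
    (hf : ∀ τ w, ‖f τ - f w‖ ≤ Λ * dist τ w) (τ w w' : Circle) :
    ‖f w - f w'‖ * dist τ w ≤ 2 * Λ * dist w w' := by
  calc _ ≤ Λ * dist w w' * 2 := mul_le_mul (hf w w') (dist_le_two _ _) dist_nonneg (by positivity)
    _ = _ := by ring

/-- The kernel `f w`. -/
def sndFun {β : ℝ≥0} (f : c1Hol β) : Ker :=
  Hol.of (fun p => f.1 p.2) <| mem_ker (f.2.1.1.comp continuous_snd).measurable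
    (M := 2 * (Real.pi / 2 * ‖derivHol f‖)) (by positivity)
    (fun _ => norm_le_supNorm f.2.1.1 _)
    (snd_kernel_bound (by positivity) (c1Hol_lipschitz f))

/-- The data of a function that enter the functional. -/
abbrev Data (β : ℝ≥0) : Type := CHol β × Ker × Ker × Ker

/-- The derivative, the difference quotient and the two values of `f`. -/
def dataLin (β : ℝ≥0) : c1Hol β →ₗ[ℝ] Data β where
  toFun f := (derivHol f, diffKer f, fstFun f, sndFun f)
  map_add' f g := by
    refine Prod.ext ?_ (Prod.ext ?_ (Prod.ext ?_ ?_))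
    · ext w
      exact congrFun (circleDeriv_add f.2.1 g.2.1) w
    · ext p
      change ((f.1 p.1 + g.1 p.1) - (f.1 p.2 + g.1 p.2)) / ((p.1 : ℂ) - p.2)
        = (f.1 p.1 - f.1 p.2) / ((p.1 : ℂ) - p.2) + (g.1 p.1 - g.1 p.2) / ((p.1 : ℂ) - p.2)
      ring
    · rfl
    · rfl
  map_smul' c f := by
    refine Prod.ext ?_ (Prod.ext ?_ (Prod.ext ?_ ?_))
    · ext w
      exact congrFun (circleDeriv_smul c f.2.1) w
    · ext p
      change ((c * f.1 p.1) - (c * f.1 p.2)) / ((p.1 : ℂ) - p.2)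
        = c * ((f.1 p.1 - f.1 p.2) / ((p.1 : ℂ) - p.2))
      ring
    · rfl
    · rfl

theorem norm_dataLin_le {β : ℝ≥0} (f : c1Hol β) :
    ‖dataLin β f‖ ≤ 5 * (supNorm f.1 + ‖derivHol f‖) := by
  have hp := norm_nonneg (derivHol f)
  have hs := supNorm_nonneg f.1
  have hpi := Real.pi_pos
  -- The constant 5 covers 3π/2, which is the sup bound π/2 plus the seminorm bound π of the
  -- difference quotient.
  have hpi4 := Real.pi_lt_d2
  have h1 : Real.pi * ‖derivHol f‖ ≤ 3.15 * ‖derivHol f‖ := by gcongr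
  refine max_le (by change ‖derivHol f‖ ≤ _; linarith) (max_le ?_ (max_le ?_ ?_))
  · refine (Hol.norm_le (f := diffKer f) (A := Real.pi / 2 * ‖derivHol f‖)
      (B := 2 * (Real.pi / 2 * ‖derivHol f‖)) (by positivity) (by positivity)
      (fun p => norm_diffQuot_le_of_lipschitz (by positivity) (c1Hol_lipschitz f) _ _)
      (kernelWeight_mul_le (by positivity)
        (diffQuot_kernel_bound (by positivity) (c1Hol_lipschitz f)))).trans ?_
    linarith
  · refine (Hol.norm_le (f := fstFun f) (A := supNorm f.1) (B := 0) hs le_rfl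
      (fun _ => norm_le_supNorm f.2.1.1 _)
      (kernelWeight_mul_le le_rfl (by intros; simp))).trans ?_
    linarith
  · refine (Hol.norm_le (f := sndFun f) (A := supNorm f.1)
      (B := 2 * (Real.pi / 2 * ‖derivHol f‖)) hs (by positivity)
      (fun _ => norm_le_supNorm f.2.1.1 _)
      (kernelWeight_mul_le (by positivity)
        (snd_kernel_bound (by positivity) (c1Hol_lipschitz f)))).trans ?_
    linarith

/-- When f has mean zero, f w is the average over τ of f w - f τ, and distances on the circle are at
most 2. So f' controls all the data of f. -/
theorem supNorm_le_of_circleCoeff_zero {β : ℝ≥0} (f : c1Hol β) (h : circleCoeff f.1 0 = 0) :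
    supNorm f.1 ≤ Real.pi * ‖derivHol f‖ := by
  refine Real.iSup_le (fun w => ?_) (by positivity)
  have h1 : circleCoeff (fun τ => f.1 w * 1 - f.1 τ) 0 = f.1 w := by
    rw [circleCoeff_sub continuous_const f.2.1.1, h, circleCoeff_const_mul, circleCoeff_one,
      if_pos rfl, mul_one, sub_zero]
  rw [← h1]
  refine norm_circleCoeff_le (fun τ => ?_) 0
  rw [mul_one]
  refine (c1Hol_lipschitz f w τ).trans ?_
  calc Real.pi / 2 * ‖derivHol f‖ * dist w τ ≤ Real.pi / 2 * ‖derivHol f‖ * 2 := by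
        gcongr; exact dist_le_two _ _
    _ = _ := by ring

theorem norm_dataLin_le_of_circleCoeff_zero {β : ℝ≥0} (f : c1Hol β)
    (h : circleCoeff f.1 0 = 0) : ‖dataLin β f‖ ≤ 25 * ‖derivHol f‖ := by
  refine (norm_dataLin_le f).trans ?_
  have h1 := supNorm_le_of_circleCoeff_zero f h
  have h2 : Real.pi * ‖derivHol f‖ ≤ 4 * ‖derivHol f‖ := by
    gcongr; exact Real.pi_le_four
  linarith

/-- Bundle a function of `X`. -/
def XSpace.of {β : ℝ≥0} (f : Circle → ℂ) (h : f ∈ xSubmodule β) : XSpace β := ⟨f, h⟩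

/-- Inclusion of `X` in `C^{1+β}`. -/
def xIncl (β : ℝ≥0) : XSpace β →ₗ[ℝ] c1Hol β where
  toFun f := ⟨f.1, f.2.1, f.2.2.1⟩
  map_add' _ _ := rfl
  map_smul' _ _ := rfl

@[simp] theorem xIncl_coe {β : ℝ≥0} (f : XSpace β) : (xIncl β f).1 = f.1 := rfl

theorem norm_xSpace_def {β : ℝ≥0} (f : XSpace β) :
    ‖f‖ = supNorm f.1 + holderNorm β (circleDeriv f.1) := rfl

theorem supNorm_add_norm_derivHol_le {β : ℝ≥0} (f : XSpace β) :
    supNorm f.1 + ‖derivHol (xIncl β f)‖ ≤ ‖f‖ := by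
  rw [norm_xSpace_def]
  gcongr
  exact norm_of_le_holderNorm f.2.1.2.2 f.2.2.1

theorem norm_derivHol_le {β : ℝ≥0} (f : XSpace β) : ‖derivHol (xIncl β f)‖ ≤ ‖f‖ := by
  have := supNorm_add_norm_derivHol_le f
  have := supNorm_nonneg f.1
  linarith

theorem norm_xSpace_le {β : ℝ≥0} (f : XSpace β) :
    ‖f‖ ≤ supNorm f.1 + ‖derivHol (xIncl β f)‖ := by
  rw [norm_xSpace_def]
  gcongr
  exact holderNorm_le_norm (derivHol (xIncl β f))

/-- The data of a function of `X`. -/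
def xData (β : ℝ≥0) : XSpace β →L[ℝ] Data β :=
  ((dataLin β).comp (xIncl β)).mkContinuous 5 fun f => by
    refine (norm_dataLin_le (xIncl β f)).trans ?_
    have := supNorm_add_norm_derivHol_le f
    rw [xIncl_coe]
    linarith

theorem xData_apply {β : ℝ≥0} (f : XSpace β) : xData β f = dataLin β (xIncl β f) := rfl

/-! ### The linearized operator -/

theorem circleCoeff_derivHol_of_nonneg {β : ℝ≥0} (f : XSpace β) {n : ℤ} (hn : -1 ≤ n) :
    circleCoeff (circleDeriv f.1) n = 0 := by
  rw [circleCoeff_circleDeriv f.2.1, f.2.2.2.1 (n + 1) (by omega), mul_zero]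

theorem circleCoeff_derivHol_im {β : ℝ≥0} (f : XSpace β) (n : ℤ) :
    (circleCoeff (circleDeriv f.1) n).im = 0 := by
  rw [circleCoeff_circleDeriv f.2.1]
  have : ((n : ℂ) + 1) = ((n + 1 : ℝ) : ℂ) := by push_cast; ring
  rw [this, Complex.im_ofReal_mul, f.2.2.2.2, mul_zero]

theorem neg_deriv_im_mem {β : ℝ≥0} (f : XSpace β) :
    (fun w => (-circleDeriv f.1 w).im) ∈ yHatSubmodule β := by
  refine im_mem_yHat f.2.1.2.2.neg ?_ (fun n => ?_) ?_
  · obtain ⟨C, hC⟩ := f.2.2.1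
    refine ⟨C, fun w w' => ?_⟩
    rw [edist_neg_neg]
    exact hC w w'
  · rw [circleCoeff_neg, Complex.neg_im, circleCoeff_derivHol_im, neg_zero]
  · rw [circleCoeff_neg, circleCoeff_neg, circleCoeff_derivHol_of_nonneg f (by norm_num),
      circleCoeff_derivHol_of_nonneg f le_rfl]

/-- The operator `h ↦ -Im h'` from `X` to `Ŷ`. -/
def linOp {β : ℝ≥0} (hβ₀ : 0 < β) (hβ₁ : β < 1) : XSpace β →L[ℝ] YHat β :=
  -((yHatProj hβ₀ hβ₁).comp ((ContinuousLinearMap.fst ℝ (CHol β) _).comp (xData β)))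

theorem linOp_apply {β : ℝ≥0} (hβ₀ : 0 < β) (hβ₁ : β < 1) (h : XSpace β) (w : Circle) :
    linOp hβ₀ hβ₁ h w = -(circleDeriv h.1 w).im := by
  have e : linOp hβ₀ hβ₁ h = yHatProj hβ₀ hβ₁ (-derivHol (xIncl β h)) :=
    (map_neg (yHatProj hβ₀ hβ₁) (derivHol (xIncl β h))).symm
  rw [e, yHatProj_apply_of_mem hβ₀ hβ₁ (g := -derivHol (xIncl β h)) (neg_deriv_im_mem h)]
  rfl

/-- The vanishing coefficient says that i e^{iη} g(e^{iη}) has integral 0 over a period, so its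
primitive is periodic and descends to the circle. Subtracting a constant removes the mean. -/
theorem exists_primitive {g : Circle → ℂ} (hg : Continuous g) (h0 : circleCoeff g (-1) = 0) :
    ∃ f, IsC1 f ∧ circleDeriv f = g ∧ circleCoeff f 0 = 0 := by
  set G : ℝ → ℂ := fun η => Complex.I * (Circle.exp η : ℂ) * g (Circle.exp η) with hG
  have hGc : Continuous G := by
    have := hg.comp Circle.exp.continuous
    have h2 : Continuous fun η : ℝ => (Circle.exp η : ℂ) := by fun_prop
    exact (continuous_const.mul h2).mul this
  set H : ℝ → ℂ := fun η => ∫ θ in (0:ℝ)..η, G θ with hH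
  have hHd : ∀ η, HasDerivAt H (G η) η := fun η =>
    intervalIntegral.integral_hasDerivAt_right (hGc.intervalIntegrable _ _)
      (hGc.stronglyMeasurableAtFilter _ _) hGc.continuousAt
  have hGp : Function.Periodic G (2 * Real.pi) := fun η => by
    simp only [hG, Circle.exp_add, Circle.exp_two_pi, mul_one]
  have hzero : ∫ θ in (0:ℝ)..0 + 2 * Real.pi, G θ = 0 := by
    have h1 := h0
    rw [circleCoeff_eq, arc_integral _ 0, mul_eq_zero] at h1
    have h2 := h1.resolve_left (by
      have := Real.pi_pos
      exact_mod_cast (by positivity : (2 * Real.pi)⁻¹ ≠ 0))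
    have e : G = fun η => Complex.I * (g (Circle.exp η) * (Circle.exp η : ℂ) ^ (- -1 : ℤ)) := by
      funext η
      simp only [hG, neg_neg, zpow_one]
      ring
    rw [e, intervalIntegral.integral_const_mul, h2, mul_zero]
  have hHp : Function.Periodic H (2 * Real.pi) := fun η => by
    have h1 := intervalIntegral.integral_add_adjacent_intervals (a := 0) (b := η)
      (c := η + 2 * Real.pi) (hGc.intervalIntegrable _ _) (hGc.intervalIntegrable (μ := volume) _ _)
    rw [hGp.intervalIntegral_add_eq η 0, hzero, add_zero] at h1
    exact h1.symm
  set f₀ : Circle → ℂ := fun w => H (Complex.arg (w : ℂ)) with hf₀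
  have hf₀e : ∀ η, f₀ (Circle.exp η) = H η := by
    intro η
    have : Circle.exp (Complex.arg (Circle.exp η : ℂ)) = Circle.exp η := Circle.exp_arg _
    obtain ⟨m, hm⟩ := Circle.exp_eq_exp.mp this
    simp only [hf₀]
    rw [hm]
    exact (hHp.int_mul m) η
  have hf₀c : Continuous f₀ := by
    -- The principal argument jumps, so continuity of `f₀` is checked after composition with the
    -- quotient map η ↦ e^{iη}.
    have hq : Topology.IsQuotientMap Circle.exp :=
      isLocalHomeomorph_circleExp.isOpenMap.isQuotientMap Circle.exp.continuous
        (fun w => ⟨_, Circle.exp_arg w⟩)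
    rw [hq.continuous_iff]
    have : f₀ ∘ Circle.exp = H := funext hf₀e
    rw [this]
    exact continuous_iff_continuousAt.mpr fun η => (hHd η).continuousAt
  set c := circleCoeff f₀ 0 with hc
  have hd : ∀ η : ℝ, HasDerivAt (fun η : ℝ => f₀ (Circle.exp η) - c * 1)
      (Complex.I * (Circle.exp η : ℂ) * g (Circle.exp η)) η := fun η => by
    simp only [hf₀e]
    exact (hHd η).sub_const _
  refine ⟨fun w => f₀ w - c * 1, isC1_of_hasDerivAt (hf₀c.sub continuous_const) hg hd,
    circleDeriv_eq hd, ?_⟩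
  rw [circleCoeff_sub hf₀c continuous_const, circleCoeff_const_mul, circleCoeff_one, if_pos rfl,
    mul_one, ← hc, sub_self]

/-- The derivative of the preimage of y is 2i C(y). It has only negative modes, and its mode -1
vanishes because y has no first mode, so a primitive exists and has the modes required in X. -/
theorem linOp_surjective {β : ℝ≥0} (hβ₀ : 0 < β) (hβ₁ : β < 1) :
    Function.Surjective (linOp hβ₀ hβ₁ (β := β)) := by
  intro y
  set Y : CHol β := yHatIncl y with hY
  have hyc : Continuous fun w => (y w : ℂ) := Complex.continuous_ofReal.comp y.2.1
  have hYcoe : Y.1 = fun w => (y w : ℂ) := rfl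
  set g : CHol β := Hol.const _ (2 * Complex.I) * cauchyHol hβ₀ hβ₁ Y with hg
  have hgc : Continuous g.1 := continuous_chol hβ₀ g
  have hconj : ∀ n, star (circleCoeff (fun w => (y w : ℂ)) (-n))
      = circleCoeff (fun w => (y w : ℂ)) n := by
    intro n
    have := circleCoeff_star (fun w => (y w : ℂ)) n
    rw [← this]
    congr 1
    funext w
    exact Complex.conj_ofReal _
  have hcoef : ∀ n, circleCoeff g.1 n
      = if n < 0 then -(2 * Complex.I * circleCoeff (fun w => (y w : ℂ)) n) else 0 := by
    intro n
    have h1 : circleCoeff g.1 n = 2 * Complex.I * circleCoeff (cauchyFun Y) n :=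
      circleCoeff_const_mul _ _ _
    rw [h1, circleCoeff_cauchyFun hβ₀ hβ₁, hYcoe]
    split_ifs <;> ring
  have hneg1 : circleCoeff g.1 (-1) = 0 := by
    rw [hcoef, if_pos (by norm_num), ← hconj, neg_neg, y.2.2.2.2]
    simp
  obtain ⟨f, hf, hfd, hf0⟩ := exists_primitive hgc hneg1
  have hfc : ∀ n : ℤ, n * circleCoeff f n = circleCoeff g.1 (n - 1) := by
    intro n
    have := circleCoeff_circleDeriv hf (n - 1)
    rw [hfd, sub_add_cancel] at this
    rw [this]
    push_cast
    ring
  have hmem : f ∈ xSubmodule β := by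
    refine ⟨hf, by rw [hfd]; exact memHolder_chol g, fun n hn => ?_, fun n => ?_⟩
    · rcases eq_or_lt_of_le hn with rfl | hn
      · exact hf0
      · have h1 := hfc n
        rw [hcoef, if_neg (by omega), mul_eq_zero] at h1
        exact h1.resolve_left (by exact_mod_cast hn.ne')
    · rcases eq_or_ne n 0 with rfl | hn
      · rw [hf0, Complex.zero_im]
      · have h1 := congrArg Complex.im (hfc n)
        have h2 : (circleCoeff g.1 (n - 1)).im = 0 := by
          rw [hcoef]
          split_ifs
          · simp [y.2.2.2.1 (n - 1)]
          · simp
        rw [h2, ← Complex.ofReal_intCast, Complex.im_ofReal_mul, mul_eq_zero] at h1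
        exact h1.resolve_left (by exact_mod_cast hn)
  refine ⟨XSpace.of f hmem, Subtype.ext (funext fun w => ?_)⟩
  rw [linOp_apply]
  change -(circleDeriv f w).im = y w
  rw [hfd]
  have h3 : (fun w => ((g w).im : ℂ)) = fun w => -(y w : ℂ) := by
    refine ext_of_circleCoeff (Complex.continuous_ofReal.comp (Complex.continuous_im.comp hgc))
      hyc.neg fun n => ?_
    rw [circleCoeff_im hgc, circleCoeff_neg, hcoef, hcoef]
    rcases lt_trichotomy n 0 with hn | hn | hn
    · rw [if_pos hn, if_neg (by omega), star_zero, sub_zero]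
      linear_combination (circleCoeff (fun w => (y w : ℂ)) n) * Complex.I_mul_I
    · subst hn
      have h4 : circleCoeff (fun w => (y w : ℂ)) 0 = 0 := by
        have h5 := hconj 0
        rw [neg_zero] at h5
        apply Complex.ext
        · exact y.2.2.2.1 0
        · have := congrArg Complex.im h5
          simp at this
          simp
          linarith
      simp [h4]
    · rw [if_neg (by omega), if_pos (by omega), star_neg, star_mul', star_mul', hconj]
      have : star Complex.I = -Complex.I := Complex.conj_I
      rw [this]
      simp only [star_ofNat]
      linear_combination (circleCoeff (fun w => (y w : ℂ)) n) * Complex.I_mul_I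
  have h4 : (((g w).im : ℝ) : ℂ) = -(y w : ℂ) := congrFun h3 w
  have h5 : (g w).im = -y w := by exact_mod_cast h4
  rw [h5, neg_neg]

/-- A bound for the inverse of the linearized operator. -/
def invConst (β : ℝ≥0) : ℝ :=
  ‖Hol.const (holderWeight β) (-2 * Complex.I)‖ * (1 / β + max (privalovConst β) 0)

theorem invConst_nonneg (β : ℝ≥0) : 0 ≤ invConst β := by
  unfold invConst
  positivity

theorem norm_le_linOp {β : ℝ≥0} (hβ₀ : 0 < β) (hβ₁ : β < 1) (h : XSpace β) :
    ‖h‖ ≤ 5 * invConst β * ‖linOp hβ₀ hβ₁ h‖ := by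
  have h1 := norm_le_norm_imHol hβ₀ hβ₁ (derivHol (xIncl β h)) fun n hn =>
    circleCoeff_derivHol_of_nonneg h (by omega)
  have e : imHol β (derivHol (xIncl β h)) = -yHatIncl (linOp hβ₀ hβ₁ h) := by
    ext w
    rw [imHol_apply, Hol.neg_apply, yHatIncl_apply, linOp_apply]
    simp
  have h2 : ‖imHol β (derivHol (xIncl β h))‖ ≤ ‖linOp hβ₀ hβ₁ h‖ := by
    rw [e, norm_neg]
    exact norm_yHatIncl_le _
  have h3 := supNorm_le_of_circleCoeff_zero (xIncl β h) (h.2.2.2.1 0 le_rfl)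
  have h4 : Real.pi * ‖derivHol (xIncl β h)‖ ≤ 4 * ‖derivHol (xIncl β h)‖ := by
    gcongr; exact Real.pi_le_four
  have h5 := norm_xSpace_le h
  rw [xIncl_coe] at h3
  have h6 : ‖derivHol (xIncl β h)‖ ≤ invConst β * ‖linOp hβ₀ hβ₁ h‖ :=
    h1.trans (mul_le_mul_of_nonneg_left h2 (invConst_nonneg β))
  linarith

theorem linOp_bijective {β : ℝ≥0} (hβ₀ : 0 < β) (hβ₁ : β < 1) :
    Function.Bijective (linOp hβ₀ hβ₁ (β := β)).toLinearMap :=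
  ⟨(injective_iff_map_eq_zero (linOp hβ₀ hβ₁ (β := β)).toLinearMap).mpr fun h hh => by
      have h1 := norm_le_linOp hβ₀ hβ₁ h
      have h2 : linOp hβ₀ hβ₁ h = 0 := hh
      rw [h2, norm_zero, mul_zero] at h1
      exact norm_le_zero_iff.mp h1, linOp_surjective hβ₀ hβ₁⟩

/-- The isomorphism `h ↦ -Im h'` of `X` onto `Ŷ`. -/
def linEquiv {β : ℝ≥0} (hβ₀ : 0 < β) (hβ₁ : β < 1) : XSpace β ≃L[ℝ] YHat β :=
  (LinearEquiv.ofBijective _ (linOp_bijective hβ₀ hβ₁)).toContinuousLinearEquivOfBounds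
    ‖linOp hβ₀ hβ₁ (β := β)‖ (5 * invConst β) (fun h => (linOp hβ₀ hβ₁).le_opNorm h) (fun y => by
      obtain ⟨h, rfl⟩ := linOp_surjective hβ₀ hβ₁ y
      have e : (LinearEquiv.ofBijective _ (linOp_bijective hβ₀ hβ₁)).symm
          (linOp hβ₀ hβ₁ h) = h :=
        LinearEquiv.ofBijective_symm_apply_apply _ (h := linOp_bijective hβ₀ hβ₁) h
      rw [e]
      exact norm_le_linOp hβ₀ hβ₁ h)

/-- The inclusion into the complete space C^β has a continuous left inverse: multiply by i, then
project. -/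
theorem completeSpace_yHat {β : ℝ≥0} (hβ₀ : 0 < β) (hβ₁ : β < 1) : CompleteSpace (YHat β) := by
  refine Metric.complete_of_cauchySeq_tendsto fun u hu => ?_
  have hincl : ∀ y z : YHat β, yHatIncl y - yHatIncl z = yHatIncl (y - z) := fun y z => by
    ext w
    exact (Complex.ofReal_sub _ _).symm
  have h1 : CauchySeq fun n => yHatIncl (u n) := by
    rw [Metric.cauchySeq_iff] at hu ⊢
    intro ε hε
    obtain ⟨N, hN⟩ := hu ε hε
    refine ⟨N, fun m hm n hn => ?_⟩
    have := hN m hm n hn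
    rw [dist_eq_norm] at this ⊢
    rw [hincl]
    exact (norm_yHatIncl_le _).trans_lt this
  -- the real functions `y` are recovered from the projection of `i y`
  obtain ⟨l, hl⟩ := cauchySeq_tendsto_of_complete h1
  have hrec : ∀ y : YHat β, yHatProj hβ₀ hβ₁ (Hol.const _ Complex.I * yHatIncl y) = y := by
    intro y
    have e : (fun w => ((Hol.const (holderWeight β) Complex.I * yHatIncl y) w).im) = y.1 := by
      funext w
      simp [Hol.mul_apply]
    apply Subtype.ext
    funext w
    rw [yHatProj_apply_of_mem hβ₀ hβ₁ (by rw [e]; exact y.2)]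
    exact congrFun e w
  refine ⟨yHatProj hβ₀ hβ₁ (Hol.const _ Complex.I * l), ?_⟩
  have h2 := ((yHatProj hβ₀ hβ₁).continuous.tendsto _).comp
    (hl.const_mul (Hol.const (holderWeight β) Complex.I))
  refine h2.congr fun n => hrec (u n)

theorem completeSpace_xSpace {β : ℝ≥0} (hβ₀ : 0 < β) (hβ₁ : β < 1) :
    CompleteSpace (XSpace β) := by
  have := completeSpace_yHat hβ₀ hβ₁
  exact (linEquiv hβ₀ hβ₁).isUniformEmbedding.isUniformInducing.completeSpace_congr
    (linEquiv hβ₀ hβ₁).surjective |>.mpr this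

/-! ### The functional on the space of data -/

theorem coe_mem_holAlg {β : ℝ≥0} (hβ₀ : 0 < β) (hβ₁ : β < 1) :
    (fun w : Circle => (w : ℂ)) ∈ holAlg (holderWeight β) :=
  mem_holAlg_of_le hβ₀ (A := 1) (B := 2) zero_le_two (fun w => (Circle.norm_coe w).le)
    fun w w' => by rw [norm_coe_sub]; exact dist_le_two_mul_rpow hβ₀ hβ₁ w w'

/-- The function `w`. -/
def coeHol {β : ℝ≥0} (hβ₀ : 0 < β) (hβ₁ : β < 1) : CHol β := Hol.of _ (coe_mem_holAlg hβ₀ hβ₁)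

@[simp] theorem coeHol_apply {β : ℝ≥0} (hβ₀ : 0 < β) (hβ₁ : β < 1) (w : Circle) :
    coeHol hβ₀ hβ₁ w = (w : ℂ) := rfl

/-- The kernel `conj (τ - w) / (τ - w)`. -/
def conjQuotKer : Ker :=
  Hol.of (fun p => diffQuot (fun w : Circle => star (w : ℂ)) p.2 p.1) <| mem_ker (M := 2 * 1)
    (by
      have h : Measurable fun w : Circle => star (w : ℂ) := (by fun_prop : Continuous _).measurable
      exact ((h.comp measurable_fst).sub (h.comp measurable_snd)).div (by fun_prop))
    (by norm_num)
    (fun p => norm_diffQuot_le_of_lipschitz zero_le_one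
      (fun τ w => by rw [← star_sub, norm_star, norm_coe_sub, one_mul]) _ _)
    (diffQuot_kernel_bound zero_le_one
      (fun τ w => by rw [← star_sub, norm_star, norm_coe_sub, one_mul]))

@[simp] theorem conjQuotKer_apply (p : Circle × Circle) :
    conjQuotKer p = star ((p.1 : ℂ) - p.2) / ((p.1 : ℂ) - p.2) := by
  rw [star_sub]
  rfl

/-- The kernel `conj τ`. -/
def conjFstKer : Ker :=
  Hol.of (fun p => star (p.1 : ℂ)) <| mem_ker (M := 0) (by
      have h : Continuous fun w : Circle => star (w : ℂ) := by fun_prop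
      exact (h.comp continuous_fst).measurable)
    le_rfl (A := 1) (fun p => by rw [norm_star, Circle.norm_coe]) (by simp)

/-- The kernel `τ + w`. -/
def sumKer : Ker :=
  Hol.of (fun p => (p.1 : ℂ) + p.2) <| mem_ker (M := 2 * 1) (by fun_prop) (by norm_num) (A := 2)
    (fun p => (norm_add_le _ _).trans (by rw [Circle.norm_coe, Circle.norm_coe]; norm_num))
    (fun τ w w' => by
      rw [add_sub_add_left_eq_sub]
      exact snd_kernel_bound zero_le_one (fun τ w => by rw [norm_coe_sub, one_mul]) τ w w')

section

variable {β : ℝ≥0} (hβ₀ : 0 < β) (hβ₁ : β < 1)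

/-- The function `w (1 + ε f')`, as a function of `ε f'`. -/
def tangentHat (x : CHol β) : CHol β := coeHol hβ₀ hβ₁ * (1 + x)

/-- The kernel in the self-interaction term; `x` stands for `ε q`. -/
def selfKer (x : Ker) (v : Data β) : Ker :=
  conjQuotKer * ((1 + Hol.conj x) * Ring.inverse (1 + x)) * fstKer β v.1
    + conjQuotKer * (Hol.conj v.2.1 - v.2.1) * Ring.inverse (1 + x)

/-- The term `F₂` on the space of data. -/
def F₂Hat (ε : ℝ) (v : Data β) : CHol β :=
  meanOp β hβ₀ hβ₁ (selfKer (ε • v.2.1) v) * tangentHat hβ₀ hβ₁ (ε • v.1)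

/-- The denominator in the interaction term, for the problem rotated by `s`; `x` stands for
`ε v`. -/
def pairDen (d ε : ℝ) (s : ℂ) (x : Data β) : Ker :=
  Hol.const _ s * (ε • (sumKer + (x.2.2.1 + x.2.2.2))) - Hol.const _ (2 * d : ℂ)

/-- The kernel in the interaction term. -/
def pairKer (d ε : ℝ) (s : ℂ) (x : Data β) : Ker :=
  Hol.const _ s * ((conjFstKer + Hol.conj x.2.2.1) * Ring.inverse (pairDen d ε s x)
    * fstKer β (1 + x.1))

/-- The term `F₃` on the space of data, for the problem rotated by `s`. -/
def F₃Hat (d ε : ℝ) (s : ℂ) (v : Data β) : CHol β :=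
  meanOp β hβ₀ hβ₁ (pairKer d ε s (ε • v)) * tangentHat hβ₀ hβ₁ (ε • v.1)

/-- The real part of the difference of the coefficients of `w` and `w⁻¹`. -/
def firstRe : CHol β →L[ℝ] ℝ :=
  LinearMap.mkContinuous
    { toFun := fun g => (circleCoeff g 1 - circleCoeff g (-1)).re
      map_add' := fun f g => by
        have := fun n => circleCoeff_add (continuous_chol hβ₀ f) (continuous_chol hβ₀ g) n
        have e : (f + g).1 = f.1 + g.1 := rfl
        rw [e, this, this]
        simp only [Complex.sub_re, Complex.add_re]
        ring
      map_smul' := fun c g => by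
        have e : (c • g).1 = c • g.1 := rfl
        rw [e, circleCoeff_smul, circleCoeff_smul, ← mul_sub, Complex.re_ofReal_mul]
        rfl } 2 fun g => by
    refine (Complex.abs_re_le_norm _).trans ((norm_sub_le _ _).trans ?_)
    linarith [norm_circleCoeff_le g.norm_apply_le 1, norm_circleCoeff_le g.norm_apply_le (-1)]

theorem firstRe_apply (g : CHol β) :
    firstRe hβ₀ g = (circleCoeff g 1 - circleCoeff g (-1)).re := rfl

/-- The functional `Re` of the coefficient of `w⁻²`. -/
def secondRe : CHol β →L[ℝ] ℝ :=
  LinearMap.mkContinuous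
    { toFun := fun g => (circleCoeff g (-2)).re
      map_add' := fun f g => by
        have := circleCoeff_add (continuous_chol hβ₀ f) (continuous_chol hβ₀ g) (-2)
        have e : (f + g).1 = f.1 + g.1 := rfl
        rw [e, this, Complex.add_re]
      map_smul' := fun c g => by
        have e : (c • g).1 = c • g.1 := rfl
        rw [e, circleCoeff_smul, Complex.re_ofReal_mul]
        rfl } 1 fun g => by
    rw [one_mul]
    exact (Complex.abs_re_le_norm _).trans (norm_circleCoeff_le g.norm_apply_le _)

theorem secondRe_apply (g : CHol β) : secondRe hβ₀ g = (circleCoeff g (-2)).re := rfl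

/-- The speed on the space of data. -/
def speedHat (d ε : ℝ) (v : Data β) : ℝ :=
  -(firstRe hβ₀ (F₂Hat hβ₀ hβ₁ ε v + F₃Hat hβ₀ hβ₁ d ε 1 v)) / (2 * (1 - ε * secondRe hβ₀ v.1))

/-- The functional `F` on the space of data, for the problem rotated by `s`. -/
def FHat (d U ε : ℝ) (s : ℂ) (v : Data β) : CHol β :=
  (2 * U) • (Hol.const _ s * tangentHat hβ₀ hβ₁ (ε • v.1)) - v.1
    + F₂Hat hβ₀ hβ₁ ε v + F₃Hat hβ₀ hβ₁ d ε s v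

end

/-! #### Pointwise formulas -/

/-- Bounds that make all the denominators of the functional nonzero. -/
def Small {β : ℝ≥0} (f : c1Hol β) : Prop :=
  (∀ w, ‖f.1 w‖ ≤ 1) ∧ ∀ w, ‖circleDeriv f.1 w‖ ≤ 1

theorem small_of_norm_lt {β : ℝ≥0} {f : XSpace β} (hf : ‖f‖ < 1) : Small (xIncl β f) := by
  have h := supNorm_add_norm_derivHol_le f
  have h1 := norm_nonneg (derivHol (xIncl β f))
  have h2 := supNorm_nonneg f.1
  refine ⟨fun w => (norm_le_supNorm f.2.1.1 w).trans (by linarith), fun w => ?_⟩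
  exact ((derivHol (xIncl β f)).norm_apply_le w).trans (by linarith)

theorem Small.norm_sub_le {β : ℝ≥0} {f : c1Hol β} (hf : Small f) (τ w : Circle) :
    ‖f.1 τ - f.1 w‖ ≤ Real.pi / 2 * dist τ w := by
  simpa using f.2.1.norm_sub_le hf.2 τ w

theorem Small.norm_diffKer_le {β : ℝ≥0} {f : c1Hol β} (hf : Small f) (p : Circle × Circle) :
    ‖diffKer f p‖ ≤ Real.pi / 2 := by
  have := Real.pi_pos
  exact norm_diffQuot_le_of_lipschitz (by positivity) hf.norm_sub_le p.2 p.1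

/-- The difference quotient is at most π/2, so |ε| ≤ 1/2 keeps ε times it below π/4 < 1. -/
theorem Small.isUnit_one_add {β : ℝ≥0} {f : c1Hol β} (hf : Small f) {ε : ℝ} (hε : |ε| ≤ 1 / 2) :
    IsUnit (1 + ε • diffKer f) := by
  refine Hol.isUnit_of_le (c := 1 - Real.pi / 4) (by linarith [Real.pi_lt_d2]) fun p => ?_
  have h1 : ‖(ε : ℂ) * diffKer f p‖ ≤ 1 / 2 * (Real.pi / 2) := by
    rw [norm_mul, Complex.norm_real, Real.norm_eq_abs]
    exact mul_le_mul hε (hf.norm_diffKer_le p) (norm_nonneg _) (by norm_num)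
  have h2 := norm_sub_le_norm_add (1 : ℂ) ((ε : ℂ) * diffKer f p)
  rw [norm_one] at h2
  rw [Hol.add_apply, Hol.one_apply, Hol.smul_apply]
  linarith

/-- The variable part of the denominator is at most (1/2)·3, while 2d > 4. -/
theorem Small.isUnit_pairDen {β : ℝ≥0} {f : c1Hol β} (hf : Small f) {d ε : ℝ} (hd : 2 < d)
    (hε : |ε| ≤ 1 / 2) {s : ℂ} (hs : ‖s‖ = 1) :
    IsUnit (pairDen d ε s (ε • dataLin β f)) := by
  refine Hol.isUnit_of_le (c := 2) two_pos fun p => ?_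
  have e : pairDen d ε s (ε • dataLin β f) p = s * (ε * (((p.1 : ℂ) + p.2)
      + (ε * f.1 p.1 + ε * f.1 p.2))) - 2 * d := rfl
  have hz : ∀ z : Circle, ‖(ε : ℂ) * f.1 z‖ ≤ 1 / 2 := fun z => by
    rw [norm_mul, Complex.norm_real, Real.norm_eq_abs, ← mul_one (1 / 2 : ℝ)]
    exact mul_le_mul hε (hf.1 z) (norm_nonneg _) (by norm_num)
  have h1 : ‖((p.1 : ℂ) + p.2) + (ε * f.1 p.1 + ε * f.1 p.2)‖ ≤ 3 := by
    refine (norm_add_le _ _).trans ?_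
    have h2 := norm_add_le (p.1 : ℂ) p.2
    have h3 := norm_add_le ((ε : ℂ) * f.1 p.1) (ε * f.1 p.2)
    rw [Circle.norm_coe, Circle.norm_coe] at h2
    linarith [hz p.1, hz p.2]
  have h4 : ‖s * (ε * (((p.1 : ℂ) + p.2) + (ε * f.1 p.1 + ε * f.1 p.2)))‖ ≤ 1 / 2 * 3 := by
    rw [norm_mul, hs, one_mul, norm_mul, Complex.norm_real, Real.norm_eq_abs]
    exact mul_le_mul hε h1 (norm_nonneg _) (by norm_num)
  rw [e, norm_sub_rev]
  have h5 := norm_sub_norm_le (2 * d : ℂ)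
    (s * (ε * (((p.1 : ℂ) + p.2) + (ε * f.1 p.1 + ε * f.1 p.2))))
  have h6 : ‖(2 * d : ℂ)‖ = 2 * d := by
    rw [norm_mul, Complex.norm_ofNat, Complex.norm_real, Real.norm_of_nonneg (by linarith)]
  linarith

/-- The kernel of the self-interaction term. -/
def selfIntegrand (ε : ℝ) (f : Circle → ℂ) (w τ : Circle) : ℂ :=
  (star ((τ : ℂ) - w) + ε * star (f τ - f w)) / (((τ : ℂ) - w) + ε * (f τ - f w))
    * circleDeriv f τ
  + (((τ : ℂ) - w) * star (f τ - f w) - star ((τ : ℂ) - w) * (f τ - f w))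
    / (((τ : ℂ) - w) * (((τ : ℂ) - w) + ε * (f τ - f w)))

/-- Factoring τ - w out of each denominator replaces A + εB by 1 + ε(B/A), which is invertible in
the algebra of kernels although A + εB is not. -/
theorem Small.selfKer_apply {β : ℝ≥0} {f : c1Hol β} (hf : Small f) {ε : ℝ} (hε : |ε| ≤ 1 / 2)
    (τ w : Circle) :
    selfKer (ε • (dataLin β f).2.1) (dataLin β f) (τ, w) = selfIntegrand ε f.1 w τ := by
  have hu := hf.isUnit_one_add hε
  have hne : (1 + ε • diffKer f) (τ, w) ≠ 0 := by
    have := congrArg (fun k : Ker => k (τ, w)) (Ring.mul_inverse_cancel _ hu)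
    simp only [Hol.mul_apply, Hol.one_apply] at this
    exact left_ne_zero_of_mul_eq_one this
  have e : selfKer (ε • (dataLin β f).2.1) (dataLin β f) (τ, w)
      = conjQuotKer (τ, w) * ((1 + star ((ε • diffKer f) (τ, w))) *
          Ring.inverse (1 + ε • diffKer f) (τ, w)) * circleDeriv f.1 τ
        + conjQuotKer (τ, w) * (star (diffKer f (τ, w)) - diffKer f (τ, w)) *
          Ring.inverse (1 + ε • diffKer f) (τ, w) := rfl
  rw [e, Hol.inverse_apply hu, conjQuotKer_apply]
  simp only [Hol.add_apply, Hol.one_apply, Hol.smul_apply, diffKer_apply] at hne ⊢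
  rw [selfIntegrand]
  -- On the diagonal both sides are 0 by the convention x / 0 = 0.
  rcases eq_or_ne τ w with rfl | h
  · simp
  have h0 : (τ : ℂ) - w ≠ 0 := sub_ne_zero.mpr fun e => h (Circle.ext e)
  have h0' : star ((τ : ℂ) - w) ≠ 0 := star_ne_zero.mpr h0
  have h1 : ((τ : ℂ) - w) + ε * (f.1 τ - f.1 w) ≠ 0 := by
    have : ((τ : ℂ) - w) + ε * (f.1 τ - f.1 w)
        = ((τ : ℂ) - w) * (1 + ε * ((f.1 τ - f.1 w) / ((τ : ℂ) - w))) := by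
      field_simp
    rw [this]
    exact mul_ne_zero h0 hne
  have hε' : star (ε : ℂ) = ε := Complex.conj_ofReal ε
  rw [star_mul', star_div₀, hε']
  set A := (τ : ℂ) - w
  set B := f.1 τ - f.1 w
  have h2 : 1 + (ε : ℂ) * (B / A) = (A + ε * B) / A := by field_simp
  rw [h2]
  field_simp

theorem Small.integrable_selfIntegrand {β : ℝ≥0} {f : c1Hol β} (hf : Small f) {ε : ℝ}
    (hε : |ε| ≤ 1 / 2) (w : Circle) : Integrable (selfIntegrand ε f.1 w) arc := by
  have h := ker_slice_integrable (selfKer (ε • (dataLin β f).2.1) (dataLin β f)) w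
  simp only [hf.selfKer_apply hε] at h
  exact h

theorem Small.F₂Hat_apply {β : ℝ≥0} (hβ₀ : 0 < β) (hβ₁ : β < 1) {f : c1Hol β} (hf : Small f)
    {ε : ℝ} (hε : |ε| ≤ 1 / 2) (w : Circle) :
    F₂Hat hβ₀ hβ₁ ε (dataLin β f) w
      = circleMean (selfIntegrand ε f.1 w) * (w * (1 + ε * circleDeriv f.1 w)) := by
  have e : F₂Hat hβ₀ hβ₁ ε (dataLin β f) w
      = circleMean (fun τ => selfKer (ε • (dataLin β f).2.1) (dataLin β f) (τ, w))
        * (w * (1 + ε * circleDeriv f.1 w)) := rfl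
  rw [e]
  simp only [hf.selfKer_apply hε]

/-- The integrand of the interaction term, for the problem rotated by `s`. -/
def pairIntegrand (d ε : ℝ) (s : ℂ) (f : Circle → ℂ) (w τ : Circle) : ℂ :=
  s * ((star (τ : ℂ) + ε * star (f τ))
    / (s * (ε * ((τ : ℂ) + w) + ε ^ 2 * (f τ + f w)) - 2 * d) * (1 + ε * circleDeriv f τ))

theorem Small.F₃Hat_apply {β : ℝ≥0} (hβ₀ : 0 < β) (hβ₁ : β < 1) {f : c1Hol β} (hf : Small f)
    {d ε : ℝ} (hd : 2 < d) (hε : |ε| ≤ 1 / 2) {s : ℂ} (hs : ‖s‖ = 1) (w : Circle) :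
    F₃Hat hβ₀ hβ₁ d ε s (dataLin β f) w
      = circleMean (pairIntegrand d ε s f.1 w) * (w * (1 + ε * circleDeriv f.1 w)) := by
  have hu := hf.isUnit_pairDen hd hε hs
  have e : F₃Hat hβ₀ hβ₁ d ε s (dataLin β f) w
      = circleMean (fun τ => s * ((star (τ : ℂ) + star ((ε : ℂ) * f.1 τ)) *
          Ring.inverse (pairDen d ε s (ε • dataLin β f)) (τ, w) * (1 + ε * circleDeriv f.1 τ)))
        * (w * (1 + ε * circleDeriv f.1 w)) := rfl
  rw [e]
  congr 2
  funext τ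
  rw [Hol.inverse_apply hu, pairIntegrand, star_mul']
  have e2 : pairDen d ε s (ε • dataLin β f) (τ, w) = s * (ε * (((τ : ℂ) + w)
      + (ε * f.1 τ + ε * f.1 w))) - 2 * d := rfl
  have hε' : star (ε : ℂ) = ε := Complex.conj_ofReal ε
  rw [e2, hε', div_eq_mul_inv]
  congr 5
  ring

/-! ### Conjugation symmetry and real Fourier coefficients -/

theorem circleMean_star_inv (g : Circle → ℂ) :
    circleMean (fun τ => star (g τ⁻¹)) = star (circleMean g) := by
  rw [circleMean_eq_circleCoeff, circleMean_eq_circleCoeff,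
    circleCoeff_star (fun τ => g τ⁻¹), circleCoeff_inv, neg_neg]

theorem circleCoeff_star_inv (g : Circle → ℂ) (n : ℤ) :
    circleCoeff (fun τ => star (g τ⁻¹)) n = star (circleCoeff g n) := by
  rw [circleCoeff_star (fun τ => g τ⁻¹), circleCoeff_inv, neg_neg]

/-- Real coefficients amount to symmetry under complex conjugation. The functional respects this
symmetry, and so its values have real coefficients as well. -/
theorem apply_inv_of_real {g : Circle → ℂ} (hg : Continuous g)
    (h : ∀ n, (circleCoeff g n).im = 0) (w : Circle) : g w⁻¹ = star (g w) := by
  have e : (fun w => star (g w⁻¹)) = g := by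
    refine ext_of_circleCoeff (continuous_star.comp (hg.comp continuous_inv)) hg fun n => ?_
    rw [circleCoeff_star_inv]
    exact Complex.conj_eq_iff_im.mpr (h n)
  have := congrFun e w
  rw [← this, star_star]

theorem xSpace_inv {β : ℝ≥0} (f : XSpace β) (w : Circle) : f w⁻¹ = star (f w) :=
  apply_inv_of_real f.2.1.1 f.2.2.2.2 w

theorem xSpace_deriv_inv {β : ℝ≥0} (f : XSpace β) (w : Circle) :
    circleDeriv f.1 w⁻¹ = star (circleDeriv f.1 w) :=
  apply_inv_of_real f.2.1.2.2 (circleCoeff_derivHol_im f) w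

/-- `F₂` is written with two separate means. Their integrands must be integrable one by one before
the means can be merged into that of `selfIntegrand`. -/
theorem Small.crossKer_apply {β : ℝ≥0} {f : c1Hol β} (hf : Small f) {ε : ℝ} (hε : |ε| ≤ 1 / 2)
    (τ w : Circle) :
    (conjQuotKer * (Hol.conj (diffKer f) - diffKer f) * Ring.inverse (1 + ε • diffKer f)) (τ, w)
      = (((τ : ℂ) - w) * star (f.1 τ - f.1 w) - star ((τ : ℂ) - w) * (f.1 τ - f.1 w))
        / (((τ : ℂ) - w) * (((τ : ℂ) - w) + ε * (f.1 τ - f.1 w))) := by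
  have h := hf.selfKer_apply hε τ w
  have hu := hf.isUnit_one_add hε
  have hne : (1 + ε • diffKer f) (τ, w) ≠ 0 := by
    have := congrArg (fun k : Ker => k (τ, w)) (Ring.mul_inverse_cancel _ hu)
    simp only [Hol.mul_apply, Hol.one_apply] at this
    exact left_ne_zero_of_mul_eq_one this
  have e : (conjQuotKer * (Hol.conj (diffKer f) - diffKer f) *
      Ring.inverse (1 + ε • diffKer f)) (τ, w)
      = conjQuotKer (τ, w) * (star (diffKer f (τ, w)) - diffKer f (τ, w)) *
          Ring.inverse (1 + ε • diffKer f) (τ, w) := rfl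
  rw [e, Hol.inverse_apply hu, conjQuotKer_apply]
  simp only [Hol.add_apply, Hol.one_apply, Hol.smul_apply, diffKer_apply] at hne ⊢
  rcases eq_or_ne τ w with rfl | hτ
  · simp
  have h0 : (τ : ℂ) - w ≠ 0 := sub_ne_zero.mpr fun e => hτ (Circle.ext e)
  have h0' : star ((τ : ℂ) - w) ≠ 0 := star_ne_zero.mpr h0
  have h1 : ((τ : ℂ) - w) + ε * (f.1 τ - f.1 w) ≠ 0 := by
    have : ((τ : ℂ) - w) + ε * (f.1 τ - f.1 w)
        = ((τ : ℂ) - w) * (1 + ε * ((f.1 τ - f.1 w) / ((τ : ℂ) - w))) := by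
      field_simp
    rw [this]
    exact mul_ne_zero h0 hne
  rw [star_div₀]
  set A := (τ : ℂ) - w
  set B := f.1 τ - f.1 w
  have h2 : 1 + (ε : ℂ) * (B / A) = (A + ε * B) / A := by field_simp
  rw [h2]
  field_simp

theorem F₂_eq {β : ℝ≥0} (hβ₀ : 0 < β) (hβ₁ : β < 1) {f : XSpace β} (hf : ‖f‖ < 1) {ε : ℝ}
    (hε : |ε| ≤ 1 / 2) (w : Circle) :
    F₂Hat hβ₀ hβ₁ ε (xData β f) w = F₂ ε f w := by
  have hs := small_of_norm_lt hf
  have h1 := ker_slice_integrable (conjQuotKer * (Hol.conj (diffKer (xIncl β f))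
    - diffKer (xIncl β f)) * Ring.inverse (1 + ε • diffKer (xIncl β f))) w
  simp only [hs.crossKer_apply hε] at h1
  have h2 := (hs.integrable_selfIntegrand hε w).sub h1
  have h3 := circleMean_add h2 h1
  rw [xData_apply, hs.F₂Hat_apply hβ₀ hβ₁ hε, F₂]
  congr 1
  refine Eq.trans (congrArg circleMean (funext fun τ => (sub_add_cancel _ _).symm))
    (h3.trans (congrArg₂ _ (congrArg _ ?_) rfl))
  funext τ
  exact add_sub_cancel_right _ _

theorem F₃_eq {β : ℝ≥0} (hβ₀ : 0 < β) (hβ₁ : β < 1) {f : XSpace β} (hf : ‖f‖ < 1) {d ε : ℝ}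
    (hd : 2 < d) (hε : |ε| ≤ 1 / 2) (w : Circle) :
    F₃Hat hβ₀ hβ₁ d ε 1 (xData β f) w = F₃ d ε f w := by
  rw [xData_apply, (small_of_norm_lt hf).F₃Hat_apply hβ₀ hβ₁ hd hε norm_one, F₃]
  congr 2
  funext τ
  rw [pairIntegrand, one_mul, one_mul, xSpace_inv, star_coe, Circle.coe_inv]
  rfl

theorem F_eq {β : ℝ≥0} (hβ₀ : 0 < β) (hβ₁ : β < 1) {f : XSpace β} (hf : ‖f‖ < 1) {d ε : ℝ}
    (hd : 2 < d) (hε : |ε| ≤ 1 / 2) (U : ℝ) (w : Circle) :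
    FHat hβ₀ hβ₁ d U ε 1 (xData β f) w = F d U ε f w := by
  rw [F, ← F₂_eq hβ₀ hβ₁ hf hε, ← F₃_eq hβ₀ hβ₁ hf hd hε, F₁]
  have e : FHat hβ₀ hβ₁ d U ε 1 (xData β f) w
      = ((2 * U : ℝ) : ℂ) * (1 * (w * (1 + ε * circleDeriv f w))) - circleDeriv f w
        + F₂Hat hβ₀ hβ₁ ε (xData β f) w + F₃Hat hβ₀ hβ₁ d ε 1 (xData β f) w := rfl
  rw [e]
  push_cast
  ring

theorem firstCoeff_eq (g : Circle → ℂ) : firstCoeff g = circleCoeff g 1 - circleCoeff g (-1) := by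
  rw [firstCoeff, circleMean_eq_circleCoeff g]
  congr 1
  rw [circleCoeff]
  congr 1
  funext w
  rw [star_coe]
  norm_num [zpow_neg, zpow_ofNat]

theorem star_selfIntegrand {β : ℝ≥0} (ε : ℝ) (f : XSpace β) (w τ : Circle) :
    star (selfIntegrand ε f w τ⁻¹) = selfIntegrand ε f w⁻¹ τ := by
  have hε' : star (ε : ℂ) = ε := Complex.conj_ofReal ε
  have hc : ∀ z : Circle, ((z⁻¹ : Circle) : ℂ) = star (z : ℂ) := fun z => by
    rw [star_coe, Circle.coe_inv]
  simp only [selfIntegrand, hc, xSpace_inv, xSpace_deriv_inv, star_add, star_sub,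
    star_mul', star_div₀, star_star, hε']

theorem star_pairIntegrand {β : ℝ≥0} (d ε : ℝ) (f : XSpace β) (w τ : Circle) :
    star (pairIntegrand d ε 1 f w τ⁻¹) = pairIntegrand d ε 1 f w⁻¹ τ := by
  have hε' : star (ε : ℂ) = ε := Complex.conj_ofReal ε
  have hd' : star (d : ℂ) = d := Complex.conj_ofReal d
  have hc : ∀ z : Circle, ((z⁻¹ : Circle) : ℂ) = star (z : ℂ) := fun z => by
    rw [star_coe, Circle.coe_inv]
  simp only [pairIntegrand, hc, xSpace_inv, xSpace_deriv_inv, star_add, star_sub,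
    star_mul', star_div₀, star_star, star_pow, star_one, star_ofNat, hε', hd']

theorem F₂Hat_F₃Hat_inv {β : ℝ≥0} (hβ₀ : 0 < β) (hβ₁ : β < 1) {f : XSpace β} (hf : ‖f‖ < 1) {d ε : ℝ}
    (hd : 2 < d) (hε : |ε| ≤ 1 / 2) (w : Circle) :
    F₂Hat hβ₀ hβ₁ ε (xData β f) w⁻¹ = star (F₂Hat hβ₀ hβ₁ ε (xData β f) w) ∧
    F₃Hat hβ₀ hβ₁ d ε 1 (xData β f) w⁻¹ = star (F₃Hat hβ₀ hβ₁ d ε 1 (xData β f) w) := by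
  have hs := small_of_norm_lt hf
  have hε' : star (ε : ℂ) = ε := Complex.conj_ofReal ε
  have hc' : (((w⁻¹ : Circle)) : ℂ) = star (w : ℂ) := by rw [star_coe, Circle.coe_inv]
  have ht : (((w⁻¹ : Circle)) : ℂ) * (1 + ε * circleDeriv (xIncl β f).1 w⁻¹)
      = star ((w : ℂ) * (1 + ε * circleDeriv (xIncl β f).1 w)) := by
    have := xSpace_deriv_inv f w
    change circleDeriv (xIncl β f).1 w⁻¹ = _ at this
    rw [this, hc', star_mul', star_add, star_mul', star_one, hε']
    rfl
  rw [xData_apply, hs.F₂Hat_apply hβ₀ hβ₁ hε, hs.F₂Hat_apply hβ₀ hβ₁ hε,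
    hs.F₃Hat_apply hβ₀ hβ₁ hd hε norm_one, hs.F₃Hat_apply hβ₀ hβ₁ hd hε norm_one, ht]
  refine ⟨?_, ?_⟩
  · refine Eq.trans ?_ (star_mul' _ _).symm
    rw [← circleMean_star_inv]
    congr 2
    funext τ
    exact (star_selfIntegrand ε f w τ).symm
  · refine Eq.trans ?_ (star_mul' _ _).symm
    rw [← circleMean_star_inv]
    congr 2
    funext τ
    exact (star_pairIntegrand d ε f w τ).symm

/-! ### The speed and the reduced functional -/

theorem coe_inv_eq_star (w : Circle) : ((w⁻¹ : Circle) : ℂ) = star (w : ℂ) := by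
  rw [star_coe, Circle.coe_inv]

theorem tangentHat_coeff {β : ℝ≥0} (hβ₀ : 0 < β) (hβ₁ : β < 1) (ε : ℝ) (p : CHol β) (n : ℤ) :
    circleCoeff (tangentHat hβ₀ hβ₁ (ε • p)) n
      = circleCoeff (fun _ => 1) (n - 1) + ε * circleCoeff p (n - 1) := by
  have e : (tangentHat hβ₀ hβ₁ (ε • p)).1
      = fun w : Circle => (w : ℂ) ^ (1 : ℤ) * (1 + (ε • p.1) : Circle → ℂ) w := by
    funext w
    rw [zpow_one]
    rfl
  rw [e, circleCoeff_zpow_mul, circleCoeff_add continuous_one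
    ((continuous_chol hβ₀ p).const_smul ε), circleCoeff_smul]
  rfl

theorem firstRe_tangentHat {β : ℝ≥0} (hβ₀ : 0 < β) (hβ₁ : β < 1) (ε : ℝ) {p : CHol β}
    (hp : circleCoeff p 0 = 0) :
    firstRe hβ₀ (tangentHat hβ₀ hβ₁ (ε • p)) = 1 - ε * secondRe hβ₀ p := by
  rw [firstRe_apply, tangentHat_coeff, tangentHat_coeff, secondRe_apply, circleCoeff_one,
    circleCoeff_one]
  norm_num [hp]

/-- Differentiation sends a w⁻¹ to -a w⁻². The denominator of `speedHat`, written with f', thereby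
agrees with that of `speed`, written with f. -/
theorem secondRe_derivHol {β : ℝ≥0} (hβ₀ : 0 < β) (f : XSpace β) :
    secondRe hβ₀ (xData β f).1 = -(circleMean f).re := by
  have h := circleCoeff_circleDeriv f.2.1 (-2)
  rw [secondRe_apply, circleMean_eq_circleCoeff]
  have e : circleCoeff (xData β f).1 (-2) = circleCoeff (circleDeriv f.1) (-2) := rfl
  rw [e, h]
  norm_num

theorem abs_secondRe_lt {β : ℝ≥0} (hβ₀ : 0 < β) {f : XSpace β} (hf : ‖f‖ < 1) :
    |secondRe hβ₀ (xData β f).1| < 1 := by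
  have h := norm_circleCoeff_le (xData β f).1.norm_apply_le (-2)
  refine ((Complex.abs_re_le_norm _).trans h).trans_lt ?_
  exact (norm_derivHol_le f).trans_lt hf

theorem speedHat_den_pos {β : ℝ≥0} (hβ₀ : 0 < β) {f : XSpace β} (hf : ‖f‖ < 1) {ε : ℝ}
    (hε : |ε| ≤ 1 / 2) : 0 < 1 - ε * secondRe hβ₀ (xData β f).1 := by
  have h := abs_secondRe_lt hβ₀ hf
  have h1 : |ε * secondRe hβ₀ (xData β f).1| ≤ 1 / 2 * 1 := by
    rw [abs_mul]
    exact mul_le_mul hε h.le (abs_nonneg _) (by norm_num)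
  linarith [le_abs_self (ε * secondRe hβ₀ (xData β f).1)]

theorem firstRe_FHat {β : ℝ≥0} (hβ₀ : 0 < β) (hβ₁ : β < 1) (d U ε : ℝ) (f : XSpace β) :
    firstRe hβ₀ (FHat hβ₀ hβ₁ d U ε 1 (xData β f))
      = 2 * U * (1 - ε * secondRe hβ₀ (xData β f).1)
        + firstRe hβ₀ (F₂Hat hβ₀ hβ₁ ε (xData β f) + F₃Hat hβ₀ hβ₁ d ε 1 (xData β f)) := by
  have h0 : ∀ n : ℤ, -1 ≤ n → circleCoeff (xData β f).1 n = 0 := fun n hn =>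
    circleCoeff_derivHol_of_nonneg f hn
  have h1 : firstRe hβ₀ (xData β f).1 = 0 := by
    rw [firstRe_apply, h0 1 (by norm_num), h0 (-1) le_rfl, sub_zero, Complex.zero_re]
  have e : Hol.const (holderWeight β) 1 * tangentHat hβ₀ hβ₁ (ε • (xData β f).1)
      = tangentHat hβ₀ hβ₁ (ε • (xData β f).1) := Hol.ext fun w => by
    rw [Hol.mul_apply, Hol.const_apply, one_mul]
  rw [FHat, e, map_add, map_add, map_sub, h1, map_smul, smul_eq_mul,
    firstRe_tangentHat hβ₀ hβ₁ ε (h0 0 (by norm_num)), map_add]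
  ring

theorem FHat_inv {β : ℝ≥0} (hβ₀ : 0 < β) (hβ₁ : β < 1) {f : XSpace β} (hf : ‖f‖ < 1) {d ε : ℝ}
    (hd : 2 < d) (hε : |ε| ≤ 1 / 2) (U : ℝ) (w : Circle) :
    FHat hβ₀ hβ₁ d U ε 1 (xData β f) w⁻¹ = star (FHat hβ₀ hβ₁ d U ε 1 (xData β f) w) := by
  have e : ∀ w : Circle, FHat hβ₀ hβ₁ d U ε 1 (xData β f) w
      = ((2 * U : ℝ) : ℂ) * (1 * (w * (1 + ε * circleDeriv f w))) - circleDeriv f w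
        + F₂Hat hβ₀ hβ₁ ε (xData β f) w + F₃Hat hβ₀ hβ₁ d ε 1 (xData β f) w := fun _ => rfl
  have hε' : star (ε : ℂ) = ε := Complex.conj_ofReal ε
  have hU : star ((2 * U : ℝ) : ℂ) = (2 * U : ℝ) := Complex.conj_ofReal _
  obtain ⟨h2, h3⟩ := F₂Hat_F₃Hat_inv hβ₀ hβ₁ hf hd hε w
  rw [e, e, h2, h3, xSpace_deriv_inv, coe_inv_eq_star]
  simp only [star_add, star_sub, star_mul', star_one, hε', hU]

theorem F_coeff_im {β : ℝ≥0} (hβ₀ : 0 < β) (hβ₁ : β < 1) {f : XSpace β} (hf : ‖f‖ < 1) {d ε : ℝ}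
    (hd : 2 < d) (hε : |ε| ≤ 1 / 2) (U : ℝ) (n : ℤ) :
    (circleCoeff (FHat hβ₀ hβ₁ d U ε 1 (xData β f)) n).im = 0 := by
  have h := circleCoeff_star_inv (FHat hβ₀ hβ₁ d U ε 1 (xData β f)) n
  have e : (fun w => star (FHat hβ₀ hβ₁ d U ε 1 (xData β f) w⁻¹))
      = FHat hβ₀ hβ₁ d U ε 1 (xData β f) := by
    funext w
    rw [FHat_inv hβ₀ hβ₁ hf hd hε, star_star]
  rw [e] at h
  exact Complex.conj_eq_iff_im.mp h.symm

theorem firstCoeff_F {β : ℝ≥0} (hβ₀ : 0 < β) (hβ₁ : β < 1) {f : XSpace β} (hf : ‖f‖ < 1)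
    {d ε : ℝ} (hd : 2 < d) (hε : |ε| ≤ 1 / 2) (U : ℝ) :
    firstCoeff (F d U ε f) = firstRe hβ₀ (FHat hβ₀ hβ₁ d U ε 1 (xData β f)) := by
  have e : F d U ε f = FHat hβ₀ hβ₁ d U ε 1 (xData β f) :=
    funext fun w => (F_eq hβ₀ hβ₁ hf hd hε U w).symm
  rw [e, firstCoeff_eq, firstRe_apply]
  refine Complex.ext rfl ?_
  rw [Complex.ofReal_im, Complex.sub_im, F_coeff_im hβ₀ hβ₁ hf hd hε,
    F_coeff_im hβ₀ hβ₁ hf hd hε, sub_zero]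

theorem speed_eq {β : ℝ≥0} (hβ₀ : 0 < β) (hβ₁ : β < 1) {f : XSpace β} (hf : ‖f‖ < 1)
    {d ε : ℝ} (hd : 2 < d) (hε : |ε| ≤ 1 / 2) :
    speed d ε f = speedHat hβ₀ hβ₁ d ε (xData β f) := by
  have e : (fun w => F₂ ε f w + F₃ d ε f w)
      = (F₂Hat hβ₀ hβ₁ ε (xData β f) + F₃Hat hβ₀ hβ₁ d ε 1 (xData β f)).1 :=
    funext fun w => congrArg₂ _ (F₂_eq hβ₀ hβ₁ hf hε w).symm (F₃_eq hβ₀ hβ₁ hf hd hε w).symm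
  rw [speed, speedHat, e, firstCoeff_eq, secondRe_derivHol, firstRe_apply]
  ring

/-- The constraint is real by conjugation symmetry, and affine in U with positive slope 2(1 + ε Re ⨍
f). -/
theorem firstCoeff_F_eq_zero_iff {β : ℝ≥0} (hβ₀ : 0 < β) (hβ₁ : β < 1) {f : XSpace β}
    (hf : ‖f‖ < 1) {d ε : ℝ} (hd : 2 < d) (hε : |ε| ≤ 1 / 2) (U : ℝ) :
    firstCoeff (F d U ε f) = 0 ↔ U = speed d ε f := by
  have h := speedHat_den_pos hβ₀ hf hε
  rw [firstCoeff_F hβ₀ hβ₁ hf hd hε, Complex.ofReal_eq_zero, firstRe_FHat,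
    speed_eq hβ₀ hβ₁ hf hd hε, speedHat, eq_div_iff (by linarith)]
  constructor <;> intro h' <;> linarith

/-- The reduced functional on the space of data. -/
def gHat {β : ℝ≥0} (hβ₀ : 0 < β) (hβ₁ : β < 1) (d ε : ℝ) (v : Data β) : CHol β :=
  FHat hβ₀ hβ₁ d (speedHat hβ₀ hβ₁ d ε v) ε 1 v

theorem gHat_im_mem {β : ℝ≥0} (hβ₀ : 0 < β) (hβ₁ : β < 1) {f : XSpace β}
    (hf : ‖f‖ < 1) {d ε : ℝ} (hd : 2 < d) (hε : |ε| ≤ 1 / 2) :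
    (fun w => (gHat hβ₀ hβ₁ d ε (xData β f) w).im) ∈ yHatSubmodule β := by
  refine im_mem_yHat (continuous_chol hβ₀ _) (memHolder_chol _) (F_coeff_im hβ₀ hβ₁ hf hd hε _) ?_
  have h := (firstCoeff_F_eq_zero_iff hβ₀ hβ₁ hf hd hε (speed d ε f)).mpr rfl
  have e : F d (speed d ε f) ε f = gHat hβ₀ hβ₁ d ε (xData β f) := by
    rw [gHat, ← speed_eq hβ₀ hβ₁ hf hd hε]
    exact funext fun w => (F_eq hβ₀ hβ₁ hf hd hε _ w).symm
  rw [e, firstCoeff_eq] at h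
  exact sub_eq_zero.mp h

theorem gHat_eq {β : ℝ≥0} (hβ₀ : 0 < β) (hβ₁ : β < 1) {f : XSpace β}
    (hf : ‖f‖ < 1) {d ε : ℝ} (hd : 2 < d) (hε : |ε| ≤ 1 / 2) (w : Circle) :
    gHat hβ₀ hβ₁ d ε (xData β f) w = F d (speed d ε f) ε f w := by
  rw [gHat, ← speed_eq hβ₀ hβ₁ hf hd hε, F_eq hβ₀ hβ₁ hf hd hε]

theorem Ghat_apply {β : ℝ≥0} (hβ₀ : 0 < β) (hβ₁ : β < 1) {f : XSpace β}
    (hf : ‖f‖ < 1) {d ε : ℝ} (hd : 2 < d) (hε : |ε| ≤ 1 / 2) (w : Circle) :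
    Ghat d ε f w = (F d (speed d ε f) ε f w).im := by
  have h := gHat_im_mem hβ₀ hβ₁ hf hd hε
  simp only [gHat_eq hβ₀ hβ₁ hf hd hε] at h
  have e : Ghat d ε f = ⟨_, h⟩ := dif_pos h
  exact congrFun (congrArg Subtype.val e) w

theorem Ghat_eq {β : ℝ≥0} (hβ₀ : 0 < β) (hβ₁ : β < 1) {f : XSpace β}
    (hf : ‖f‖ < 1) {d ε : ℝ} (hd : 2 < d) (hε : |ε| ≤ 1 / 2) :
    Ghat d ε f = yHatProj hβ₀ hβ₁ (gHat hβ₀ hβ₁ d ε (xData β f)) := by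
  refine Subtype.ext (funext fun w => ?_)
  exact (Ghat_apply hβ₀ hβ₁ hf hd hε w).trans ((congrArg Complex.im
    (gHat_eq hβ₀ hβ₁ hf hd hε w)).symm.trans
      (yHatProj_apply_of_mem hβ₀ hβ₁ (gHat_im_mem hβ₀ hβ₁ hf hd hε) w).symm)

/-! ### Rotations and the symmetry of the solution set -/

theorem circleMean_mul_left (g : Circle → ℂ) (s : Circle) :
    circleMean (fun w => g (s * w)) = (s : ℂ)⁻¹ * circleMean g := by
  rw [circleMean_eq_circleCoeff, circleCoeff_mul_left, circleMean_eq_circleCoeff, zpow_neg_one]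

theorem IsC1.hasDerivAt_rotate {f : Circle → ℂ} (hf : IsC1 f) (s : Circle) (η : ℝ) :
    HasDerivAt (fun η : ℝ => (s : ℂ)⁻¹ * f (s * Circle.exp η))
      (Complex.I * (Circle.exp η : ℂ) * circleDeriv f (s * Circle.exp η)) η := by
  obtain ⟨t, rfl⟩ : ∃ t, Circle.exp t = s := ⟨_, Circle.exp_arg s⟩
  have h := ((hf.hasDerivAt (t + η)).comp_const_add t η).const_mul (Circle.exp t : ℂ)⁻¹
  simp only [Circle.exp_add, Circle.coe_mul] at h
  have e : (Circle.exp t : ℂ)⁻¹ * (Complex.I * ((Circle.exp t : ℂ) * Circle.exp η)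
      * circleDeriv f (Circle.exp t * Circle.exp η))
      = Complex.I * (Circle.exp η : ℂ) * circleDeriv f (Circle.exp t * Circle.exp η) := by
    have : (Circle.exp t : ℂ) ≠ 0 := Circle.coe_ne_zero _
    field_simp
  rw [e] at h
  exact h

theorem circleDeriv_rotate {f : Circle → ℂ} (hf : IsC1 f) (s : Circle) :
    circleDeriv (fun w => (s : ℂ)⁻¹ * f (s * w)) = fun w => circleDeriv f (s * w) :=
  circleDeriv_eq (hf.hasDerivAt_rotate s)

theorem memHolder_mul_left {β : ℝ≥0} {g : Circle → ℂ} (hg : MemHolder β g) (s : Circle) :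
    MemHolder β fun w => g (s * w) :=
  ⟨nnHolderNorm β g, holderWith_of_le fun w w' => by
    rw [← dist_mul_left_eq s]
    exact hg.norm_sub_le _ _⟩

/-- The function `s⁻¹ f(s w)`. -/
def rotate {β : ℝ≥0} (s : Circle) (f : c1Hol β) : c1Hol β :=
  ⟨fun w => (s : ℂ)⁻¹ * f.1 (s * w),
    isC1_of_hasDerivAt (continuous_const.mul (f.2.1.1.comp (continuous_const_mul s)))
      (f.2.1.2.2.comp (continuous_const_mul s)) (f.2.1.hasDerivAt_rotate s), by
    rw [circleDeriv_rotate f.2.1]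
    exact memHolder_mul_left f.2.2 s⟩

theorem rotate_apply {β : ℝ≥0} (s : Circle) (f : c1Hol β) (w : Circle) :
    (rotate s f).1 w = (s : ℂ)⁻¹ * f.1 (s * w) := rfl

theorem deriv_rotate_apply {β : ℝ≥0} (s : Circle) (f : c1Hol β) (w : Circle) :
    circleDeriv (rotate s f).1 w = circleDeriv f.1 (s * w) :=
  congrFun (circleDeriv_rotate f.2.1 s) w

theorem circleCoeff_rotate {β : ℝ≥0} (s : Circle) (f : c1Hol β) (n : ℤ) :
    circleCoeff (rotate s f).1 n = (s : ℂ) ^ (n - 1) * circleCoeff f.1 n := by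
  have e : (rotate s f).1 = fun w => (s : ℂ)⁻¹ * f.1 (s * w) := rfl
  rw [e, circleCoeff_const_mul, circleCoeff_mul_left, zpow_sub_one₀ (Circle.coe_ne_zero s)]
  ring

theorem norm_derivHol_rotate_le {β : ℝ≥0} (s : Circle) (f : c1Hol β) :
    ‖derivHol (rotate s f)‖ ≤ ‖derivHol f‖ := by
  refine Hol.norm_le (derivHol f).sup_nonneg (derivHol f).semi_nonneg (fun w => ?_) fun w w' => ?_
  · rw [derivHol_apply, deriv_rotate_apply]
    exact (derivHol f).le_sup (s * w)
  · rw [derivHol_apply, derivHol_apply, deriv_rotate_apply, deriv_rotate_apply]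
    have h := (derivHol f).le_semi (s * w) (s * w')
    have e : holderWeight β (s * w) (s * w') = holderWeight β w w' := by
      rw [holderWeight, holderWeight]
      congr 1
      exact NNReal.eq (dist_mul_left_eq s w w')
    rw [e] at h
    exact h

theorem Small.rotate {β : ℝ≥0} {f : c1Hol β} (hf : Small f) (s : Circle) : Small (rotate s f) := by
  refine ⟨fun w => ?_, fun w => ?_⟩
  · rw [rotate_apply, norm_mul, norm_inv, Circle.norm_coe, inv_one, one_mul]
    exact hf.1 _
  · rw [deriv_rotate_apply]
    exact hf.2 _

theorem selfIntegrand_rotate {β : ℝ≥0} (ε : ℝ) (s : Circle) (f : c1Hol β) (w τ : Circle) :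
    selfIntegrand ε (rotate s f).1 w τ = (s : ℂ) ^ 2 * selfIntegrand ε f.1 (s * w) (s * τ) := by
  have hs : (s : ℂ) ≠ 0 := Circle.coe_ne_zero s
  simp only [selfIntegrand, deriv_rotate_apply, rotate_apply, Circle.coe_mul]
  have e1 : ((s : ℂ)⁻¹ * f.1 (s * τ) - (s : ℂ)⁻¹ * f.1 (s * w))
      = (s : ℂ)⁻¹ * (f.1 (s * τ) - f.1 (s * w)) := by ring
  have e2 : (s : ℂ) * τ - s * w = s * (τ - w) := by ring
  have e3 : star (s : ℂ)⁻¹ = s := by rw [← star_coe, star_star]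
  rw [e1, e2, star_mul', star_mul', e3, star_coe]
  set A := (τ : ℂ) - w
  set B := f.1 (s * τ) - f.1 (s * w)
  have h1 : A + ε * ((s : ℂ)⁻¹ * B) = (s : ℂ)⁻¹ * (s * A + ε * B) := by field_simp
  rw [h1]
  by_cases hA : A = 0
  · rw [hA]
    by_cases hB : (ε : ℂ) * B = 0
    · simp [hB]
    · have : B ≠ 0 := right_ne_zero_of_mul hB
      have : (ε : ℂ) ≠ 0 := left_ne_zero_of_mul hB
      simp only [star_zero, mul_zero, zero_mul, zero_add, div_zero, add_zero, sub_zero]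
      field_simp
  by_cases hD : (s : ℂ) * A + ε * B = 0
  · simp [hD]
  field_simp

theorem pairIntegrand_rotate {β : ℝ≥0} (d ε : ℝ) (s : Circle) (f : c1Hol β) (w τ : Circle) :
    pairIntegrand d ε s (rotate s f).1 w τ
      = (s : ℂ) ^ 2 * pairIntegrand d ε 1 f.1 (s * w) (s * τ) := by
  have hs : (s : ℂ) ≠ 0 := Circle.coe_ne_zero s
  simp only [pairIntegrand, deriv_rotate_apply, rotate_apply, Circle.coe_mul]
  have e3 : star (s : ℂ)⁻¹ = s := by rw [← star_coe, star_star]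
  have e4 : (s : ℂ) * (ε * ((τ : ℂ) + w) + ε ^ 2 * ((s : ℂ)⁻¹ * f.1 (s * τ)
      + (s : ℂ)⁻¹ * f.1 (s * w))) - 2 * d
      = 1 * (ε * ((s : ℂ) * τ + s * w) + ε ^ 2 * (f.1 (s * τ) + f.1 (s * w))) - 2 * d := by
    field_simp
  rw [e4, star_mul', star_mul', e3, star_coe, star_coe]
  set D := 1 * (ε * ((s : ℂ) * τ + s * w) + ε ^ 2 * (f.1 (s * τ) + f.1 (s * w))) - 2 * d
  rw [div_eq_mul_inv, div_eq_mul_inv]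
  generalize D⁻¹ = D'
  field_simp

/-- Both integrands scale by s². The change of variable in the mean takes back one s, and the other
turns the outer factor w into sw. An explicit s remains only in the speed term and in the
interaction term, which break rotational invariance. -/
theorem FHat_rotate {β : ℝ≥0} (hβ₀ : 0 < β) (hβ₁ : β < 1) {f : c1Hol β} (hf : Small f)
    {d ε : ℝ} (hd : 2 < d) (hε : |ε| ≤ 1 / 2) (U : ℝ) (s w : Circle) :
    FHat hβ₀ hβ₁ d U ε s (dataLin β (rotate s f)) w
      = FHat hβ₀ hβ₁ d U ε 1 (dataLin β f) (s * w) := by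
  have hs : (s : ℂ) ≠ 0 := Circle.coe_ne_zero s
  have e : ∀ (s : ℂ) (f : c1Hol β) (w : Circle), FHat hβ₀ hβ₁ d U ε s (dataLin β f) w
      = ((2 * U : ℝ) : ℂ) * (s * (w * (1 + ε * circleDeriv f.1 w))) - circleDeriv f.1 w
        + F₂Hat hβ₀ hβ₁ ε (dataLin β f) w + F₃Hat hβ₀ hβ₁ d ε s (dataLin β f) w :=
    fun _ _ _ => rfl
  have h2 : circleMean (selfIntegrand ε (rotate s f).1 w)
      = s * circleMean (selfIntegrand ε f.1 (s * w)) := by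
    have : selfIntegrand ε (rotate s f).1 w
        = fun τ => (s : ℂ) ^ 2 * selfIntegrand ε f.1 (s * w) (s * τ) :=
      funext (selfIntegrand_rotate ε s f w)
    rw [this, circleMean_const_mul, circleMean_mul_left]
    field_simp
  have h3 : circleMean (pairIntegrand d ε s (rotate s f).1 w)
      = s * circleMean (pairIntegrand d ε 1 f.1 (s * w)) := by
    have : pairIntegrand d ε s (rotate s f).1 w
        = fun τ => (s : ℂ) ^ 2 * pairIntegrand d ε 1 f.1 (s * w) (s * τ) :=
      funext (pairIntegrand_rotate d ε s f w)
    rw [this, circleMean_const_mul, circleMean_mul_left]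
    field_simp
  rw [e, e, hf.F₂Hat_apply hβ₀ hβ₁ hε, hf.F₃Hat_apply hβ₀ hβ₁ hd hε norm_one,
    (hf.rotate s).F₂Hat_apply hβ₀ hβ₁ hε, (hf.rotate s).F₃Hat_apply hβ₀ hβ₁ hd hε
      (Circle.norm_coe s), deriv_rotate_apply, h2, h3, Circle.coe_mul]
  ring

/-- Changing the signs of both ε and v leaves εv alone. The remaining v enters linearly, and the
remaining ε, in the denominator of the interaction, occurs only as the product sε. -/
theorem FHat_neg {β : ℝ≥0} (hβ₀ : 0 < β) (hβ₁ : β < 1) (d U ε : ℝ) (v : Data β) :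
    FHat hβ₀ hβ₁ d U (-ε) 1 (-v) = -FHat hβ₀ hβ₁ d U ε (-1) v := by
  have h1 : (-ε) • (-v) = ε • v := by rw [neg_smul, smul_neg, neg_neg]
  have h2 : F₂Hat hβ₀ hβ₁ (-ε) (-v) = -F₂Hat hβ₀ hβ₁ ε v := by
    have e1 : (-ε) • (-v).1 = ε • v.1 := congrArg Prod.fst h1
    have e2 : (-ε) • (-v).2.1 = ε • v.2.1 := congrArg (fun x : Data β => x.2.1) h1
    have e3 : selfKer (ε • v.2.1) (-v) = -selfKer (ε • v.2.1) v := by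
      simp only [selfKer, Prod.fst_neg, Prod.snd_neg, map_neg]
      ring
    rw [F₂Hat, e1, e2, e3, map_neg, neg_mul]
    rfl
  have h3 : F₃Hat hβ₀ hβ₁ d (-ε) 1 (-v) = -F₃Hat hβ₀ hβ₁ d ε (-1) v := by
    have e1 : (-ε) • (-v).1 = ε • v.1 := congrArg Prod.fst h1
    have e2 : ∀ x : Data β, pairDen d (-ε) 1 x = pairDen d ε (-1) x := fun x => by
      simp only [pairDen, map_neg, neg_smul, mul_neg, neg_mul]
    have e3 : ∀ x : Data β, pairKer d (-ε) 1 x = -pairKer d ε (-1) x := fun x => by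
      simp only [pairKer, e2, map_neg]
      ring
    rw [F₃Hat, e1, h1, e3, map_neg, neg_mul]
    rfl
  have e1 : (-ε) • (-v).1 = ε • v.1 := congrArg Prod.fst h1
  rw [FHat, FHat, h2, h3, e1, Prod.fst_neg, map_neg, neg_mul, smul_neg]
  ring

/-- The function `f(-w)`. -/
def reflect {β : ℝ≥0} (f : XSpace β) : XSpace β :=
  XSpace.of (-rotate (-1) (xIncl β f)).1 ⟨(-rotate (-1) (xIncl β f)).2.1,
    (-rotate (-1) (xIncl β f)).2.2, fun n hn => by
      have e : (-rotate (-1) (xIncl β f)).1 = fun w => -(rotate (-1) (xIncl β f)).1 w := rfl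
      rw [e, circleCoeff_neg, circleCoeff_rotate, xIncl_coe, f.2.2.2.1 n hn, mul_zero, neg_zero],
    fun n => by
      have e : (-rotate (-1) (xIncl β f)).1 = fun w => -(rotate (-1) (xIncl β f)).1 w := rfl
      have e2 : (((-1 : Circle) : ℂ)) = ((-1 : ℝ) : ℂ) := by simp
      rw [e, circleCoeff_neg, circleCoeff_rotate, xIncl_coe, Complex.neg_im, e2,
        ← Complex.ofReal_zpow, Complex.im_ofReal_mul, f.2.2.2.2, mul_zero, neg_zero]⟩

theorem reflect_apply {β : ℝ≥0} (f : XSpace β) (w : Circle) : reflect f w = f (-w) := by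
  have e : reflect f w = -((((-1 : Circle) : ℂ))⁻¹ * f ((-1) * w)) := rfl
  rw [e, neg_one_mul, Circle.coe_neg, Circle.coe_one]
  norm_num

theorem xIncl_reflect {β : ℝ≥0} (f : XSpace β) :
    xIncl β (reflect f) = -rotate (-1) (xIncl β f) := rfl

theorem norm_reflect_le {β : ℝ≥0} (f : XSpace β) : ‖reflect f‖ ≤ ‖f‖ := by
  refine (norm_xSpace_le _).trans (le_trans (add_le_add ?_ ?_) (supNorm_add_norm_derivHol_le f))
  · refine Real.iSup_le (fun w => ?_) (supNorm_nonneg _)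
    exact (congrArg norm (reflect_apply f w)).trans_le (norm_le_supNorm f.2.1.1 _)
  · refine le_trans (le_of_eq ?_) (norm_derivHol_rotate_le (-1) (xIncl β f))
    have h : xData β (reflect f) = -dataLin β (rotate (-1) (xIncl β f)) := by
      rw [xData_apply, xIncl_reflect, map_neg]
    have h2 : derivHol (xIncl β (reflect f)) = -derivHol (rotate (-1) (xIncl β f)) :=
      congrArg Prod.fst h
    rw [h2, norm_neg]

/-- The reflection is minus the rotation by s = -1, so `FHat_rotate` and `FHat_neg` combine. -/
theorem F_reflect {β : ℝ≥0} (hβ₀ : 0 < β) (hβ₁ : β < 1) {f : XSpace β} (hf : ‖f‖ < 1)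
    {d ε : ℝ} (hd : 2 < d) (hε : |ε| ≤ 1 / 2) (U : ℝ) (w : Circle) :
    F d U (-ε) (reflect f) w = -F d U ε f (-w) := by
  have h : xData β (reflect f) = -dataLin β (rotate (-1) (xIncl β f)) := by
    rw [xData_apply, xIncl_reflect, map_neg]
  have e : ((-1 : Circle) : ℂ) = -1 := by simp
  rw [← F_eq hβ₀ hβ₁ ((norm_reflect_le f).trans_lt hf) hd (by rwa [abs_neg]),
    ← F_eq hβ₀ hβ₁ hf hd hε, h, FHat_neg, Hol.neg_apply, ← neg_one_mul w, xData_apply,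
    ← FHat_rotate hβ₀ hβ₁ (small_of_norm_lt hf) hd hε, e]

theorem speed_reflect {β : ℝ≥0} (hβ₀ : 0 < β) (hβ₁ : β < 1) {f : XSpace β} (hf : ‖f‖ < 1)
    {d ε : ℝ} (hd : 2 < d) (hε : |ε| ≤ 1 / 2) :
    speed d (-ε) (reflect f) = speed d ε f := by
  symm
  rw [← firstCoeff_F_eq_zero_iff hβ₀ hβ₁ ((norm_reflect_le f).trans_lt hf) hd (by rwa [abs_neg])]
  have h := (firstCoeff_F_eq_zero_iff hβ₀ hβ₁ hf hd hε (speed d ε f)).mpr rfl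
  have e : F d (speed d ε f) (-ε) (reflect f)
      = fun w => -(fun w => F d (speed d ε f) ε f ((-1) * w)) w := by
    funext w
    rw [F_reflect hβ₀ hβ₁ hf hd hε, ← neg_one_mul w]
  rw [e, firstCoeff_eq, circleCoeff_neg, circleCoeff_neg, circleCoeff_mul_left,
    circleCoeff_mul_left]
  rw [firstCoeff_eq] at h
  simpa using h

theorem Ghat_reflect {β : ℝ≥0} (hβ₀ : 0 < β) (hβ₁ : β < 1) {f : XSpace β} (hf : ‖f‖ < 1)
    {d ε : ℝ} (hd : 2 < d) (hε : |ε| ≤ 1 / 2) (h : Ghat d ε f = 0) :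
    Ghat d (-ε) (reflect f) = 0 := by
  refine Subtype.ext (funext fun w => ?_)
  refine (Ghat_apply hβ₀ hβ₁ ((norm_reflect_le f).trans_lt hf) hd (by rwa [abs_neg]) w).trans ?_
  rw [speed_reflect hβ₀ hβ₁ hf hd hε, F_reflect hβ₀ hβ₁ hf hd hε, Complex.neg_im,
    ← Ghat_apply hβ₀ hβ₁ hf hd hε, h]
  exact neg_zero

/-! ### The functional for small `ε` -/

open MeasureTheory Filter Topology

section

variable {E : Type*} [NormedAddCommGroup E] [NormedSpace ℝ E] {β : ℝ≥0}

theorem contDiffAt_inverse {Ω : Type*} [MeasurableSpace Ω] [Nonempty Ω] {N : Ω → Ω → ℝ≥0}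
    {n : WithTop ℕ∞} {k : E → Hol N} {x : E}
    (hk : ContDiffAt ℝ n k x) (h : IsUnit (k x)) :
    ContDiffAt ℝ n (fun y => Ring.inverse (k y)) x := by
  obtain ⟨u, hu⟩ := h
  have h1 := contDiffAt_ringInverse ℝ (n := n) u
  rw [hu] at h1
  exact h1.comp x hk

theorem contDiffAt_tangentHat (hβ₀ : 0 < β) (hβ₁ : β < 1) {n : WithTop ℕ∞} {p : E → CHol β} {x : E}
    (hp : ContDiffAt ℝ n p x) : ContDiffAt ℝ n (fun y => tangentHat hβ₀ hβ₁ (p y)) x := by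
  unfold tangentHat
  exact contDiffAt_const.mul (contDiffAt_const.add hp)

theorem contDiffAt_F₂Hat (hβ₀ : 0 < β) (hβ₁ : β < 1) {n : WithTop ℕ∞} {a : E → ℝ}
    {v : E → Data β} {x : E}
    (ha : ContDiffAt ℝ n a x) (hv : ContDiffAt ℝ n v x) (h : IsUnit (1 + a x • (v x).2.1)) :
    ContDiffAt ℝ n (fun y => F₂Hat hβ₀ hβ₁ (a y) (v y)) x := by
  have h1 : ContDiffAt ℝ n (fun y => (v y).1) x := hv.fst
  have h2 : ContDiffAt ℝ n (fun y => (v y).2.1) x := hv.snd.fst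
  have h3 := contDiffAt_inverse (contDiffAt_const.add (ha.smul h2)) h
  have h4 := Hol.conj.contDiff.contDiffAt.comp x h2
  have h4' := Hol.conj.contDiff.contDiffAt.comp x (ha.smul h2)
  have h5 := (fstKer β).contDiff.contDiffAt.comp x h1
  unfold F₂Hat selfKer
  refine ((meanOp β hβ₀ hβ₁).contDiff.contDiffAt.comp x ?_).mul
    (contDiffAt_tangentHat hβ₀ hβ₁ (ha.smul h1))
  exact ((contDiffAt_const.mul ((contDiffAt_const.add h4').mul h3)).mul h5).add
    ((contDiffAt_const.mul (h4.sub h2)).mul h3)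

theorem contDiffAt_F₃Hat (hβ₀ : 0 < β) (hβ₁ : β < 1) {n : WithTop ℕ∞} (d : ℝ) {a : E → ℝ}
    {s : E → ℂ} {v : E → Data β} {x : E}
    (ha : ContDiffAt ℝ n a x) (hs : ContDiffAt ℝ n s x) (hv : ContDiffAt ℝ n v x)
    (h : IsUnit (pairDen d (a x) (s x) (a x • v x))) :
    ContDiffAt ℝ n (fun y => F₃Hat hβ₀ hβ₁ d (a y) (s y) (v y)) x := by
  have h1 : ContDiffAt ℝ n (fun y => (a y • v y).1) x := (ha.smul hv).fst
  have h2 : ContDiffAt ℝ n (fun y => (a y • v y).2.2.1) x := (ha.smul hv).snd.snd.fst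
  have h3 : ContDiffAt ℝ n (fun y => (a y • v y).2.2.2) x := (ha.smul hv).snd.snd.snd
  have h4 : ContDiffAt ℝ n (fun y => Hol.const kernelWeight (s y)) x :=
    (Hol.const kernelWeight).contDiff.contDiffAt.comp x hs
  have h5 : ContDiffAt ℝ n (fun y => pairDen d (a y) (s y) (a y • v y)) x := by
    unfold pairDen
    exact (h4.mul (ha.smul (contDiffAt_const.add (h2.add h3)))).sub contDiffAt_const
  have h6 := contDiffAt_inverse h5 h
  have h7 := (fstKer β).contDiff.contDiffAt.comp x
    ((contDiffAt_const (c := (1 : CHol β))).add h1)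
  have h8 := Hol.conj.contDiff.contDiffAt.comp x h2
  unfold F₃Hat pairKer
  exact ((meanOp β hβ₀ hβ₁).contDiff.contDiffAt.comp x
    (h4.mul (((contDiffAt_const.add h8).mul h6).mul h7))).mul (contDiffAt_tangentHat hβ₀ hβ₁ h1)

theorem isUnit_one_add_zero_smul (k : Ker) : IsUnit (1 + (0 : ℝ) • k) := by
  rw [zero_smul, add_zero]
  exact isUnit_one

theorem pairDen_zero (d : ℝ) (s : ℂ) (x : Data β) :
    pairDen d 0 s x = Hol.const _ (-(2 * d) : ℂ) := by
  rw [pairDen, zero_smul, mul_zero, zero_sub, map_neg]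

theorem isUnit_pairDen_zero {d : ℝ} (hd : 2 < d) (s : ℂ) (x : Data β) :
    IsUnit (pairDen d 0 s x) := by
  rw [pairDen_zero]
  refine Hol.isUnit_of_le (c := 4) (by norm_num) fun p => ?_
  rw [Hol.const_apply, norm_neg, norm_mul, Complex.norm_ofNat, Complex.norm_real,
    Real.norm_of_nonneg (by linarith)]
  linarith

theorem F₃Hat_zero (hβ₀ : 0 < β) (hβ₁ : β < 1) {d : ℝ} (hd : 2 < d) (s : ℂ) (v : Data β) :
    F₃Hat hβ₀ hβ₁ d 0 s v = Hol.const _ (-(s / (2 * d)) : ℂ) * coeHol hβ₀ hβ₁ := by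
  ext w
  have e : F₃Hat hβ₀ hβ₁ d 0 s v w = circleMean (fun τ => s * ((star (τ : ℂ)
      + star (((0 : ℝ) : ℂ) * v.2.2.1 (τ, w))) * Ring.inverse (pairDen d 0 s ((0 : ℝ) • v)) (τ, w)
        * (1 + ((0 : ℝ) : ℂ) * v.1 τ))) * (w * (1 + ((0 : ℝ) : ℂ) * v.1 w)) := rfl
  rw [e, Hol.mul_apply, Hol.const_apply, coeHol_apply]
  have hi : ∀ p, Ring.inverse (pairDen d 0 s ((0 : ℝ) • v)) p = (-(2 * d) : ℂ)⁻¹ := fun p => by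
    rw [Hol.inverse_apply (isUnit_pairDen_zero hd s ((0 : ℝ) • v)), pairDen_zero, Hol.const_apply]
  simp only [hi, Complex.ofReal_zero, zero_mul, star_zero, add_zero, mul_one]
  have e2 : (fun τ : Circle => s * (star (τ : ℂ) * (-(2 * d : ℂ))⁻¹))
      = fun τ : Circle => (-(s / (2 * d)) : ℂ) * (τ : ℂ) ^ (-1 : ℤ) := by
    funext τ
    rw [star_coe, zpow_neg_one, inv_neg]
    ring
  rw [e2, circleMean_const_mul, circleMean_eq_circleCoeff, circleCoeff_zpow, if_pos rfl, mul_one]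

theorem contDiffAt_speedHat (hβ₀ : 0 < β) (hβ₁ : β < 1) {n : WithTop ℕ∞} {d : ℝ}
    {a : E → ℝ} {v : E → Data β} {x : E} (ha : ContDiffAt ℝ n a x) (hv : ContDiffAt ℝ n v x)
    (h2 : IsUnit (1 + a x • (v x).2.1)) (h3 : IsUnit (pairDen d (a x) 1 (a x • v x)))
    (h : 1 - a x * secondRe hβ₀ (v x).1 ≠ 0) :
    ContDiffAt ℝ n (fun y => speedHat hβ₀ hβ₁ d (a y) (v y)) x := by
  have h1 := contDiffAt_F₂Hat hβ₀ hβ₁ ha hv h2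
  have h1' := contDiffAt_F₃Hat hβ₀ hβ₁ d ha contDiffAt_const hv h3
  unfold speedHat
  refine ((firstRe hβ₀).contDiff.contDiffAt.comp x (h1.add h1')).neg.div ?_
    (mul_ne_zero two_ne_zero h)
  exact contDiffAt_const.mul (contDiffAt_const.sub (ha.mul
    ((secondRe hβ₀).contDiff.contDiffAt.comp x hv.fst)))

theorem contDiffAt_gHat (hβ₀ : 0 < β) (hβ₁ : β < 1) {n : WithTop ℕ∞} {d : ℝ}
    {a : E → ℝ} {v : E → Data β} {x : E} (ha : ContDiffAt ℝ n a x) (hv : ContDiffAt ℝ n v x)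
    (h2 : IsUnit (1 + a x • (v x).2.1)) (h3 : IsUnit (pairDen d (a x) 1 (a x • v x)))
    (h : 1 - a x * secondRe hβ₀ (v x).1 ≠ 0) :
    ContDiffAt ℝ n (fun y => gHat hβ₀ hβ₁ d (a y) (v y)) x := by
  unfold gHat FHat
  exact (((contDiffAt_const.mul (contDiffAt_speedHat hβ₀ hβ₁ ha hv h2 h3 h)).smul
    (contDiffAt_const.mul (contDiffAt_tangentHat hβ₀ hβ₁ (ha.smul hv.fst)))).sub hv.fst).add
    (contDiffAt_F₂Hat hβ₀ hβ₁ ha hv h2) |>.add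
    (contDiffAt_F₃Hat hβ₀ hβ₁ d ha contDiffAt_const hv h3)

theorem contDiffAt_yHatProj_gHat (hβ₀ : 0 < β) (hβ₁ : β < 1) {d : ℝ} (hd : 2 < d)
    {ε : ℝ} (hε : |ε| ≤ 1 / 2) {f : XSpace β} (hf : ‖f‖ < 1) {n : WithTop ℕ∞} :
    ContDiffAt ℝ n (fun y : ℝ × XSpace β => yHatProj hβ₀ hβ₁ (gHat hβ₀ hβ₁ d y.1 (xData β y.2)))
      (ε, f) := by
  have hs := small_of_norm_lt hf
  refine (yHatProj hβ₀ hβ₁).contDiff.contDiffAt.comp _ (contDiffAt_gHat hβ₀ hβ₁ contDiffAt_fst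
    ((xData β).contDiff.contDiffAt.comp _ contDiffAt_snd) ?_ ?_ ?_)
  · exact hs.isUnit_one_add hε
  · exact hs.isUnit_pairDen hd hε norm_one
  · exact (speedHat_den_pos hβ₀ hf hε).ne'

end

/-! #### The self-interaction term at `ε = 0` -/

theorem c1Hol_mem_holAlg {β : ℝ≥0} (hβ₀ : 0 < β) (hβ₁ : β < 1) (f : c1Hol β) :
    f.1 ∈ holAlg (holderWeight β) := by
  refine mem_holAlg_of_le hβ₀ (A := supNorm f.1) (B := Real.pi / 2 * ‖derivHol f‖ * 2)
    (by positivity) (norm_le_supNorm f.2.1.1) fun w w' => ?_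
  refine (c1Hol_lipschitz f w w').trans ?_
  rw [mul_assoc (Real.pi / 2 * ‖derivHol f‖)]
  exact mul_le_mul_of_nonneg_left (dist_le_two_mul_rpow hβ₀ hβ₁ w w') (by positivity)

/-- On the circle the conjugate of τ - w is -(τ - w)/(τw), so the integrand splits into Cauchy
quotients and continuous terms. The Cauchy integral is -f for f, which has only negative modes, and
0 for its conjugate, which has only positive ones. The term with f' has mean 0, and what is left is
w⁻²(-f w + f w). -/
theorem circleMean_selfIntegrand_zero {β : ℝ≥0} (hβ₀ : 0 < β) (hβ₁ : β < 1) {f : c1Hol β}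
    (hf : ∀ n : ℤ, 0 ≤ n → circleCoeff f.1 n = 0) (w : Circle) :
    circleMean (selfIntegrand 0 f.1 w) = 0 := by
  have hw : (w : ℂ) ≠ 0 := Circle.coe_ne_zero w
  let g : CHol β := Hol.of f.1 (c1Hol_mem_holAlg hβ₀ hβ₁ f)
  have hg1 : cauchyFun g.1 w = -f.1 w := by
    have : cauchyFun g.1 = fun w => -f.1 w :=
      ext_of_circleCoeff (continuous_cauchyFun hβ₀ hβ₁ g) f.2.1.1.neg fun n => by
        rw [circleCoeff_cauchyFun hβ₀ hβ₁, circleCoeff_neg]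
        split_ifs with h
        · rfl
        · rw [hf n (not_lt.mp h), neg_zero]
    exact congrFun this w
  have hg2 : cauchyFun (Hol.conj g).1 w = 0 := by
    have : cauchyFun (Hol.conj g).1 = fun w => 0 :=
      ext_of_circleCoeff (continuous_cauchyFun hβ₀ hβ₁ _) continuous_const fun n => by
        have h0 : circleCoeff (fun _ : Circle => (0 : ℂ)) n = 0 := by
          simp [circleCoeff, circleMean]
        rw [circleCoeff_cauchyFun hβ₀ hβ₁, h0]
        split_ifs with h
        · have e : circleCoeff (Hol.conj g).1 n = star (circleCoeff f.1 (-n)) :=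
            circleCoeff_star f.1 n
          rw [e, hf (-n) (by omega), star_zero, neg_zero]
        · rfl
    exact congrFun this w
  have hd0 : circleCoeff (circleDeriv f.1) 0 = 0 := by
    rw [circleCoeff_circleDeriv f.2.1, hf _ (by norm_num), mul_zero]
  have hcont : ∀ {h : Circle → ℂ}, Continuous h → Integrable h arc := fun {h} hh =>
    hh.integrable_of_hasCompactSupport (HasCompactSupport.of_compactSpace _)
  have hinv : Continuous fun τ : Circle => (τ : ℂ)⁻¹ :=
    continuous_coe_circle.inv₀ fun τ => Circle.coe_ne_zero τ
  have e : ∀ᵐ τ ∂arc, selfIntegrand 0 f.1 w τ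
      = ((diffQuot (Hol.conj g).1 w τ + (w : ℂ)⁻¹ * ((w : ℂ)⁻¹ * diffQuot g.1 w τ))
        + -((w : ℂ)⁻¹ * ((τ : ℂ)⁻¹ * circleDeriv f.1 τ)))
        + -((w : ℂ)⁻¹ * ((w : ℂ)⁻¹ * ((τ : ℂ)⁻¹ * f.1 τ - f.1 w * (τ : ℂ)⁻¹))) := by
    filter_upwards [Measure.ae_ne arc w] with τ hτ
    have h0 : (τ : ℂ) - w ≠ 0 := sub_ne_zero.mpr fun e => hτ (Circle.ext e)
    have h1 : (τ : ℂ) ≠ 0 := Circle.coe_ne_zero τ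
    have h2 : star ((τ : ℂ) - w) = -((τ : ℂ) - w) * ((τ : ℂ)⁻¹ * (w : ℂ)⁻¹) := by
      rw [star_sub, star_coe, star_coe]
      field_simp
      ring
    have h3 : diffQuot (Hol.conj g).1 w τ = star (f.1 τ - f.1 w) / ((τ : ℂ) - w) := by
      rw [star_sub]; rfl
    have h4 : diffQuot g.1 w τ = (f.1 τ - f.1 w) / ((τ : ℂ) - w) := rfl
    rw [selfIntegrand, h2, h3, h4]
    simp only [Complex.ofReal_zero, zero_mul, add_zero]
    generalize star (f.1 τ - f.1 w) = B'
    field_simp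
    ring
  have i1 := integrable_diffQuot hβ₀ hβ₁ (Hol.conj g) w
  have i2 := integrable_diffQuot hβ₀ hβ₁ g w
  have i3 : Integrable (fun τ : Circle => (τ : ℂ)⁻¹ * circleDeriv f.1 τ) arc :=
    hcont (hinv.mul f.2.1.2.2)
  have i4 : Integrable (fun τ : Circle => (τ : ℂ)⁻¹ * f.1 τ) arc := hcont (hinv.mul f.2.1.1)
  have i5 : Integrable (fun τ : Circle => f.1 w * (τ : ℂ)⁻¹) arc := (hcont hinv).const_mul _
  have m : ∀ h : Circle → ℂ, circleMean (fun τ => (τ : ℂ)⁻¹ * h τ) = circleCoeff h 0 := fun h => by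
    have := circleCoeff_zpow_mul h (-1) (-1)
    simp only [zpow_neg_one] at this
    rw [circleMean_eq_circleCoeff, this]
    norm_num
  have m1 : circleMean (fun τ : Circle => (τ : ℂ)⁻¹) = 1 := by
    have := m fun _ => 1
    simp only [mul_one] at this
    rw [this, circleCoeff_one, if_pos rfl]
  have neg : ∀ h : Circle → ℂ, circleMean (fun τ => -h τ) = -circleMean h := fun h => by
    have := circleMean_const_mul (-1) h
    simpa using this
  have j2 : Integrable (fun τ => (w : ℂ)⁻¹ * ((w : ℂ)⁻¹ * diffQuot g.1 w τ)) arc :=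
    (i2.const_mul _).const_mul _
  have j3 : Integrable (fun τ : Circle => -((w : ℂ)⁻¹ * ((τ : ℂ)⁻¹ * circleDeriv f.1 τ))) arc :=
    (i3.const_mul _).neg
  have j4 : Integrable (fun τ : Circle =>
      -((w : ℂ)⁻¹ * ((w : ℂ)⁻¹ * ((τ : ℂ)⁻¹ * f.1 τ - f.1 w * (τ : ℂ)⁻¹)))) arc :=
    (((i4.sub i5).const_mul _).const_mul _).neg
  have k2 : Integrable (fun τ => diffQuot (Hol.conj g).1 w τ
      + (w : ℂ)⁻¹ * ((w : ℂ)⁻¹ * diffQuot g.1 w τ)) arc := i1.add j2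
  have k3 : Integrable (fun τ => diffQuot (Hol.conj g).1 w τ
      + (w : ℂ)⁻¹ * ((w : ℂ)⁻¹ * diffQuot g.1 w τ)
      + -((w : ℂ)⁻¹ * ((τ : ℂ)⁻¹ * circleDeriv f.1 τ))) arc := k2.add j3
  rw [circleMean_congr_ae e, circleMean_add k3 j4, circleMean_add k2 j3,
    circleMean_add i1 j2, neg, neg, circleMean_const_mul,
    circleMean_const_mul, circleMean_const_mul, circleMean_const_mul, circleMean_const_mul,
    circleMean_sub i4 i5, circleMean_const_mul, m, m, m1, hd0, hf 0 le_rfl]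
  rw [cauchyFun] at hg1 hg2
  rw [hg1, hg2]
  ring

theorem Small.F₂Hat_zero {β : ℝ≥0} (hβ₀ : 0 < β) (hβ₁ : β < 1) {f : c1Hol β} (hs : Small f)
    (hf : ∀ n : ℤ, 0 ≤ n → circleCoeff f.1 n = 0) : F₂Hat hβ₀ hβ₁ 0 (dataLin β f) = 0 := by
  ext w
  rw [hs.F₂Hat_apply hβ₀ hβ₁ (by norm_num), circleMean_selfIntegrand_zero hβ₀ hβ₁ hf, zero_mul,
    Hol.zero_apply]

/-! ### Uniform convergence as `ε → 0` -/

section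

variable {ι : Type*} {l : Filter ι} {β : ℝ≥0} {a : ι → ℝ} {v : ι → Data β}

theorem tendsto_smul_data (ha : Tendsto a l (𝓝 0))
    (hv : IsBoundedUnder (· ≤ ·) l fun i => ‖v i‖) : Tendsto (fun i => a i • v i) l (𝓝 0) :=
  ha.zero_smul_isBoundedUnder_le hv

/-- Stated for an arbitrary filter and merely bounded data: this gives convergence uniform on the
unit ball and, for the filter `pure`, the exact value at ε = 0. The kernel is linear in v with
coefficients depending on εv, and the differences of these coefficients tend to 0. -/
theorem tendsto_F₂Hat (hβ₀ : 0 < β) (hβ₁ : β < 1) (ha : Tendsto a l (𝓝 0))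
    (hv : IsBoundedUnder (· ≤ ·) l fun i => ‖v i‖) (h0 : ∀ᶠ i in l, F₂Hat hβ₀ hβ₁ 0 (v i) = 0) :
    Tendsto (fun i => F₂Hat hβ₀ hβ₁ (a i) (v i)) l (𝓝 0) := by
  have hx := tendsto_smul_data ha hv
  have hx1 : Tendsto (fun i => a i • (v i).1) l (𝓝 0) := (continuous_fst.tendsto _).comp hx
  have hx2 : Tendsto (fun i => a i • (v i).2.1) l (𝓝 0) :=
    ((continuous_fst.comp continuous_snd).tendsto _).comp hx
  have hI : Tendsto (fun i => Ring.inverse (1 + a i • (v i).2.1)) l (𝓝 1) := by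
    have h1 : Tendsto (fun i => 1 + a i • (v i).2.1) l (𝓝 (1 : Ker)) := by
      simpa using hx2.const_add (1 : Ker)
    have h2 : ContinuousAt Ring.inverse (1 : Ker) := NormedRing.inverse_continuousAt 1
    have h3 := h2.tendsto.comp h1
    rw [Ring.inverse_one] at h3
    exact h3
  have hJ : Tendsto (fun i => Ring.inverse (1 + a i • (v i).2.1) - 1) l (𝓝 0) := by
    simpa using hI.sub_const 1
  have hK : Tendsto (fun i => (1 + Hol.conj (a i • (v i).2.1)) *
      Ring.inverse (1 + a i • (v i).2.1) - 1) l (𝓝 0) := by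
    have h1 : Tendsto (fun i => Hol.conj (a i • (v i).2.1)) l (𝓝 0) := by
      have := (Hol.conj.continuous.tendsto (0 : Ker)).comp hx2
      rwa [map_zero] at this
    have := ((h1.const_add 1).mul hI).sub_const 1
    simpa using this
  have hb : ∀ (T : Data β →L[ℝ] Ker), IsBoundedUnder (· ≤ ·) l fun i => ‖T (v i)‖ := fun T => by
    obtain ⟨C, hC⟩ := hv
    refine ⟨‖T‖ * C, eventually_map.mpr ((eventually_map.mp hC).mono fun i hi => ?_)⟩
    exact (T.le_opNorm _).trans (mul_le_mul_of_nonneg_left hi (norm_nonneg _))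
  have hker : Tendsto (fun i => selfKer (a i • (v i).2.1) (v i) - selfKer ((0 : ℝ) • (v i).2.1) (v i))
      l (𝓝 0) := by
    have e : ∀ i, selfKer (a i • (v i).2.1) (v i) - selfKer ((0 : ℝ) • (v i).2.1) (v i)
        = conjQuotKer * (((1 + Hol.conj (a i • (v i).2.1)) *
            Ring.inverse (1 + a i • (v i).2.1) - 1) * fstKer β (v i).1)
          + conjQuotKer * ((Ring.inverse (1 + a i • (v i).2.1) - 1)
            * (Hol.conj (v i).2.1 - (v i).2.1)) := fun i => by
      have h1 : Ring.inverse (1 + (0 : ℝ) • (v i).2.1) = 1 := by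
        rw [zero_smul, add_zero, Ring.inverse_one]
      rw [selfKer, selfKer, h1, zero_smul, map_zero]
      ring
    simp only [e]
    have h1 := hK.zero_mul_isBoundedUnder_le
      (hb ((fstKer β).comp (ContinuousLinearMap.fst ℝ _ _)))
    have h2 := hJ.zero_mul_isBoundedUnder_le
      (hb ((Hol.conj - ContinuousLinearMap.id ℝ Ker).comp
        ((ContinuousLinearMap.fst ℝ _ _).comp (ContinuousLinearMap.snd ℝ _ _))))
    simpa using (h1.const_mul conjQuotKer).add (h2.const_mul conjQuotKer)
  have hmean : Tendsto (fun i => meanOp β hβ₀ hβ₁ (selfKer (a i • (v i).2.1) (v i))) l (𝓝 0) := by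
    have h1 := ((meanOp β hβ₀ hβ₁).continuous.tendsto 0).comp hker
    rw [map_zero] at h1
    refine h1.congr' (h0.mono fun i hi => ?_)
    have h2 : meanOp β hβ₀ hβ₁ (selfKer ((0 : ℝ) • (v i).2.1) (v i)) = 0 := by
      rw [F₂Hat, zero_smul ℝ (v i).1, tangentHat, add_zero, mul_one] at hi
      ext w
      have := congrArg (fun g : CHol β => g w) hi
      simp only [Hol.mul_apply, Hol.zero_apply, coeHol_apply] at this
      exact (mul_eq_zero.mp this).resolve_right (Circle.coe_ne_zero w)
    rw [Function.comp_apply, map_sub, h2, sub_zero]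
  have ht : Tendsto (fun i => tangentHat hβ₀ hβ₁ (a i • (v i).1)) l (𝓝 (coeHol hβ₀ hβ₁)) := by
    simpa [tangentHat] using (hx1.const_add 1).const_mul (coeHol hβ₀ hβ₁)
  simpa [F₂Hat] using hmean.mul ht

theorem tendsto_F₃Hat (hβ₀ : 0 < β) (hβ₁ : β < 1) {d : ℝ} (hd : 2 < d) (ha : Tendsto a l (𝓝 0))
    (hv : IsBoundedUnder (· ≤ ·) l fun i => ‖v i‖) :
    Tendsto (fun i => F₃Hat hβ₀ hβ₁ d (a i) 1 (v i)) l
      (𝓝 (Hol.const _ (-(1 / (2 * d)) : ℂ) * coeHol hβ₀ hβ₁)) := by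
  have hx := tendsto_smul_data ha hv
  have hx1 : Tendsto (fun i => a i • (v i).1) l (𝓝 0) := (continuous_fst.tendsto _).comp hx
  have hx3 : Tendsto (fun i => a i • (v i).2.2.1) l (𝓝 0) :=
    (((continuous_fst.comp continuous_snd).comp continuous_snd).tendsto _).comp hx
  have hx4 : Tendsto (fun i => a i • (v i).2.2.2) l (𝓝 0) :=
    (((continuous_snd.comp continuous_snd).comp continuous_snd).tendsto _).comp hx
  have hD : Tendsto (fun i => pairDen d (a i) 1 (a i • v i)) l (𝓝 (pairDen d 0 1 (0 : Data β))) := by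
    have h1 : Tendsto (fun i => a i • (sumKer + (a i • (v i).2.2.1 + a i • (v i).2.2.2))) l
        (𝓝 ((0 : ℝ) • (sumKer + (0 + 0)))) := ha.smul ((hx3.add hx4).const_add _)
    exact (h1.const_mul _).sub_const _
  have hI := Filter.Tendsto.comp
    (NormedRing.inverse_continuousAt (isUnit_pairDen_zero hd 1 (0 : Data β)).unit).tendsto hD
  have hc : Tendsto (fun i => Hol.conj (a i • (v i).2.2.1)) l (𝓝 (Hol.conj 0)) :=
    (Hol.conj.continuous.tendsto (0 : Ker)).comp hx3
  have hf : Tendsto (fun i => fstKer β (1 + a i • (v i).1)) l (𝓝 (fstKer β (1 + 0))) :=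
    ((fstKer β).continuous.tendsto _).comp (hx1.const_add 1)
  have hk : Tendsto (fun i => pairKer d (a i) 1 (a i • v i)) l
      (𝓝 (pairKer d 0 1 (0 : Data β))) :=
    (((hc.const_add conjFstKer).mul hI).mul hf).const_mul _
  have h := (((meanOp β hβ₀ hβ₁).continuous.tendsto _).comp hk).mul
    ((hx1.const_add 1).const_mul (coeHol hβ₀ hβ₁))
  rw [← F₃Hat_zero hβ₀ hβ₁ hd 1 (0 : Data β)]
  have e : F₃Hat hβ₀ hβ₁ d 0 1 (0 : Data β)
      = meanOp β hβ₀ hβ₁ (pairKer d 0 1 (0 : Data β)) * (coeHol hβ₀ hβ₁ * (1 + 0)) := by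
    rw [F₃Hat, smul_zero, Prod.fst_zero, smul_zero, tangentHat]
  rw [e]
  exact h

theorem firstRe_coeHol (hβ₀ : 0 < β) (hβ₁ : β < 1) : firstRe hβ₀ (coeHol hβ₀ hβ₁) = 1 := by
  have h := firstRe_tangentHat hβ₀ hβ₁ 0 (p := 0) (by
    simp [circleCoeff, circleMean])
  rw [smul_zero, tangentHat, add_zero, mul_one, map_zero, mul_zero, sub_zero] at h
  exact h

theorem const_ofReal_mul (c : ℝ) (g : CHol β) : Hol.const _ (c : ℂ) * g = c • g := by
  ext w
  rw [Hol.mul_apply, Hol.const_apply, Hol.smul_apply]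

theorem tendsto_speedHat (hβ₀ : 0 < β) (hβ₁ : β < 1) {d : ℝ} (hd : 2 < d) (ha : Tendsto a l (𝓝 0))
    (hv : IsBoundedUnder (· ≤ ·) l fun i => ‖v i‖) (h0 : ∀ᶠ i in l, F₂Hat hβ₀ hβ₁ 0 (v i) = 0) :
    Tendsto (fun i => speedHat hβ₀ hβ₁ d (a i) (v i)) l (𝓝 (1 / (4 * d))) := by
  have h1 := ((firstRe hβ₀).continuous.tendsto _).comp
    ((tendsto_F₂Hat hβ₀ hβ₁ ha hv h0).add (tendsto_F₃Hat hβ₀ hβ₁ hd ha hv))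
  have e : (-(1 / (2 * d)) : ℂ) = ((-(1 / (2 * d)) : ℝ) : ℂ) := by push_cast; ring
  rw [zero_add, e, const_ofReal_mul, map_smul, firstRe_coeHol] at h1
  have hx1 : Tendsto (fun i => a i * secondRe hβ₀ (v i).1) l (𝓝 0) := by
    have := ((secondRe hβ₀).continuous.tendsto _).comp
      ((continuous_fst.tendsto _).comp (tendsto_smul_data ha hv))
    rw [Prod.fst_zero, map_zero] at this
    refine this.congr fun i => ?_
    exact (secondRe hβ₀).map_smul (a i) (v i).1
  have h2 : Tendsto (fun i => 2 * (1 - a i * secondRe hβ₀ (v i).1)) l (𝓝 (2 * (1 - 0))) :=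
    (hx1.const_sub 1).const_mul 2
  have h3 := h1.neg.div h2 (by norm_num)
  have e2 : -(-(1 / (2 * d)) • (1 : ℝ)) / (2 * (1 - 0)) = 1 / (4 * d) := by
    rw [smul_eq_mul]
    field_simp
    norm_num
  rw [e2] at h3
  exact h3

/-- The speed term tends to w/(2d) and the interaction to -w/(2d); they cancel, and only the
principal part -f' survives. -/
theorem tendsto_gHat_add (hβ₀ : 0 < β) (hβ₁ : β < 1) {d : ℝ} (hd : 2 < d) (ha : Tendsto a l (𝓝 0))
    (hv : IsBoundedUnder (· ≤ ·) l fun i => ‖v i‖) (h0 : ∀ᶠ i in l, F₂Hat hβ₀ hβ₁ 0 (v i) = 0) :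
    Tendsto (fun i => gHat hβ₀ hβ₁ d (a i) (v i) + (v i).1) l (𝓝 0) := by
  have h2 := tendsto_F₂Hat hβ₀ hβ₁ ha hv h0
  have h3 := tendsto_F₃Hat hβ₀ hβ₁ hd ha hv
  have hU := (tendsto_speedHat hβ₀ hβ₁ hd ha hv h0).const_mul 2
  have hx1 : Tendsto (fun i => a i • (v i).1) l (𝓝 0) :=
    (continuous_fst.tendsto _).comp (tendsto_smul_data ha hv)
  have h1 := hU.smul (((hx1.const_add 1).const_mul (coeHol hβ₀ hβ₁)).const_mul
    (Hol.const (holderWeight β) 1))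
  have h := (h1.add h2).add h3
  have e : (2 * (1 / (4 * d))) • (Hol.const (holderWeight β) 1 * (coeHol hβ₀ hβ₁ * (1 + 0))) + 0
      + Hol.const (holderWeight β) (-(1 / (2 * d)) : ℂ) * coeHol hβ₀ hβ₁ = 0 := by
    ext w
    simp only [Hol.add_apply, Hol.mul_apply, Hol.smul_apply, Hol.const_apply, Hol.zero_apply,
      Hol.one_apply]
    have : (d : ℂ) ≠ 0 := by exact_mod_cast (by linarith : d ≠ 0)
    push_cast
    field_simp
    ring
  rw [e] at h
  refine h.congr fun i => ?_
  rw [gHat, FHat, tangentHat]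
  ring

end

/-! ### The curve of solutions -/

theorem F₂Hat_zero_xData {β : ℝ≥0} (hβ₀ : 0 < β) (hβ₁ : β < 1) {f : XSpace β} (hf : ‖f‖ < 1) : F₂Hat hβ₀ hβ₁ 0 (xData β f) = 0 :=
  (small_of_norm_lt hf).F₂Hat_zero hβ₀ hβ₁ f.2.2.2.1

theorem linEquiv_eq {β : ℝ≥0} (hβ₀ : 0 < β) (hβ₁ : β < 1) (f : XSpace β) :
    linEquiv hβ₀ hβ₁ f = yHatProj hβ₀ hβ₁ (-(xData β f).1) := by
  rw [map_neg]
  rfl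

/-- The limit statement along `pure ()`: a constant that tends to 0 is 0. -/
theorem Ghat_zero_left {β : ℝ≥0} (hβ₀ : 0 < β) (hβ₁ : β < 1) {d : ℝ} (hd : 2 < d) {f : XSpace β} (hf : ‖f‖ < 1) :
    Ghat d 0 f = linEquiv hβ₀ hβ₁ f := by
  have h := tendsto_gHat_add (l := pure ()) (a := fun _ => (0 : ℝ)) (v := fun _ => xData β f)
    hβ₀ hβ₁ hd tendsto_const_nhds (isBoundedUnder_const) (by
      simpa using F₂Hat_zero_xData hβ₀ hβ₁ hf)
  have h2 := tendsto_nhds_unique tendsto_const_nhds h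
  rw [Ghat_eq hβ₀ hβ₁ hf hd (by norm_num), linEquiv_eq hβ₀ hβ₁]
  exact congrArg _ (eq_neg_of_add_eq_zero_left h2)

theorem speed_zero_left {β : ℝ≥0} (hβ₀ : 0 < β) (hβ₁ : β < 1) {d : ℝ} (hd : 2 < d) {f : XSpace β} (hf : ‖f‖ < 1) :
    speed d 0 f = 1 / (4 * d) := by
  have h := tendsto_speedHat (l := pure ()) (a := fun _ => (0 : ℝ)) (v := fun _ => xData β f)
    hβ₀ hβ₁ hd tendsto_const_nhds (isBoundedUnder_const) (by
      simpa using F₂Hat_zero_xData hβ₀ hβ₁ hf)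
  have h2 := tendsto_nhds_unique tendsto_const_nhds h
  rw [speed_eq hβ₀ hβ₁ hf hd (by norm_num)]
  exact h2

theorem eventually_norm_lt_one {β : ℝ≥0} : ∀ᶠ f : XSpace β in 𝓝 0, ‖f‖ < 1 := by
  have h : Tendsto (fun f : XSpace β => ‖f‖) (𝓝 0) (𝓝 0) := by
    simpa using (continuous_norm (E := XSpace β)).tendsto 0
  exact h.eventually (gt_mem_nhds one_pos)

theorem hasFDerivAt_Ghat_zero {β : ℝ≥0} (hβ₀ : 0 < β) (hβ₁ : β < 1) {d : ℝ} (hd : 2 < d) :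
    HasFDerivAt (fun f : XSpace β => Ghat d 0 f)
      (linEquiv hβ₀ hβ₁ : XSpace β →L[ℝ] YHat β) 0 :=
  (linEquiv hβ₀ hβ₁).hasFDerivAt.congr_of_eventuallyEq
    (eventually_norm_lt_one.mono fun _ hf => Ghat_zero_left hβ₀ hβ₁ hd hf)

/-- The reduced functional, in its smooth form. -/
def phi {β : ℝ≥0} (hβ₀ : 0 < β) (hβ₁ : β < 1) (d : ℝ) (y : ℝ × XSpace β) : YHat β :=
  yHatProj hβ₀ hβ₁ (gHat hβ₀ hβ₁ d y.1 (xData β y.2))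

/-- Neighbourhoods of `0` in `ε`, uniformly in the unit ball. -/
def unifFilter (β : ℝ≥0) : Filter (ℝ × XSpace β) := 𝓝 0 ×ˢ 𝓟 {f | ‖f‖ < 1}

theorem eventually_unifFilter_norm {β : ℝ≥0} : ∀ᶠ p in unifFilter β, ‖p.2‖ < 1 :=
  eventually_prod_principal_iff.mpr (Eventually.of_forall fun _ _ hf => hf)

theorem eventually_abs_lt_half : ∀ᶠ ε : ℝ in 𝓝 0, |ε| < 1 / 2 := by
  have h : Tendsto (fun ε : ℝ => |ε|) (𝓝 0) (𝓝 0) := by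
    simpa using (continuous_abs (G := ℝ)).tendsto 0
  exact h.eventually (gt_mem_nhds (by norm_num))

theorem eventually_unifFilter_abs {β : ℝ≥0} : ∀ᶠ p in unifFilter β, |p.1| ≤ 1 / 2 := by
  refine eventually_prod_principal_iff.mpr ?_
  exact eventually_abs_lt_half.mono fun ε hε _ _ => hε.le

theorem unifFilter_bounded  {β : ℝ≥0} :
    IsBoundedUnder (· ≤ ·) (unifFilter β) fun p => ‖xData β p.2‖ := by
  refine ⟨‖xData β‖ * 1, eventually_map.mpr (eventually_unifFilter_norm.mono fun p hp => ?_)⟩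
  exact ((xData β).le_opNorm _).trans (mul_le_mul_of_nonneg_left hp.le (norm_nonneg _))

theorem tendsto_speed {β : ℝ≥0} (hβ₀ : 0 < β) (hβ₁ : β < 1) {d : ℝ} (hd : 2 < d) :
    Tendsto (fun p : ℝ × XSpace β => speed d p.1 p.2) (unifFilter β) (𝓝 (1 / (4 * d))) := by
  refine (tendsto_speedHat hβ₀ hβ₁ hd tendsto_fst unifFilter_bounded
    (eventually_unifFilter_norm.mono fun p hp => F₂Hat_zero_xData hβ₀ hβ₁ hp)).congr' ?_
  filter_upwards [eventually_unifFilter_norm, eventually_unifFilter_abs] with p hp hε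
  exact (speed_eq hβ₀ hβ₁ hp hd hε).symm

theorem tendsto_Ghat_sub {β : ℝ≥0} (hβ₀ : 0 < β) (hβ₁ : β < 1) {d : ℝ} (hd : 2 < d) :
    Tendsto (fun p : ℝ × XSpace β => Ghat d p.1 p.2 - linEquiv hβ₀ hβ₁ p.2) (unifFilter β)
      (𝓝 0) := by
  have h := ((yHatProj hβ₀ hβ₁).continuous.tendsto _).comp (tendsto_gHat_add hβ₀ hβ₁ hd
    tendsto_fst unifFilter_bounded
    (eventually_unifFilter_norm.mono fun p hp => F₂Hat_zero_xData hβ₀ hβ₁ hp))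
  rw [map_zero] at h
  refine h.congr' ?_
  filter_upwards [eventually_unifFilter_norm, eventually_unifFilter_abs] with p hp hε
  rw [Ghat_eq hβ₀ hβ₁ hp hd hε, linEquiv_eq, ← map_sub, sub_neg_eq_add]
  rfl

/-- The implicit function theorem gives uniqueness only for f near 0. At a zero of Ĝ(ε, ·) in the
unit ball, the linear part of f equals minus Ĝ(ε, f) minus that linear part up to sign, that is, the
uniformly small remainder; inverting the linear part shows that f is near 0. -/
theorem exists_curve {β : ℝ≥0} (hβ₀ : 0 < β) (hβ₁ : β < 1) {d : ℝ} (hd : 2 < d) : ∃ ψ : ℝ → XSpace β,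
    (∀ᶠ ε in 𝓝 0, ContDiffAt ℝ 1 ψ ε) ∧ Tendsto ψ (𝓝 0) (𝓝 0) ∧
    ∀ᶠ ε in 𝓝 0, ∀ f : XSpace β, ‖f‖ < 1 → (Ghat d ε f = 0 ↔ ψ ε = f) := by
  have := completeSpace_xSpace hβ₀ hβ₁
  have := completeSpace_yHat hβ₀ hβ₁
  have h01 : ‖(0 : XSpace β)‖ < 1 := by rw [norm_zero]; exact one_pos
  have hphi : ∀ {ε : ℝ} {f : XSpace β}, |ε| ≤ 1 / 2 → ‖f‖ < 1 → phi hβ₀ hβ₁ d (ε, f) = Ghat d ε f :=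
    fun hε hf => (Ghat_eq hβ₀ hβ₁ hf hd hε).symm
  have cdf : ContDiffAt ℝ 1 (phi hβ₀ hβ₁ d) ((0, 0) : ℝ × XSpace β) :=
    contDiffAt_yHatProj_gHat hβ₀ hβ₁ hd (by norm_num) h01
  have h0 : phi hβ₀ hβ₁ d ((0, 0) : ℝ × XSpace β) = 0 := by
    rw [hphi (by norm_num) h01, Ghat_zero_left hβ₀ hβ₁ hd h01, map_zero]
  have hfd : fderiv ℝ (phi hβ₀ hβ₁ d) (0, 0) ∘L .inr ℝ ℝ (XSpace β)
      = (linEquiv hβ₀ hβ₁ : XSpace β →L[ℝ] YHat β) := by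
    have h1 : HasFDerivAt (fun f : XSpace β => phi hβ₀ hβ₁ d (0, f))
        (fderiv ℝ (phi hβ₀ hβ₁ d) (0, 0) ∘L .inr ℝ ℝ (XSpace β)) 0 :=
      HasFDerivAt.comp (0 : XSpace β) (cdf.differentiableAt one_ne_zero).hasFDerivAt
        (hasFDerivAt_prodMk_right (0 : ℝ) (0 : XSpace β))
    refine h1.unique ((hasFDerivAt_Ghat_zero hβ₀ hβ₁ hd).congr_of_eventuallyEq ?_)
    exact eventually_norm_lt_one.mono fun f hf => hphi (by norm_num) hf
  have hinv : (fderiv ℝ (phi hβ₀ hβ₁ d) (0, 0) ∘L .inr ℝ ℝ (XSpace β)).IsInvertible :=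
    ⟨linEquiv hβ₀ hβ₁, hfd.symm⟩
  let ψ := cdf.implicitFunction one_ne_zero hinv
  have hψ : ContDiffAt ℝ 1 ψ 0 := cdf.contDiffAt_implicitFunction one_ne_zero hinv
  have hψ0 : ψ 0 = 0 := cdf.implicitFunction_apply_self one_ne_zero hinv
  have htend : Tendsto ψ (𝓝 0) (𝓝 0) := by
    have := hψ.continuousAt.tendsto
    rwa [hψ0] at this
  refine ⟨ψ, hψ.eventually (by simp), htend, ?_⟩
  have hiff := cdf.eventually_apply_eq_iff_implicitFunction one_ne_zero hinv
  rw [h0, nhds_prod_eq, eventually_prod_iff] at hiff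
  obtain ⟨pa, hpa, pb, hpb, hiff⟩ := hiff
  obtain ⟨r, hr, hrb⟩ := Metric.eventually_nhds_iff.mp hpb
  set C := ‖((linEquiv hβ₀ hβ₁).symm : YHat β →L[ℝ] XSpace β)‖
  have hC : 0 ≤ C := norm_nonneg _
  have hsmall := (tendsto_Ghat_sub hβ₀ hβ₁ hd).norm
  rw [norm_zero] at hsmall
  -- The threshold makes C times the remainder smaller than r, the radius in which the implicit
  -- function theorem applies.
  have hsmall' := hsmall.eventually (gt_mem_nhds (show 0 < r / (C + 1) by positivity))
  filter_upwards [eventually_prod_principal_iff.mp hsmall', hpa, htend.eventually hpb,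
    htend.eventually eventually_norm_lt_one, eventually_abs_lt_half] with ε h1 h2 h3 h4 h5 f hf
  have key : pb f → (Ghat d ε f = 0 ↔ ψ ε = f) := fun hb => by
    rw [← hphi h5.le hf]
    exact hiff h2 hb
  refine ⟨fun h => (key ?_).mp h, fun h => (key (h ▸ h3)).mpr h⟩
  have h6 := h1 f hf
  rw [h, zero_sub, norm_neg, lt_div_iff₀ (by positivity)] at h6
  refine hrb ?_
  rw [dist_zero_right]
  have h7 : ‖f‖ ≤ C * ‖linEquiv hβ₀ hβ₁ f‖ := by
    have := ((linEquiv hβ₀ hβ₁).symm : YHat β →L[ℝ] XSpace β).le_opNorm (linEquiv hβ₀ hβ₁ f)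
    simpa using this
  nlinarith [norm_nonneg (linEquiv hβ₀ hβ₁ f)]

/-! #### The circular patches do not translate -/

theorem circleMean_eq_circleIntegral (g : ℂ → ℂ) :
    circleMean (fun τ => g τ) = (2 * Real.pi * Complex.I)⁻¹ * ∮ z in C(0, 1), g z := by
  rw [circleMean, circleIntegral]
  congr 2
  funext θ
  rw [deriv_circleMap, circleMap_zero, Circle.coe_exp, smul_eq_mul]
  push_cast
  ring_nf

/-- Cauchy's formula at the centre: the denominator ε(z + w) - 2d has no zero in the closed unit
disc. -/
theorem F_zero_right {β : ℝ≥0} {d U ε : ℝ} (hd : 2 < d) (hε : |ε| ≤ 1 / 2) (w : Circle) :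
    F d U ε (0 : XSpace β) w = 2 * U * w + w / (ε * w - 2 * d) := by
  have h0 : ∀ w, (0 : XSpace β) w = 0 := fun _ => rfl
  have h1 : circleDeriv (0 : XSpace β) = fun _ => 0 := by
    funext w
    have e : ((0 : XSpace β) : Circle → ℂ) = 0 := rfl
    simp [circleDeriv, e]
  have hz : circleMean (fun _ => 0) = 0 := by simp [circleMean]
  have hden : ∀ z : ℂ, ‖z‖ ≤ 1 → (ε * (z + w) - 2 * d : ℂ) ≠ 0 := fun z hz h => by
    have h2 : ‖(ε * (z + w) : ℂ)‖ = 2 * d := by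
      rw [sub_eq_zero.mp h, norm_mul, Complex.norm_ofNat, Complex.norm_real,
        Real.norm_of_nonneg (by linarith)]
    rw [norm_mul, Complex.norm_real, Real.norm_eq_abs] at h2
    have h3 := norm_add_le z w
    rw [Circle.norm_coe] at h3
    nlinarith [abs_nonneg ε, norm_nonneg (z + w)]
  have h3 : circleMean (fun τ : Circle => (τ : ℂ)⁻¹ / (ε * ((τ : ℂ) + w) - 2 * d))
      = 1 / (ε * w - 2 * d) := by
    rw [circleMean_eq_circleIntegral fun z => z⁻¹ / (ε * (z + w) - 2 * d)]
    have hdiff : DiffContOnCl ℂ (fun z : ℂ => (ε * (z + w) - 2 * d : ℂ)⁻¹) (Metric.ball 0 1) := by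
      refine DifferentiableOn.diffContOnCl ?_
      rw [closure_ball _ one_ne_zero]
      intro z hz
      have : DifferentiableAt ℂ (fun z : ℂ => (ε * (z + w) - 2 * d : ℂ)) z := by fun_prop
      exact (this.inv (hden z (by simpa using hz))).differentiableWithinAt
    have h := hdiff.circleIntegral_sub_inv_smul (Metric.mem_ball_self one_pos)
    simp only [sub_zero, smul_eq_mul, zero_add] at h
    simp only [div_eq_mul_inv, one_mul]
    rw [h, ← mul_assoc, inv_mul_cancel₀, one_mul]
    simp [Real.pi_ne_zero]
  rw [F, F₁, F₂, F₃]
  simp only [h0, h1, mul_zero, add_zero, sub_zero, mul_one, star_zero, hz,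
    zero_div, zero_mul, Circle.coe_inv]
  rw [h3, one_div_mul_eq_div]

/-- Adding the equations at w and -w eliminates the speed. With w² = i the sum is -2εi/(4d² - ε²i),
which is not real unless ε = 0. -/
theorem Ghat_zero_right_ne_zero {β : ℝ≥0} (hβ₀ : 0 < β) (hβ₁ : β < 1) {d ε : ℝ} (hd : 2 < d)
    (hε : |ε| ≤ 1 / 2) (hε0 : ε ≠ 0) : Ghat d ε (0 : XSpace β) ≠ 0 := by
  intro h
  have h01 : ‖(0 : XSpace β)‖ < 1 := by rw [norm_zero]; exact one_pos
  have h1 : ∀ w : Circle, (F d (speed d ε (0 : XSpace β)) ε (0 : XSpace β) w).im = 0 := fun w => by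
    rw [← Ghat_apply hβ₀ hβ₁ h01 hd hε, h]
    rfl
  obtain ⟨w, hw⟩ : ∃ w : Circle, (w : ℂ) ^ 2 = Complex.I := by
    refine ⟨Circle.exp (Real.pi / 4), ?_⟩
    rw [← Circle.coe_pow, ← Circle.exp_nsmul, Circle.coe_exp]
    have : ((2 • (Real.pi / 4) : ℝ) : ℂ) = Real.pi / 2 := by
      rw [nsmul_eq_mul]
      push_cast
      ring
    rw [this, Complex.exp_pi_div_two_mul_I]
  have h2 := h1 w
  have h3 := h1 (-w)
  rw [F_zero_right hd hε] at h2 h3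
  set c : ℂ := 2 * d with hc
  have hden : ∀ z : Circle, (ε * (z : ℂ) - c) ≠ 0 := fun z h => by
    have h2 : ‖(ε * (z : ℂ))‖ = 2 * d := by
      rw [sub_eq_zero.mp h, hc, norm_mul, Complex.norm_ofNat, Complex.norm_real,
        Real.norm_of_nonneg (by linarith)]
    rw [norm_mul, Complex.norm_real, Real.norm_eq_abs, Circle.norm_coe] at h2
    linarith
  have hw1 := hden w
  have hw2 := hden (-w)
  rw [Circle.coe_neg] at hw2 h3
  set z : ℂ := w / (ε * w - c) + -w / (ε * -w - c) with hz
  have hzim : z.im = 0 := by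
    rw [hz, Complex.add_im]
    rw [Complex.add_im] at h2 h3
    have : (2 * (speed d ε (0 : XSpace β) : ℂ) * -w).im
        = -(2 * (speed d ε (0 : XSpace β) : ℂ) * w).im := by
      rw [mul_neg, Complex.neg_im]
    linarith
  have hz2 : z * (((4 * d ^ 2 : ℝ) : ℂ) - ((ε ^ 2 : ℝ) : ℂ) * Complex.I)
      = ((-2 * ε : ℝ) : ℂ) * Complex.I := by
    rw [← hw, hz, div_add_div _ _ hw1 hw2, div_mul_eq_mul_div, div_eq_iff (mul_ne_zero hw1 hw2), hc]
    push_cast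
    ring
  have hre := congrArg Complex.re hz2
  have him := congrArg Complex.im hz2
  simp only [Complex.mul_re, Complex.mul_im, Complex.sub_re, Complex.sub_im, Complex.ofReal_re,
    Complex.ofReal_im, Complex.I_re, Complex.I_im, hzim] at hre him
  have hzre : z.re = 0 := by
    have h4 : z.re * (4 * d ^ 2) = 0 := by linarith
    have h5 : (4 * d ^ 2 : ℝ) ≠ 0 := by positivity
    exact (mul_eq_zero.mp h4).resolve_right h5
  rw [hzre] at him
  exact hε0 (by linarith)

/-! ### Solutions have a Lipschitz derivative -/

/-- The functional without its principal part, as a function of `ε`, the rotation, the speed and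
the data. -/
def remainderHat {β : ℝ≥0} (hβ₀ : 0 < β) (hβ₁ : β < 1) (d : ℝ) (x : ℝ × ℂ × ℝ × Data β) :
    CHol β :=
  (2 * x.2.2.1) • (Hol.const _ x.2.1 * tangentHat hβ₀ hβ₁ (x.1 • x.2.2.2.1))
    -- The value of `F₂Hat` at ε = 0 vanishes on the data of small functions with only negative
    -- modes, but is not known to vanish on all of `Data`. Subtracting it changes nothing for
    -- solutions.
    + (F₂Hat hβ₀ hβ₁ x.1 x.2.2.2 - F₂Hat hβ₀ hβ₁ 0 x.2.2.2) + F₃Hat hβ₀ hβ₁ d x.1 x.2.1 x.2.2.2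

theorem contDiffAt_remainderHat {β : ℝ≥0} (hβ₀ : 0 < β) (hβ₁ : β < 1) {d : ℝ} (hd : 2 < d)
    (s : ℂ) (U : ℝ) (v : Data β) : ContDiffAt ℝ 1 (remainderHat hβ₀ hβ₁ d) (0, s, U, v) := by
  have h1 : ContDiffAt ℝ 1 (fun x : ℝ × ℂ × ℝ × Data β => x.1) (0, s, U, v) := contDiffAt_fst
  have h2 : ContDiffAt ℝ 1 (fun x : ℝ × ℂ × ℝ × Data β => x.2.1) (0, s, U, v) :=
    contDiffAt_snd.fst
  have h3 : ContDiffAt ℝ 1 (fun x : ℝ × ℂ × ℝ × Data β => x.2.2.1) (0, s, U, v) :=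
    contDiffAt_snd.snd.fst
  have h4 : ContDiffAt ℝ 1 (fun x : ℝ × ℂ × ℝ × Data β => x.2.2.2) (0, s, U, v) :=
    contDiffAt_snd.snd.snd
  have hc := (Hol.const (holderWeight β)).contDiff.contDiffAt.comp (0, s, U, v) h2
  unfold remainderHat
  exact ((contDiffAt_const.mul h3).smul (hc.mul (contDiffAt_tangentHat hβ₀ hβ₁
    (h1.smul h4.fst)))).add
    ((contDiffAt_F₂Hat hβ₀ hβ₁ h1 h4 (isUnit_one_add_zero_smul _)).sub
      (contDiffAt_F₂Hat hβ₀ hβ₁ contDiffAt_const h4 (isUnit_one_add_zero_smul _))) |>.add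
    (contDiffAt_F₃Hat hβ₀ hβ₁ d h1 h2 h4 (isUnit_pairDen_zero hd _ _))

/-- At ε = 0 every term that sees the data disappears. Hence the derivative in the data vanishes
there, which is what lets a fixed point of comparison absorb it later. -/
theorem remainderHat_zero {β : ℝ≥0} (hβ₀ : 0 < β) (hβ₁ : β < 1) {d : ℝ} (hd : 2 < d)
    (s : ℂ) (U : ℝ) (v w : Data β) :
    remainderHat hβ₀ hβ₁ d (0, s, U, v) = remainderHat hβ₀ hβ₁ d (0, s, U, w) := by
  simp only [remainderHat, sub_self, F₃Hat_zero hβ₀ hβ₁ hd, zero_smul]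

/-- Strict differentiability at (0, 1, U₀, 0): the derivative sees the increment of s but not that
of the data, so the latter comes only with an arbitrarily small constant c. -/
theorem remainderHat_bound {β : ℝ≥0} (hβ₀ : 0 < β) (hβ₁ : β < 1) {d : ℝ} (hd : 2 < d) (U₀ : ℝ)
    {c : ℝ} (hc : 0 < c) : ∃ C δ : ℝ, 0 ≤ C ∧ 0 < δ ∧ ∀ (ε : ℝ) (s : ℂ) (U : ℝ) (v v' : Data β),
      |ε| < δ → ‖s - 1‖ < δ → |U - U₀| < δ → ‖v‖ < δ → ‖v'‖ < δ →
      ‖remainderHat hβ₀ hβ₁ d (ε, s, U, v) - remainderHat hβ₀ hβ₁ d (ε, 1, U, v')‖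
        ≤ C * ‖s - 1‖ + c * ‖v - v'‖ := by
  set x₀ : ℝ × ℂ × ℝ × Data β := (0, 1, U₀, 0)
  have hR := (contDiffAt_remainderHat hβ₀ hβ₁ hd 1 U₀ (0 : Data β)).hasStrictFDerivAt one_ne_zero
  set D := fderiv ℝ (remainderHat hβ₀ hβ₁ d) x₀
  have hD : ∀ v : Data β, D (0, 0, 0, v) = 0 := by
    have h1 : HasFDerivAt (fun v : Data β => ((0, 1, U₀, v) : ℝ × ℂ × ℝ × Data β))
        (.inr ℝ ℝ _ ∘L .inr ℝ ℂ _ ∘L .inr ℝ ℝ _) 0 :=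
      (hasFDerivAt_prodMk_right (0 : ℝ) _).comp (0 : Data β)
        ((hasFDerivAt_prodMk_right (1 : ℂ) _).comp (0 : Data β)
          (hasFDerivAt_prodMk_right U₀ (0 : Data β)))
    have h2 := HasFDerivAt.comp (0 : Data β) hR.hasFDerivAt h1
    have h3 : HasFDerivAt (remainderHat hβ₀ hβ₁ d ∘ fun v : Data β =>
        ((0, 1, U₀, v) : ℝ × ℂ × ℝ × Data β)) (0 : Data β →L[ℝ] CHol β) 0 :=
      (hasFDerivAt_const (remainderHat hβ₀ hβ₁ d x₀) (0 : Data β)).congr_of_eventuallyEq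
        (Eventually.of_forall fun v => remainderHat_zero hβ₀ hβ₁ hd 1 U₀ v 0)
    intro v
    exact congrArg (fun T : Data β →L[ℝ] CHol β => T v) (h2.unique h3)
  have ho := hR.isLittleO.def hc
  obtain ⟨δ, hδ, hδb⟩ := Metric.eventually_nhds_iff.mp ho
  refine ⟨‖D‖ + c, δ, by positivity, hδ, fun ε s U v v' hε hs hU hv hv' => ?_⟩
  have hdist : ∀ (s : ℂ) (v : Data β), ‖s - 1‖ < δ → ‖v‖ < δ →
      dist ((ε, s, U, v) : ℝ × ℂ × ℝ × Data β) x₀ < δ := fun s v hs hv => by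
    have e : ((ε, s, U, v) : ℝ × ℂ × ℝ × Data β) - x₀ = (ε, s - 1, U - U₀, v) := by
      simp only [x₀, Prod.mk_sub_mk, sub_zero]
    rw [dist_eq_norm, e, Prod.norm_mk, Prod.norm_mk, Prod.norm_mk, Real.norm_eq_abs,
      Real.norm_eq_abs]
    exact max_lt hε (max_lt hs (max_lt hU hv))
  have hb := @hδb (((ε, s, U, v), (ε, 1, U, v')) : (ℝ × ℂ × ℝ × Data β) × (ℝ × ℂ × ℝ × Data β))
    (max_lt (hdist s v hs hv) (hdist 1 v' (by rwa [sub_self, norm_zero]) hv'))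
  have e : ((ε, s, U, v) : ℝ × ℂ × ℝ × Data β) - (ε, 1, U, v') = (0, s - 1, 0, v - v') := by
    simp only [Prod.mk_sub_mk, sub_self]
  simp only [e] at hb
  have e2 : D (0, s - 1, 0, v - v') = D (0, s - 1, 0, 0) := by
    have : ((0, s - 1, 0, v - v') : ℝ × ℂ × ℝ × Data β) = (0, s - 1, 0, 0) + (0, 0, 0, v - v') := by
      simp only [Prod.mk_add_mk, add_zero, zero_add]
    rw [this, map_add, hD, add_zero]
  have h5 : ‖D (0, s - 1, 0, 0)‖ ≤ ‖D‖ * ‖s - 1‖ := by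
    refine (D.le_opNorm _).trans (le_of_eq ?_)
    simp [Prod.norm_mk]
  have h6 : ‖((0, s - 1, 0, v - v') : ℝ × ℂ × ℝ × Data β)‖ ≤ ‖s - 1‖ + ‖v - v'‖ := by
    rw [Prod.norm_mk, Prod.norm_mk, Prod.norm_mk, norm_zero]
    have := norm_nonneg (s - 1)
    have := norm_nonneg (v - v')
    simp only [max_le_iff]
    refine ⟨?_, ?_, ?_, ?_⟩ <;> linarith
  have e3 : ((0 : ℝ), s - 1, (0 : ℝ), v - v')
      = ((0, s - 1, 0, v - v') : ℝ × ℂ × ℝ × Data β) := rfl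
  rw [e2] at hb
  set X := remainderHat hβ₀ hβ₁ d (ε, s, U, v) - remainderHat hβ₀ hβ₁ d (ε, 1, U, v')
  calc ‖X‖ ≤ ‖X - D (0, s - 1, 0, 0)‖ + ‖D (0, s - 1, 0, 0)‖ := by
        simpa using norm_add_le (X - D (0, s - 1, 0, 0)) (D (0, s - 1, 0, 0))
    _ ≤ c * (‖s - 1‖ + ‖v - v'‖) + ‖D‖ * ‖s - 1‖ :=
        add_le_add (hb.trans (mul_le_mul_of_nonneg_left h6 hc.le)) h5
    _ = _ := by ring

/-- Let g be the rotation of f by s minus f. The two equations give Im g' as the imaginary part of a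
difference of remainders; since g has only negative modes, g' is recovered from Im g'. The
contribution of the data of g is at most half of ‖g'‖ and is absorbed, which leaves a bound by |s -
1|. -/
theorem exists_lipschitz_deriv {β : ℝ≥0} (hβ₀ : 0 < β) (hβ₁ : β < 1) {d : ℝ} (hd : 2 < d)
    (U₀ : ℝ) : ∃ Λ δ : ℝ, 0 ≤ Λ ∧ 0 < δ ∧ ∀ (ε : ℝ) (f : XSpace β), |ε| < δ → ‖f‖ < δ →
      |speed d ε f - U₀| < δ → Ghat d ε f = 0 →
      ∀ τ w, ‖circleDeriv f τ - circleDeriv f w‖ ≤ Λ * dist τ w := by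
  set K := ‖Hol.const (holderWeight β) (-2 * Complex.I)‖ * (1 / β + max (privalovConst β) 0)
  have hK : 0 ≤ K := by positivity
  set M := ‖imHol β‖
  have hM : 0 ≤ M := norm_nonneg _
  obtain ⟨C, δ, hC, hδ, hb⟩ := remainderHat_bound hβ₀ hβ₁ hd U₀
    -- The data of g are bounded by 25‖g'‖, so this c makes their contribution at most ‖g'‖/2.
    (c := 1 / (50 * (K * M + 1))) (by positivity)
  -- The term 2/δ covers rotations with |s - 1| ≥ δ, where |f'| ≤ 1 is enough. The bound δ/26 keeps
  -- the data, at most 25‖f'‖, below δ.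
  refine ⟨2 * (K * M * C) + 2 / δ, min (1 / 2) (δ / 26), by positivity, by positivity,
    fun ε f hε hf hU hG τ w => ?_⟩
  have hε1 : |ε| ≤ 1 / 2 := hε.le.trans (min_le_left _ _)
  have hε2 : |ε| < δ := by linarith [hε.trans_le (min_le_right _ _)]
  have hf1 : ‖f‖ < 1 := by linarith [hf.trans_le (min_le_left _ _)]
  have hf2 : ‖f‖ < δ / 26 := hf.trans_le (min_le_right _ _)
  have hU2 : |speed d ε f - U₀| < δ := by linarith [hU.trans_le (min_le_right _ _)]
  have hfn := norm_derivHol_le f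
  have hsm := small_of_norm_lt hf1
  obtain ⟨s, rfl⟩ : ∃ s, s * w = τ := ⟨τ * w⁻¹, by simp⟩
  have hdist : dist (s * w) w = ‖(s : ℂ) - 1‖ := by
    rw [dist_eq, Circle.coe_mul, ← sub_one_mul, norm_mul, Circle.norm_coe, mul_one]
  rw [hdist]
  rcases le_or_gt δ ‖(s : ℂ) - 1‖ with hs | hs
  · have h1 : ‖circleDeriv f (s * w) - circleDeriv f w‖ ≤ 2 := by
      refine (norm_sub_le _ _).trans ?_
      have a1 : ‖circleDeriv f (s * w)‖ ≤ 1 := hsm.2 _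
      have a2 : ‖circleDeriv f w‖ ≤ 1 := hsm.2 _
      linarith
    have h2 : 2 ≤ 2 / δ * ‖(s : ℂ) - 1‖ := by
      rw [div_mul_eq_mul_div, le_div_iff₀ hδ]
      linarith
    have h3 : 0 ≤ 2 * (K * M * C) * ‖(s : ℂ) - 1‖ := by positivity
    linarith
  set U := speed d ε f
  have hcoef : ∀ s n, 0 ≤ n → circleCoeff (rotate s (xIncl β f)).1 n = 0 := fun s n hn => by
    rw [circleCoeff_rotate, xIncl_coe, f.2.2.2.1 n hn, mul_zero]
  have hR : ∀ s : Circle, imHol β (dataLin β (rotate s (xIncl β f))).1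
      = imHol β (remainderHat hβ₀ hβ₁ d (ε, (s : ℂ), U, dataLin β (rotate s (xIncl β f)))) := by
    intro s
    have h1 : imHol β (FHat hβ₀ hβ₁ d U ε s (dataLin β (rotate s (xIncl β f)))) = 0 := by
      ext z
      rw [imHol_apply, FHat_rotate hβ₀ hβ₁ hsm hd hε1, ← xData_apply, F_eq hβ₀ hβ₁ hf1 hd hε1,
        ← Ghat_apply hβ₀ hβ₁ hf1 hd hε1, hG]
      rfl
    have h2 : FHat hβ₀ hβ₁ d U ε s (dataLin β (rotate s (xIncl β f)))
        = remainderHat hβ₀ hβ₁ d (ε, (s : ℂ), U, dataLin β (rotate s (xIncl β f)))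
          - (dataLin β (rotate s (xIncl β f))).1 := by
      rw [FHat, remainderHat, (hsm.rotate s).F₂Hat_zero hβ₀ hβ₁ (hcoef s)]
      ring
    rw [h2, map_sub, sub_eq_zero] at h1
    exact h1.symm
  set g := rotate s (xIncl β f) - rotate 1 (xIncl β f) with hg
  have hgc : ∀ n, 0 ≤ n → circleCoeff g.1 n = 0 := fun n hn => by
    have e : g.1 = fun w => (rotate s (xIncl β f)).1 w - (rotate 1 (xIncl β f)).1 w := rfl
    rw [e, circleCoeff_sub (rotate s (xIncl β f)).2.1.1 (rotate 1 (xIncl β f)).2.1.1,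
      hcoef s n hn, hcoef 1 n hn, sub_zero]
  have hdata : dataLin β g = dataLin β (rotate s (xIncl β f)) - dataLin β (rotate 1 (xIncl β f)) :=
    map_sub _ _ _
  have hv : ∀ s, ‖dataLin β (rotate s (xIncl β f))‖ < δ := fun s => by
    have h1 := norm_dataLin_le_of_circleCoeff_zero _ (hcoef s 0 le_rfl)
    have h2 := norm_derivHol_rotate_le s (xIncl β f)
    linarith
  have hbd := hb ε s U _ _ hε2 hs hU2 (hv s) (hv 1)
  rw [← hdata] at hbd
  have h1 : ‖dataLin β g‖ ≤ 25 * ‖derivHol g‖ := norm_dataLin_le_of_circleCoeff_zero g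
    (hgc 0 le_rfl)
  have h2 : ‖derivHol g‖ ≤ K * ‖imHol β (derivHol g)‖ := by
    refine norm_le_norm_imHol hβ₀ hβ₁ _ fun n hn => ?_
    have e : circleCoeff (derivHol g) n = circleCoeff (circleDeriv g.1) n := rfl
    rw [e, circleCoeff_circleDeriv g.2.1, hgc _ (by omega), mul_zero]
  have h3 : imHol β (derivHol g) = imHol β
      (remainderHat hβ₀ hβ₁ d (ε, (s : ℂ), U, dataLin β (rotate s (xIncl β f)))
        - remainderHat hβ₀ hβ₁ d (ε, 1, U, dataLin β (rotate 1 (xIncl β f)))) := by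
    have e : derivHol g = (dataLin β (rotate s (xIncl β f))).1
        - (dataLin β (rotate 1 (xIncl β f))).1 := congrArg Prod.fst hdata
    rw [e, map_sub, map_sub, hR s, hR 1, Circle.coe_one]
  have h4 : ‖imHol β (derivHol g)‖
      ≤ M * (C * ‖(s : ℂ) - 1‖ + 1 / (50 * (K * M + 1)) * (25 * ‖derivHol g‖)) := by
    rw [h3]
    refine ((imHol β).le_opNorm _).trans (mul_le_mul_of_nonneg_left (hbd.trans ?_) hM)
    gcongr
  have h5 : K * (M * (1 / (50 * (K * M + 1)) * (25 * ‖derivHol g‖))) ≤ 1 / 2 * ‖derivHol g‖ := by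
    have e : K * (M * (1 / (50 * (K * M + 1)) * (25 * ‖derivHol g‖)))
        = (K * M) / (K * M + 1) * (1 / 2 * ‖derivHol g‖) := by
      field_simp
      ring
    rw [e]
    refine mul_le_of_le_one_left (by positivity) ?_
    rw [div_le_one (by positivity)]
    linarith
  have h6 : ‖derivHol g‖ ≤ 2 * (K * M * C) * ‖(s : ℂ) - 1‖ := by
    have h7 := h2.trans (mul_le_mul_of_nonneg_left h4 hK)
    rw [mul_add, mul_add] at h7
    nlinarith
  have h8 : circleDeriv f (s * w) - circleDeriv f w = derivHol g w := by
    have e : derivHol g w = circleDeriv (rotate s (xIncl β f)).1 w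
        - circleDeriv (rotate 1 (xIncl β f)).1 w :=
      congrArg (fun v : Data β => v.1 w) hdata
    rw [e, deriv_rotate_apply, deriv_rotate_apply, one_mul]
    rfl
  rw [h8]
  have h9 : 0 ≤ 2 / δ * ‖(s : ℂ) - 1‖ := by positivity
  linarith [(derivHol g).norm_apply_le w]

/-! ### Curves with supporting lines -/

/-- The curve `γ` lies strictly on one side of each of the lines through `γ w` with normal `n w`,
and is a polar graph about `0`. -/
structure SupportedCurve (γ n : Circle → ℂ) : Prop where
  continuous : Continuous γ
  continuous_normal : Continuous n
  support : ∀ w τ, τ ≠ w → inner ℝ (n w) (γ τ - γ w) < 0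
  pos : ∀ w, 0 < inner ℝ (n w) (γ w)
  -- This condition separates inside from outside without the Jordan curve theorem: r < 1 is inside,
  -- r > 1 outside.
  polar : ∀ z : ℂ, ∃ r : ℝ, 0 ≤ r ∧ ∃ w, z = r • γ w

/-- The intersection of the open half-planes bounded by the supporting lines. -/
def insideSet (γ n : Circle → ℂ) : Set ℂ := {z | ∀ w, inner ℝ (n w) (z - γ w) < 0}

namespace SupportedCurve

variable {γ n : Circle → ℂ}

theorem injective (h : SupportedCurve γ n) : Function.Injective γ := by
  intro τ w e
  by_contra hne
  have := h.support w τ hne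
  rw [e, sub_self, inner_zero_right] at this
  exact lt_irrefl _ this

theorem support_le (h : SupportedCurve γ n) (w τ : Circle) : inner ℝ (n w) (γ τ - γ w) ≤ 0 := by
  rcases eq_or_ne τ w with rfl | hne
  · rw [sub_self, inner_zero_right]
  · exact (h.support w τ hne).le

theorem inner_smul_sub (r : ℝ) (w τ : Circle) :
    inner ℝ (n w) (r • γ τ - γ w)
      = r * inner ℝ (n w) (γ τ - γ w) - (1 - r) * inner ℝ (n w) (γ w) := by
  simp only [inner_sub_right, real_inner_smul_right]
  ring

theorem smul_mem (h : SupportedCurve γ n) {r : ℝ} (hr : 0 ≤ r) (hr1 : r < 1) (τ : Circle) :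
    r • γ τ ∈ insideSet γ n := fun w => by
  rw [inner_smul_sub]
  have h1 := h.support_le w τ
  have h2 := h.pos w
  nlinarith

theorem inner_smul_pos (h : SupportedCurve γ n) {r : ℝ} (hr1 : 1 < r) (w : Circle) :
    0 < inner ℝ (n w) (r • γ w - γ w) := by
  rw [inner_smul_sub, sub_self, inner_zero_right]
  nlinarith [h.pos w]

theorem mem_inside_or (h : SupportedCurve γ n) (z : ℂ) :
    z ∈ insideSet γ n ∨ z ∈ Set.range γ ∨ ∃ r : ℝ, 1 < r ∧ ∃ w, z = r • γ w := by
  obtain ⟨r, hr, w, rfl⟩ := h.polar z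
  rcases lt_trichotomy r 1 with h1 | h1 | h1
  · exact Or.inl (h.smul_mem hr h1 w)
  · exact Or.inr (Or.inl ⟨w, by rw [h1, one_smul]⟩)
  · exact Or.inr (Or.inr ⟨r, h1, w, rfl⟩)

theorem notMem_range (z : ℂ) (hz : z ∈ insideSet γ n) : z ∉ Set.range γ := by
  rintro ⟨w, rfl⟩
  have := hz w
  rw [sub_self, inner_zero_right] at this
  exact lt_irrefl _ this

/-- The complement is the projection of a closed set along the compact circle, hence closed. -/
theorem isOpen_inside (h : SupportedCurve γ n) : IsOpen (insideSet γ n) := by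
  have h1 : IsClosed {p : Circle × ℂ | 0 ≤ inner ℝ (n p.1) (p.2 - γ p.1)} :=
    isClosed_le continuous_const ((h.continuous_normal.comp continuous_fst).inner
      (continuous_snd.sub (h.continuous.comp continuous_fst)))
  have h2 := isClosedMap_snd_of_compactSpace _ h1
  have e : insideSet γ n = (Prod.snd '' {p : Circle × ℂ | 0 ≤ inner ℝ (n p.1) (p.2 - γ p.1)})ᶜ := by
    ext z
    constructor
    · rintro hz ⟨⟨w, z'⟩, hp, rfl⟩
      exact not_lt.mpr hp (hz w)
    · intro hz w
      by_contra hw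
      exact hz ⟨(w, z), not_lt.mp hw, rfl⟩
  rw [e]
  exact h2.isOpen_compl

theorem convex_inside : Convex ℝ (insideSet γ n) := by
  intro x hx y hy a b ha hb hab w
  have e : a • x + b • y - γ w = a • (x - γ w) + b • (y - γ w) := by
    rw [smul_sub, smul_sub, ← add_sub_add_comm, ← add_smul, hab, one_smul]
  rw [e, inner_add_right, real_inner_smul_right, real_inner_smul_right]
  rcases ha.eq_or_lt with rfl | ha
  · rw [zero_add] at hab
    rw [hab, zero_mul, zero_add, one_mul]
    exact hy w
  · nlinarith [hx w, hy w]

theorem zero_mem (h : SupportedCurve γ n) : (0 : ℂ) ∈ insideSet γ n := by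
  have := h.smul_mem le_rfl one_pos 1
  rwa [zero_smul] at this

theorem closure_inside (h : SupportedCurve γ n) :
    closure (insideSet γ n) = insideSet γ n ∪ Set.range γ := by
  refine Set.Subset.antisymm ?_ (Set.union_subset subset_closure ?_)
  · have h1 : closure (insideSet γ n) ⊆ {z | ∀ w, inner ℝ (n w) (z - γ w) ≤ 0} := by
      refine closure_minimal (fun z hz w => (hz w).le) ?_
      rw [Set.ofPred_forall]
      exact isClosed_iInter fun w => isClosed_le (continuous_const.inner
        (continuous_id.sub continuous_const)) continuous_const
    intro z hz
    rcases h.mem_inside_or z with h2 | h2 | ⟨r, hr, w, rfl⟩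
    · exact Or.inl h2
    · exact Or.inr h2
    · exact absurd (h1 hz w) (not_le.mpr (h.inner_smul_pos hr w))
  · rintro _ ⟨w, rfl⟩
    have h2 : Tendsto (fun r : ℝ => r • γ w) (𝓝[<] 1) (𝓝 ((1 : ℝ) • γ w)) :=
      ((continuous_id.smul continuous_const).tendsto 1).mono_left nhdsWithin_le_nhds
    rw [one_smul] at h2
    refine mem_closure_of_tendsto h2 ?_
    have h3 : ∀ᶠ r : ℝ in 𝓝[<] 1, 0 < r := nhdsWithin_le_nhds (lt_mem_nhds one_pos)
    filter_upwards [h3, self_mem_nhdsWithin] with r hr hr1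
    exact h.smul_mem hr.le hr1 w

theorem frontier_inside (h : SupportedCurve γ n) : frontier (insideSet γ n) = Set.range γ := by
  rw [frontier, h.isOpen_inside.interior_eq, h.closure_inside, Set.union_sdiff_left]
  refine Set.Subset.antisymm Set.sdiff_subset fun z hz => ⟨hz, fun hz' => notMem_range z hz' hz⟩

theorem isBounded_inside (h : SupportedCurve γ n) : Bornology.IsBounded (insideSet γ n) := by
  obtain ⟨R, hR⟩ := (isCompact_range h.continuous).isBounded.subset_closedBall 0
  refine (Metric.isBounded_closedBall (x := (0 : ℂ)) (r := R)).subset fun z hz => ?_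
  obtain ⟨r, hr, w, rfl⟩ := h.polar z
  have hr1 : r ≤ 1 := not_lt.mp fun h1 => lt_asymm (hz w) (h.inner_smul_pos h1 w)
  have h2 := hR ⟨w, rfl⟩
  rw [mem_closedBall_zero_iff] at h2 ⊢
  rw [norm_smul, Real.norm_of_nonneg hr]
  exact (mul_le_of_le_one_left (norm_nonneg _) hr1).trans h2

/-- An outside point rγ(w), r > 1, escapes to infinity along its ray without meeting the curve. A
component of the complement that contains an inside point stays inside, because off the curve inside
and outside are disjoint open sets. -/
theorem enclosed_eq (h : SupportedCurve γ n) : enclosed γ = insideSet γ n := by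
  ext z
  constructor
  · rintro ⟨hz, hb⟩
    rcases h.mem_inside_or z with h2 | h2 | ⟨r, hr, w, rfl⟩
    · exact h2
    · exact absurd h2 hz
    · exfalso
      have hray : (fun t : ℝ => t • γ w) '' Set.Ici r
          ⊆ connectedComponentIn (Set.range γ)ᶜ (r • γ w) := by
        refine IsPreconnected.subset_connectedComponentIn ?_ ⟨r, Set.self_mem_Ici, rfl⟩ ?_
        · exact (convex_Ici r).isPreconnected.image _
            (continuous_id.smul continuous_const).continuousOn
        · rintro _ ⟨t, ht, rfl⟩ ⟨τ, hτ⟩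
          have h3 := h.inner_smul_pos (hr.trans_le ht) w
          change γ τ = t • γ w at hτ
          rw [← hτ] at h3
          exact not_lt.mpr (h.support_le w τ) h3
      obtain ⟨R, hR⟩ := (hb.subset hray).subset_closedBall 0
      have hγ : γ w ≠ 0 := fun e => by
        have := h.pos w
        rw [e, inner_zero_right] at this
        exact lt_irrefl _ this
      have hγ' : 0 < ‖γ w‖ := norm_pos_iff.mpr hγ
      have h4 := hR ⟨max r ((|R| + 1) / ‖γ w‖), Set.mem_Ici.mpr (le_max_left _ _), rfl⟩
      rw [mem_closedBall_zero_iff] at h4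
      simp only [norm_smul] at h4
      have h5 : (|R| + 1) / ‖γ w‖ ≤ ‖max r ((|R| + 1) / ‖γ w‖)‖ :=
        (le_max_right _ _).trans (Real.le_norm_self _)
      rw [div_le_iff₀ hγ'] at h5
      linarith [le_abs_self R]
  · intro hz
    refine ⟨notMem_range z hz, h.isBounded_inside.subset ?_⟩
    have hext : IsOpen {z | ∃ w, 0 < inner ℝ (n w) (z - γ w)} := by
      rw [Set.ofPred_exists]
      exact isOpen_iUnion fun w => isOpen_lt continuous_const
        (continuous_const.inner (continuous_id.sub continuous_const))
    refine isPreconnected_connectedComponentIn.subset_left_of_subset_union h.isOpen_inside hext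
      ?_ ?_ ⟨z, mem_connectedComponentIn (notMem_range z hz), hz⟩
    · refine Set.disjoint_left.mpr fun x hx ⟨w, hw⟩ => lt_asymm hw (hx w)
    · intro x hx
      have hx' := connectedComponentIn_subset _ _ hx
      rcases h.mem_inside_or x with h2 | h2 | ⟨r, hr, w, rfl⟩
      · exact Or.inl h2
      · exact absurd h2 hx'
      · exact Or.inr ⟨w, h.inner_smul_pos hr w⟩

theorem eq_of_inner_eq_zero (h : SupportedCurve γ n) {z : ℂ} (hz : z ∈ closure (insideSet γ n))
    {w : Circle} (hw : 0 ≤ inner ℝ (n w) (z - γ w)) : z = γ w := by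
  rw [h.closure_inside] at hz
  rcases hz with hz | ⟨τ, rfl⟩
  · exact absurd (hz w) (not_lt.mpr hw)
  · by_contra hne
    exact not_lt.mpr hw (h.support w τ fun e => hne (by rw [e]))

theorem inner_le_of_mem_closure (h : SupportedCurve γ n) {z : ℂ}
    (hz : z ∈ closure (insideSet γ n)) (w : Circle) : inner ℝ (n w) (z - γ w) ≤ 0 := by
  by_contra hlt
  rw [h.eq_of_inner_eq_zero hz (not_le.mp hlt).le, sub_self, inner_zero_right] at hlt
  exact hlt le_rfl

/-- If a point strictly between x and y reached a supporting line, both endpoints would lie on that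
line, and each would equal its only contact point. -/
theorem segment_mem (h : SupportedCurve γ n) {x y : ℂ} (hx : x ∈ closure (insideSet γ n))
    (hy : y ∈ closure (insideSet γ n)) (hxy : x ≠ y) {a b : ℝ} (ha : 0 < a) (hb : 0 < b)
    (hab : a + b = 1) : a • x + b • y ∈ insideSet γ n := by
  intro w
  by_contra hlt
  rw [not_lt] at hlt
  have e : a • x + b • y - γ w = a • (x - γ w) + b • (y - γ w) := by
    rw [smul_sub, smul_sub, ← add_sub_add_comm, ← add_smul, hab, one_smul]
  rw [e, inner_add_right, real_inner_smul_right, real_inner_smul_right] at hlt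
  have h1 := h.inner_le_of_mem_closure hx w
  have h2 := h.inner_le_of_mem_closure hy w
  have h3 : 0 ≤ inner ℝ (n w) (x - γ w) := by
    by_contra h3
    nlinarith [not_le.mp h3]
  have h4 : 0 ≤ inner ℝ (n w) (y - γ w) := by
    by_contra h4
    nlinarith [not_le.mp h4]
  exact hxy ((h.eq_of_inner_eq_zero hx h3).trans (h.eq_of_inner_eq_zero hy h4).symm)

theorem isStrictlyConvexDomain (h : SupportedCurve γ n) :
    IsStrictlyConvexDomain (insideSet γ n) := by
  refine ⟨⟨0, h.zero_mem⟩, h.isOpen_inside, convex_inside, ?_⟩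
  intro x hx y hy hxy a b ha hb hab
  exact interior_mono subset_closure (by
    rw [h.isOpen_inside.interior_eq]
    exact h.segment_mem hx hy hxy ha hb hab)

/-- Every interior point lies on a unique chord issuing from a given point of the curve. -/
theorem exists_chord (h : SupportedCurve γ n) (w : Circle) {z : ℂ} (hz : z ∈ insideSet γ n) :
    ∃ r : ℝ, 0 < r ∧ r < 1 ∧ ∃ τ, τ ≠ w ∧ z = γ w + r • (γ τ - γ w) := by
  have hne : z - γ w ≠ 0 := fun e => notMem_range z hz ⟨w, (sub_eq_zero.mp e).symm⟩
  have hn : 0 < ‖z - γ w‖ := norm_pos_iff.mpr hne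
  let p : ℝ → ℂ := fun t => γ w + t • (z - γ w)
  have hp : Continuous p := continuous_const.add (continuous_id.smul continuous_const)
  have hp1 : p 1 = z := by simp [p]
  obtain ⟨R, hR⟩ := h.isBounded_inside.subset_closedBall (γ w)
  have hbig : ∀ t : ℝ, |R| / ‖z - γ w‖ < t → p t ∉ insideSet γ n := fun t ht hm => by
    have h1 := hR hm
    rw [mem_closedBall_iff_norm] at h1
    have h2 : p t - γ w = t • (z - γ w) := by simp [p]
    rw [h2, norm_smul] at h1
    rw [div_lt_iff₀ hn] at ht
    have h3 : t * ‖z - γ w‖ ≤ ‖t‖ * ‖z - γ w‖ :=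
      mul_le_mul_of_nonneg_right (Real.le_norm_self _) hn.le
    linarith [le_abs_self R]
  -- If the half-line beyond z missed the curve, connectedness would keep it in the bounded inside.
  obtain ⟨t, ht1, ht⟩ : ∃ t, 1 < t ∧ p t ∈ Set.range γ := by
    by_contra hcon
    push Not at hcon
    have hsub : p '' Set.Ici 1 ⊆ insideSet γ n ∪ {z | ∃ w, 0 < inner ℝ (n w) (z - γ w)} := by
      rintro _ ⟨t, ht, rfl⟩
      rcases h.mem_inside_or (p t) with h2 | h2 | ⟨r, hr, w', e⟩
      · exact Or.inl h2
      · rcases (show (1 : ℝ) ≤ t from ht).eq_or_lt with rfl | ht'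
        · rw [hp1]
          exact Or.inl hz
        · exact absurd h2 (hcon t ht')
      · refine Or.inr ⟨w', ?_⟩
        rw [e]
        exact h.inner_smul_pos hr w'
    have hext : IsOpen {z | ∃ w, 0 < inner ℝ (n w) (z - γ w)} := by
      rw [Set.ofPred_exists]
      exact isOpen_iUnion fun w => isOpen_lt continuous_const
        (continuous_const.inner (continuous_id.sub continuous_const))
    have hpre : IsPreconnected (p '' Set.Ici 1) :=
      (convex_Ici (1 : ℝ)).isPreconnected.image _ hp.continuousOn
    have := hpre.subset_left_of_subset_union h.isOpen_inside hext
      (Set.disjoint_left.mpr fun x hx ⟨w, hw⟩ => lt_asymm hw (hx w)) hsub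
      ⟨z, ⟨1, Set.self_mem_Ici, hp1⟩, hz⟩
    refine hbig (max 1 (|R| / ‖z - γ w‖ + 1)) ?_ (this ⟨_, Set.mem_Ici.mpr (le_max_left _ _), rfl⟩)
    exact (lt_add_one _).trans_le (le_max_right _ _)
  obtain ⟨τ, hτ⟩ := ht
  have ht0 : 0 < t := one_pos.trans ht1
  have e : γ τ - γ w = t • (z - γ w) := by rw [hτ]; simp [p]
  refine ⟨t⁻¹, inv_pos.mpr ht0, inv_lt_one_of_one_lt₀ ht1, τ, fun e' => ?_, ?_⟩
  · rw [e', sub_self] at e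
    exact (smul_ne_zero ht0.ne' hne) e.symm
  · rw [e, smul_smul, inv_mul_cancel₀ ht0.ne', one_smul, add_sub_cancel]

theorem chord_mem (h : SupportedCurve γ n) {w τ : Circle} (hne : τ ≠ w) {r : ℝ} (hr0 : 0 < r)
    (hr1 : r < 1) : γ w + r • (γ τ - γ w) ∈ insideSet γ n := by
  have e : γ w + r • (γ τ - γ w) = (1 - r) • γ w + r • γ τ := by
    rw [smul_sub, sub_smul, one_smul]
    ring
  rw [e]
  have hmem : ∀ w, γ w ∈ closure (insideSet γ n) := fun w => by
    rw [h.closure_inside]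
    exact Or.inr ⟨w, rfl⟩
  exact h.segment_mem (hmem w) (hmem τ) (fun e => hne (h.injective e).symm) (by linarith) hr0
    (by ring)

/-- If two chords from γ w had the same direction but different lengths, the nearer endpoint would
lie in the open chord to the farther one, hence inside and not on the curve. -/
theorem chord_injective (h : SupportedCurve γ n) {w τ τ' : Circle} (hne : τ ≠ w) (hne' : τ' ≠ w)
    {r r' : ℝ} (hr : 0 < r) (hr' : 0 < r') (e : r • (γ τ - γ w) = r' • (γ τ' - γ w)) :
    r = r' ∧ τ = τ' := by
  have key : ∀ {r r' : ℝ} {τ τ' : Circle}, τ ≠ w → τ' ≠ w → 0 < r → 0 < r' →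
      r • (γ τ - γ w) = r' • (γ τ' - γ w) → ¬r < r' := by
    intro r r' τ τ' hne hne' hr hr' e hlt
    have h1 : γ w + (r / r') • (γ τ - γ w) = γ τ' := by
      rw [div_eq_inv_mul, ← smul_smul, e, smul_smul, inv_mul_cancel₀ hr'.ne', one_smul,
        add_sub_cancel]
    have h2 := h.chord_mem hne (div_pos hr hr') ((div_lt_one hr').mpr hlt)
    rw [h1] at h2
    exact notMem_range _ h2 ⟨τ', rfl⟩
  have e1 : r = r' := le_antisymm (not_lt.mp (key hne' hne hr' hr e.symm))
    (not_lt.mp (key hne hne' hr hr' e))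
  subst e1
  refine ⟨rfl, h.injective ?_⟩
  have := smul_right_injective ℂ hr.ne' e
  exact sub_left_injective this

end SupportedCurve

/-! ### Small perturbations of the circle -/

/-- The mean value inequality on the shorter arc, applied to f - pw with p the derivative of f at
the base point. -/
theorem IsC1.norm_sub_sub_le {f : Circle → ℂ} (hf : IsC1 f) {Λ : ℝ} (hΛ0 : 0 ≤ Λ)
    (hΛ : ∀ τ w, ‖circleDeriv f τ - circleDeriv f w‖ ≤ Λ * dist τ w) (τ w : Circle) :
    ‖f τ - f w - circleDeriv f w * ((τ : ℂ) - w)‖ ≤ Λ * (Real.pi / 2 * dist τ w) ^ 2 := by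
  have hpi := Real.pi_pos
  obtain ⟨θ, hθ, rfl⟩ := exists_mul_exp w τ
  have h2 := le_dist_mul_exp w hθ
  rw [div_mul_eq_mul_div, div_le_iff₀ hpi] at h2
  obtain ⟨η, rfl⟩ : ∃ η, Circle.exp η = w := ⟨_, Circle.exp_arg w⟩
  set p := circleDeriv f (Circle.exp η)
  have hd : ∀ x : ℝ, HasDerivAt (fun x : ℝ => f (Circle.exp x) - p * (Circle.exp x : ℂ))
      (Complex.I * (Circle.exp x : ℂ) * (circleDeriv f (Circle.exp x) - p)) x := fun x => by
    have := (hf.hasDerivAt x).sub ((hasDerivAt_coe_exp x).const_mul p)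
    rw [show Complex.I * (Circle.exp x : ℂ) * (circleDeriv f (Circle.exp x) - p)
      = Complex.I * (Circle.exp x : ℂ) * circleDeriv f (Circle.exp x)
        - p * (Complex.I * (Circle.exp x : ℂ)) by ring]
    exact this
  have h := Convex.norm_image_sub_le_of_norm_hasDerivWithin_le (s := Set.uIcc η (η + θ))
    (C := Λ * |θ|) (x := η) (y := η + θ)
    (fun x _ => (hd x).hasDerivWithinAt) (fun x hx => by
      rw [norm_mul, norm_mul, Complex.norm_I, Circle.norm_coe, one_mul, one_mul]
      refine (hΛ _ _).trans (mul_le_mul_of_nonneg_left ?_ hΛ0)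
      have h3 := dist_mul_exp_le (Circle.exp η) (x - η)
      rw [← Circle.exp_add, add_sub_cancel] at h3
      refine h3.trans ?_
      have := Set.abs_sub_left_of_mem_uIcc hx
      rwa [add_sub_cancel_left] at this) (convex_uIcc _ _) Set.left_mem_uIcc Set.right_mem_uIcc
  rw [add_sub_cancel_left, Circle.exp_add, Real.norm_eq_abs] at h
  have e : f (Circle.exp η * Circle.exp θ) - f (Circle.exp η)
      - p * (((Circle.exp η * Circle.exp θ : Circle) : ℂ) - Circle.exp η)
      = f (Circle.exp η * Circle.exp θ) - p * ((Circle.exp η * Circle.exp θ : Circle) : ℂ)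
        - (f (Circle.exp η) - p * (Circle.exp η : ℂ)) := by ring
  rw [e]
  refine h.trans ?_
  have h4 : |θ| ≤ Real.pi / 2 * dist (Circle.exp η * Circle.exp θ) (Circle.exp η) := by linarith
  have h5 : |θ| * |θ| ≤ (Real.pi / 2 * dist (Circle.exp η * Circle.exp θ) (Circle.exp η)) ^ 2 := by
    rw [sq]
    exact mul_self_le_mul_self (abs_nonneg _) h4
  rw [mul_assoc]
  exact mul_le_mul_of_nonneg_left h5 hΛ0

theorem re_star_mul_sub (w τ : Circle) :
    (star (w : ℂ) * ((τ : ℂ) - w)).re = -(‖(τ : ℂ) - w‖ ^ 2 / 2) := by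
  have h1 : (w : ℂ).re ^ 2 + (w : ℂ).im ^ 2 = 1 := by
    have := Circle.normSq_coe w
    rw [Complex.normSq_apply] at this
    linarith
  have h2 : (τ : ℂ).re ^ 2 + (τ : ℂ).im ^ 2 = 1 := by
    have := Circle.normSq_coe τ
    rw [Complex.normSq_apply] at this
    linarith
  rw [← Complex.normSq_eq_norm_sq, Complex.normSq_apply]
  simp only [Complex.star_def, Complex.mul_re, Complex.conj_re, Complex.conj_im, Complex.sub_re,
    Complex.sub_im]
  nlinarith

/-- The circle recedes from its tangent by |τ - w|²/2. With p = g'(w), this gains a factor |1 + p|²,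
while the Taylor error of g costs at most |1 + p||τ - w|²/8 and cannot compensate, as |1 + p| ≥
19/20. Quadratic smallness of that error is where the Lipschitz derivative is needed. -/
theorem supportedCurve_add {g : Circle → ℂ} (hg : IsC1 g) (h0 : ∀ w, ‖g w‖ ≤ 1 / 20)
    (h1 : ∀ w, ‖circleDeriv g w‖ ≤ 1 / 20)
    (h2 : ∀ τ w, ‖circleDeriv g τ - circleDeriv g w‖ ≤ 1 / 20 * dist τ w) :
    SupportedCurve (fun w => (w : ℂ) + g w) (fun w => (w : ℂ) * (1 + circleDeriv g w)) where
  continuous := continuous_coe_circle.add hg.1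
  continuous_normal := continuous_coe_circle.mul (continuous_const.add hg.2.2)
  support w τ hne := by
    set p := circleDeriv g w
    set E := g τ - g w - p * ((τ : ℂ) - w)
    have hδ : 0 < ‖(τ : ℂ) - w‖ := norm_pos_iff.mpr (sub_ne_zero.mpr fun e => hne (Circle.ext e))
    have hE : ‖E‖ ≤ ‖(τ : ℂ) - w‖ ^ 2 / 8 := by
      refine (hg.norm_sub_sub_le (by norm_num) h2 τ w).trans ?_
      rw [norm_coe_sub, mul_pow]
      -- The Lipschitz constant 1/20 times 2.5 is 1/8.
      have : (Real.pi / 2) ^ 2 ≤ 2.5 := by nlinarith [Real.pi_gt_d2, Real.pi_lt_d2]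
      nlinarith [sq_nonneg (dist τ w)]
    have hm : 19 / 20 ≤ ‖1 + p‖ := by
      have := norm_sub_le_norm_add (1 : ℂ) p
      rw [norm_one] at this
      linarith [h1 w]
    have e : (starRingEnd ℂ) ((w : ℂ) * (1 + p)) * ((τ : ℂ) + g τ - (w + g w))
        = ((‖1 + p‖ ^ 2 : ℝ) : ℂ) * (star (w : ℂ) * ((τ : ℂ) - w))
          + (starRingEnd ℂ) ((w : ℂ) * (1 + p)) * E := by
      have h3 : ((‖1 + p‖ ^ 2 : ℝ) : ℂ) = (starRingEnd ℂ) (1 + p) * (1 + p) := by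
        rw [← Complex.normSq_eq_norm_sq, Complex.normSq_eq_conj_mul_self]
      rw [h3, map_mul, Complex.star_def]
      ring
    have h4 : ((starRingEnd ℂ) ((w : ℂ) * (1 + p)) * E).re ≤ ‖1 + p‖ * ‖E‖ := by
      refine (Complex.re_le_norm _).trans (le_of_eq ?_)
      rw [norm_mul, RCLike.norm_conj, norm_mul, Circle.norm_coe, one_mul]
    rw [Complex.inner, mul_comm, e, Complex.add_re, Complex.re_ofReal_mul, re_star_mul_sub]
    have h5 : ‖1 + p‖ * ‖E‖ ≤ ‖1 + p‖ * (‖(τ : ℂ) - w‖ ^ 2 / 8) :=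
      mul_le_mul_of_nonneg_left hE (norm_nonneg _)
    have h6 : 0 < ‖(τ : ℂ) - w‖ ^ 2 := by positivity
    have h7 : 0 < ‖1 + p‖ := by linarith
    have h8 : ‖1 + p‖ * (19 / 20) * ‖(τ : ℂ) - w‖ ^ 2 ≤ ‖1 + p‖ ^ 2 * ‖(τ : ℂ) - w‖ ^ 2 := by
      rw [sq ‖1 + p‖]
      gcongr
    have h9 : 0 < ‖1 + p‖ * ‖(τ : ℂ) - w‖ ^ 2 := by positivity
    nlinarith
  pos w := by
    set p := circleDeriv g w
    have hw : star (w : ℂ) * w = 1 := by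
      rw [star_coe, inv_mul_cancel₀ (Circle.coe_ne_zero w)]
    have e : (starRingEnd ℂ) ((w : ℂ) * (1 + p)) * (w + g w)
        = 1 + (star p + (1 + star p) * (star (w : ℂ) * g w)) := by
      rw [map_mul, map_add, map_one, ← Complex.star_def]
      linear_combination (1 + star p) * hw
    rw [Complex.inner, mul_comm, e, Complex.add_re, Complex.one_re]
    have h3 : ‖star p + (1 + star p) * (star (w : ℂ) * g w)‖ ≤ 1 / 20 + (1 + 1 / 20) * (1 / 20) := by
      refine (norm_add_le _ _).trans (add_le_add (by rw [norm_star]; exact h1 w) ?_)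
      rw [norm_mul, norm_mul, norm_star, Circle.norm_coe, one_mul]
      refine mul_le_mul ((norm_add_le _ _).trans ?_) (h0 w) (norm_nonneg _) (by norm_num)
      rw [norm_one, norm_star]
      linarith [h1 w]
    have h4 := (abs_le.mp ((Complex.abs_re_le_norm _).trans h3)).1
    linarith
  polar z := by
    set u := Circle.exp (Complex.arg z)
    have hz : z = (‖z‖ : ℂ) * u := by
      rw [Circle.coe_exp, Complex.norm_mul_exp_arg_mul_I]
    have hu : star (u : ℂ) * u = 1 := by
      rw [star_coe, inv_mul_cancel₀ (Circle.coe_ne_zero u)]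
    let k : ℝ → ℂ := fun θ => star (u : ℂ) * g (u * Circle.exp θ)
    have hk : ∀ θ, ‖k θ‖ ≤ 1 / 20 := fun θ => by
      rw [norm_mul, norm_star, Circle.norm_coe, one_mul]
      exact h0 _
    have hkc : Continuous k :=
      continuous_const.mul (hg.1.comp (continuous_const.mul Circle.exp.continuous))
    have hcont : Continuous fun θ : ℝ => Real.sin θ + (k θ).im :=
      Real.continuous_sin.add (Complex.continuous_im.comp hkc)
    have hpi := Real.pi_pos
    have him : ∀ θ, |(k θ).im| ≤ 1 / 20 := fun θ => (Complex.abs_im_le_norm _).trans (hk θ)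
    -- After rotation by the argument of z, the curve is e^{iθ} + k θ with |k| ≤ 1/20. On the right
    -- half-circle its imaginary part changes sign, and at a zero of it the real part is positive.
    obtain ⟨θ, hθ, hθ0⟩ : (0 : ℝ) ∈ (fun θ : ℝ => Real.sin θ + (k θ).im) ''
        Set.Icc (-(Real.pi / 2)) (Real.pi / 2) := by
      refine intermediate_value_Icc (by linarith) hcont.continuousOn ⟨?_, ?_⟩
      · simp only [Real.sin_neg, Real.sin_pi_div_two]
        linarith [(abs_le.mp (him (-(Real.pi / 2)))).2]
      · simp only [Real.sin_pi_div_two]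
        linarith [(abs_le.mp (him (Real.pi / 2))).1]
    have hcos := Real.cos_nonneg_of_mem_Icc hθ
    have hsc := Real.sin_sq_add_cos_sq θ
    simp only at hθ0
    have hsin : |Real.sin θ| ≤ 1 / 20 := by
      rw [eq_neg_of_add_eq_zero_left hθ0, abs_neg]
      exact him θ
    have hcos' : 1 / 2 ≤ Real.cos θ := by
      have := sq_abs (Real.sin θ)
      nlinarith [abs_nonneg (Real.sin θ)]
    set t := Real.cos θ + (k θ).re
    have ht : 0 < t := by
      linarith [(abs_le.mp ((Complex.abs_re_le_norm _).trans (hk θ))).1]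
    have e : (u * Circle.exp θ : Circle) + g (u * Circle.exp θ) = (t : ℂ) * u := by
      have h3 : (Circle.exp θ : ℂ) + k θ = t := by
        rw [Circle.coe_exp]
        refine Complex.ext ?_ ?_
        · rw [Complex.add_re, Complex.exp_ofReal_mul_I_re, Complex.ofReal_re]
        · rw [Complex.add_im, Complex.exp_ofReal_mul_I_im, Complex.ofReal_im, hθ0]
      rw [← h3, Circle.coe_mul]
      linear_combination -g (u * Circle.exp θ) * hu
    refine ⟨‖z‖ / t, by positivity, u * Circle.exp θ, ?_⟩
    rw [e, Complex.real_smul]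
    conv_lhs => rw [hz]
    have : (t : ℂ) ≠ 0 := by exact_mod_cast ht.ne'
    push_cast
    field_simp

/-- Curve and normal are scaled together, so inner products acquire c². Negative c is thus allowed,
which covers ε < 0. -/
theorem SupportedCurve.const_mul {γ n : Circle → ℂ} (h : SupportedCurve γ n) {c : ℝ}
    (hc : c ≠ 0) : SupportedCurve (fun w => (c : ℂ) * γ w) (fun w => (c : ℂ) * n w) := by
  have hc2 : 0 < c * c := mul_self_pos.mpr hc
  have key : ∀ a b : ℂ, inner ℝ ((c : ℂ) * a) ((c : ℂ) * b) = c * c * inner ℝ a b := fun a b => by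
    rw [← Complex.real_smul, ← Complex.real_smul, real_inner_smul_left, real_inner_smul_right]
    ring
  refine ⟨continuous_const.mul h.continuous, continuous_const.mul h.continuous_normal,
    fun w τ hne => ?_, fun w => ?_, fun z => ?_⟩
  · rw [← mul_sub, key]
    exact mul_neg_of_pos_of_neg hc2 (h.support w τ hne)
  · rw [key]
    exact mul_pos hc2 (h.pos w)
  · obtain ⟨r, hr, w, e⟩ := h.polar ((c : ℂ)⁻¹ * z)
    refine ⟨r, hr, w, ?_⟩
    have hc' : (c : ℂ) ≠ 0 := by exact_mod_cast hc
    rw [inv_mul_eq_iff_eq_mul₀ hc'] at e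
    rw [e, Complex.real_smul, Complex.real_smul]
    ring

theorem isC1_const_mul {f : Circle → ℂ} (c : ℝ) (hf : IsC1 f) :
    IsC1 (fun w => (c : ℂ) * f w) ∧
      circleDeriv (fun w => (c : ℂ) * f w) = fun w => (c : ℂ) * circleDeriv f w := by
  have e : (fun w => (c : ℂ) * f w) = c • f := rfl
  rw [e]
  exact ⟨hf.smul c, circleDeriv_smul c hf⟩

theorem hasDerivAt_boundaryCurve {f : Circle → ℂ} (ε : ℝ) (hf : IsC1 f) (η : ℝ) :
    HasDerivAt (fun η : ℝ => boundaryCurve ε f (Circle.exp η))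
      (Complex.I * (Circle.exp η : ℂ)
        * (ε * (1 + ε * circleDeriv f (Circle.exp η)))) η := by
  have h := ((hasDerivAt_coe_exp η).add ((hf.hasDerivAt η).const_mul (ε : ℂ))).const_mul (ε : ℂ)
  rw [show Complex.I * (Circle.exp η : ℂ) * (ε * (1 + ε * circleDeriv f (Circle.exp η)))
    = (ε : ℂ) * (Complex.I * (Circle.exp η : ℂ) + (ε : ℂ) * (Complex.I * (Circle.exp η : ℂ)
      * circleDeriv f (Circle.exp η))) by ring]
  exact h

theorem circleDeriv_boundaryCurve {f : Circle → ℂ} (ε : ℝ) (hf : IsC1 f) :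
    circleDeriv (boundaryCurve ε f) = fun w => (ε : ℂ) * (1 + ε * circleDeriv f w) :=
  circleDeriv_eq (hasDerivAt_boundaryCurve ε hf)

theorem supportedCurve_boundaryCurve {f : Circle → ℂ} {ε Λ : ℝ} (hf : IsC1 f) (hε0 : ε ≠ 0)
    (hε : |ε| ≤ 1 / 20) (hεΛ : |ε| * Λ ≤ 1 / 20) (h0 : ∀ w, ‖f w‖ ≤ 1)
    (h1 : ∀ w, ‖circleDeriv f w‖ ≤ 1)
    (h2 : ∀ τ w, ‖circleDeriv f τ - circleDeriv f w‖ ≤ Λ * dist τ w) :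
    SupportedCurve (boundaryCurve ε f) fun w => (w : ℂ) * circleDeriv (boundaryCurve ε f) w := by
  obtain ⟨hg, hg'⟩ := isC1_const_mul ε hf
  have hsmall : ∀ x : ℂ, ‖x‖ ≤ 1 → ‖(ε : ℂ) * x‖ ≤ 1 / 20 := fun x hx => by
    rw [norm_mul, Complex.norm_real, Real.norm_eq_abs]
    nlinarith [abs_nonneg ε, norm_nonneg x]
  have h := (supportedCurve_add hg (fun w => hsmall _ (h0 w))
    (fun w => by rw [hg']; exact hsmall _ (h1 w)) (fun τ w => by
      rw [hg']
      simp only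
      rw [← mul_sub, norm_mul, Complex.norm_real, Real.norm_eq_abs]
      calc |ε| * ‖circleDeriv f τ - circleDeriv f w‖ ≤ |ε| * (Λ * dist τ w) :=
            mul_le_mul_of_nonneg_left (h2 τ w) (abs_nonneg _)
        _ = |ε| * Λ * dist τ w := by ring
        _ ≤ _ := mul_le_mul_of_nonneg_right hεΛ dist_nonneg)).const_mul hε0
  rw [circleDeriv_boundaryCurve ε hf]
  rw [hg'] at h
  have e : (fun w : Circle => (w : ℂ) * ((ε : ℂ) * (1 + ε * circleDeriv f w)))
      = fun w : Circle => (ε : ℂ) * ((w : ℂ) * (1 + ε * circleDeriv f w)) := by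
    funext w
    ring
  rw [e]
  exact h

/-! ### Area integrals over the domain bounded by a supported curve -/

/-- The real linear map `x + iy ↦ x A + y B`. -/
def frameMap (A B : ℂ) : ℂ →L[ℝ] ℂ := Complex.reCLM.smulRight A + Complex.imCLM.smulRight B

theorem frameMap_det (A B : ℂ) : (frameMap A B).det = (star A * B).im := by
  rw [ContinuousLinearMap.det, ← LinearMap.det_toMatrix Complex.basisOneI, Matrix.det_fin_two]
  simp [LinearMap.toMatrix_apply, frameMap]
  ring

namespace SupportedCurve

variable {γ n : Circle → ℂ}

/-- The chord from `γ (exp a)` to `γ (exp θ)`. -/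
def chord (γ : Circle → ℂ) (a θ : ℝ) : ℂ := γ (Circle.exp θ) - γ (Circle.exp a)

theorem hasDerivAt_chord
    (hγ : ∀ η : ℝ, HasDerivAt (fun η : ℝ => γ (Circle.exp η)) (Complex.I * n (Circle.exp η)) η)
    (a θ : ℝ) : HasDerivAt (chord γ a) (Complex.I * n (Circle.exp θ)) θ :=
  (hγ θ).sub_const _

theorem continuous_chord (h : SupportedCurve γ n) (a : ℝ) : Continuous (chord γ a) :=
  (h.continuous.comp Circle.exp.continuous).sub continuous_const

theorem chord_self (γ : Circle → ℂ) (a : ℝ) : chord γ a a = 0 := sub_self _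

theorem chord_add_two_pi (γ : Circle → ℂ) (a : ℝ) : chord γ a (a + 2 * Real.pi) = 0 := by
  rw [chord, Circle.exp_add, Circle.exp_two_pi, mul_one, sub_self]

theorem exp_ne_exp {a θ : ℝ} (hθ : θ ∈ Set.Ioo a (a + 2 * Real.pi)) :
    Circle.exp θ ≠ Circle.exp a := by
  intro e
  obtain ⟨m, hm⟩ := Circle.exp_eq_exp.mp e
  have hpi := Real.two_pi_pos
  have h1 : 0 < (m : ℝ) * (2 * Real.pi) := by linarith [hθ.1]
  have h2 : (m : ℝ) * (2 * Real.pi) < 1 * (2 * Real.pi) := by linarith [hθ.2]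
  have h3 : 0 < (m : ℝ) := pos_of_mul_pos_left h1 hpi.le
  have h4 : (m : ℝ) < 1 := lt_of_mul_lt_mul_right h2 hpi.le
  have h5 : 0 < m := by exact_mod_cast h3
  have h6 : m < 1 := by exact_mod_cast h4
  omega

theorem exp_injOn {a θ θ' : ℝ} (hθ : θ ∈ Set.Ioo a (a + 2 * Real.pi))
    (hθ' : θ' ∈ Set.Ioo a (a + 2 * Real.pi)) (e : Circle.exp θ = Circle.exp θ') : θ = θ' := by
  obtain ⟨m, hm⟩ := Circle.exp_eq_exp.mp e
  have hpi := Real.two_pi_pos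
  have h1 : (-1) * (2 * Real.pi) < (m : ℝ) * (2 * Real.pi) := by linarith [hθ.1, hθ'.2]
  have h2 : (m : ℝ) * (2 * Real.pi) < 1 * (2 * Real.pi) := by linarith [hθ.2, hθ'.1]
  have h3 : (-1 : ℝ) < m := lt_of_mul_lt_mul_right h1 hpi.le
  have h4 : (m : ℝ) < 1 := lt_of_mul_lt_mul_right h2 hpi.le
  have h5 : -1 < m := by exact_mod_cast h3
  have h6 : m < 1 := by exact_mod_cast h4
  have h7 : m = 0 := by omega
  rw [hm, h7]
  simp

theorem exists_exp_eq (a : ℝ) {τ : Circle} (hτ : τ ≠ Circle.exp a) :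
    ∃ θ ∈ Set.Ioo a (a + 2 * Real.pi), Circle.exp θ = τ := by
  obtain ⟨η, rfl⟩ : ∃ η, Circle.exp η = τ := ⟨_, Circle.exp_arg τ⟩
  refine ⟨toIcoMod Real.two_pi_pos a η, ⟨?_, toIcoMod_lt_right _ _ _⟩, ?_⟩
  · refine (left_le_toIcoMod _ _ _).lt_of_ne fun e => hτ ?_
    conv_rhs => rw [e]
    rw [Circle.exp_eq_exp]
    refine ⟨toIcoDiv Real.two_pi_pos a η, ?_⟩
    have := toIcoMod_add_toIcoDiv_zsmul Real.two_pi_pos a η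
    rw [zsmul_eq_mul] at this
    exact this.symm
  · rw [Circle.exp_eq_exp]
    refine ⟨-toIcoDiv Real.two_pi_pos a η, ?_⟩
    have := toIcoMod_add_toIcoDiv_zsmul Real.two_pi_pos a η
    rw [zsmul_eq_mul] at this
    push_cast
    linarith

/-- The Jacobian factor. -/
theorem chord_wronskian_pos (h : SupportedCurve γ n) {a θ : ℝ}
    (hθ : θ ∈ Set.Ioo a (a + 2 * Real.pi)) :
    0 < (star (chord γ a θ) * (Complex.I * n (Circle.exp θ))).im := by
  have h1 := h.support (Circle.exp θ) (Circle.exp a) (exp_ne_exp hθ).symm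
  have e : (star (chord γ a θ) * (Complex.I * n (Circle.exp θ))).im
      = -inner ℝ (n (Circle.exp θ)) (γ (Circle.exp a) - γ (Circle.exp θ)) := by
    rw [← inner_neg_right, neg_sub, Complex.inner, chord, Complex.star_def]
    simp only [Complex.mul_im, Complex.mul_re, Complex.conj_re, Complex.conj_im, Complex.I_re,
      Complex.I_im]
    ring
  rw [e]
  linarith

/-- Change of variables along the chords from a fixed boundary point. Strict convexity makes the
chords sweep the inside exactly once, and the tangent lines make the Jacobian positive. -/
theorem integral_inside (h : SupportedCurve γ n)
    (hγ : ∀ η : ℝ, HasDerivAt (fun η : ℝ => γ (Circle.exp η)) (Complex.I * n (Circle.exp η)) η)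
    (a : ℝ) (φ : ℂ → ℂ) :
    ∫ z in insideSet γ n, φ z = ∫ p in Set.Ioo (0 : ℝ) 1 ×ˢ Set.Ioo a (a + 2 * Real.pi),
      ((p.1 * (star (chord γ a p.2) * (Complex.I * n (Circle.exp p.2))).im : ℝ) : ℂ)
        * φ (γ (Circle.exp a) + p.1 * chord γ a p.2) := by
  set T := Set.Ioo (0 : ℝ) 1 ×ˢ Set.Ioo a (a + 2 * Real.pi)
  set S : Set ℂ := Complex.measurableEquivRealProd ⁻¹' T
  have hT : MeasurableSet T := measurableSet_Ioo.prod measurableSet_Ioo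
  have hS : MeasurableSet S := Complex.measurableEquivRealProd.measurable hT
  have hmemS : ∀ x : ℂ, x ∈ S ↔ (x.re ∈ Set.Ioo (0 : ℝ) 1 ∧ x.im ∈ Set.Ioo a (a + 2 * Real.pi)) :=
    fun x => Iff.rfl
  let G : ℂ → ℂ := fun x => γ (Circle.exp a) + x.re • chord γ a x.im
  have himg : G '' S = insideSet γ n := by
    ext z
    constructor
    · rintro ⟨x, hx, rfl⟩
      obtain ⟨hr, hθ⟩ := (hmemS x).mp hx
      exact h.chord_mem (exp_ne_exp hθ) hr.1 hr.2
    · intro hz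
      obtain ⟨r, hr0, hr1, τ, hne, e⟩ := h.exists_chord (Circle.exp a) hz
      obtain ⟨θ, hθ, rfl⟩ := exists_exp_eq a hne
      exact ⟨⟨r, θ⟩, (hmemS _).mpr ⟨⟨hr0, hr1⟩, hθ⟩, e.symm⟩
  have hinj : Set.InjOn G S := by
    intro x hx y hy e
    obtain ⟨hr, hθ⟩ := (hmemS x).mp hx
    obtain ⟨hr', hθ'⟩ := (hmemS y).mp hy
    obtain ⟨e1, e2⟩ := h.chord_injective (exp_ne_exp hθ) (exp_ne_exp hθ') hr.1 hr'.1
      (add_left_cancel e)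
    exact Complex.ext e1 (exp_injOn hθ hθ' e2)
  have hderiv : ∀ x ∈ S, HasFDerivWithinAt G
      (frameMap (chord γ a x.im) (x.re • (Complex.I * n (Circle.exp x.im)))) S x := by
    intro x _
    have h1 : HasFDerivAt (fun x : ℂ => x.re) Complex.reCLM x := Complex.reCLM.hasFDerivAt
    have h2 : HasFDerivAt (fun x : ℂ => chord γ a x.im)
        ((ContinuousLinearMap.toSpanSingleton ℝ (Complex.I * n (Circle.exp x.im))).comp
          Complex.imCLM) x :=
      (hasDerivAt_chord hγ a x.im).hasFDerivAt.comp x Complex.imCLM.hasFDerivAt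
    refine ((h1.smul h2).const_add _).hasFDerivWithinAt.congr_fderiv ?_
    ext y
    all_goals
      simp [frameMap]
      ring
  rw [← himg, integral_image_eq_integral_abs_det_fderiv_smul volume hS hderiv hinj]
  have h3 := Complex.volume_preserving_equiv_real_prod.setIntegral_preimage_emb
    Complex.measurableEquivRealProd.measurableEmbedding (fun p : ℝ × ℝ =>
      ((p.1 * (star (chord γ a p.2) * (Complex.I * n (Circle.exp p.2))).im : ℝ) : ℂ)
        * φ (γ (Circle.exp a) + p.1 * chord γ a p.2)) T
  rw [← h3]
  refine setIntegral_congr_fun hS fun x hx => ?_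
  obtain ⟨hr, hθ⟩ := (hmemS x).mp hx
  have e : (frameMap (chord γ a x.im) (x.re • (Complex.I * n (Circle.exp x.im)))).det
      = x.re * (star (chord γ a x.im) * (Complex.I * n (Circle.exp x.im))).im := by
    rw [frameMap_det, Complex.real_smul, mul_left_comm, Complex.im_ofReal_mul]
  simp only [e]
  rw [abs_of_pos (mul_pos hr.1 (h.chord_wronskian_pos hθ)), Complex.real_smul]
  rfl

end SupportedCurve

/-! ### The Cauchy transform of the domain bounded by a supported curve -/

namespace SupportedCurve

variable {γ n : Circle → ℂ}

theorem ofReal_im_star_mul (q q' : ℂ) :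
    (((star q * q').im : ℝ) : ℂ) = (2 * Complex.I)⁻¹ * (star q * q' - q * star q') := by
  rw [im_eq, star_mul', star_star, mul_inv, Complex.inv_I]
  ring

theorem continuous_normal_exp (h : SupportedCurve γ n) :
    Continuous fun θ : ℝ => Complex.I * n (Circle.exp θ) :=
  continuous_const.mul (h.continuous_normal.comp Circle.exp.continuous)

/-- The chords are drawn from the singular point itself, so the r of the Jacobian cancels the one in
1/(rq). What remains depends on θ alone: up to 1/(2i) it is (conj q/q)q' - conj q', and the last
term integrates to 0 over a period. -/
theorem integral_inv_sub_boundary (h : SupportedCurve γ n)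
    (hγ : ∀ η : ℝ, HasDerivAt (fun η : ℝ => γ (Circle.exp η)) (Complex.I * n (Circle.exp η)) η)
    (w : Circle) :
    ∫ z in insideSet γ n, (z - γ w)⁻¹
      = 2⁻¹ * ∫ τ, star (γ τ - γ w) / (γ τ - γ w) * n τ ∂arc := by
  obtain ⟨a, rfl⟩ : ∃ a, Circle.exp a = w := ⟨_, Circle.exp_arg w⟩
  have hpi := Real.two_pi_pos
  set b := a + 2 * Real.pi with hb
  have hab : a ≤ b := by linarith
  set q := chord γ a with hq
  set q' : ℝ → ℂ := fun θ => Complex.I * n (Circle.exp θ) with hq'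
  have hqd : ∀ θ, HasDerivAt q (q' θ) θ := hasDerivAt_chord hγ a
  have hqc : Continuous q := h.continuous_chord a
  have hqc' : Continuous q' := h.continuous_normal_exp
  have hstar : ∫ θ in a..b, star (q' θ) = 0 := by
    have := intervalIntegral.integral_eq_sub_of_hasDerivAt (a := a) (b := b)
      (f := fun θ => star (q θ)) (f' := fun θ => star (q' θ)) (fun θ _ => (hqd θ).star)
      (hqc'.star.intervalIntegrable _ _)
    rw [this, hq, hb, chord_add_two_pi, chord_self, sub_self]
  have hi1 : IntervalIntegrable (fun θ => star (q θ) / q θ * q' θ) volume a b := by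
    refine (hqc'.intervalIntegrable a b).mono_fun
      (((hqc.star.measurable.div hqc.measurable).mul hqc'.measurable).aestronglyMeasurable)
      (Eventually.of_forall fun θ => ?_)
    simp only [norm_mul, norm_div, norm_star]
    exact mul_le_of_le_one_left (norm_nonneg _) (div_self_le_one _)
  rw [h.integral_inside hγ a]
  have e1 : ∀ p ∈ Set.Ioo (0 : ℝ) 1 ×ˢ Set.Ioo a b,
      ((p.1 * (star (q p.2) * q' p.2).im : ℝ) : ℂ)
        * (γ (Circle.exp a) + p.1 * q p.2 - γ (Circle.exp a))⁻¹
      = 1 * ((2 * Complex.I)⁻¹ * (star (q p.2) / q p.2 * q' p.2 - star (q' p.2))) := by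
    rintro ⟨r, θ⟩ ⟨hr, hθ⟩
    have hr0 : (r : ℂ) ≠ 0 := by exact_mod_cast hr.1.ne'
    have hq0 : q θ ≠ 0 := sub_ne_zero.mpr fun e => exp_ne_exp hθ (h.injective e)
    simp only
    rw [Complex.ofReal_mul, ofReal_im_star_mul, add_sub_cancel_left]
    field_simp
  rw [setIntegral_congr_fun (measurableSet_Ioo.prod measurableSet_Ioo) e1, Measure.volume_eq_prod]
  have e2 := setIntegral_prod_mul (μ := (volume : Measure ℝ)) (ν := (volume : Measure ℝ))
    (fun _ : ℝ => (1 : ℂ))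
    (fun θ => (2 * Complex.I)⁻¹ * (star (q θ) / q θ * q' θ - star (q' θ)))
    (Set.Ioo 0 1) (Set.Ioo a b)
  rw [e2]
  have e3 : ∫ _ in Set.Ioo (0 : ℝ) 1, (1 : ℂ) = 1 := by simp
  rw [e3, one_mul, ← integral_Ioc_eq_integral_Ioo, ← intervalIntegral.integral_of_le hab,
    intervalIntegral.integral_const_mul, intervalIntegral.integral_sub hi1
      (hqc'.star.intervalIntegrable _ _), hstar, sub_zero, arc_integral _ a]
  have e4 : ∀ θ, star (q θ) / q θ * q' θ = Complex.I * (star (γ (Circle.exp θ) - γ (Circle.exp a))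
      / (γ (Circle.exp θ) - γ (Circle.exp a)) * n (Circle.exp θ)) := fun θ => by
    simp only [hq, hq', chord]
    ring
  simp only [e4]
  rw [intervalIntegral.integral_const_mul, ← mul_assoc, mul_inv, mul_assoc 2⁻¹,
    inv_mul_cancel₀ Complex.I_ne_zero, mul_one]

/-- Green's formula for the form conj z dz/(z - p), pulled back to chord coordinates as Q dr + P dθ:
the integrand is (∂P/∂r - ∂Q/∂θ)/(2i). P vanishes at r = 0 and gives the boundary integral at r = 1;
Q vanishes at both ends in θ, where the chord degenerates. -/
theorem integral_inv_sub_outside (h : SupportedCurve γ n)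
    (hγ : ∀ η : ℝ, HasDerivAt (fun η : ℝ => γ (Circle.exp η)) (Complex.I * n (Circle.exp η)) η)
    {p : ℂ} (hp : p ∉ closure (insideSet γ n)) :
    ∫ z in insideSet γ n, (z - p)⁻¹ = 2⁻¹ * ∫ τ, star (γ τ) / (γ τ - p) * n τ ∂arc := by
  have hpi := Real.two_pi_pos
  set a : ℝ := 0
  set b := a + 2 * Real.pi with hb
  have hab : a ≤ b := by linarith
  set z₀ := γ (Circle.exp a) with hz₀
  set q := chord γ a with hq
  set q' : ℝ → ℂ := fun θ => Complex.I * n (Circle.exp θ) with hq'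
  have hqd : ∀ θ, HasDerivAt q (q' θ) θ := hasDerivAt_chord hγ a
  have hqc : Continuous q := h.continuous_chord a
  have hqc' : Continuous q' := h.continuous_normal_exp
  have hclos : ∀ w, γ w ∈ closure (insideSet γ n) := fun w => by
    rw [h.closure_inside]
    exact Or.inr ⟨w, rfl⟩
  have hden : ∀ r ∈ Set.Icc (0 : ℝ) 1, ∀ θ : ℝ, z₀ + r * q θ - p ≠ 0 := fun r hr θ e => by
    refine hp ?_
    have h1 := (convex_inside (γ := γ) (n := n)).closure (hclos (Circle.exp a))
      (hclos (Circle.exp θ)) (sub_nonneg.mpr hr.2) hr.1 (by ring)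
    have h2 : (1 - r) • γ (Circle.exp a) + r • γ (Circle.exp θ) = p := by
      rw [← sub_eq_zero.mp e, hq, chord, hz₀, Complex.real_smul, Complex.real_smul]
      push_cast
      ring
    rwa [h2] at h1
  -- the two partial derivatives whose difference is the integrand
  let P : ℝ → ℝ → ℂ := fun r θ => (r * star (q θ) + star z₀) * (r * q' θ) * (z₀ + r * q θ - p)⁻¹
  let Q : ℝ → ℝ → ℂ := fun r θ => (r * star (q θ) + star z₀) * q θ * (z₀ + r * q θ - p)⁻¹
  let Pr : ℝ × ℝ → ℂ := fun x => (star (q x.2) * (x.1 * q' x.2)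
      + (x.1 * star (q x.2) + star z₀) * q' x.2) * (z₀ + x.1 * q x.2 - p)⁻¹
    + (x.1 * star (q x.2) + star z₀) * (x.1 * q' x.2)
      * (-q x.2 / (z₀ + x.1 * q x.2 - p) ^ 2)
  let Qt : ℝ × ℝ → ℂ := fun x => (x.1 * star (q' x.2) * q x.2
      + (x.1 * star (q x.2) + star z₀) * q' x.2) * (z₀ + x.1 * q x.2 - p)⁻¹
    + (x.1 * star (q x.2) + star z₀) * q x.2
      * (-(x.1 * q' x.2) / (z₀ + x.1 * q x.2 - p) ^ 2)
  have hP : ∀ r ∈ Set.Icc (0 : ℝ) 1, ∀ θ, HasDerivAt (fun r => P r θ) (Pr (r, θ)) r := by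
    intro r hr θ
    have h0 : HasDerivAt (fun r : ℝ => (r : ℂ)) 1 r := Complex.ofRealCLM.hasDerivAt
    have h1 := (h0.mul_const (star (q θ))).add_const (star z₀)
    have h2 := h0.mul_const (q' θ)
    have h3 := (((h0.mul_const (q θ)).const_add z₀).sub_const p).inv (hden r hr θ)
    have h4 := (h1.mul h2).mul h3
    simp only [one_mul] at h4
    exact h4
  have hQ : ∀ r ∈ Set.Icc (0 : ℝ) 1, ∀ θ, HasDerivAt (fun θ => Q r θ) (Qt (r, θ)) θ := by
    intro r hr θ
    have h1 := (((hqd θ).star).const_mul (r : ℂ)).add_const (star z₀)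
    have h3 := ((((hqd θ).const_mul (r : ℂ)).const_add z₀).sub_const p).inv (hden r hr θ)
    exact (h1.mul (hqd θ)).mul h3
  set R : Set (ℝ × ℝ) := Set.Icc (0 : ℝ) 1 ×ˢ Set.Icc a b
  have hR : IsCompact R := isCompact_Icc.prod isCompact_Icc
  have hq2 : Continuous fun x : ℝ × ℝ => q x.2 := hqc.comp continuous_snd
  have hq2' : Continuous fun x : ℝ × ℝ => q' x.2 := hqc'.comp continuous_snd
  have hr1 : Continuous fun x : ℝ × ℝ => (x.1 : ℂ) := Complex.continuous_ofReal.comp continuous_fst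
  have hdc : Continuous fun x : ℝ × ℝ => z₀ + x.1 * q x.2 - p :=
    (continuous_const.add (hr1.mul hq2)).sub continuous_const
  have hd0 : ∀ x ∈ R, z₀ + x.1 * q x.2 - p ≠ 0 := fun x hx => hden x.1 hx.1 x.2
  have hc1 : Continuous fun x : ℝ × ℝ => (x.1 : ℂ) * star (q x.2) + star z₀ :=
    (hr1.mul hq2.star).add continuous_const
  have hPc : ContinuousOn Pr R := by
    refine ContinuousOn.add (ContinuousOn.mul ?_ (hdc.continuousOn.inv₀ hd0))
      (ContinuousOn.mul ?_ (ContinuousOn.div hq2.neg.continuousOn (hdc.pow 2).continuousOn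
        fun x hx => pow_ne_zero 2 (hd0 x hx)))
    · exact ((hq2.star.mul (hr1.mul hq2')).add (hc1.mul hq2')).continuousOn
    · exact (hc1.mul (hr1.mul hq2')).continuousOn
  have hQc : ContinuousOn Qt R := by
    refine ContinuousOn.add (ContinuousOn.mul ?_ (hdc.continuousOn.inv₀ hd0))
      (ContinuousOn.mul ?_ (ContinuousOn.div (hr1.mul hq2').neg.continuousOn
        (hdc.pow 2).continuousOn fun x hx => pow_ne_zero 2 (hd0 x hx)))
    · exact (((hr1.mul hq2'.star).mul hq2).add (hc1.mul hq2')).continuousOn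
    · exact (hc1.mul hq2).continuousOn
  set T : Set (ℝ × ℝ) := Set.Ioo (0 : ℝ) 1 ×ˢ Set.Ioo a b
  have hTR : T ⊆ R := Set.prod_mono Set.Ioo_subset_Icc_self Set.Ioo_subset_Icc_self
  have hPi : IntegrableOn Pr T volume := (hPc.integrableOn_compact hR).mono_set hTR
  have hQi : IntegrableOn Qt T volume := (hQc.integrableOn_compact hR).mono_set hTR
  have e1 : ∀ x ∈ T, ((x.1 * (star (q x.2) * q' x.2).im : ℝ) : ℂ) * (z₀ + x.1 * q x.2 - p)⁻¹
      = (2 * Complex.I)⁻¹ * (Pr x - Qt x) := by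
    intro x _
    rw [Complex.ofReal_mul, ofReal_im_star_mul]
    simp only [Pr, Qt]
    ring
  have slice1 : ∀ θ ∈ Set.Icc a b, ContinuousOn (fun r => Pr (r, θ)) (Set.Icc 0 1) := fun θ hθ =>
    hPc.comp (by fun_prop) fun r hr => ⟨hr, hθ⟩
  have slice2 : ∀ r ∈ Set.Icc (0 : ℝ) 1, ContinuousOn (fun θ => Qt (r, θ)) (Set.Icc a b) :=
    fun r hr => hQc.comp (by fun_prop) fun θ hθ => ⟨hr, hθ⟩
  have hPint : ∫ x in T, Pr x = ∫ θ in a..b, star (γ (Circle.exp θ)) / (γ (Circle.exp θ) - p)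
      * q' θ := by
    have hPi' : Integrable Pr ((volume.restrict (Set.Ioo (0 : ℝ) 1)).prod
        (volume.restrict (Set.Ioo a b))) := by
      rw [Measure.prod_restrict]
      exact hPi
    rw [Measure.volume_eq_prod, ← Measure.prod_restrict, integral_prod_symm _ hPi',
      intervalIntegral.integral_of_le hab, integral_Ioc_eq_integral_Ioo]
    refine setIntegral_congr_fun measurableSet_Ioo fun θ hθ => ?_
    rw [← integral_Ioc_eq_integral_Ioo, ← intervalIntegral.integral_of_le zero_le_one,
      intervalIntegral.integral_eq_sub_of_hasDerivAt (f := fun r => P r θ)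
        (fun r hr => hP r (by rwa [Set.uIcc_of_le zero_le_one] at hr) θ)
        ((slice1 θ (Set.Ioo_subset_Icc_self hθ)).intervalIntegrable_of_Icc zero_le_one)]
    simp only [P, hq, chord, hz₀, Complex.ofReal_one, Complex.ofReal_zero, one_mul, zero_mul,
      mul_zero, sub_zero, add_sub_cancel]
    rw [star_sub, sub_add_cancel]
    ring
  have hQint : ∫ x in T, Qt x = 0 := by
    rw [Measure.volume_eq_prod, setIntegral_prod _ (by rwa [← Measure.volume_eq_prod])]
    refine setIntegral_eq_zero_of_forall_eq_zero fun r hr => ?_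
    have hr' := Set.Ioo_subset_Icc_self hr
    rw [← integral_Ioc_eq_integral_Ioo, ← intervalIntegral.integral_of_le hab,
      intervalIntegral.integral_eq_sub_of_hasDerivAt (f := fun θ => Q r θ)
        (fun θ _ => hQ r hr' θ) ((slice2 r hr').intervalIntegrable_of_Icc hab)]
    simp only [Q, hq, hb, chord_add_two_pi, chord_self, mul_zero, zero_mul, sub_self]
  rw [h.integral_inside hγ a, setIntegral_congr_fun (measurableSet_Ioo.prod measurableSet_Ioo) e1,
    integral_const_mul, integral_sub hPi hQi, hPint, hQint, sub_zero, arc_integral _ a]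
  have e4 : ∀ θ, star (γ (Circle.exp θ)) / (γ (Circle.exp θ) - p) * q' θ
      = Complex.I * (star (γ (Circle.exp θ)) / (γ (Circle.exp θ) - p) * n (Circle.exp θ)) :=
    fun θ => by
      simp only [hq']
      ring
  simp only [e4]
  rw [intervalIntegral.integral_const_mul, ← mul_assoc, mul_inv, mul_assoc 2⁻¹,
    inv_mul_cancel₀ Complex.I_ne_zero, mul_one]

end SupportedCurve

/-! ### The velocity on the boundary of the patches -/

theorem integral_arc_mul_coe (g : Circle → ℂ) :
    ∫ τ, g τ * (τ : ℂ) ∂arc = 2 * Real.pi * circleMean g := by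
  have hpi : (Real.pi : ℂ) ≠ 0 := by exact_mod_cast Real.pi_ne_zero
  rw [circleMean_eq]
  push_cast
  field_simp

theorem circleMean_inv_coe : circleMean (fun τ => (τ : ℂ)⁻¹) = 1 := by
  have h := circleCoeff_zpow (-1) (-1)
  rw [if_pos rfl, ← circleMean_eq_circleCoeff] at h
  simpa only [zpow_neg_one] using h

/-- The Cauchy transform, at the boundary point `γ w`, of the domain bounded by `γ`. -/
theorem integral_patch₁_boundary {β : ℝ≥0} {f : XSpace β} (hf : ‖f‖ < 1) {ε : ℝ} (hε0 : ε ≠ 0)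
    (hε : |ε| ≤ 1 / 2)
    (h : SupportedCurve (boundaryCurve ε f) fun w => (w : ℂ) * circleDeriv (boundaryCurve ε f) w)
    (w : Circle) :
    ∫ ζ in patch₁ ε f, (ζ - boundaryCurve ε f w)⁻¹
      = Real.pi * ε * (-(w : ℂ)⁻¹ + ε * circleMean (selfIntegrand ε f w)) := by
  have hε' : star (ε : ℂ) = ε := Complex.conj_ofReal ε
  have hεc : (ε : ℂ) ≠ 0 := by exact_mod_cast hε0
  have hd := circleDeriv_boundaryCurve ε f.2.1
  have hγ : ∀ η : ℝ, HasDerivAt (fun η : ℝ => boundaryCurve ε f (Circle.exp η))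
      (Complex.I * ((Circle.exp η : ℂ) * circleDeriv (boundaryCurve ε f) (Circle.exp η))) η :=
    fun η => by
      rw [hd, ← mul_assoc]
      exact hasDerivAt_boundaryCurve ε f.2.1 η
  rw [patch₁, h.enclosed_eq, h.integral_inv_sub_boundary hγ w]
  have e1 : ∀ τ : Circle, star (boundaryCurve ε f τ - boundaryCurve ε f w)
      / (boundaryCurve ε f τ - boundaryCurve ε f w)
        * ((τ : ℂ) * circleDeriv (boundaryCurve ε f) τ)
      = star (boundaryCurve ε f τ - boundaryCurve ε f w)
        / (boundaryCurve ε f τ - boundaryCurve ε f w) * circleDeriv (boundaryCurve ε f) τ * τ :=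
    fun τ => by ring
  simp only [e1]
  rw [integral_arc_mul_coe]
  have hne : ∀ᵐ τ ∂arc, τ ≠ w := Measure.ae_ne arc w
  -- The contribution -1/(wτ) = conj A/A of the disc is split off; the rest is ε times
  -- `selfIntegrand`.
  have e2 : circleMean (fun τ => star (boundaryCurve ε f τ - boundaryCurve ε f w)
        / (boundaryCurve ε f τ - boundaryCurve ε f w) * circleDeriv (boundaryCurve ε f) τ)
      = circleMean (fun τ => ε * (-(w : ℂ)⁻¹ * (τ : ℂ)⁻¹ + ε * selfIntegrand ε f w τ)) := by
    refine circleMean_congr_ae (hne.mono fun τ hτ => ?_)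
    have hA : (τ : ℂ) - w ≠ 0 := sub_ne_zero.mpr fun e => hτ (Circle.ext e)
    have hC : boundaryCurve ε f τ - boundaryCurve ε f w ≠ 0 :=
      sub_ne_zero.mpr fun e => hτ (h.injective e)
    have eC : boundaryCurve ε f τ - boundaryCurve ε f w
        = ε * (((τ : ℂ) - w) + ε * (f τ - f w)) := by
      simp only [boundaryCurve]
      ring
    have hC' : ((τ : ℂ) - w) + ε * (f τ - f w) ≠ 0 := by
      rw [eC] at hC
      exact right_ne_zero_of_mul hC
    have e3 : -(w : ℂ)⁻¹ * (τ : ℂ)⁻¹ = star ((τ : ℂ) - w) / ((τ : ℂ) - w) := by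
      have h1 := Circle.coe_ne_zero τ
      have h2 := Circle.coe_ne_zero w
      rw [star_sub, star_coe, star_coe]
      field_simp
      ring
    simp only [hd]
    rw [e3, eC, star_mul', hε', star_add, star_mul', hε', selfIntegrand]
    field_simp
    ring
  have hs := (small_of_norm_lt hf).integrable_selfIntegrand hε w
  have hs' : Integrable (fun τ => (ε : ℂ) * selfIntegrand ε f w τ) arc := hs.const_mul _
  have hi : Integrable (fun τ : Circle => -(w : ℂ)⁻¹ * (τ : ℂ)⁻¹) arc := by
    refine Continuous.integrable_of_hasCompactSupport ?_ (HasCompactSupport.of_compactSpace _)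
    exact continuous_const.mul (continuous_coe_circle.inv₀ Circle.coe_ne_zero)
  rw [e2, circleMean_const_mul, circleMean_add hi hs', circleMean_const_mul, circleMean_const_mul,
    circleMean_inv_coe]
  ring

/-- The Cauchy transform of the first patch, at the mirror image of a boundary point. -/
theorem integral_patch₁_outside {β : ℝ≥0} {f : XSpace β} {d ε : ℝ}
    (h : SupportedCurve (boundaryCurve ε f) fun w => (w : ℂ) * circleDeriv (boundaryCurve ε f) w)
    (w : Circle) (hp : 2 * (d : ℂ) - boundaryCurve ε f w ∉ closure (patch₁ ε f)) :
    ∫ ζ in patch₁ ε f, (ζ - (2 * d - boundaryCurve ε f w))⁻¹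
      = Real.pi * ε ^ 2 * circleMean (pairIntegrand d ε 1 f w) := by
  have hε' : star (ε : ℂ) = ε := Complex.conj_ofReal ε
  have hd := circleDeriv_boundaryCurve ε f.2.1
  have hγ : ∀ η : ℝ, HasDerivAt (fun η : ℝ => boundaryCurve ε f (Circle.exp η))
      (Complex.I * ((Circle.exp η : ℂ) * circleDeriv (boundaryCurve ε f) (Circle.exp η))) η :=
    fun η => by
      rw [hd, ← mul_assoc]
      exact hasDerivAt_boundaryCurve ε f.2.1 η
  rw [patch₁, h.enclosed_eq] at hp ⊢
  rw [h.integral_inv_sub_outside hγ hp]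
  have e1 : ∀ τ : Circle, star (boundaryCurve ε f τ)
      / (boundaryCurve ε f τ - (2 * d - boundaryCurve ε f w))
        * ((τ : ℂ) * circleDeriv (boundaryCurve ε f) τ)
      = (ε : ℂ) ^ 2 * pairIntegrand d ε 1 f w τ * τ := fun τ => by
    have e2 : boundaryCurve ε f τ - (2 * d - boundaryCurve ε f w)
        = 1 * (ε * ((τ : ℂ) + w) + ε ^ 2 * (f τ + f w)) - 2 * d := by
      simp only [boundaryCurve]
      ring
    rw [e2, hd, pairIntegrand]
    simp only [boundaryCurve, star_mul', star_add, hε']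
    ring
  simp only [e1]
  rw [integral_arc_mul_coe, circleMean_const_mul]
  ring

/-! ### Exchange of the patches by z ↦ 2d - z, and tangency of the velocity -/

theorem integral_patch₂ {f : Circle → ℂ} (d ε : ℝ) (z : ℂ) :
    ∫ ζ in patch₂ d ε f, (z - ζ)⁻¹ = ∫ ξ in patch₁ ε f, (ξ - (2 * d - z))⁻¹ := by
  have e : (fun z : ℂ => -z + 2 * (d : ℂ)) = fun z => 2 * (d : ℂ) - z := funext fun z => by ring
  rw [patch₂, e, (Measure.measurePreserving_sub_left volume (2 * (d : ℂ))).setIntegral_image_emb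
    (Homeomorph.subLeft (2 * (d : ℂ))).measurableEmbedding]
  congr 1
  funext ξ
  congr 1
  ring

theorem integral_inv_sub_comm (s : Set ℂ) (z : ℂ) :
    ∫ ζ in s, (z - ζ)⁻¹ = -∫ ζ in s, (ζ - z)⁻¹ := by
  rw [← integral_neg]
  congr 1
  funext ζ
  rw [← inv_neg, neg_sub]

theorem conjVelocity_eq (d ε : ℝ) (f : Circle → ℂ) (z : ℂ) :
    conjVelocity d ε f z = Complex.I / (2 * Real.pi * ε ^ 2)
      * ((∫ ζ in patch₁ ε f, (ζ - z)⁻¹) + ∫ ζ in patch₁ ε f, (ζ - (2 * d - z))⁻¹) := by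
  rw [conjVelocity, integral_patch₂, integral_inv_sub_comm]
  ring

/-- The point reflection exchanges the patches, so it changes the sign of the vorticity, and it also
changes the sign of the kernel. Tangency on the second boundary follows from the first. -/
theorem conjVelocity_neg_add (d ε : ℝ) (f : Circle → ℂ) (z : ℂ) :
    conjVelocity d ε f (-z + 2 * (d : ℂ)) = conjVelocity d ε f z := by
  have e1 : -z + 2 * (d : ℂ) = 2 * d - z := by ring
  have e2 : 2 * (d : ℂ) - (2 * d - z) = z := by ring
  rw [conjVelocity_eq, conjVelocity_eq, e1, e2, add_comm]

/-- The disc part -1/w of the Cauchy transform contributes -(i/2)(1 + εf'), that is, the constant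
-i/2, which has no real part, and the term -f' of `F₁`. -/
theorem conjVelocity_mul_normal {β : ℝ≥0} (hβ₀ : 0 < β) (hβ₁ : β < 1) {f : XSpace β} (hf : ‖f‖ < 1)
    {d ε : ℝ} (hd : 2 < d) (hε0 : ε ≠ 0) (hε : |ε| ≤ 1 / 2)
    (h : SupportedCurve (boundaryCurve ε f) fun w => (w : ℂ) * circleDeriv (boundaryCurve ε f) w)
    (U : ℝ) (w : Circle) (hp : 2 * (d : ℂ) - boundaryCurve ε f w ∉ closure (patch₁ ε f)) :
    (conjVelocity d ε f (boundaryCurve ε f w) + Complex.I * U)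
        * (w * circleDeriv (boundaryCurve ε f) w)
      = Complex.I * ((ε / 2 : ℝ) * F d U ε f w) - Complex.I * (1 / 2 : ℝ) := by
  have hεc : (ε : ℂ) ≠ 0 := by exact_mod_cast hε0
  have hpi : (Real.pi : ℂ) ≠ 0 := by exact_mod_cast Real.pi_ne_zero
  have hw := Circle.coe_ne_zero w
  have hs := small_of_norm_lt hf
  have h2 : F₂ ε f w = circleMean (selfIntegrand ε f w) * (w * (1 + ε * circleDeriv f w)) := by
    rw [← F₂_eq hβ₀ hβ₁ hf hε, xData_apply]
    exact hs.F₂Hat_apply hβ₀ hβ₁ hε w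
  have h3 : F₃ d ε f w
      = circleMean (pairIntegrand d ε 1 f w) * (w * (1 + ε * circleDeriv f w)) := by
    rw [← F₃_eq hβ₀ hβ₁ hf hd hε, xData_apply]
    exact hs.F₃Hat_apply hβ₀ hβ₁ hd hε norm_one w
  rw [conjVelocity_eq, integral_patch₁_boundary hf hε0 hε h, integral_patch₁_outside h w hp,
    circleDeriv_boundaryCurve ε f.2.1, F, h2, h3, F₁]
  push_cast
  field_simp
  ring

theorem norm_boundaryCurve_le {f : Circle → ℂ} (h0 : ∀ w, ‖f w‖ ≤ 1) {ε : ℝ} (hε : |ε| ≤ 1 / 2)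
    (w : Circle) : ‖boundaryCurve ε f w‖ ≤ 1 := by
  have h1 : ‖(w : ℂ) + ε * f w‖ ≤ 1 + |ε| * 1 := by
    refine (norm_add_le _ _).trans (add_le_add (Circle.norm_coe w).le ?_)
    rw [norm_mul, Complex.norm_real, Real.norm_eq_abs]
    exact mul_le_mul_of_nonneg_left (h0 w) (abs_nonneg ε)
  rw [boundaryCurve, norm_mul, Complex.norm_real, Real.norm_eq_abs]
  nlinarith [abs_nonneg ε, norm_nonneg ((w : ℂ) + ε * f w)]

theorem SupportedCurve.norm_le_of_mem_closure {γ n : Circle → ℂ} (h : SupportedCurve γ n) {r : ℝ}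
    (hr : ∀ w, ‖γ w‖ ≤ r) {z : ℂ} (hz : z ∈ closure (insideSet γ n)) : ‖z‖ ≤ r := by
  rw [h.closure_inside] at hz
  have h0 : 0 ≤ r := (norm_nonneg _).trans (hr 1)
  rcases hz with hz | ⟨w, rfl⟩
  · obtain ⟨s, hs, w, rfl⟩ := h.polar z
    rcases le_or_gt s 1 with hs1 | hs1
    · rw [norm_smul, Real.norm_of_nonneg hs]
      nlinarith [hr w, norm_nonneg (γ w)]
    · exact absurd (hz w) (h.inner_smul_pos hs1 w).not_gt
  · exact hr w

theorem isTranslatingPair {β : ℝ≥0} (hβ₀ : 0 < β) (hβ₁ : β < 1) {f : XSpace β} (hf : ‖f‖ < 1)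
    {d ε : ℝ} (hd : 2 < d) (hε0 : ε ≠ 0) (hε : |ε| ≤ 1 / 2)
    (h : SupportedCurve (boundaryCurve ε f) fun w => (w : ℂ) * circleDeriv (boundaryCurve ε f) w)
    (hG : Ghat d ε f = 0) : IsTranslatingPair d ε (speed d ε f) f := by
  have hs := small_of_norm_lt hf
  have hnorm : ∀ z ∈ closure (patch₁ ε f), ‖z‖ ≤ 1 := fun z hz => by
    rw [patch₁, h.enclosed_eq] at hz
    exact h.norm_le_of_mem_closure (norm_boundaryCurve_le hs.1 hε) hz
  -- The patch lies in the unit disc, whereas |2d - z| > 3. This gives disjointness and puts the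
  -- mirror points of the boundary outside the closed patch.
  have hfar : ∀ z : ℂ, ‖z‖ ≤ 1 → 2 * (d : ℂ) - z ∉ closure (patch₁ ε f) := fun z hz hm => by
    have h1 := hnorm _ hm
    have h2 := norm_sub_norm_le (2 * (d : ℂ)) z
    have h3 : ‖2 * (d : ℂ)‖ = 2 * d := by
      rw [norm_mul, Complex.norm_real, Real.norm_of_nonneg (by linarith), Complex.norm_ofNat]
    linarith
  have hre : ∀ w : Circle, ((conjVelocity d ε f (boundaryCurve ε f w)
      + Complex.I * speed d ε f) * unitNormal (boundaryCurve ε f) w).re = 0 := fun w => by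
    have h1 := conjVelocity_mul_normal hβ₀ hβ₁ hf hd hε0 hε h (speed d ε f) w
      (hfar _ (norm_boundaryCurve_le hs.1 hε w))
    have h2 : (F d (speed d ε f) ε f w).im = 0 := by
      rw [← Ghat_apply hβ₀ hβ₁ hf hd hε w, hG]
      rfl
    rw [unitNormal, ← mul_div_assoc, h1, Complex.div_ofReal_re, Complex.sub_re, Complex.I_mul_re,
      Complex.I_mul_re, Complex.im_ofReal_mul, h2, Complex.ofReal_im]
    simp
  refine ⟨h.injective, fun w h0 => ?_, ?_, ?_, ?_, fun w => ⟨hre w, ?_⟩⟩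
  · have := h.pos w
    rw [h0, mul_zero, inner_zero_left] at this
    exact lt_irrefl _ this
  · rw [patch₁, h.enclosed_eq]
    exact h.zero_mem
  · rw [patch₁, h.enclosed_eq]
    exact h.frontier_inside
  · have e : (fun z : ℂ => -z + 2 * (d : ℂ)) = Homeomorph.subLeft (2 * (d : ℂ)) :=
      funext fun z => by
        change -z + 2 * (d : ℂ) = 2 * d - z
        ring
    rw [patch₂, e, ← Homeomorph.image_closure, Set.disjoint_left]
    rintro _ hz ⟨ξ, hξ, rfl⟩
    exact hfar ξ (hnorm ξ hξ) hz
  · rw [conjVelocity_neg_add, mul_neg, Complex.neg_re, hre w, neg_zero]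

/-! ### Convexity and the conclusion -/

theorem supportedCurve_of_lipschitz {β : ℝ≥0} {f : XSpace β} (hf : ‖f‖ < 1) {ε Λ : ℝ}
    (hε0 : ε ≠ 0) (hε : |ε| ≤ 1 / 20) (hεΛ : |ε| * Λ ≤ 1 / 20)
    (h2 : ∀ τ w, ‖circleDeriv f τ - circleDeriv f w‖ ≤ Λ * dist τ w) :
    SupportedCurve (boundaryCurve ε f) fun w => (w : ℂ) * circleDeriv (boundaryCurve ε f) w :=
  supportedCurve_boundaryCurve f.2.1 hε0 hε hεΛ (small_of_norm_lt hf).1 (small_of_norm_lt hf).2 h2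

theorem eventually_solution {β : ℝ≥0} (hβ₀ : 0 < β) (hβ₁ : β < 1) {d : ℝ} (hd : 2 < d)
    {ψ : ℝ → XSpace β} (hψ : Tendsto ψ (𝓝 0) (𝓝 0)) :
    ∀ᶠ ε : ℝ in 𝓝 0, Ghat d ε (ψ ε) = 0 → ε ≠ 0 →
      ψ ε ≠ 0 ∧ IsTranslatingPair d ε (speed d ε (ψ ε)) (ψ ε) ∧
        IsStrictlyConvexDomain (patch₁ ε (ψ ε)) := by
  obtain ⟨Λ, δ, -, hδ, hΛ⟩ := exists_lipschitz_deriv hβ₀ hβ₁ hd (1 / (4 * d))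
  have hnorm : Tendsto (fun ε => ‖ψ ε‖) (𝓝 0) (𝓝 0) := by simpa using hψ.norm
  have habs : Tendsto (fun ε : ℝ => |ε|) (𝓝 0) (𝓝 0) := by
    simpa using (continuous_abs (G := ℝ)).tendsto 0
  have habsΛ : Tendsto (fun ε : ℝ => |ε| * Λ) (𝓝 0) (𝓝 0) := by simpa using habs.mul_const Λ
  have hsp := eventually_prod_principal_iff.mp
    ((tendsto_speed hβ₀ hβ₁ hd).eventually (Metric.ball_mem_nhds _ hδ))
  filter_upwards [hnorm.eventually (gt_mem_nhds one_pos), hnorm.eventually (gt_mem_nhds hδ),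
    habs.eventually (gt_mem_nhds hδ), habs.eventually (gt_mem_nhds (show (0 : ℝ) < 1 / 20 by norm_num)),
    habsΛ.eventually (gt_mem_nhds (show (0 : ℝ) < 1 / 20 by norm_num)), hsp]
    with ε h1 hδ1 hδ2 h20 hεΛ hsp hG hε0
  have hε : |ε| ≤ 1 / 2 := by linarith
  have h := supportedCurve_of_lipschitz h1 hε0 h20.le hεΛ.le (hΛ ε (ψ ε) hδ2 hδ1 (hsp _ h1) hG)
  refine ⟨fun h0 => ?_, isTranslatingPair hβ₀ hβ₁ h1 hd hε0 hε h hG, ?_⟩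
  · rw [h0] at hG
    exact Ghat_zero_right_ne_zero hβ₀ hβ₁ hd hε hε0 hG
  · rw [patch₁, h.enclosed_eq]
    exact h.isStrictlyConvexDomain

end

end VortexPair

theorem mainTheorem3 (d : ℝ) (hd : 2 < d) (β : ℝ≥0) (hβ₀ : 0 < β) (hβ₁ : β < 1) :
    -- the speed is the one fixed by the constraint, and `Ĝ` takes values in `Ŷ`
    (∀ (ε : ℝ) (f : VortexPair.XSpace β), |ε| < 1 / 2 → ‖f‖ < 1 →
      (∀ U : ℝ, VortexPair.firstCoeff (VortexPair.F d U ε f) = 0 ↔ U = VortexPair.speed d ε f) ∧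
      ∀ w : Circle, VortexPair.Ghat d ε f w =
        (VortexPair.F d (VortexPair.speed d ε f) ε f w).im) ∧
    VortexPair.speed d 0 (0 : VortexPair.XSpace β) = 1 / (4 * d) ∧
    -- the linearized operator is the isomorphism `h ↦ -Im h'`
    (∃ L : VortexPair.XSpace β ≃L[ℝ] VortexPair.YHat β,
      (∀ (h : VortexPair.XSpace β) (w : Circle), L h w = -(VortexPair.circleDeriv h w).im) ∧
      HasFDerivAt (fun f : VortexPair.XSpace β => VortexPair.Ghat d 0 f)
        (L : VortexPair.XSpace β →L[ℝ] VortexPair.YHat β) 0) ∧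
    -- symmetry of the solution set
    (∀ (ε : ℝ) (f : VortexPair.XSpace β), |ε| < 1 / 2 → ‖f‖ < 1 → VortexPair.Ghat d ε f = 0 →
      ∃ g : VortexPair.XSpace β, (∀ w : Circle, g w = f (-w)) ∧ ‖g‖ < 1 ∧
        VortexPair.Ghat d (-ε) g = 0) ∧
    -- the curve of solutions
    ∃ ε₀ : ℝ, 0 < ε₀ ∧ ε₀ < 1 / 2 ∧ ∃ fc : ℝ → VortexPair.XSpace β,
      ContDiffOn ℝ 1 fc (Set.Icc (-ε₀) ε₀) ∧
      {p : ℝ × VortexPair.XSpace β | p.1 ∈ Set.Icc (-ε₀) ε₀ ∧ ‖p.2‖ < 1 ∧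
          VortexPair.Ghat d p.1 p.2 = 0}
        = (fun ε => (ε, fc ε)) '' Set.Icc (-ε₀) ε₀ ∧
      (∀ ε ∈ Set.Icc (-ε₀) ε₀, ∀ w : Circle, fc (-ε) w = fc ε (-w)) ∧
      ∀ ε ∈ Set.Icc (-ε₀) ε₀, ε ≠ 0 →
        fc ε ≠ 0 ∧
        VortexPair.IsTranslatingPair d ε (VortexPair.speed d ε (fc ε)) (fc ε) ∧
        VortexPair.IsStrictlyConvexDomain (VortexPair.patch₁ ε (fc ε)) := by
  refine ⟨fun ε f hε hf => ⟨fun U => VortexPair.firstCoeff_F_eq_zero_iff hβ₀ hβ₁ hf hd hε.le U,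
    fun w => VortexPair.Ghat_apply hβ₀ hβ₁ hf hd hε.le w⟩,
    VortexPair.speed_zero_left hβ₀ hβ₁ hd (by rw [norm_zero]; exact one_pos),
    ⟨VortexPair.linEquiv hβ₀ hβ₁, VortexPair.linOp_apply hβ₀ hβ₁,
      VortexPair.hasFDerivAt_Ghat_zero hβ₀ hβ₁ hd⟩,
    fun ε f hε hf hG => ⟨VortexPair.reflect f, VortexPair.reflect_apply f,
      (VortexPair.norm_reflect_le f).trans_lt hf,
      VortexPair.Ghat_reflect hβ₀ hβ₁ hf hd hε.le hG⟩, ?_⟩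
  obtain ⟨ψ, hdiff, hψ, huniq⟩ := VortexPair.exists_curve hβ₀ hβ₁ hd
  have hnorm : ∀ᶠ ε in nhds (0 : ℝ), ‖ψ ε‖ < 1 :=
    hψ.eventually VortexPair.eventually_norm_lt_one
  obtain ⟨r, hr, hball⟩ := Metric.eventually_nhds_iff_ball.mp
    (hdiff.and (huniq.and (hnorm.and (VortexPair.eventually_solution hβ₀ hβ₁ hd hψ))))
  have hmem : ∀ ε ∈ Set.Icc (-min (r / 2) (1 / 4)) (min (r / 2) (1 / 4)),
      ε ∈ Metric.ball (0 : ℝ) r ∧ |ε| ≤ 1 / 2 := fun ε hε => by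
    have h1 : |ε| ≤ min (r / 2) (1 / 4) := abs_le.mpr hε
    rw [mem_ball_zero_iff, Real.norm_eq_abs]
    have h2 := min_le_left (r / 2) (1 / 4)
    have h3 := min_le_right (r / 2) (1 / 4)
    constructor <;> linarith
  have hsol : ∀ ε ∈ Set.Icc (-min (r / 2) (1 / 4)) (min (r / 2) (1 / 4)),
      VortexPair.Ghat d ε (ψ ε) = 0 := fun ε hε =>
    ((hball ε (hmem ε hε).1).2.1 _ (hball ε (hmem ε hε).1).2.2.1).mpr rfl
  refine ⟨min (r / 2) (1 / 4), lt_min (half_pos hr) (by norm_num),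
    (min_le_right _ _).trans_lt (by norm_num), ψ,
    fun ε hε => (hball ε (hmem ε hε).1).1.contDiffWithinAt, ?_, fun ε hε w => ?_,
    fun ε hε hε0 => (hball ε (hmem ε hε).1).2.2.2 (hsol ε hε) hε0⟩
  · ext ⟨ε, f⟩
    constructor
    · rintro ⟨hε, hf, hG⟩
      exact ⟨ε, hε, Prod.ext rfl (((hball ε (hmem ε hε).1).2.1 f hf).mp hG)⟩
    · rintro ⟨ε', hε, e⟩
      obtain ⟨rfl, rfl⟩ := Prod.mk.inj e
      exact ⟨hε, (hball _ (hmem _ hε).1).2.2.1, hsol _ hε⟩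
  · have hε' : -ε ∈ Set.Icc (-min (r / 2) (1 / 4)) (min (r / 2) (1 / 4)) :=
      ⟨neg_le_neg hε.2, neg_le.mp hε.1⟩
    have hf := (hball ε (hmem ε hε).1).2.2.1
    -- The reflection of the solution at ε is a zero at -ε in the unit ball, so uniqueness
    -- identifies it with the solution there.
    have h := ((hball (-ε) (hmem _ hε').1).2.1 (VortexPair.reflect (ψ ε))
      ((VortexPair.norm_reflect_le _).trans_lt hf)).mp
      (VortexPair.Ghat_reflect hβ₀ hβ₁ hf hd (hmem ε hε).2 (hsol ε hε))
    rw [h]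
    exact VortexPair.reflect_apply (ψ ε) w
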